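/- **Setting.** Let $d\ge1$; $\mathcal D=C_c^\infty(\mathbb R^d)$, $\mathcal D'$ is its dual, $\varphi_x^\lambda(y)=\lambda^{-d}\varphi(\lambda^{-1}(y-x))$, and $\mathscr B^r$ ($r\in\mathbb N_0$) is the set of $\varphi\in\mathcal D$ supported in the closed unit ball with $|\partial^k\varphi|\le1$ for $|k|\le r$. A *germ* is a family $F=(F_x)_{x\in\mathbb R^d}\subset\mathcal D'$ with $x\mapsto F_x(\varphi)$ measurable for all $\varphi\in\mathcal D$; a distribution is also viewed as a constant germ. For $K\subset\mathbb R^d$ compact, $\bar\lambda>0$, $r\in\mathbb N_0$ put $$\|F\|^{a}_{\mathrm{hom};K,\bar\lambda,r}=\sup_{x\in K,\,\lambda\in(0,\bar\lambda],\,\varphi\in\mathscr B^r}\frac{|F_x(\varphi_x^\lambda)|}{\lambda^a},\qquad \|F\|^{\alpha,\gamma}_{\mathrm{coh};K,\bar\lambda,r}=\sup_{x,y\in K,\,\lambda\in(0,\bar\lambda],\,\varphi\in\mathscr B^r}\frac{|(F_y-F_x)(\varphi_x^\lambda)|}{\lambda^{\alpha}(|y-x|+\lambda)^{\gamma-\alpha}},$$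 and let $\|F\|^{a;\alpha,\gamma}_{K,\bar\lambda,r}$ be their sum. $F$ is *$a$-homogeneous* (resp. *$(\alpha,\gamma)$-coherent*) if for some $r$ the first (resp. second) seminorm is finite for all compact $K$ and all $\bar\lambda\ge1$. A distribution $f$ is a *$\gamma$-reconstruction* of the $(\alpha,\gamma)$-coherent germ $F$ if $\|F-f\|^\gamma_{\mathrm{hom};K,1,r}<\infty$ for all compact $K$ and all $r>-\alpha$. Let $r_{a,\alpha}=\min\{r\in\mathbb N_0: r>\max\{-a,-\alpha\}\}$. $\mathcal Z^a$ is the local Hölder–Zygmund space: $f\in\mathcal Z^a$ iff for all compact $K$ and $\bar\lambda\ge1$: for $a<0$, $\|f\|^a_{\mathrm{hom};K,\bar\lambda,\lfloor -a+1\rfloor}<\infty$; for $a\ge0$, $\sup_{x\in K,\psi\in\mathscr B^0}|f(\psi_x^1)|<\infty$ and $\sup|f(\varphi_x^\lambda)|\lambda^{-a}<\infty$ over $x\in K$, $\lambda\in(0,\bar\lambda]$ and $\varphi\in\mathscr B^0$ with $\int\varphi(z)z^k\,dz=0$ for all $|k|\le a$. A *$\beta$-regularising kernel of order $(m,r)$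 with range $\rho$* ($\beta,\rho>0$, $m,r\in\mathbb N_0$) is a function $\mathsf K:\mathbb R^d\times\mathbb R^d\to\mathbb R$ with $\mathsf K=\sum_{n\ge0}\mathsf K_n$ a.e., where, for all $n$, the derivatives $\partial_1^k\partial_2^l\mathsf K_n$ exist and are continuous for $|k|\le m$, $|l|\le r$; $\mathsf K_n(x,y)=0$ for $|x-y|>\rho2^{-n}$; and for every compact $K$ there is $c$ such that for all $n$: $|\partial_1^k\partial_2^l\mathsf K_n(x,y)|\le c\,2^{(d-\beta+|l|+|k|)n}$ for $x,y\in K$, $|k|\le m$, $|l|\le r$, and $\bigl|\int(y-x)^l\partial_2^k\mathsf K_n(x,y)\,dx\bigr|\le c\,2^{-\beta n}$ for $y\in K$, $|k|,|l|\le r$. We call $\mathsf K f$ *well defined* if for every $\psi\in\mathcal D$ each function $\mathsf K_n^*\psi=\int\psi(x)\mathsf K_n(x,\cdot)\,dx$ is a $C^s$ function, for some $s\in\mathbb N_0$ such that $f$ has order at most $s$ on a compact neighbourhood of its support, so that $f(\mathsf K_n^*\psi)$ is defined by continuous extension, and if $\mathsf Kf(\psi):=\sum_n f(\mathsf K_n^*\psi)$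 converges and defines a distribution. $\mathsf K$ is *translation invariant* if each $\mathsf K_n(x,y)$ depends only on $x-y$. For $g\in\mathcal D'$ and $\delta\in\mathbb R$, put $D^kg(x)=\lim_{\lambda\downarrow0}D^kg(\eta_x^\lambda)$ for $|k|<\delta$, if for every $\eta\in\mathcal D$ with $\int\eta=1$ and $\int\eta(z)z^l\,dz=0$ for $1\le|l|<\delta$ the limit exists and it does not depend on $\eta$; and $\mathcal T_x^\delta(g)=\sum_{|k|<\delta}D^kg(x)\frac{(\cdot-x)^k}{k!}$ (which is $0$ for $\delta\le0$). **Theorem.** Let $\alpha\le\gamma$, $\gamma\ne0$, $\beta>0$, $\alpha+\beta\ne0$, $\gamma+\beta\notin\mathbb N_0$, and let $\mathsf K$ be a $\beta$-regularising kernel of order $(m,r)$ with range $\rho$, where $m>\gamma+\beta$ and $r>-\alpha$. Write $\alpha'=(\alpha+\beta)\wedge0$, $\gamma'=\gamma+\beta$ and $\bar\lambda'=8(\bar\lambda+\rho+\mathrm{diam}(K))$. Pairs $(F,\mathcal RF)$ below consist of an $(\alpha,\gamma)$-coherent germ and a $\gamma$-reconstruction of it. Put $$H_x=\mathsf K\{F_x-\mathcal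 RF\}-\mathcal T_x^{\gamma'}(\mathsf K\{F_x-\mathcal RF\}),\qquad (\mathcal KF)_x=\mathsf KF_x-\mathcal T_x^{\gamma'}(\mathsf K\{F_x-\mathcal RF\}).$$ All constants below depend neither on $F$ nor on $\mathcal RF$ (in (7), only on the family). 1. For every pair, $\mathsf K\{F_x-\mathcal RF\}$ is well defined and has pointwise derivatives at $x$ of all orders $|k|<\gamma'$; $H=(H_x)$ is a germ, it is $\gamma'$-homogeneous and $(\alpha',\gamma')$-coherent. 2. For all compact $K$ and $\bar\lambda>0$ there is $C<\infty$ such that for all pairs $\|H\|^{\gamma';\alpha',\gamma'}_{K,\bar\lambda,r_{\gamma,\alpha}}\le C\,\|F-\mathcal RF\|^{\gamma;\alpha,\gamma}_{K,\bar\lambda',r_{\gamma,\alpha}}$. 3. For all compact $K$ and $\bar\lambda>0$ there are a compact $K''$, $\bar\lambda''>0$ and $C<\infty$ such that for all pairs $\|H\|^{\gamma';\alpha',\gamma'}_{K,\bar\lambda,r_{\gamma',\alpha'}}\le C\,\|F-\mathcal RF\|^{\gamma;\alpha,\gamma}_{K'',\bar\lambda'',r_{\gamma,\alpha}}$. 4.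 If $\mathsf K(\mathcal RF)$ is well defined, then so is each $\mathsf KF_x$; $\mathcal KF$ is a germ, $\mathcal KF-\mathsf K(\mathcal RF)=H$, $\mathcal KF$ is $(\alpha',\gamma')$-coherent, and $\mathsf K(\mathcal RF)$ is a $\gamma'$-reconstruction of $\mathcal KF$. 5. Let $\bar\alpha\le\gamma$, $\bar\alpha+\beta\ne0$, and let $r>-\bar\alpha$ or $\mathsf K$ be translation invariant. If $\mathsf K(\mathcal RF)$ is well defined and $F$ is $\bar\alpha$-homogeneous, then $\mathcal KF$ is $((\bar\alpha+\beta)\wedge0)$-homogeneous; moreover $\mathcal RF\in\mathcal Z^{\bar\alpha}$ and $\mathsf K(\mathcal RF)\in\mathcal Z^{(\bar\alpha+\beta)\wedge0}$. 6. $\mathcal K$ is linear: if $(F,f)$, $(G,g)$ are pairs with $\mathsf Kf$, $\mathsf Kg$ well defined and $a,b\in\mathbb R$, then $(aF+bG,af+bg)$ is a pair, $\mathsf K(af+bg)$ is well defined, and the germ $\mathcal K(aF+bG)$ built with $af+bg$ is $a\mathcal KF+b\mathcal KG$, with $\mathcal KF$, $\mathcal KG$ built with $f$, $g$. 7. $\mathcal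 K$ is continuous: let $P$ be a family of pairs with $\mathsf K(\mathcal RF)$ well defined for each of them. If $\gamma<0$, assume moreover the *reconstruction bounds* on $P$: for all compact $K$, $\bar\lambda>0$ and integers $s\ge r_{\gamma,\alpha}$ there is $C$ with $\|F-\mathcal RF\|^{\gamma;\alpha,\gamma}_{K,\bar\lambda,r_{\gamma,\alpha}}\le C\|F\|^{\alpha,\gamma}_{\mathrm{coh};K\oplus B(0,1+\bar\lambda),\bar\lambda,s}$ on $P$. Let $K$ be compact, $\bar\lambda>0$, and $K'=K\oplus B(0,1+\bar\lambda')$ ($B$ the closed ball). Then for every integer $s\ge r_{\gamma,\alpha}$ there is $C$ such that on $P$ $$\|\mathcal KF\|^{\alpha',\gamma'}_{\mathrm{coh};K,\bar\lambda,r_{\gamma,\alpha}}\le C\,\|F\|^{\alpha,\gamma}_{\mathrm{coh};K',\bar\lambda',s};$$ and for every $\bar\alpha$ as in (5), with $\bar\alpha'=(\bar\alpha+\beta)\wedge0$, there is $C$ such that for all $\bar\alpha$-homogeneous $F$ in the family $$\|\mathcal KF\|^{\bar\alpha';\alpha',\gamma'}_{K,\bar\lambda,r_{\bar\alpha,\alpha}}\le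 C\,\|F\|^{\bar\alpha;\alpha,\gamma}_{K',\bar\lambda',r_{\bar\alpha,\alpha}}.$$ Both bounds also hold with the orders $r_{\gamma',\alpha'}$, resp. $r_{\bar\alpha',\alpha'}$, on the left, if $K',\bar\lambda'$ are replaced by some compact $K''$ and some $\bar\lambda''>0$ depending only on $K,\bar\lambda$ and the fixed parameters and the family (not on its individual members). 8. There is a map $F\mapsto\mathcal RF$, linear on the space of $(\alpha,\gamma)$-coherent germs, that assigns to each such germ a $\gamma$-reconstruction and satisfies the reconstruction bounds of (7). If $\gamma>0$, the $\gamma$-reconstruction of a germ is unique. -/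

import Mathlib

open MeasureTheory Filter Topology TopologicalSpace
open scoped NNReal ENNReal Distributions LineDeriv

noncomputable section

/-- The Euclidean space `ℝ^d`. -/
abbrev Rd (d : ℕ) : Type := EuclideanSpace ℝ (Fin d)

/-- The space `𝓓` of smooth compactly supported functions `ℝ^d → ℝ`. -/
abbrev TestFn (d : ℕ) : Type := 𝓓((⊤ : Opens (Rd d)), ℝ)

/-- The space `𝓓'` of distributions on `ℝ^d`. -/
abbrev Distr (d : ℕ) : Type := 𝓓'((⊤ : Opens (Rd d)), ℝ)

variable {d : ℕ}

/-! ### Multi-indices and partial derivatives -/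

/-- The length `|k| = k_1 + ... + k_d` of a multi-index. -/
def mlen (k : Fin d → ℕ) : ℕ := ∑ i, k i

/-- The monomial `z^k`. -/
def mpow (z : Rd d) (k : Fin d → ℕ) : ℝ := ∏ i, z i ^ k i

/-- The factorial `k!` of a multi-index. -/
def mfact (k : Fin d → ℕ) : ℝ := ∏ i, ((k i).factorial : ℝ)

/-- The (finite) set of multi-indices `k` with `|k| < δ`; it is empty for `δ ≤ 0`. -/
def multiIndicesLT (d : ℕ) (δ : ℝ) : Finset (Fin d → ℕ) :=
  {k ∈ Fintype.piFinset fun _ : Fin d => Finset.range ⌈δ⌉₊ | (mlen k : ℝ) < δ}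

/-- The `i`-th vector of the standard basis. -/
def stdVec (i : Fin d) : Rd d := EuclideanSpace.single i 1

/-- `∂^k f = ∂_1^{k_1} ⋯ ∂_d^{k_d} f` for a function `f : ℝ^d → ℝ`. -/
def partialDeriv (k : Fin d → ℕ) (f : Rd d → ℝ) : Rd d → ℝ :=
  (List.finRange d).foldr
    (fun i g => (fun (h : Rd d → ℝ) (x : Rd d) => lineDeriv ℝ h x (stdVec i))^[k i] g) f

/-- The derivative `D^k f = D_1^{k_1} ⋯ D_d^{k_d} f` of a distribution. -/
def distrDeriv (k : Fin d → ℕ) (f : Distr d) : Distr d :=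
  (List.finRange d).foldr (fun i g => (fun h : Distr d => ∂_{stdVec i} h)^[k i] g) f

/-! ### Test functions -/

/-- The class `𝓑^r` of test functions supported in the closed unit ball with `‖φ‖_{C^r} ≤ 1`. -/
def testBall (d r : ℕ) : Set (TestFn d) :=
  {φ | tsupport φ ⊆ Metric.closedBall 0 1 ∧
    ∀ k : Fin d → ℕ, mlen k ≤ r → ∀ x, |partialDeriv k φ x| ≤ 1}

/-- The test functions `φ` with `∫ φ(z) z^k dz = 0` for all `0 ≤ |k| ≤ γ`. -/
def annihilating (d : ℕ) (γ : ℝ) : Set (TestFn d) :=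
  {φ | ∀ k : Fin d → ℕ, (mlen k : ℝ) ≤ γ → ∫ z, φ z * mpow z k = 0}

/-- The centred and scaled test function `φ_x^t = t^{-d} φ(t^{-1}(· - x))` for `t > 0`
(by convention `0` for `t ≤ 0`). -/
def scaled (φ : TestFn d) (x : Rd d) (t : ℝ) : TestFn d :=
  if ht : 0 < t then
    { toFun := fun y => t⁻¹ ^ d * φ (t⁻¹ • (y - x))
      contDiff' := by
        have h := φ.contDiff
        exact contDiff_const.mul (h.comp ((contDiff_id.sub contDiff_const).const_smul _))
      hasCompactSupport' := by
        have h : HasCompactSupport fun y => φ (t⁻¹ • (y - x)) := by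
          have h1 := φ.hasCompactSupport.comp_smul (inv_ne_zero ht.ne')
          have h2 := h1.comp_homeomorph (Homeomorph.subRight x)
          exact h2
        exact h.mul_left
      tsupport_subset' := fun _ _ => trivial }
  else 0

/-! ### Distributions of finite order and their extension to less regular functions -/

/-- `f` is of order (at most) `s` on the set `L`: `|f(φ)| ≤ c ‖φ‖_{C^s}` for all test functions
`φ` supported in `L`. -/
def HasOrderOn (f : Distr d) (s : ℕ) (L : Set (Rd d)) : Prop :=
  ∃ c : ℝ, ∀ φ : TestFn d, tsupport φ ⊆ L → ∀ M : ℝ,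
    (∀ k : Fin d → ℕ, mlen k ≤ s → ∀ x, |partialDeriv k φ x| ≤ M) → |f φ| ≤ c * M

/-- `ExtPairing f g v`: the canonical extension of `f` to functions of class `C^s` is defined at
the compactly supported function `g` and takes the value `v` there. That is, for some `s` and some
compact neighbourhood `L` of the support of `g`, `f` is of order `s` on `L`, `g` is of class `C^s`,
and `f(φ_j) → v` whenever the test functions `φ_j`, supported in `L`, converge to `g` in `C^s`. -/
def ExtPairing (f : Distr d) (g : Rd d → ℝ) (v : ℝ) : Prop :=
  ∃ (s : ℕ) (L : Set (Rd d)), IsCompact L ∧ HasOrderOn f s L ∧ ContDiff ℝ s g ∧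
    tsupport g ⊆ interior L ∧
    ∀ φ : ℕ → TestFn d, (∀ j, tsupport (φ j) ⊆ L) →
      (∀ k : Fin d → ℕ, mlen k ≤ s →
        TendstoUniformly (fun j => partialDeriv k (φ j)) (partialDeriv k g) atTop) →
      Tendsto (fun j => f (φ j)) atTop (𝓝 v)

/-! ### Regularising kernels and integration against them -/

/-- The space `C^{m,r}`: the partial derivatives `∂_1^k ∂_2^l` exist and are continuous for all
`|k| ≤ m` and `|l| ≤ r`. -/
def IsCmr (m r : ℕ) (G : Rd d → Rd d → ℝ) : Prop :=
  (∀ x, ContDiff ℝ r (G x)) ∧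
  (∀ l : Fin d → ℕ, mlen l ≤ r → ∀ y, ContDiff ℝ m fun x => partialDeriv l (G x) y) ∧
  ∀ k l : Fin d → ℕ, mlen k ≤ m → mlen l ≤ r →
    Continuous fun p : Rd d × Rd d => partialDeriv k (fun x => partialDeriv l (G x) p.2) p.1

/-- `K` is a `β`-regularising kernel of order `(m, r)` with range `ρ`, with dyadic decomposition
`K = ∑_n Kn n`. -/
structure IsRegularisingKernel (β : ℝ) (m r : ℕ) (ρ : ℝ) (K : Rd d → Rd d → ℝ)
    (Kn : ℕ → Rd d → Rd d → ℝ) : Prop where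
  beta_pos : 0 < β
  rho_pos : 0 < ρ
  hasSum : ∀ᵐ p : Rd d × Rd d, HasSum (fun n => Kn n p.1 p.2) (K p.1 p.2)
  isCmr : ∀ n, IsCmr m r (Kn n)
  support : ∀ n x y, Kn n x y ≠ 0 → ‖x - y‖ ≤ ρ * 2⁻¹ ^ n
  bounds : ∀ L : Set (Rd d), IsCompact L → ∃ c : ℝ, 0 < c ∧
    (∀ (n : ℕ) (k l : Fin d → ℕ), mlen k ≤ m → mlen l ≤ r → ∀ x ∈ L, ∀ y ∈ L,
      |partialDeriv k (fun x' => partialDeriv l (Kn n x') y) x|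
        ≤ c * (2 : ℝ) ^ (((d : ℝ) - β + mlen l + mlen k) * n)) ∧
    (∀ (n : ℕ) (k l : Fin d → ℕ), mlen k ≤ r → mlen l ≤ r → ∀ y ∈ L,
      |∫ x, mpow (y - x) l * partialDeriv k (Kn n x) y| ≤ c * (2 : ℝ) ^ (-β * n))

/-- The decomposition is translation invariant: `Kn n x y` only depends on `x - y`. -/
def IsTranslationInvariant (Kn : ℕ → Rd d → Rd d → ℝ) : Prop :=
  ∀ n x y z, Kn n (x + z) (y + z) = Kn n x y

/-- `(G^* ψ)(y) = ∫ ψ(x) G(x, y) dx`. -/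
def kernelAdjoint (G : Rd d → Rd d → ℝ) (ψ : TestFn d) (y : Rd d) : ℝ :=
  ∫ x, ψ x * G x y

/-- The distribution `g` is the integration of `f` with the kernel `∑_n Kn n`:
`g(ψ) = ∑_n f(Kn n ^* ψ)` for every test function `ψ`, where every term makes sense and the
series converges. -/
def IsKernelInt (Kn : ℕ → Rd d → Rd d → ℝ) (f g : Distr d) : Prop :=
  ∀ ψ : TestFn d, ∃ a : ℕ → ℝ, (∀ n, ExtPairing f (kernelAdjoint (Kn n) ψ) (a n)) ∧
    Tendsto (fun N => ∑ n ∈ Finset.range N, a n) atTop (𝓝 (g ψ))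

/-- The integration of `f` with the kernel `∑_n Kn n` is well defined. -/
def KernelIntDefined (Kn : ℕ → Rd d → Rd d → ℝ) (f : Distr d) : Prop :=
  ∃ g, IsKernelInt Kn f g

open Classical in
/-- The integration of `f` with the kernel `∑_n Kn n` (`0` if it is not well defined). -/
def kernelInt (Kn : ℕ → Rd d → Rd d → ℝ) (f : Distr d) : Distr d :=
  if h : KernelIntDefined Kn f then h.choose else 0

/-! ### Pointwise derivatives and Taylor polynomials of distributions -/

/-- `v` is the pointwise derivative `D^k f(x) = lim_{t ↓ 0} D^k f(η_x^t)`, for any test function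
`η` with `∫ η = 1` and `∫ η(z) z^l dz = 0` for `1 ≤ |l| < δ`. -/
def HasPointDeriv (δ : ℝ) (f : Distr d) (x : Rd d) (k : Fin d → ℕ) (v : ℝ) : Prop :=
  ∀ η : TestFn d, ∫ z, η z = 1 →
    (∀ l : Fin d → ℕ, 1 ≤ mlen l → (mlen l : ℝ) < δ → ∫ z, η z * mpow z l = 0) →
    Tendsto (fun t => distrDeriv k f (scaled η x t)) (𝓝[>] 0) (𝓝 v)

open Classical in
/-- The pointwise derivative `D^k f(x)` (`0` if it does not exist). -/
def pointDeriv (δ : ℝ) (f : Distr d) (x : Rd d) (k : Fin d → ℕ) : ℝ :=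
  if h : ∃ v, HasPointDeriv δ f x k v then h.choose else 0

/-- The Taylor polynomial `∑_{|k| < δ} D^k f(x) (y - x)^k / k!` as a function of `y`. -/
def taylorPoly (δ : ℝ) (f : Distr d) (x y : Rd d) : ℝ :=
  ∑ k ∈ multiIndicesLT d δ, pointDeriv δ f x k * (mpow (y - x) k / mfact k)

/-- The Taylor polynomial `𝒯_x^δ(f)` as a distribution, `ψ ↦ ∫ ψ(y) 𝒯_x^δ(f)(y) dy`. -/
def taylorDistr (δ : ℝ) (f : Distr d) (x : Rd d) : Distr d :=
  ContinuousLinearMap.toUniformConvergenceCLM (RingHom.id ℝ) ℝ {S | IsCompact S}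
    (TestFunction.integralAgainstBilinCLM (ContinuousLinearMap.mul ℝ ℝ) volume
      (taylorPoly δ f x))

/-! ### Germs, homogeneity, coherence, reconstruction -/

/-- A germ: a family of distributions such that `x ↦ F_x(φ)` is measurable for all `φ`. -/
def IsGerm (F : Rd d → Distr d) : Prop :=
  ∀ φ : TestFn d, Measurable fun x => F x φ

/-- `a`-homogeneity of order `r`. -/
def IsHomogeneousOfOrder (a : ℝ) (r : ℕ) (F : Rd d → Distr d) : Prop :=
  ∀ L : Set (Rd d), IsCompact L → ∀ Λ : ℝ, 1 ≤ Λ → ∃ C : ℝ,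
    ∀ x ∈ L, ∀ t ∈ Set.Ioc 0 Λ, ∀ φ ∈ testBall d r, |F x (scaled φ x t)| ≤ C * t ^ a

/-- `a`-homogeneity (of some order). -/
def IsHomogeneous (a : ℝ) (F : Rd d → Distr d) : Prop :=
  ∃ r : ℕ, IsHomogeneousOfOrder a r F

/-- `(α, γ)`-coherence of order `r`. -/
def IsCoherentOfOrder (α γ : ℝ) (r : ℕ) (F : Rd d → Distr d) : Prop :=
  ∀ L : Set (Rd d), IsCompact L → ∀ Λ : ℝ, 1 ≤ Λ → ∃ C : ℝ,
    ∀ x ∈ L, ∀ y ∈ L, ∀ t ∈ Set.Ioc 0 Λ, ∀ φ ∈ testBall d r,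
      |(F y - F x) (scaled φ x t)| ≤ C * (t ^ α * (‖y - x‖ + t) ^ (γ - α))

/-- `(α, γ)`-coherence (of some order). -/
def IsCoherent (α γ : ℝ) (F : Rd d → Distr d) : Prop :=
  ∃ r : ℕ, IsCoherentOfOrder α γ r F

/-- The distribution `f` is a `γ`-reconstruction of the `(α, γ)`-coherent germ `F`. -/
def IsReconstruction (α γ : ℝ) (F : Rd d → Distr d) (f : Distr d) : Prop :=
  ∀ r : ℕ, -α < r → ∀ L : Set (Rd d), IsCompact L → ∃ C : ℝ,
    ∀ x ∈ L, ∀ t ∈ Set.Ioc (0 : ℝ) 1, ∀ φ ∈ testBall d r,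
      |(F x - f) (scaled φ x t)| ≤ C * t ^ γ

/-- The set of `(α, γ)`-coherent germs. -/
def coherentGerms (d : ℕ) (α γ : ℝ) : Set (Rd d → Distr d) :=
  {F | IsGerm F ∧ IsCoherent α γ F}

/-- The set of pairs consisting of an `(α, γ)`-coherent germ and a `γ`-reconstruction of it. -/
def reconstructedGerms (d : ℕ) (α γ : ℝ) : Set ((Rd d → Distr d) × Distr d) :=
  {p | p.1 ∈ coherentGerms d α γ ∧ IsReconstruction α γ p.1 p.2}

/-! ### Seminorms, with values in `[0, ∞]` -/

/-- The homogeneity seminorm over the compact `L`, scales up to `Λ`, test functions in `𝓑^r`. -/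
def homSeminorm (a : ℝ) (r : ℕ) (L : Set (Rd d)) (Λ : ℝ) (F : Rd d → Distr d) : ℝ≥0∞ :=
  ⨆ x ∈ L, ⨆ t ∈ Set.Ioc 0 Λ, ⨆ φ ∈ testBall d r,
    ENNReal.ofReal (|F x (scaled φ x t)| / t ^ a)

/-- The coherence seminorm over the compact `L`, scales up to `Λ`, test functions in `𝓑^r`. -/
def cohSeminorm (α γ : ℝ) (r : ℕ) (L : Set (Rd d)) (Λ : ℝ) (F : Rd d → Distr d) : ℝ≥0∞ :=
  ⨆ x ∈ L, ⨆ y ∈ L, ⨆ t ∈ Set.Ioc 0 Λ, ⨆ φ ∈ testBall d r,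
    ENNReal.ofReal (|(F y - F x) (scaled φ x t)| / (t ^ α * (‖y - x‖ + t) ^ (γ - α)))

/-- The joint seminorm of homogeneity `a` and `(α, γ)`-coherence. -/
def jointSeminorm (a α γ : ℝ) (r : ℕ) (L : Set (Rd d)) (Λ : ℝ) (F : Rd d → Distr d) : ℝ≥0∞ :=
  homSeminorm a r L Λ F + cohSeminorm α γ r L Λ F

/-- The canonical order `r_{a,α} = min {r ∈ ℕ₀ : r > max {-a, -α}}`. -/
def canonicalOrder (a α : ℝ) : ℕ := sInf {r : ℕ | max (-a) (-α) < r}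

/-- The reconstruction bounds, uniform over a family `P` of pairs `(F, f)` of a germ and a
`γ`-reconstruction of it: the joint seminorms of `F - f` are controlled by the coherence
seminorms of `F` on slightly larger compacts. -/
def HasReconstructionBounds (α γ : ℝ) (P : Set ((Rd d → Distr d) × Distr d)) : Prop :=
  ∀ L : Set (Rd d), IsCompact L → ∀ Λ : ℝ, 0 < Λ → ∀ s : ℕ, canonicalOrder γ α ≤ s →
    ∃ C : ℝ≥0, ∀ p ∈ P,
      jointSeminorm γ α γ (canonicalOrder γ α) L Λ (fun x => p.1 x - p.2)
        ≤ C * cohSeminorm α γ s (Metric.cthickening (1 + Λ) L) Λ p.1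

/-! ### Hölder–Zygmund spaces -/

/-- The local Hölder–Zygmund norm over the compact `L` and scales up to `Λ`. -/
def zygmundNorm (γ : ℝ) (L : Set (Rd d)) (Λ : ℝ) (f : Distr d) : ℝ≥0∞ :=
  if γ < 0 then
    ⨆ x ∈ L, ⨆ t ∈ Set.Ioc 0 Λ, ⨆ φ ∈ testBall d ⌊-γ + 1⌋₊,
      ENNReal.ofReal (|f (scaled φ x t)| / t ^ γ)
  else
    (⨆ x ∈ L, ⨆ ψ ∈ testBall d 0, ENNReal.ofReal |f (scaled ψ x 1)|) +
    ⨆ x ∈ L, ⨆ t ∈ Set.Ioc 0 Λ, ⨆ φ ∈ testBall d 0 ∩ annihilating d γ,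
      ENNReal.ofReal (|f (scaled φ x t)| / t ^ γ)

/-- The local Hölder–Zygmund space `𝒵^γ`. -/
def zygmundSpace (d : ℕ) (γ : ℝ) : Set (Distr d) :=
  {f | ∀ L : Set (Rd d), IsCompact L → ∀ Λ : ℝ, 1 ≤ Λ → zygmundNorm γ L Λ f < ⊤}

/-! ### The lifted integration map -/

/-- `K{F_x - f} - 𝒯_x^δ(K{F_x - f})`, which makes sense of `(𝒦F)_x - K f` even when `K f` does
not make sense on its own. -/
def schauderDiff (Kn : ℕ → Rd d → Rd d → ℝ) (δ : ℝ) (F : Rd d → Distr d) (f : Distr d)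
    (x : Rd d) : Distr d :=
  kernelInt Kn (F x - f) - taylorDistr δ (kernelInt Kn (F x - f)) x

/-- `(𝒦F)_x = K F_x - 𝒯_x^δ(K{F_x - f})`, where `f` is the chosen reconstruction of `F`. -/
def schauderGerm (Kn : ℕ → Rd d → Rd d → ℝ) (δ : ℝ) (F : Rd d → Distr d) (f : Distr d)
    (x : Rd d) : Distr d :=
  kernelInt Kn (F x) - taylorDistr δ (kernelInt Kn (F x - f)) x

/-- The enlarged scale `8 (Λ + ρ + diam L)`. -/
def enlargedScale (ρ : ℝ) (L : Set (Rd d)) (Λ : ℝ) : ℝ := 8 * (Λ + ρ + Metric.diam L)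

end

open MeasureTheory Filter Topology TopologicalSpace
open scoped NNReal ENNReal Distributions LineDeriv

noncomputable section

variable {d : ℕ}

/-! ### Calculus of partial derivatives -/

/-- The `i`-th partial derivative of a function. -/
def coordDeriv (i : Fin d) (f : Rd d → ℝ) : Rd d → ℝ := fun x => lineDeriv ℝ f x (stdVec i)

/-- The `i`-th unit multi-index. -/
def unitIdx (i : Fin d) : Fin d → ℕ := Pi.single i 1

lemma mlen_zero : mlen (0 : Fin d → ℕ) = 0 := by simp [mlen]

lemma mlen_add (k l : Fin d → ℕ) : mlen (k + l) = mlen k + mlen l := by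
  simp [mlen, Finset.sum_add_distrib]

lemma mlen_unitIdx (i : Fin d) : mlen (unitIdx i) = 1 := by
  simp [mlen, unitIdx]

lemma mlen_add_unitIdx (k : Fin d → ℕ) (i : Fin d) : mlen (k + unitIdx i) = mlen k + 1 := by
  rw [mlen_add, mlen_unitIdx]

lemma eq_zero_of_mlen_eq_zero {k : Fin d → ℕ} (h : mlen k = 0) : k = 0 := by
  funext i
  have := (Finset.sum_eq_zero_iff (s := Finset.univ) (f := k)).1 h i (Finset.mem_univ i)
  simpa using this

lemma exists_eq_add_unitIdx {k : Fin d → ℕ} (h : mlen k ≠ 0) :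
    ∃ k' i, k = k' + unitIdx i := by
  obtain ⟨i, -, hi⟩ := Finset.exists_ne_zero_of_sum_ne_zero h
  refine ⟨k - unitIdx i, i, ?_⟩
  funext j
  by_cases hj : j = i
  · subst hj
    simp [unitIdx]; omega
  · simp [unitIdx, hj]

lemma multiIndex_induction {p : (Fin d → ℕ) → Prop} (h0 : p 0)
    (hs : ∀ k i, p k → p (k + unitIdx i)) (k : Fin d → ℕ) : p k := by
  induction hn : mlen k generalizing k with
  | zero => rw [eq_zero_of_mlen_eq_zero hn]; exact h0
  | succ n ih =>
    obtain ⟨k', i, rfl⟩ := exists_eq_add_unitIdx (k := k) (by omega)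
    rw [mlen_add_unitIdx] at hn
    exact hs _ _ (ih k' (by omega))

lemma mem_multiIndicesLT {δ : ℝ} {k : Fin d → ℕ} :
    k ∈ multiIndicesLT d δ ↔ (mlen k : ℝ) < δ := by
  simp only [multiIndicesLT, Finset.mem_filter, Fintype.mem_piFinset, Finset.mem_range,
    and_iff_right_iff_imp]
  intro h i
  rw [Nat.lt_ceil]
  refine lt_of_le_of_lt ?_ h
  exact_mod_cast Finset.single_le_sum (f := k) (fun _ _ => Nat.zero_le _) (Finset.mem_univ i)

lemma multiIndicesLT_ceil (δ : ℝ) : multiIndicesLT d δ = multiIndicesLT d (⌈δ⌉₊ : ℝ) := by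
  ext k
  rw [mem_multiIndicesLT, mem_multiIndicesLT, Nat.cast_lt, Nat.lt_ceil]

/-- The finite set of multi-indices of length at most `n`. -/
def multiIndicesLE (d n : ℕ) : Finset (Fin d → ℕ) := multiIndicesLT d (n + 1 : ℝ)

lemma mem_multiIndicesLE {n : ℕ} {k : Fin d → ℕ} : k ∈ multiIndicesLE d n ↔ mlen k ≤ n := by
  rw [multiIndicesLE, mem_multiIndicesLT]
  norm_cast
  omega

lemma fderiv_stdVec {f : Rd d → ℝ} {x : Rd d} (hf : DifferentiableAt ℝ f x) (i : Fin d) :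
    fderiv ℝ f x (stdVec i) = coordDeriv i f x :=
  hf.lineDeriv_eq_fderiv.symm

lemma sum_smul_stdVec (v : Rd d) : ∑ i, v i • stdVec i = v := by
  ext j
  simp [stdVec, Pi.single_apply]

lemma fderiv_eq_sum {f : Rd d → ℝ} {x : Rd d} (hf : DifferentiableAt ℝ f x) (v : Rd d) :
    fderiv ℝ f x v = ∑ i, v i * coordDeriv i f x := by
  conv_lhs => rw [← sum_smul_stdVec v]
  simp [map_sum, fderiv_stdVec hf]

lemma contDiff_coordDeriv {n : ℕ} {f : Rd d → ℝ} (hf : ContDiff ℝ (n + 1 : ℕ) f) (i : Fin d) :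
    ContDiff ℝ n (coordDeriv i f) := by
  have h1 : ContDiff ℝ n (fun x => fderiv ℝ f x (stdVec i)) := by
    have : ContDiff ℝ n (fderiv ℝ f) := hf.fderiv_right (by norm_cast)
    exact this.clm_apply contDiff_const
  have hd : Differentiable ℝ f := hf.differentiable (by norm_cast)
  convert h1 using 1
  funext x
  exact (fderiv_stdVec (hd x) i).symm

lemma coordDeriv_comm {f : Rd d → ℝ} (hf : ContDiff ℝ 2 f) (i j : Fin d) :
    coordDeriv i (coordDeriv j f) = coordDeriv j (coordDeriv i f) := by
  have hd : Differentiable ℝ f := hf.differentiable (by norm_num)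
  have h1 : Differentiable ℝ (fderiv ℝ f) :=
    (hf.fderiv_right (m := 1) (by norm_num)).differentiable (by norm_num)
  have key : ∀ a b : Fin d, ∀ x,
      coordDeriv a (coordDeriv b f) x = fderiv ℝ (fderiv ℝ f) x (stdVec a) (stdVec b) := by
    intro a b x
    have e : coordDeriv b f = fun x => fderiv ℝ f x (stdVec b) := by
      funext x; exact (fderiv_stdVec (hd x) b).symm
    have hdiff : DifferentiableAt ℝ (fun x => fderiv ℝ f x (stdVec b)) x :=
      (h1 x).clm_apply (differentiableAt_const _)
    rw [e, ← fderiv_stdVec hdiff, fderiv_clm_apply (h1 x) (differentiableAt_const _)]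
    simp
  funext x
  rw [key, key]
  have := (hf.contDiffAt (x := x)).isSymmSndFDerivAt (by simp)
  exact this _ _

lemma contDiff_iterate_coordDeriv {n m : ℕ} {f : Rd d → ℝ} (hf : ContDiff ℝ (n + m : ℕ) f)
    (i : Fin d) : ContDiff ℝ n ((coordDeriv i)^[m] f) := by
  induction m generalizing f with
  | zero => simpa using hf
  | succ m ih =>
    rw [Function.iterate_succ_apply]
    exact ih (contDiff_coordDeriv (by rw [add_assoc]; exact hf) i)

lemma coordDeriv_iterate_comm {n : ℕ} {f : Rd d → ℝ} (hf : ContDiff ℝ (n + 1 : ℕ) f)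
    (i j : Fin d) :
    coordDeriv i ((coordDeriv j)^[n] f) = (coordDeriv j)^[n] (coordDeriv i f) := by
  induction n generalizing f with
  | zero => rfl
  | succ n ih =>
    rw [Function.iterate_succ_apply, ih (contDiff_coordDeriv hf j), Function.iterate_succ_apply,
      coordDeriv_comm (hf.of_le (by norm_cast; omega))]

/-- Iterated partial derivatives in the directions of a list of coordinates. -/
def listDeriv (L : List (Fin d)) (k : Fin d → ℕ) (f : Rd d → ℝ) : Rd d → ℝ :=
  L.foldr (fun i g => (coordDeriv i)^[k i] g) f

lemma partialDeriv_eq_listDeriv (k : Fin d → ℕ) (f : Rd d → ℝ) :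
    partialDeriv k f = listDeriv (List.finRange d) k f := rfl

lemma contDiff_listDeriv (L : List (Fin d)) (k : Fin d → ℕ) {n : ℕ} {f : Rd d → ℝ}
    (hf : ContDiff ℝ (n + (L.map k).sum : ℕ) f) : ContDiff ℝ n (listDeriv L k f) := by
  induction L generalizing n with
  | nil => simpa [listDeriv] using hf
  | cons a L ih =>
    have : ContDiff ℝ (n + k a : ℕ) (listDeriv L k f) := ih (by
      convert hf using 2
      simp only [List.map_cons, List.sum_cons]
      ring)
    exact contDiff_iterate_coordDeriv this a

lemma coordDeriv_listDeriv (L : List (Fin d)) (k : Fin d → ℕ) {f : Rd d → ℝ}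
    (hf : ContDiff ℝ ((L.map k).sum + 1 : ℕ) f) (i : Fin d) :
    coordDeriv i (listDeriv L k f) = listDeriv L k (coordDeriv i f) := by
  induction L with
  | nil => rfl
  | cons a L ih =>
    have h1 : ContDiff ℝ (k a + 1 : ℕ) (listDeriv L k f) := contDiff_listDeriv L k (by
      convert hf using 2
      simp only [List.map_cons, List.sum_cons]
      ring)
    have h2 := coordDeriv_iterate_comm h1 i a
    have h3 := ih (hf.of_le (by norm_cast; simp only [List.map_cons, List.sum_cons]; omega))
    change coordDeriv i ((coordDeriv a)^[k a] (listDeriv L k f)) =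
      (coordDeriv a)^[k a] (listDeriv L k (coordDeriv i f))
    rw [h2, h3]

lemma listDeriv_add_unitIdx_of_notMem {L : List (Fin d)} {i : Fin d} (hi : i ∉ L)
    (k : Fin d → ℕ) (f : Rd d → ℝ) : listDeriv L (k + unitIdx i) f = listDeriv L k f := by
  induction L with
  | nil => rfl
  | cons a L ih =>
    simp only [List.mem_cons, not_or] at hi
    have : (k + unitIdx i) a = k a := by simp [unitIdx, Ne.symm hi.1]
    change (coordDeriv a)^[(k + unitIdx i) a] (listDeriv L (k + unitIdx i) f) = _
    rw [this, ih hi.2]; rfl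

lemma listDeriv_add_unitIdx {L : List (Fin d)} (hL : L.Nodup) {i : Fin d} (hi : i ∈ L)
    (k : Fin d → ℕ) {f : Rd d → ℝ} (hf : ContDiff ℝ ((L.map k).sum + 1 : ℕ) f) :
    listDeriv L (k + unitIdx i) f = coordDeriv i (listDeriv L k f) := by
  induction L with
  | nil => simp at hi
  | cons a L ih =>
    rw [List.nodup_cons] at hL
    change (coordDeriv a)^[(k + unitIdx i) a] (listDeriv L (k + unitIdx i) f) =
      coordDeriv i ((coordDeriv a)^[k a] (listDeriv L k f))
    by_cases hia : i = a
    · subst hia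
      rw [listDeriv_add_unitIdx_of_notMem hL.1]
      have : (k + unitIdx i) i = k i + 1 := by simp [unitIdx]
      rw [this, Function.iterate_succ_apply']
    · have h1 : ContDiff ℝ (k a + 1 : ℕ) (listDeriv L k f) := contDiff_listDeriv L k (by
        convert hf using 2
        simp only [List.map_cons, List.sum_cons]
        ring)
      have : (k + unitIdx i) a = k a := by simp [unitIdx, Ne.symm hia]
      rw [this, ih hL.2 (by simpa [hia] using hi) (hf.of_le (by norm_cast; simp only [List.map_cons, List.sum_cons]; omega)),
        coordDeriv_iterate_comm h1]

lemma sum_map_finRange (k : Fin d → ℕ) : ((List.finRange d).map k).sum = mlen k := by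
  rw [mlen, ← List.sum_ofFn, List.ofFn_eq_map]

lemma partialDeriv_zero (f : Rd d → ℝ) : partialDeriv 0 f = f := by
  rw [partialDeriv_eq_listDeriv]
  have : ∀ L : List (Fin d), listDeriv L 0 f = f := by
    intro L
    induction L with
    | nil => rfl
    | cons a L ih => exact ih
  exact this _

lemma contDiff_partialDeriv {n : ℕ} {f : Rd d → ℝ} (k : Fin d → ℕ)
    (hf : ContDiff ℝ (n + mlen k : ℕ) f) : ContDiff ℝ n (partialDeriv k f) :=
  contDiff_listDeriv _ k (by rw [sum_map_finRange]; exact hf)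

lemma continuous_partialDeriv {n : ℕ} {f : Rd d → ℝ} (hf : ContDiff ℝ n f) {k : Fin d → ℕ}
    (hk : mlen k ≤ n) : Continuous (partialDeriv k f) :=
  (contDiff_partialDeriv (n := 0) k (hf.of_le (by norm_cast; omega))).continuous

lemma partialDeriv_add_unitIdx {f : Rd d → ℝ} (k : Fin d → ℕ) (i : Fin d)
    (hf : ContDiff ℝ (mlen k + 1 : ℕ) f) :
    partialDeriv (k + unitIdx i) f = coordDeriv i (partialDeriv k f) :=
  listDeriv_add_unitIdx (List.nodup_finRange d) (List.mem_finRange i) k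
    (by rw [sum_map_finRange]; exact hf)

lemma partialDeriv_add_unitIdx' {f : Rd d → ℝ} (k : Fin d → ℕ) (i : Fin d)
    (hf : ContDiff ℝ (mlen k + 1 : ℕ) f) :
    partialDeriv (k + unitIdx i) f = partialDeriv k (coordDeriv i f) := by
  rw [partialDeriv_add_unitIdx k i hf]
  exact coordDeriv_listDeriv _ k (by rw [sum_map_finRange]; exact hf) i

lemma partialDeriv_unitIdx {f : Rd d → ℝ} (i : Fin d) (hf : ContDiff ℝ 1 f) :
    partialDeriv (unitIdx i) f = coordDeriv i f := by
  have := partialDeriv_add_unitIdx (f := f) 0 i (by simpa [mlen_zero] using hf)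
  rwa [zero_add, partialDeriv_zero] at this

/-- The differential with prescribed partial derivatives. -/
def gradForm (a : Fin d → ℝ) : Rd d →L[ℝ] ℝ := ∑ i, a i • (EuclideanSpace.proj i : Rd d →L[ℝ] ℝ)

lemma gradForm_apply (a : Fin d → ℝ) (v : Rd d) : gradForm a v = ∑ i, v i * a i := by
  simp [gradForm, mul_comm]

lemma hasFDerivAt_gradForm {f : Rd d → ℝ} {x : Rd d} (hf : DifferentiableAt ℝ f x) :
    HasFDerivAt f (gradForm fun i => coordDeriv i f x) x := by
  convert hf.hasFDerivAt using 1
  ext v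
  rw [gradForm_apply, fderiv_eq_sum hf]

lemma coordDeriv_eq_of_hasFDerivAt {f : Rd d → ℝ} {x : Rd d} {a : Fin d → ℝ}
    (h : HasFDerivAt f (gradForm a) x) (i : Fin d) : coordDeriv i f x = a i := by
  rw [← fderiv_stdVec h.differentiableAt, h.fderiv, gradForm_apply]
  simp [stdVec, PiLp.single_apply]

/-- A family `g l`, `|l| ≤ r`, of continuous functions is a derivative family if
`∂_i g l = g (l + e_i)`. -/
structure IsDerivFamily (r : ℕ) (g : (Fin d → ℕ) → Rd d → ℝ) : Prop where
  cont : ∀ l, mlen l ≤ r → Continuous (g l)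
  deriv : ∀ l, mlen l < r → ∀ x, HasFDerivAt (g l) (gradForm fun i => g (l + unitIdx i) x) x

lemma continuous_gradForm {X : Type*} [TopologicalSpace X] {a : X → Fin d → ℝ}
    (ha : ∀ i, Continuous fun x => a x i) : Continuous fun x => gradForm (a x) := by
  unfold gradForm
  exact continuous_finsetSum _ fun i _ => (ha i).smul continuous_const

lemma contDiff_gradForm {n : ℕ} {a : Rd d → Fin d → ℝ}
    (ha : ∀ i, ContDiff ℝ n fun x => a x i) : ContDiff ℝ n fun x => gradForm (a x) := by
  unfold gradForm
  exact ContDiff.sum fun i _ => (ha i).smul contDiff_const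

lemma IsDerivFamily.contDiff {r : ℕ} {g : (Fin d → ℕ) → Rd d → ℝ} (h : IsDerivFamily r g)
    {n : ℕ} {l : Fin d → ℕ} (hl : mlen l + n ≤ r) : ContDiff ℝ n (g l) := by
  induction n generalizing l with
  | zero => exact contDiff_zero.2 (h.cont l (by omega))
  | succ n ih =>
    have hd := h.deriv l (by omega)
    push_cast
    rw [contDiff_succ_iff_hasFDerivAt]
    refine ⟨fun x => gradForm fun i => g (l + unitIdx i) x, ?_, hd⟩
    exact contDiff_gradForm fun i => ih (by rw [mlen_add_unitIdx]; omega)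

lemma IsDerivFamily.partialDeriv_eq {r : ℕ} {g : (Fin d → ℕ) → Rd d → ℝ}
    (h : IsDerivFamily r g) (k : Fin d → ℕ) {l : Fin d → ℕ} (hl : mlen l + mlen k ≤ r) :
    partialDeriv k (g l) = g (l + k) := by
  induction k using multiIndex_induction with
  | h0 => rw [partialDeriv_zero, add_zero]
  | hs k i ih =>
    rw [mlen_add_unitIdx] at hl
    rw [partialDeriv_add_unitIdx k i (h.contDiff (by omega)), ih (by omega)]
    funext x
    rw [coordDeriv_eq_of_hasFDerivAt (h.deriv (l + k) (by rw [mlen_add]; omega) x), add_assoc]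

lemma isDerivFamily_partialDeriv {r : ℕ} {f : Rd d → ℝ} (hf : ContDiff ℝ r f) :
    IsDerivFamily r fun l => partialDeriv l f where
  cont l hl := continuous_partialDeriv hf hl
  deriv l hl x := by
    have h1 : ContDiff ℝ 1 (partialDeriv l f) :=
      contDiff_partialDeriv (n := 1) l (hf.of_le (by norm_cast; omega))
    have := hasFDerivAt_gradForm (h1.differentiable (by norm_num) x)
    convert this using 3
    rw [partialDeriv_add_unitIdx l _ (hf.of_le (by norm_cast))]

lemma partialDeriv_partialDeriv {f : Rd d → ℝ} (k l : Fin d → ℕ)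
    (hf : ContDiff ℝ (mlen l + mlen k : ℕ) f) :
    partialDeriv k (partialDeriv l f) = partialDeriv (l + k) f :=
  (isDerivFamily_partialDeriv hf).partialDeriv_eq k le_rfl

lemma IsDerivFamily.contDiff_zero' {r : ℕ} {g : (Fin d → ℕ) → Rd d → ℝ}
    (h : IsDerivFamily r g) : ContDiff ℝ r (g 0) :=
  h.contDiff (by simp [mlen_zero])

lemma IsDerivFamily.partialDeriv_zero_eq {r : ℕ} {g : (Fin d → ℕ) → Rd d → ℝ}
    (h : IsDerivFamily r g) {k : Fin d → ℕ} (hk : mlen k ≤ r) :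
    partialDeriv k (g 0) = g k := by
  rw [h.partialDeriv_eq k (by simpa [mlen_zero] using hk), zero_add]

lemma IsDerivFamily.add {r : ℕ} {g g' : (Fin d → ℕ) → Rd d → ℝ} (h : IsDerivFamily r g)
    (h' : IsDerivFamily r g') : IsDerivFamily r fun l x => g l x + g' l x where
  cont l hl := (h.cont l hl).add (h'.cont l hl)
  deriv l hl x := by
    refine ((h.deriv l hl x).add (h'.deriv l hl x)).congr_fderiv ?_
    ext v
    simp [gradForm_apply, mul_add, Finset.sum_add_distrib]

lemma IsDerivFamily.const_mul {r : ℕ} {g : (Fin d → ℕ) → Rd d → ℝ} (h : IsDerivFamily r g)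
    (c : ℝ) : IsDerivFamily r fun l x => c * g l x where
  cont l hl := (h.cont l hl).const_mul c
  deriv l hl x := by
    refine ((h.deriv l hl x).const_mul c).congr_fderiv ?_
    ext v
    simp only [gradForm_apply, _root_.smul_apply, smul_eq_mul, Finset.mul_sum]
    exact Finset.sum_congr rfl fun i _ => by ring

/-- Precomposition with `y ↦ c (y - x)`. -/
lemma IsDerivFamily.comp_affine {r : ℕ} {g : (Fin d → ℕ) → Rd d → ℝ} (h : IsDerivFamily r g)
    (c : ℝ) (x : Rd d) : IsDerivFamily r fun l y => c ^ mlen l * g l (c • (y - x)) where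
  cont l hl := ((h.cont l hl).comp (by fun_prop)).const_mul _
  deriv l hl y := by
    have h1 : HasFDerivAt (fun y : Rd d => c • (y - x)) (c • ContinuousLinearMap.id ℝ (Rd d)) y :=
      ((hasFDerivAt_id y).sub_const x).const_smul c
    have h2 := ((h.deriv l hl (c • (y - x))).comp y h1).const_mul (c ^ mlen l)
    refine h2.congr_fderiv ?_
    ext v
    simp only [gradForm_apply, mlen_add_unitIdx, _root_.smul_apply,
      ContinuousLinearMap.comp_apply, ContinuousLinearMap.id_apply, PiLp.smul_apply, smul_eq_mul,
      Finset.mul_sum]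
    exact Finset.sum_congr rfl fun i _ => by ring

lemma partialDeriv_comp_affine {f : Rd d → ℝ} {k : Fin d → ℕ} (hf : ContDiff ℝ (mlen k) f)
    (c : ℝ) (x : Rd d) :
    partialDeriv k (fun y => f (c • (y - x))) =
      fun y => c ^ mlen k * partialDeriv k f (c • (y - x)) := by
  have h := (isDerivFamily_partialDeriv hf).comp_affine c x
  have := h.partialDeriv_zero_eq le_rfl
  simpa [partialDeriv_zero, mlen_zero] using this

lemma partialDeriv_add {f g : Rd d → ℝ} {k : Fin d → ℕ} (hf : ContDiff ℝ (mlen k) f)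
    (hg : ContDiff ℝ (mlen k) g) :
    partialDeriv k (fun y => f y + g y) = fun y => partialDeriv k f y + partialDeriv k g y := by
  have h := (isDerivFamily_partialDeriv hf).add (isDerivFamily_partialDeriv hg)
  simpa [partialDeriv_zero] using h.partialDeriv_zero_eq le_rfl

lemma partialDeriv_const_mul {f : Rd d → ℝ} {k : Fin d → ℕ} (hf : ContDiff ℝ (mlen k) f)
    (c : ℝ) : partialDeriv k (fun y => c * f y) = fun y => c * partialDeriv k f y := by
  have h := (isDerivFamily_partialDeriv hf).const_mul c
  simpa [partialDeriv_zero] using h.partialDeriv_zero_eq le_rfl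

lemma partialDeriv_sub {f g : Rd d → ℝ} {k : Fin d → ℕ} (hf : ContDiff ℝ (mlen k) f)
    (hg : ContDiff ℝ (mlen k) g) :
    partialDeriv k (fun y => f y - g y) = fun y => partialDeriv k f y - partialDeriv k g y := by
  have h := partialDeriv_add hf (contDiff_const.mul hg (n := mlen k) (f := fun _ => (-1 : ℝ)))
  rw [partialDeriv_const_mul hg] at h
  simpa [sub_eq_add_neg] using h

lemma tsupport_partialDeriv_subset (k : Fin d → ℕ) (f : Rd d → ℝ) :
    tsupport (partialDeriv k f) ⊆ tsupport f := by
  have hc : ∀ (i : Fin d) (f : Rd d → ℝ), tsupport (coordDeriv i f) ⊆ tsupport f := by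
    intro i f
    refine closure_minimal (fun x hx => ?_) isClosed_closure
    by_contra hxf
    apply hx
    have : f =ᶠ[𝓝 x] 0 := notMem_tsupport_iff_eventuallyEq.1 hxf
    have h := this.lineDeriv_eq (𝕜 := ℝ) (v := stdVec i)
    change lineDeriv ℝ f x (stdVec i) = 0
    rw [h]
    simp [lineDeriv]
  have hi : ∀ (n : ℕ) (i : Fin d) (f : Rd d → ℝ), tsupport ((coordDeriv i)^[n] f) ⊆ tsupport f := by
    intro n i
    induction n with
    | zero => exact fun f => subset_rfl
    | succ n ih => exact fun f => (ih _).trans (hc i f)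
  have : ∀ L : List (Fin d), tsupport (listDeriv L k f) ⊆ tsupport f := by
    intro L
    induction L with
    | nil => exact subset_rfl
    | cons a L ih => exact (hi _ _ _).trans ih
  exact this _

/-! ### Taylor's formula in multi-index notation -/

lemma mpow_add (v : Rd d) (k l : Fin d → ℕ) : mpow v (k + l) = mpow v k * mpow v l := by
  simp [mpow, pow_add, Finset.prod_mul_distrib]

lemma mpow_zero (v : Rd d) : mpow v 0 = 1 := by simp [mpow]

lemma mpow_unitIdx (v : Rd d) (i : Fin d) : mpow v (unitIdx i) = v i := by
  rw [mpow, Finset.prod_eq_single i]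
  · simp [unitIdx]
  · intro j _ hj
    simp [unitIdx, hj]
  · simp

lemma mpow_smul (c : ℝ) (v : Rd d) (k : Fin d → ℕ) : mpow (c • v) k = c ^ mlen k * mpow v k := by
  simp [mpow, mul_pow, Finset.prod_mul_distrib, mlen, Finset.prod_pow_eq_pow_sum]

lemma abs_mpow_le (v : Rd d) (k : Fin d → ℕ) : |mpow v k| ≤ ‖v‖ ^ mlen k := by
  rw [mpow, Finset.abs_prod, mlen, ← Finset.prod_pow_eq_pow_sum]
  refine Finset.prod_le_prod (fun _ _ => abs_nonneg _) fun i _ => ?_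
  rw [abs_pow]
  exact pow_le_pow_left₀ (abs_nonneg _) (by simpa using PiLp.norm_apply_le v i) _

lemma continuous_mpow (k : Fin d → ℕ) : Continuous fun v : Rd d => mpow v k := by
  unfold mpow
  fun_prop

lemma mfact_pos (k : Fin d → ℕ) : 0 < mfact k :=
  Finset.prod_pos fun i _ => by exact_mod_cast Nat.factorial_pos _

lemma one_le_mfact (k : Fin d → ℕ) : 1 ≤ mfact k := by
  unfold mfact
  exact_mod_cast Nat.one_le_iff_ne_zero.2
    (Finset.prod_ne_zero_iff.2 fun i _ => Nat.factorial_ne_zero _)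

lemma mfact_add_unitIdx (k : Fin d → ℕ) (i : Fin d) :
    mfact (k + unitIdx i) = (k i + 1) * mfact k := by
  unfold mfact
  rw [← Finset.mul_prod_erase _ _ (Finset.mem_univ i),
    ← Finset.mul_prod_erase Finset.univ (fun j => ((k j).factorial : ℝ))
      (Finset.mem_univ i), ← mul_assoc]
  congr 1
  · simp [unitIdx, Nat.factorial_succ]
  · refine Finset.prod_congr rfl fun j hj => ?_
    simp [unitIdx, (Finset.mem_erase.1 hj).1]

/-- The multi-indices of length `n`. -/
def multiIndicesEQ (d n : ℕ) : Finset (Fin d → ℕ) := {k ∈ multiIndicesLE d n | mlen k = n}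

lemma mem_multiIndicesEQ {n : ℕ} {k : Fin d → ℕ} : k ∈ multiIndicesEQ d n ↔ mlen k = n := by
  simp only [multiIndicesEQ, Finset.mem_filter, mem_multiIndicesLE]
  omega

lemma sum_multiIndicesEQ_succ (n : ℕ) (A : (Fin d → ℕ) → ℝ) :
    ∑ i, ∑ k ∈ multiIndicesEQ d n, A (k + unitIdx i) / mfact k =
      (n + 1) * ∑ k ∈ multiIndicesEQ d (n + 1), A k / mfact k := by
  have h1 : ∀ i, ∑ k ∈ multiIndicesEQ d n, A (k + unitIdx i) / mfact k =
      ∑ k ∈ multiIndicesEQ d (n + 1), k i * (A k / mfact k) := by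
    intro i
    have h2 : ∑ k ∈ multiIndicesEQ d (n + 1), k i * (A k / mfact k) =
        ∑ k ∈ multiIndicesEQ d (n + 1) with k i ≠ 0, k i * (A k / mfact k) := by
      refine (Finset.sum_filter_of_ne fun k _ hk => ?_).symm
      intro h0
      simp [h0] at hk
    rw [h2]
    refine Finset.sum_bij' (fun k _ => k + unitIdx i) (fun k _ => k - unitIdx i) ?_ ?_ ?_ ?_ ?_
    · intro k hk
      simp only [Finset.mem_filter, mem_multiIndicesEQ, mlen_add_unitIdx] at hk ⊢
      exact ⟨by omega, by simp [unitIdx]⟩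
    · intro k hk
      simp only [Finset.mem_filter, mem_multiIndicesEQ] at hk ⊢
      have : k - unitIdx i + unitIdx i = k := by
        funext j
        by_cases hj : j = i
        · subst hj; simp [unitIdx]; omega
        · simp [unitIdx, hj]
      have h3 := mlen_add_unitIdx (k - unitIdx i) i
      rw [this] at h3
      omega
    · intro k _
      simp
    · intro k hk
      simp only [Finset.mem_filter, mem_multiIndicesEQ] at hk
      funext j
      by_cases hj : j = i
      · subst hj; simp [unitIdx]; omega
      · simp [unitIdx, hj]
    · intro k _
      rw [mfact_add_unitIdx]
      have := mfact_pos k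
      simp only [unitIdx, Pi.add_apply, Pi.single_eq_same]
      push_cast
      field_simp
  simp_rw [h1]
  rw [Finset.sum_comm, Finset.mul_sum]
  refine Finset.sum_congr rfl fun k hk => ?_
  rw [← Finset.sum_mul]
  congr 1
  have := mem_multiIndicesEQ.1 hk
  rw [mlen] at this
  exact_mod_cast this

lemma sum_fin_multiIndices (n : ℕ) (A : (Fin d → ℕ) → ℝ) :
    ∑ l : Fin n → Fin d, A (∑ j, unitIdx (l j)) =
      n.factorial * ∑ k ∈ multiIndicesEQ d n, A k / mfact k := by
  induction n generalizing A with
  | zero =>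
    have : multiIndicesEQ d 0 = {0} := by
      ext k
      rw [mem_multiIndicesEQ, Finset.mem_singleton]
      exact ⟨eq_zero_of_mlen_eq_zero, fun h => by rw [h, mlen_zero]⟩
    simp [this, mfact]
  | succ n ih =>
    rw [← (Fin.consEquiv fun _ => Fin d).sum_comp, Fintype.sum_prod_type]
    have : ∀ i, ∑ l : Fin n → Fin d,
        A (∑ j, unitIdx ((Fin.consEquiv fun _ : Fin (n + 1) => Fin d) (i, l) j)) =
        n.factorial * ∑ k ∈ multiIndicesEQ d n, A (k + unitIdx i) / mfact k := by
      intro i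
      rw [← ih fun k => A (k + unitIdx i)]
      refine Finset.sum_congr rfl fun l _ => ?_
      rw [Fin.sum_univ_succ]
      simp [Fin.consEquiv, add_comm]
    simp_rw [this]
    rw [← Finset.mul_sum, sum_multiIndicesEQ_succ, Nat.factorial_succ]
    push_cast
    ring

lemma iteratedFDeriv_stdVec {n : ℕ} {f : Rd d → ℝ} (hf : ContDiff ℝ n f) (l : Fin n → Fin d)
    (x : Rd d) :
    iteratedFDeriv ℝ n f x (fun j => stdVec (l j)) = partialDeriv (∑ j, unitIdx (l j)) f x := by
  induction n generalizing x with
  | zero => simp [partialDeriv_zero]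
  | succ n ih =>
    have hd : DifferentiableAt ℝ (iteratedFDeriv ℝ n f) x :=
      hf.contDiffAt.differentiableAt_iteratedFDeriv (by norm_cast; omega)
    rw [hd.iteratedFDeriv_succ_apply_left']
    have h1 : (fun y => iteratedFDeriv ℝ n f y (Fin.tail fun j => stdVec (l j))) =
        partialDeriv (∑ j : Fin n, unitIdx (l j.succ)) f := by
      funext y
      exact ih (hf.of_le (by norm_cast; omega)) (fun j => l j.succ) y
    have hlen : mlen (∑ j : Fin n, unitIdx (l j.succ)) = n := by
      have : ∀ (s : Finset (Fin n)), mlen (∑ j ∈ s, unitIdx (l j.succ)) = s.card := by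
        intro s
        induction s using Finset.induction_on with
        | empty => simp [mlen_zero]
        | insert a s ha ih => rw [Finset.sum_insert ha, mlen_add, mlen_unitIdx, ih,
            Finset.card_insert_of_notMem ha, add_comm]
      simpa using this Finset.univ
    rw [h1, Fin.sum_univ_succ, add_comm (unitIdx (l 0)),
      partialDeriv_add_unitIdx _ _ (by rw [hlen]; exact hf)]
    have hdiff : Differentiable ℝ (partialDeriv (∑ j : Fin n, unitIdx (l j.succ)) f) :=
      (contDiff_partialDeriv (n := 1) _ (by rw [hlen, add_comm]; exact hf)).differentiable
        (by norm_num)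
    exact fderiv_stdVec (hdiff x) (l 0)

lemma iteratedFDeriv_eq_sum {n : ℕ} {f : Rd d → ℝ} (hf : ContDiff ℝ n f) (x : Rd d)
    (v : Fin n → Rd d) :
    iteratedFDeriv ℝ n f x v =
      ∑ l : Fin n → Fin d, (∏ j, v j (l j)) * partialDeriv (∑ j, unitIdx (l j)) f x := by
  have h1 : v = fun j => ∑ i, v j i • stdVec i := by
    funext j; exact (sum_smul_stdVec (v j)).symm
  conv_lhs => rw [h1]
  have h2 := (iteratedFDeriv ℝ n f x).toMultilinearMap.map_sum
    (g := fun (j : Fin n) (i : Fin d) => v j i • (stdVec i : Rd d))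
  refine h2.trans (Finset.sum_congr rfl fun l _ => ?_)
  have h3 := (iteratedFDeriv ℝ n f x).toMultilinearMap.map_smul_univ (fun j => v j (l j))
    (fun j => (stdVec (l j) : Rd d))
  refine h3.trans ?_
  rw [smul_eq_mul]
  congr 1
  exact iteratedFDeriv_stdVec hf l x

lemma mlen_sum_unitIdx {n : ℕ} (l : Fin n → Fin d) : mlen (∑ j, unitIdx (l j)) = n := by
  have : ∀ (s : Finset (Fin n)), mlen (∑ j ∈ s, unitIdx (l j)) = s.card := by
    intro s
    induction s using Finset.induction_on with
    | empty => simp [mlen_zero]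
    | insert a s ha ih => rw [Finset.sum_insert ha, mlen_add, mlen_unitIdx, ih,
        Finset.card_insert_of_notMem ha, add_comm]
  simpa using this Finset.univ

lemma norm_iteratedFDeriv_le_of_partialDeriv {n : ℕ} {f : Rd d → ℝ} (hf : ContDiff ℝ n f)
    {x : Rd d} {M : ℝ} (hM : ∀ k : Fin d → ℕ, mlen k = n → |partialDeriv k f x| ≤ M) :
    ‖iteratedFDeriv ℝ n f x‖ ≤ d ^ n * |M| := by
  refine ContinuousMultilinearMap.opNorm_le_bound (by positivity) fun v => ?_
  rw [iteratedFDeriv_eq_sum hf]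
  refine (norm_sum_le _ _).trans ?_
  have : ∀ l ∈ (Finset.univ : Finset (Fin n → Fin d)),
      ‖(∏ j, v j (l j)) * partialDeriv (∑ j, unitIdx (l j)) f x‖ ≤ |M| * ∏ j, ‖v j‖ := by
    intro l _
    rw [norm_mul, mul_comm, norm_prod]
    refine mul_le_mul ((hM _ (mlen_sum_unitIdx l)).trans (le_abs_self _)) ?_ (by positivity)
      (abs_nonneg _)
    exact Finset.prod_le_prod (fun _ _ => norm_nonneg _) fun j _ => PiLp.norm_apply_le _ _
  refine (Finset.sum_le_card_nsmul _ _ _ this).trans (le_of_eq ?_)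
  simp
  ring

lemma norm_stdVec (i : Fin d) : ‖(stdVec i : Rd d)‖ = 1 := by simp [stdVec]

lemma exists_sum_unitIdx (k : Fin d → ℕ) : ∃ l : Fin (mlen k) → Fin d, ∑ j, unitIdx (l j) = k := by
  induction k using multiIndex_induction with
  | h0 => exact ⟨fun j => absurd j.2 (by simp [mlen_zero]), by
      apply eq_zero_of_mlen_eq_zero; rw [mlen_sum_unitIdx, mlen_zero]⟩
  | hs k i ih =>
    obtain ⟨l, hl⟩ := ih
    rw [mlen_add_unitIdx]
    refine ⟨Fin.cons i l, ?_⟩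
    rw [Fin.sum_univ_succ]
    simp [hl, add_comm]

lemma abs_partialDeriv_le_norm_iteratedFDeriv {f : Rd d → ℝ} {k : Fin d → ℕ}
    (hf : ContDiff ℝ (mlen k) f) (x : Rd d) :
    |partialDeriv k f x| ≤ ‖iteratedFDeriv ℝ (mlen k) f x‖ := by
  obtain ⟨l, hl⟩ := exists_sum_unitIdx k
  have h1 := iteratedFDeriv_stdVec hf l x
  rw [hl] at h1
  rw [← h1, ← Real.norm_eq_abs]
  refine (ContinuousMultilinearMap.le_opNorm _ _).trans ?_
  simp [norm_stdVec]

lemma iteratedFDeriv_const_apply {n : ℕ} {f : Rd d → ℝ} (hf : ContDiff ℝ n f) (x v : Rd d) :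
    iteratedFDeriv ℝ n f x (fun _ => v) =
      n.factorial * ∑ k ∈ multiIndicesEQ d n, partialDeriv k f x * (mpow v k / mfact k) := by
  rw [iteratedFDeriv_eq_sum hf]
  have h1 := sum_fin_multiIndices n fun k => mpow v k * partialDeriv k f x
  have h2 : ∀ l : Fin n → Fin d, (∏ j, v (l j)) = mpow v (∑ j, unitIdx (l j)) := by
    intro l
    have : ∀ s : Finset (Fin n), ∏ j ∈ s, v (l j) = mpow v (∑ j ∈ s, unitIdx (l j)) := by
      intro s
      induction s using Finset.induction_on with
      | empty => simp [mpow_zero]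
      | insert a s ha ih => rw [Finset.prod_insert ha, Finset.sum_insert ha, mpow_add,
          mpow_unitIdx, ih]
    exact this _
  simp_rw [h2]
  rw [h1]
  congr 1
  exact Finset.sum_congr rfl fun k _ => by ring

lemma sum_multiIndicesLT_eq (n : ℕ) (A : (Fin d → ℕ) → ℝ) :
    ∑ k ∈ multiIndicesLT d (n : ℝ), A k = ∑ i ∈ Finset.range n, ∑ k ∈ multiIndicesEQ d i, A k := by
  rw [← Finset.sum_fiberwise_of_maps_to (g := mlen) (t := Finset.range n)]
  · refine Finset.sum_congr rfl fun i hi => Finset.sum_congr ?_ fun _ _ => rfl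
    ext k
    simp only [Finset.mem_filter, mem_multiIndicesLT, mem_multiIndicesEQ, Nat.cast_lt]
    rw [Finset.mem_range] at hi
    constructor
    · exact fun h => h.2
    · exact fun h => ⟨by omega, h⟩
  · intro k hk
    rw [mem_multiIndicesLT] at hk
    exact Finset.mem_range.2 (by exact_mod_cast hk)

/-- Taylor's formula with a bound on the remainder. -/
lemma taylor_bound {j : ℕ} {f : Rd d → ℝ} (hf : ContDiff ℝ j f) (x v : Rd d) {M : ℝ}
    (hM : ∀ k : Fin d → ℕ, mlen k = j → ∀ τ ∈ Set.Icc (0 : ℝ) 1,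
      |partialDeriv k f (x + τ • v)| ≤ M) :
    |f (x + v) - ∑ k ∈ multiIndicesLT d (j : ℝ), partialDeriv k f x * (mpow v k / mfact k)|
      ≤ d ^ j * |M| * ‖v‖ ^ j := by
  cases j with
  | zero =>
    have h := hM 0 mlen_zero 1 (by simp)
    rw [partialDeriv_zero, one_smul] at h
    rw [sum_multiIndicesLT_eq]
    simpa using h.trans (le_abs_self M)
  | succ n =>
    have h1 := map_add_eq_sum_add_integral_iteratedFDeriv (f := f) (x := x) (y := v) (n := n)
      (fun t _ => by exact_mod_cast hf.contDiffAt)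
    have h2 : ∑ k ∈ multiIndicesLT d ((n + 1 : ℕ) : ℝ), partialDeriv k f x * (mpow v k / mfact k) =
        ∑ k ∈ Finset.range (n + 1), (k.factorial : ℝ)⁻¹ • iteratedFDeriv ℝ k f x fun _ => v := by
      rw [sum_multiIndicesLT_eq]
      refine Finset.sum_congr rfl fun i hi => ?_
      rw [Finset.mem_range] at hi
      rw [iteratedFDeriv_const_apply (hf.of_le (by norm_cast; omega)), smul_eq_mul, ← mul_assoc,
        inv_mul_cancel₀ (by exact_mod_cast Nat.factorial_ne_zero i), one_mul]
    rw [h2, h1, add_sub_cancel_left, smul_eq_mul, abs_mul]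
    have h3 : ‖∫ t in (0 : ℝ)..1, (1 - t) ^ n • iteratedFDeriv ℝ (n + 1) f (x + t • v) fun _ => v‖
        ≤ d ^ (n + 1) * |M| * ‖v‖ ^ (n + 1) * |(1 : ℝ) - 0| := by
      refine intervalIntegral.norm_integral_le_of_norm_le_const fun t ht => ?_
      rw [Set.uIoc_of_le zero_le_one] at ht
      rw [norm_smul]
      have h4 : ‖(1 - t) ^ n‖ ≤ 1 := by
        rw [norm_pow]
        refine pow_le_one₀ (norm_nonneg _) ?_
        rw [Real.norm_eq_abs, abs_le]
        constructor <;> linarith [ht.1, ht.2]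
      have h5 := (iteratedFDeriv ℝ (n + 1) f (x + t • v)).le_opNorm fun _ => v
      have h6 := norm_iteratedFDeriv_le_of_partialDeriv hf (x := x + t • v)
        fun k hk => hM k hk t ⟨ht.1.le, ht.2⟩
      calc _ ≤ 1 * ‖(iteratedFDeriv ℝ (n + 1) f (x + t • v)) fun _ => v‖ := by gcongr
        _ ≤ _ := by
          rw [one_mul]
          refine h5.trans ?_
          simp only [Finset.prod_const, Finset.card_univ, Fintype.card_fin]
          gcongr
    rw [Real.norm_eq_abs] at h3
    have h7 : |((n.factorial : ℝ))⁻¹| ≤ 1 := by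
      rw [abs_of_nonneg (by positivity)]
      exact inv_le_one_of_one_le₀ (by exact_mod_cast Nat.one_le_iff_ne_zero.2 (Nat.factorial_ne_zero n))
    calc _ ≤ 1 * (d ^ (n + 1) * |M| * ‖v‖ ^ (n + 1) * |(1 : ℝ) - 0|) := by gcongr
      _ = _ := by simp

/-! ### Integrals depending on a parameter, convolutions -/

lemma continuous_integral_param {u : Rd d → ℝ} (hu : Continuous u) (hs : HasCompactSupport u)
    {G : Rd d → Rd d → ℝ} (hG : Continuous fun p : Rd d × Rd d => G p.1 p.2) :
    Continuous fun y => ∫ x, u x * G x y := by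
  have h1 : (fun y => ∫ x, u x * G x y) = fun y => ∫ x in tsupport u, u x * G x y := by
    funext y
    refine (setIntegral_eq_integral_of_forall_compl_eq_zero fun x hx => ?_).symm
    rw [image_eq_zero_of_notMem_tsupport hx, zero_mul]
  rw [h1]
  refine continuous_parametric_integral_of_continuous (f := fun y x => u x * G x y) ?_ hs
  exact (hu.comp continuous_snd).mul (hG.comp continuous_swap)

lemma integrable_mul_of_continuous {u v : Rd d → ℝ} (hu : Continuous u)
    (hs : HasCompactSupport u) (hv : Continuous v) : Integrable fun x => u x * v x :=
  (hu.mul hv).integrable_of_hasCompactSupport hs.mul_right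

/-- Differentiation under the integral sign. -/
lemma isDerivFamily_integral {r : ℕ} {u : Rd d → ℝ} (hu : Continuous u)
    (hs : HasCompactSupport u) {G : (Fin d → ℕ) → Rd d → Rd d → ℝ}
    (hc : ∀ l, mlen l ≤ r → Continuous fun p : Rd d × Rd d => G l p.1 p.2)
    (hd : ∀ l, mlen l < r → ∀ x y,
      HasFDerivAt (G l x) (gradForm fun i => G (l + unitIdx i) x y) y) :
    IsDerivFamily r fun l y => ∫ x, u x * G l x y where
  cont l hl := continuous_integral_param hu hs (hc l hl)
  deriv l hl y₀ := by
    have hcs : ∀ l, mlen l ≤ r → ∀ y, Continuous fun x => G l x y := fun l hl y =>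
      (hc l hl).comp (by fun_prop : Continuous fun x : Rd d => (x, y))
    have hG' : Continuous fun p : Rd d × Rd d =>
        u p.1 • gradForm fun i => G (l + unitIdx i) p.1 p.2 :=
      (hu.comp continuous_fst).smul (continuous_gradForm fun i =>
        hc _ (by rw [mlen_add_unitIdx]; omega))
    obtain ⟨M, hM⟩ := (hs.prod (isCompact_closedBall y₀ 1)).exists_bound_of_continuousOn
      hG'.continuousOn
    have key := hasFDerivAt_integral_of_dominated_of_fderiv_le (𝕜 := ℝ) (μ := volume)
      (F := fun y x => u x * G l x y)
      (F' := fun y x => u x • gradForm fun i => G (l + unitIdx i) x y)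
      (bound := (tsupport u).indicator fun _ => M) (x₀ := y₀) (s := Metric.closedBall y₀ 1)
      (Metric.closedBall_mem_nhds _ one_pos)
      (Eventually.of_forall fun y => (hu.mul (hcs l hl.le y)).aestronglyMeasurable)
      (integrable_mul_of_continuous hu hs (hcs l hl.le y₀))
      ((hG'.comp (by fun_prop : Continuous fun x : Rd d => (x, y₀))).aestronglyMeasurable)
      (Eventually.of_forall fun x y hy => by
        by_cases hx : x ∈ tsupport u
        · rw [Set.indicator_of_mem hx]
          exact hM (x, y) ⟨hx, hy⟩
        · simp [Set.indicator_of_notMem hx, image_eq_zero_of_notMem_tsupport hx])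
      ((integrable_indicator_iff (isClosed_tsupport u).measurableSet).2
        (integrableOn_const hs.measure_lt_top.ne))
      (Eventually.of_forall fun x y _ => (hd l hl x y).const_mul (u x))
    refine key.congr_fderiv ?_
    ext v
    rw [ContinuousLinearMap.integral_apply, gradForm_apply]
    · simp only [_root_.smul_apply, gradForm_apply, smul_eq_mul, Finset.mul_sum]
      rw [integral_finsetSum]
      · refine Finset.sum_congr rfl fun i _ => ?_
        rw [← integral_const_mul]
        congr 1
        funext x
        ring
      · intro i _
        have := (integrable_mul_of_continuous hu hs
          (hcs (l + unitIdx i) (by rw [mlen_add_unitIdx]; omega) y₀)).const_mul (v i)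
        refine this.congr (Eventually.of_forall fun x => ?_)
        simp only
        ring
    · refine Continuous.integrable_of_hasCompactSupport
        (hG'.comp (by fun_prop : Continuous fun x : Rd d => (x, y₀))) ?_
      exact hs.smul_right

/-- The convolution `(u * κ)(y) = ∫ u(x) κ(y - x) dx`. -/
def conv (u κ : Rd d → ℝ) (y : Rd d) : ℝ := ∫ x, u x * κ (y - x)

lemma conv_comm (u κ : Rd d → ℝ) : conv u κ = conv κ u := by
  funext y
  unfold conv
  rw [← integral_sub_left_eq_self _ volume y]
  simp [mul_comm]

lemma isDerivFamily_conv {r : ℕ} {u : Rd d → ℝ} (hu : Continuous u) (hs : HasCompactSupport u)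
    {g : (Fin d → ℕ) → Rd d → ℝ} (hg : IsDerivFamily r g) :
    IsDerivFamily r fun l => conv u (g l) := by
  refine isDerivFamily_integral (G := fun l x y => g l (y - x)) hu hs ?_ ?_
  · exact fun l hl => (hg.cont l hl).comp (by fun_prop)
  · intro l hl x y
    have := (hg.deriv l hl (y - x)).comp y ((hasFDerivAt_id y).sub_const x)
    exact this

lemma contDiff_conv {r : ℕ} {u κ : Rd d → ℝ} (hu : Continuous u) (hs : HasCompactSupport u)
    (hκ : ContDiff ℝ r κ) : ContDiff ℝ r (conv u κ) := by
  have := (isDerivFamily_conv hu hs (isDerivFamily_partialDeriv hκ)).contDiff_zero'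
  simpa [partialDeriv_zero] using this

lemma partialDeriv_conv {k : Fin d → ℕ} {u κ : Rd d → ℝ} (hu : Continuous u)
    (hs : HasCompactSupport u) (hκ : ContDiff ℝ (mlen k) κ) :
    partialDeriv k (conv u κ) = conv u (partialDeriv k κ) := by
  have := (isDerivFamily_conv hu hs (isDerivFamily_partialDeriv hκ)).partialDeriv_zero_eq
    (k := k) le_rfl
  simpa [partialDeriv_zero] using this

lemma partialDeriv_conv_left {k : Fin d → ℕ} {u κ : Rd d → ℝ} (hu : ContDiff ℝ (mlen k) u)
    (hκ : Continuous κ) (hs : HasCompactSupport κ) :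
    partialDeriv k (conv u κ) = conv (partialDeriv k u) κ := by
  rw [conv_comm, partialDeriv_conv hκ hs hu, conv_comm]

lemma conv_eq_zero {u κ : Rd d → ℝ} {x : Rd d} {R s : ℝ}
    (hu : ∀ y, R < ‖y - x‖ → u y = 0) (hκ : ∀ y, s < ‖y‖ → κ y = 0) {y : Rd d}
    (hy : R + s < ‖y - x‖) : conv u κ y = 0 := by
  refine integral_eq_zero_of_ae (Eventually.of_forall fun z => ?_)
  by_cases hz : R < ‖z - x‖
  · simp [hu z hz]
  · have : s < ‖y - z‖ := by
      have h1 : y - x = (y - z) + (z - x) := by abel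
      have h2 := norm_add_le (y - z) (z - x)
      rw [← h1] at h2
      linarith
    simp [hκ _ this]

lemma conv_right_comm {u κ κ' : Rd d → ℝ} (hu : Continuous u) (hus : HasCompactSupport u)
    (hκ : Continuous κ) (hκs : HasCompactSupport κ) (hκ' : Continuous κ')
    (hκs' : HasCompactSupport κ') : conv (conv u κ) κ' = conv (conv u κ') κ := by
  have assoc : ∀ {a b c : Rd d → ℝ}, Continuous a → HasCompactSupport a → Continuous b →
      HasCompactSupport b → Continuous c → HasCompactSupport c →
      conv (conv a b) c = conv a (conv b c) := by
    intro a b c ha has hb hbs hc hcs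
    have h0 : ∀ f g : Rd d → ℝ,
        conv f g = convolution f g (ContinuousLinearMap.mul ℝ ℝ) volume := fun f g => rfl
    funext x
    rw [h0 (conv a b), h0 a b, h0 a, h0 b]
    refine convolution_assoc _ _ _ _ (fun x y z => mul_assoc x y z) ha.aestronglyMeasurable
      hb.aestronglyMeasurable hc.aestronglyMeasurable ?_ ?_ ?_
    · exact Eventually.of_forall
        (HasCompactSupport.convolutionExists_left _ has ha hb.locallyIntegrable)
    · exact Eventually.of_forall (HasCompactSupport.convolutionExists_left _ hbs.norm hb.norm
        hc.norm.locallyIntegrable)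
    · refine HasCompactSupport.convolutionExists_left _ has.norm ha.norm ?_ x
      exact (HasCompactSupport.continuous_convolution_left _ hbs.norm hb.norm
        hc.norm.locallyIntegrable).locallyIntegrable
  rw [assoc hu hus hκ hκs hκ' hκs', assoc hu hus hκ' hκs' hκ hκs, conv_comm κ κ']

lemma integral_mul_coordDeriv {u v : Rd d → ℝ} (hu : ContDiff ℝ 1 u) (hs : HasCompactSupport u)
    (hv : ContDiff ℝ 1 v) (i : Fin d) :
    ∫ x, u x * coordDeriv i v x = -∫ x, coordDeriv i u x * v x := by
  have hl : ∀ {f : Rd d → ℝ}, ContDiff ℝ 1 f → ∀ x,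
      HasLineDerivAt ℝ f (coordDeriv i f x) x (stdVec i) := fun hf x =>
    ((hf.differentiable (by norm_num) x).lineDifferentiableAt).hasLineDerivAt
  have hc : ∀ {f : Rd d → ℝ}, ContDiff ℝ 1 f → Continuous (coordDeriv i f) := fun hf =>
    (contDiff_coordDeriv (n := 0) (by simpa using hf) i).continuous
  have hs' : HasCompactSupport (coordDeriv i u) := by
    rw [← partialDeriv_unitIdx i hu]
    exact hs.mono' (subset_tsupport _ |>.trans (tsupport_partialDeriv_subset _ _))
  exact integral_bilinear_hasLineDerivAt_right_eq_neg_left_of_integrable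
    (B := ContinuousLinearMap.mul ℝ ℝ)
    (integrable_mul_of_continuous (hc hu) hs' hv.continuous)
    (integrable_mul_of_continuous hu.continuous hs (hc hv))
    (integrable_mul_of_continuous hu.continuous hs hv.continuous)
    (fun x _ => hl hu x) (fun x _ => hl hv x)

lemma integral_mul_partialDeriv {k : Fin d → ℕ} {u v : Rd d → ℝ} (hu : ContDiff ℝ (mlen k) u)
    (hs : HasCompactSupport u) (hv : ContDiff ℝ (mlen k) v) :
    ∫ x, u x * partialDeriv k v x = (-1) ^ mlen k * ∫ x, partialDeriv k u x * v x := by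
  induction k using multiIndex_induction generalizing u with
  | h0 => simp [partialDeriv_zero, mlen_zero]
  | hs k i ih =>
    rw [mlen_add_unitIdx] at *
    have hv' : ContDiff ℝ (mlen k) v := hv.of_le (by norm_cast; omega)
    rw [partialDeriv_add_unitIdx k i hv, partialDeriv_add_unitIdx' k i hu,
      integral_mul_coordDeriv (hu.of_le (by norm_cast; omega)) hs
        (contDiff_partialDeriv (n := 1) k (hv.of_le (by norm_cast; omega)))]
    have hs' : HasCompactSupport (coordDeriv i u) := by
      rw [← partialDeriv_unitIdx i (hu.of_le (by norm_cast; omega))]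
      exact hs.mono' (subset_tsupport _ |>.trans (tsupport_partialDeriv_subset _ _))
    rw [ih (contDiff_coordDeriv hu i) hs' hv', pow_succ]
    ring

/-! ### Test functions -/

lemma contDiff_testFn (φ : TestFn d) (n : ℕ) : ContDiff ℝ n φ :=
  φ.contDiff.of_le (by exact_mod_cast le_top)

lemma contDiff_infty_of_forall {f : Rd d → ℝ} (h : ∀ n : ℕ, ContDiff ℝ n f) :
    ContDiff ℝ ((⊤ : ℕ∞) : WithTop ℕ∞) f := contDiff_infty.2 h

/-- A smooth function vanishing outside of a ball, as a test function. -/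
def mkTest (f : Rd d → ℝ) (hf : ∀ n : ℕ, ContDiff ℝ n f) (x : Rd d) (R : ℝ)
    (hs : ∀ y, R < ‖y - x‖ → f y = 0) : TestFn d where
  toFun := f
  contDiff' := contDiff_infty_of_forall hf
  hasCompactSupport' := HasCompactSupport.intro (isCompact_closedBall x R) fun y hy =>
    hs y (by simpa [dist_eq_norm] using hy)
  tsupport_subset' := fun _ _ => trivial

@[simp] lemma mkTest_apply (f : Rd d → ℝ) (hf : ∀ n : ℕ, ContDiff ℝ n f) (x : Rd d) (R : ℝ)
    (hs : ∀ y, R < ‖y - x‖ → f y = 0) (y : Rd d) : mkTest f hf x R hs y = f y := rfl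

lemma coe_mkTest (f : Rd d → ℝ) (hf : ∀ n : ℕ, ContDiff ℝ n f) (x : Rd d) (R : ℝ)
    (hs : ∀ y, R < ‖y - x‖ → f y = 0) : (mkTest f hf x R hs : Rd d → ℝ) = f := rfl

lemma tsupport_subset_closedBall_iff {f : Rd d → ℝ} {x : Rd d} {R : ℝ} :
    tsupport f ⊆ Metric.closedBall x R ↔ ∀ y, R < ‖y - x‖ → f y = 0 := by
  constructor
  · intro h y hy
    refine image_eq_zero_of_notMem_tsupport fun hy' => ?_
    have := h hy'
    rw [Metric.mem_closedBall, dist_eq_norm] at this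
    linarith
  · intro h
    refine closure_minimal (fun y hy => ?_) Metric.isClosed_closedBall
    by_contra hy'
    rw [Metric.mem_closedBall, dist_eq_norm, not_le] at hy'
    exact hy (h y hy')

lemma exists_testFn_supp (φ : TestFn d) (x : Rd d) :
    ∃ R : ℝ, 0 < R ∧ ∀ y, R < ‖y - x‖ → φ y = 0 := by
  obtain ⟨R, hR⟩ := φ.hasCompactSupport.isCompact.isBounded.subset_closedBall x
  refine ⟨max R 1, by positivity, tsupport_subset_closedBall_iff.1
    (hR.trans (Metric.closedBall_subset_closedBall (le_max_left _ _)))⟩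

/-- The partial derivative of a test function, as a test function. -/
def derivTest (k : Fin d → ℕ) (φ : TestFn d) : TestFn d where
  toFun := partialDeriv k φ
  contDiff' := contDiff_infty_of_forall fun _ => contDiff_partialDeriv k (contDiff_testFn φ _)
  hasCompactSupport' := φ.hasCompactSupport.mono'
    ((subset_tsupport _).trans (tsupport_partialDeriv_subset _ _))
  tsupport_subset' := fun _ _ => trivial

lemma coe_derivTest (k : Fin d → ℕ) (φ : TestFn d) : (derivTest k φ : Rd d → ℝ) = partialDeriv k φ :=
  rfl

lemma partialDeriv_smul_test (k : Fin d → ℕ) (c : ℝ) (φ : TestFn d) :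
    partialDeriv k (c • φ : TestFn d) = fun y => c * partialDeriv k φ y := by
  rw [← partialDeriv_const_mul (contDiff_testFn φ _)]
  rfl

lemma partialDeriv_add_test (k : Fin d → ℕ) (φ ψ : TestFn d) :
    partialDeriv k (φ + ψ : TestFn d) = fun y => partialDeriv k φ y + partialDeriv k ψ y := by
  rw [← partialDeriv_add (contDiff_testFn φ _) (contDiff_testFn ψ _)]
  rfl

lemma partialDeriv_sub_test (k : Fin d → ℕ) (φ ψ : TestFn d) :
    partialDeriv k (φ - ψ : TestFn d) = fun y => partialDeriv k φ y - partialDeriv k ψ y := by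
  rw [← partialDeriv_sub (contDiff_testFn φ _) (contDiff_testFn ψ _)]
  rfl

lemma partialDeriv_vanish {f : Rd d → ℝ} {x : Rd d} {R : ℝ}
    (hs : ∀ y, R < ‖y - x‖ → f y = 0) (k : Fin d → ℕ) (y : Rd d) (hy : R < ‖y - x‖) :
    partialDeriv k f y = 0 :=
  tsupport_subset_closedBall_iff.1
    ((tsupport_partialDeriv_subset k f).trans (tsupport_subset_closedBall_iff.2 hs)) y hy

lemma scaled_apply (φ : TestFn d) (x : Rd d) {t : ℝ} (ht : 0 < t) (y : Rd d) :
    scaled φ x t y = t⁻¹ ^ d * φ (t⁻¹ • (y - x)) := by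
  simp only [scaled, dif_pos ht]
  rfl

lemma coe_scaled (φ : TestFn d) (x : Rd d) {t : ℝ} (ht : 0 < t) :
    (scaled φ x t : Rd d → ℝ) = fun y => t⁻¹ ^ d * φ (t⁻¹ • (y - x)) :=
  funext (scaled_apply φ x ht)

lemma partialDeriv_scaled (k : Fin d → ℕ) (φ : TestFn d) (x : Rd d) {t : ℝ} (ht : 0 < t) :
    partialDeriv k (scaled φ x t) =
      fun y => t⁻¹ ^ (d + mlen k) * partialDeriv k φ (t⁻¹ • (y - x)) := by
  have h1 := partialDeriv_comp_affine (k := k) (contDiff_testFn φ _) t⁻¹ x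
  have hc : ContDiff ℝ (mlen k) (fun y : Rd d => φ (t⁻¹ • (y - x))) :=
    (contDiff_testFn φ _).comp ((contDiff_id.sub contDiff_const).const_smul _)
  rw [coe_scaled φ x ht, partialDeriv_const_mul hc, h1]
  funext y
  ring

lemma scaled_vanish {φ : TestFn d} {R : ℝ} (hs : ∀ y, R < ‖y‖ → φ y = 0) (x : Rd d) {t : ℝ}
    (ht : 0 < t) (y : Rd d) (hy : R * t < ‖y - x‖) : scaled φ x t y = 0 := by
  rw [scaled_apply φ x ht, hs, mul_zero]
  rw [norm_smul, norm_inv, Real.norm_of_nonneg ht.le, inv_mul_eq_div, lt_div_iff₀ ht]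
  exact hy

lemma scaled_smul (c : ℝ) (φ : TestFn d) (x : Rd d) (t : ℝ) :
    scaled (c • φ) x t = c • scaled φ x t := by
  by_cases ht : 0 < t
  · ext y
    change scaled (c • φ) x t y = c * scaled φ x t y
    rw [scaled_apply _ _ ht, scaled_apply _ _ ht, mul_left_comm]
    rfl
  · simp [scaled, ht]

lemma integral_scaled_mul (φ : TestFn d) (x : Rd d) {t : ℝ} (ht : 0 < t) (g : Rd d → ℝ) :
    ∫ y, scaled φ x t y * g y = ∫ z, φ z * g (x + t • z) := by
  simp_rw [scaled_apply φ x ht]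
  rw [← integral_add_left_eq_self _ x]
  have h := Measure.integral_comp_inv_smul_of_nonneg (volume : Measure (Rd d))
    (fun z => φ z * g (x + t • z)) ht.le
  simp only [finrank_euclideanSpace, Fintype.card_fin, smul_inv_smul₀ ht.ne', smul_eq_mul] at h
  simp only [add_sub_cancel_left, mul_assoc]
  rw [integral_const_mul, h, ← mul_assoc, ← mul_pow, inv_mul_cancel₀ ht.ne', one_pow, one_mul]

lemma integrable_testFn (φ : TestFn d) : Integrable φ :=
  φ.continuous.integrable_of_hasCompactSupport φ.hasCompactSupport

lemma integral_abs_scaled (φ : TestFn d) (x : Rd d) {t : ℝ} (ht : 0 < t) :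
    ∫ y, |scaled φ x t y| = ∫ z, |φ z| := by
  simp_rw [scaled_apply φ x ht, abs_mul]
  rw [← integral_add_left_eq_self _ x]
  have h := Measure.integral_comp_inv_smul_of_nonneg (volume : Measure (Rd d))
    (fun z => |φ z|) ht.le
  simp only [finrank_euclideanSpace, Fintype.card_fin, smul_eq_mul] at h
  simp only [add_sub_cancel_left]
  rw [integral_const_mul, h, ← mul_assoc, abs_of_nonneg (by positivity), ← mul_pow,
    inv_mul_cancel₀ ht.ne', one_pow, one_mul]

/-! ### Quantitative smoothness at a scale -/

/-- `g` is of class `C^q`, vanishes outside of the ball of radius `t` around `x`, and its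
derivatives are bounded by `b` times those of an `L¹`-normalised bump at scale `t`. -/
structure BumpAt (q : ℕ) (x : Rd d) (t b : ℝ) (g : Rd d → ℝ) : Prop where
  contDiff : ContDiff ℝ q g
  supp : ∀ y, t < ‖y - x‖ → g y = 0
  bound : ∀ k : Fin d → ℕ, mlen k ≤ q → ∀ y, |partialDeriv k g y| ≤ b * t⁻¹ ^ (d + mlen k)

lemma BumpAt.nonneg {q : ℕ} {x : Rd d} {t b : ℝ} {g : Rd d → ℝ} (h : BumpAt q x t b g)
    (ht : 0 < t) : 0 ≤ b := by
  have := (abs_nonneg _).trans (h.bound 0 (by simp [mlen_zero]) 0)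
  exact nonneg_of_mul_nonneg_left this (by positivity)

lemma BumpAt.mono {q q' : ℕ} {x : Rd d} {t b b' : ℝ} {g : Rd d → ℝ} (h : BumpAt q x t b g)
    (ht : 0 < t) (hq : q' ≤ q) (hb : b ≤ b') : BumpAt q' x t b' g where
  contDiff := h.contDiff.of_le (by exact_mod_cast hq)
  supp := h.supp
  bound k hk y := (h.bound k (hk.trans hq) y).trans (by gcongr)

lemma BumpAt.hasCompactSupport {q : ℕ} {x : Rd d} {t b : ℝ} {g : Rd d → ℝ}
    (h : BumpAt q x t b g) : HasCompactSupport g :=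
  HasCompactSupport.intro (isCompact_closedBall x t) fun y hy =>
    h.supp y (by simpa [dist_eq_norm] using hy)

lemma BumpAt.abs_le {q : ℕ} {x : Rd d} {t b : ℝ} {g : Rd d → ℝ} (h : BumpAt q x t b g) (y : Rd d) :
    |g y| ≤ b * t⁻¹ ^ d := by
  simpa [partialDeriv_zero, mlen_zero] using h.bound 0 (by simp [mlen_zero]) y

lemma BumpAt.enlarge {q : ℕ} {x x' : Rd d} {t t' b : ℝ} {g : Rd d → ℝ} (h : BumpAt q x t b g)
    (ht : 0 < t) (ht' : ‖x - x'‖ + t ≤ t') : BumpAt q x' t' (b * (t' / t) ^ (d + q)) g := by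
  have htt : t ≤ t' := by linarith [norm_nonneg (x - x')]
  have ht0 : 0 < t' := by linarith
  have hb := h.nonneg ht
  refine ⟨h.contDiff, fun y hy => h.supp y ?_, fun k hk y => (h.bound k hk y).trans ?_⟩
  · have := norm_add_le (y - x) (x - x')
    rw [sub_add_sub_cancel] at this
    linarith
  · rw [mul_assoc]
    refine mul_le_mul_of_nonneg_left ?_ hb
    have h1 : (1 : ℝ) ≤ t' / t := (one_le_div ht).2 htt
    calc t⁻¹ ^ (d + mlen k) = (t' / t) ^ (d + mlen k) * t'⁻¹ ^ (d + mlen k) := by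
          rw [← mul_pow]; congr 1; field_simp
      _ ≤ _ := by gcongr

lemma bumpAt_scaled {q : ℕ} {φ : TestFn d} (hφ : φ ∈ testBall d q) (x : Rd d) {t : ℝ}
    (ht : 0 < t) : BumpAt q x t 1 (scaled φ x t) := by
  refine ⟨contDiff_testFn _ _, fun y hy => scaled_vanish (R := 1) ?_ x ht y (by simpa using hy),
    fun k hk y => ?_⟩
  · simpa using tsupport_subset_closedBall_iff.1 hφ.1
  · rw [partialDeriv_scaled k φ x ht, abs_mul, abs_of_nonneg (by positivity), one_mul]
    exact mul_le_of_le_one_right (by positivity) (hφ.2 k hk _)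

lemma exists_partialDeriv_bound (φ : TestFn d) (q : ℕ) :
    ∃ b : ℝ, 0 < b ∧ ∀ k : Fin d → ℕ, mlen k ≤ q → ∀ y, |partialDeriv k φ y| ≤ b := by
  have h1 : ∀ k : Fin d → ℕ, ∃ b : ℝ, ∀ y, |partialDeriv k φ y| ≤ b := fun k =>
    (derivTest k φ).continuous.bounded_above_of_compact_support (derivTest k φ).hasCompactSupport
  choose b hb using h1
  have hb0 : ∀ k, 0 ≤ b k := fun k => (abs_nonneg _).trans (hb k 0)
  refine ⟨∑ k ∈ multiIndicesLE d q, b k + 1,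
    by have := Finset.sum_nonneg fun k (_ : k ∈ multiIndicesLE d q) => hb0 k; linarith,
    fun k hk y => (hb k y).trans ?_⟩
  have := Finset.single_le_sum (f := b) (fun k _ => hb0 k) (mem_multiIndicesLE.2 hk)
  linarith

lemma exists_bumpAt_scaled {φ : TestFn d} {R : ℝ} (hR : 0 < R) (hs : ∀ y, R < ‖y‖ → φ y = 0)
    (q : ℕ) : ∃ b : ℝ, 0 < b ∧ ∀ x t, 0 < t → BumpAt q x (R * t) b (scaled φ x t) := by
  obtain ⟨b, hb0, hb⟩ := exists_partialDeriv_bound φ q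
  have hR1 : 0 < max R 1 := by positivity
  refine ⟨b * (max R 1) ^ (d + q), by positivity, fun x t ht => ⟨contDiff_testFn _ _,
    scaled_vanish hs x ht, fun k hk y => ?_⟩⟩
  rw [partialDeriv_scaled k φ x ht, abs_mul, abs_of_nonneg (by positivity), mul_comm]
  rw [mul_assoc]
  refine mul_le_mul (hb k hk _) ?_ (by positivity) hb0.le
  calc t⁻¹ ^ (d + mlen k) = R ^ (d + mlen k) * (R * t)⁻¹ ^ (d + mlen k) := by
        rw [← mul_pow]; congr 1; field_simp
    _ ≤ (max R 1) ^ (d + mlen k) * (R * t)⁻¹ ^ (d + mlen k) := by gcongr; exact le_max_left _ _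
    _ ≤ _ := by gcongr; exact le_max_right _ _

lemma exists_bumpAt (ψ : TestFn d) (q : ℕ) (x : Rd d) {R : ℝ} (hR : 0 < R)
    (hs : ∀ y, R < ‖y - x‖ → ψ y = 0) : ∃ b : ℝ, 0 < b ∧ BumpAt q x R b ψ := by
  obtain ⟨b, hb0, hb⟩ := exists_partialDeriv_bound ψ q
  have hR1 : 0 < max R 1 := by positivity
  refine ⟨b * (max R 1) ^ (d + q), by positivity, contDiff_testFn _ _, hs, fun k hk y => ?_⟩
  rw [mul_assoc]
  refine (hb k hk y).trans (le_mul_of_one_le_right hb0.le ?_)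
  calc (1 : ℝ) = R ^ (d + mlen k) * R⁻¹ ^ (d + mlen k) := by
        rw [← mul_pow, mul_inv_cancel₀ hR.ne', one_pow]
    _ ≤ (max R 1) ^ (d + mlen k) * R⁻¹ ^ (d + mlen k) := by gcongr; exact le_max_left _ _
    _ ≤ _ := by gcongr; exact le_max_right _ _

/-- `T` is bounded by `A` on test functions of class `𝓑^q` at scale `t` around `x`. -/
def BoundedAt (T : Distr d) (q : ℕ) (x : Rd d) (t A : ℝ) : Prop :=
  ∀ φ ∈ testBall d q, |T (scaled φ x t)| ≤ A

lemma zero_mem_testBall (q : ℕ) : (0 : TestFn d) ∈ testBall d q := by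
  refine ⟨tsupport_subset_closedBall_iff.2 fun y _ => rfl, fun k _ y => ?_⟩
  have := partialDeriv_smul_test k 0 (0 : TestFn d)
  rw [zero_smul] at this
  rw [this]
  simp

lemma BoundedAt.nonneg {T : Distr d} {q : ℕ} {x : Rd d} {t A : ℝ} (h : BoundedAt T q x t A) :
    0 ≤ A := (abs_nonneg _).trans (h 0 (zero_mem_testBall q))

lemma BoundedAt.apply {T : Distr d} {q : ℕ} {x : Rd d} {t A b : ℝ} (ht : 0 < t)
    (h : BoundedAt T q x t A) {ψ : TestFn d} (hψ : BumpAt q x t b ψ) : |T ψ| ≤ b * A := by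
  rcases (hψ.nonneg ht).eq_or_lt with hb | hb
  · have : ψ = 0 := by
      ext y
      have := hψ.abs_le y
      rw [← hb, zero_mul] at this
      exact abs_nonpos_iff.1 this
    simp [this, ← hb]
  · have hti : 0 < t⁻¹ := inv_pos.2 ht
    set φ : TestFn d := b⁻¹ • scaled ψ (-(t⁻¹ • x)) t⁻¹ with hφ
    have harg : ∀ y : Rd d, t⁻¹⁻¹ • (y - -(t⁻¹ • x)) = x + t • y := by
      intro y
      rw [inv_inv, sub_neg_eq_add, smul_add, smul_inv_smul₀ ht.ne', add_comm]
    have hmem : φ ∈ testBall d q := by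
      constructor
      · refine tsupport_subset_closedBall_iff.2 fun y hy => ?_
        change b⁻¹ * scaled ψ (-(t⁻¹ • x)) t⁻¹ y = 0
        rw [scaled_apply _ _ hti, harg, hψ.supp, mul_zero, mul_zero]
        rw [add_sub_cancel_left, norm_smul, Real.norm_of_nonneg ht.le]
        rw [sub_zero] at hy
        exact lt_mul_of_one_lt_right ht hy
      · intro k hk y
        rw [hφ, partialDeriv_smul_test, partialDeriv_scaled _ _ _ hti]
        simp only
        rw [harg, abs_mul, abs_mul, abs_of_pos (inv_pos.2 hb), abs_of_pos (by positivity), inv_inv]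
        calc _ ≤ b⁻¹ * (t ^ (d + mlen k) * (b * t⁻¹ ^ (d + mlen k))) := by
              gcongr; exact hψ.bound k hk _
          _ = (b⁻¹ * b) * (t * t⁻¹) ^ (d + mlen k) := by rw [mul_pow]; ring
          _ = 1 := by rw [inv_mul_cancel₀ hb.ne', mul_inv_cancel₀ ht.ne']; simp
    have heq : ψ = b • scaled φ x t := by
      rw [hφ, scaled_smul, smul_smul, mul_inv_cancel₀ hb.ne', one_smul]
      ext y
      rw [scaled_apply _ _ ht, scaled_apply _ _ hti, harg, smul_inv_smul₀ ht.ne',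
        add_sub_cancel, ← mul_assoc, ← mul_pow, mul_inv_cancel₀ hti.ne', one_pow, one_mul]
    rw [heq, map_smul, smul_eq_mul, abs_mul, abs_of_pos hb]
    exact mul_le_mul_of_nonneg_left (h φ hmem) hb.le

lemma boundedAt_of_bump {T : Distr d} {q : ℕ} {x : Rd d} {t A : ℝ} (ht : 0 < t)
    (h : ∀ ψ : TestFn d, BumpAt q x t 1 ψ → |T ψ| ≤ A) : BoundedAt T q x t A :=
  fun _ hφ => h _ (bumpAt_scaled hφ x ht)

/-! ### Distributions -/

/-- Every distribution is of finite order on balls. -/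
lemma exists_order (T : Distr d) (R : ℝ) :
    ∃ (s : ℕ) (C : ℝ), 0 ≤ C ∧ ∀ φ : TestFn d, (∀ y, R < ‖y‖ → φ y = 0) → ∀ M : ℝ,
      (∀ k : Fin d → ℕ, mlen k ≤ s → ∀ x, |partialDeriv k φ x| ≤ M) → |T φ| ≤ C * M := by
  let K : Compacts (Rd d) := ⟨Metric.closedBall 0 R, isCompact_closedBall 0 R⟩
  have hK : (K : Set (Rd d)) ⊆ (⊤ : Opens (Rd d)) := fun _ _ => trivial
  let f : 𝓓_{K}(Rd d, ℝ) →ₗ[ℝ] ℝ :=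
    { toFun := fun φ => T (TestFunction.ofSupportedInCLM ℝ hK φ)
      map_add' := fun φ ψ => by rw [map_add, map_add]
      map_smul' := fun c φ => by rw [map_smul, map_smul]; rfl }
  have hf : Continuous f := T.continuous.comp (TestFunction.ofSupportedInCLM ℝ hK).continuous
  let q : Seminorm ℝ (𝓓_{K}(Rd d, ℝ)) := (normSeminorm ℝ ℝ).comp f
  obtain ⟨s, C, -, hsC⟩ := Seminorm.bound_of_continuous
    (ContDiffMapSupportedIn.withSeminorms ℝ (Rd d) ℝ ⊤ K) q (continuous_norm.comp hf)
  refine ⟨s.sup id, C * (d + 1 : ℝ) ^ (s.sup id), by positivity, fun φ hφ M hM => ?_⟩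
  have hM0 : 0 ≤ M := (abs_nonneg _).trans (hM 0 (by simp [mlen_zero]) 0)
  let φ' : 𝓓_{K}(Rd d, ℝ) := ⟨φ, φ.contDiff, fun y hy => hφ y (by
    simpa [K] using hy)⟩
  have h1 : T φ = f φ' := rfl
  have h2 := hsC φ'
  change |f φ'| ≤ _ at h2
  rw [h1]
  refine h2.trans ?_
  rw [_root_.smul_apply, NNReal.smul_def, smul_eq_mul, mul_assoc]
  refine mul_le_mul_of_nonneg_left ?_ C.2
  refine Seminorm.finset_sup_apply_le (by positivity) fun i hi => ?_
  refine (ContDiffMapSupportedIn.seminorm_top_le_iff ℝ (by positivity) i φ').2 fun x _ => ?_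
  have hle : i ≤ s.sup id := Finset.le_sup (f := id) hi
  have h3 := norm_iteratedFDeriv_le_of_partialDeriv (contDiff_testFn φ i) (x := x)
    fun k hk => hM k (hk.trans_le hle) x
  rw [abs_of_nonneg hM0] at h3
  refine h3.trans ?_
  gcongr
  calc (d : ℝ) ^ i ≤ (d + 1 : ℝ) ^ i := by gcongr; linarith
    _ ≤ _ := pow_le_pow_right₀ (by linarith [(Nat.cast_nonneg d : (0 : ℝ) ≤ d)]) hle

/-- A linear functional on test functions with local bounds is a distribution. -/
lemma exists_distr_of_bound (f : TestFn d →ₗ[ℝ] ℝ)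
    (h : ∀ R : ℝ, ∃ (s : ℕ) (C : ℝ), ∀ φ : TestFn d, (∀ y, R < ‖y‖ → φ y = 0) → ∀ M : ℝ,
      (∀ k : Fin d → ℕ, mlen k ≤ s → ∀ x, |partialDeriv k φ x| ≤ M) → |f φ| ≤ C * M) :
    ∃ T : Distr d, ∀ φ, T φ = f φ := by
  have hf : Continuous f := by
    rw [TestFunction.continuous_iff_continuous_comp]
    intro K hK
    obtain ⟨R, hR⟩ := K.isCompact.isBounded.subset_closedBall (0 : Rd d)
    obtain ⟨s, C, hC⟩ := h R
    let g : 𝓓_{K}(Rd d, ℝ) →ₗ[ℝ] ℝ := f.comp (TestFunction.ofSupportedInCLM ℝ hK).toLinearMap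
    change Continuous g
    refine WithSeminorms.continuous_normedSpace_rng ℝ
      (ContDiffMapSupportedIn.withSeminorms ℝ (Rd d) ℝ ⊤ K) g ⟨Finset.range (s + 1),
        ⟨|C|, abs_nonneg C⟩, fun φ => ?_⟩
    set N := ((Finset.range (s + 1)).sup
      (ContDiffMapSupportedIn.seminorm ℝ (Rd d) ℝ ⊤ K)) φ with hN
    have h1 := hC (TestFunction.ofSupportedInCLM ℝ hK φ) (fun y hy => by
      refine φ.zero_on_compl fun hyK => ?_
      have := hR hyK
      rw [mem_closedBall_zero_iff] at this
      linarith) N (fun k hk x => by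
        refine (abs_partialDeriv_le_norm_iteratedFDeriv
          (contDiff_testFn (TestFunction.ofSupportedInCLM ℝ hK φ) (mlen k)) x).trans ?_
        refine (ContDiffMapSupportedIn.norm_iteratedFDeriv_apply_le_seminorm_top ℝ).trans ?_
        exact Seminorm.le_finset_sup_apply (Finset.mem_range.2 (by omega)))
    change |f _| ≤ |C| * N
    refine h1.trans (mul_le_mul_of_nonneg_right (le_abs_self C) (apply_nonneg _ _))
  exact ⟨ContinuousLinearMap.toUniformConvergenceCLM (RingHom.id ℝ) ℝ {S | IsCompact S} ⟨f, hf⟩,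
    fun φ => rfl⟩

lemma lineDerivOp_test_apply (φ : TestFn d) (i : Fin d) :
    ((∂_{stdVec i} φ : TestFn d) : Rd d → ℝ) = coordDeriv i φ := by
  funext x
  rw [TestFunction.lineDerivOp_eq_lineDerivCLM ℝ, TestFunction.lineDerivCLM_apply]
  simp [coordDeriv]

lemma distrDeriv_apply (k : Fin d → ℕ) (T : Distr d) (φ : TestFn d) :
    distrDeriv k T φ = (-1) ^ mlen k * T (derivTest k φ) := by
  have h1 : ∀ (n : ℕ) (i : Fin d) (T : Distr d) (φ : TestFn d), ∃ ψ : TestFn d,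
      (ψ : Rd d → ℝ) = (coordDeriv i)^[n] φ ∧
      ((fun h : Distr d => ∂_{stdVec i} h)^[n] T) φ = (-1) ^ n * T ψ := by
    intro n i
    induction n with
    | zero => exact fun T φ => ⟨φ, rfl, by simp⟩
    | succ n ih =>
      intro T φ
      obtain ⟨ψ, hψ, hT⟩ := ih (∂_{stdVec i} T) φ
      refine ⟨∂_{stdVec i} ψ, ?_, ?_⟩
      · rw [lineDerivOp_test_apply, hψ, Function.iterate_succ_apply']
      · rw [Function.iterate_succ_apply, hT, Distribution.lineDerivOp_apply_apply, map_neg, pow_succ]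
        ring
  have hsmooth : ∀ (n : ℕ) (i : Fin d) (f : Rd d → ℝ), (∀ m : ℕ, ContDiff ℝ m f) →
      ∀ m : ℕ, ContDiff ℝ m ((coordDeriv i)^[n] f) :=
    fun n i f hf m => contDiff_iterate_coordDeriv (hf _) i
  have h2 : ∀ (L : List (Fin d)) (φ : TestFn d), ∃ ψ : TestFn d,
      (ψ : Rd d → ℝ) = listDeriv L k φ ∧
      (L.foldr (fun i g => (fun h : Distr d => ∂_{stdVec i} h)^[k i] g) T) φ =
        (-1) ^ (L.map k).sum * T ψ := by
    intro L
    induction L with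
    | nil => exact fun φ => ⟨φ, rfl, by simp⟩
    | cons a L ih =>
      intro φ
      obtain ⟨ψ, hψ, hT⟩ := h1 (k a) a
        (L.foldr (fun i g => (fun h : Distr d => ∂_{stdVec i} h)^[k i] g) T) φ
      obtain ⟨ψ', hψ', hT'⟩ := ih ψ
      refine ⟨ψ', ?_, ?_⟩
      · rw [hψ', hψ]
        change _ = (coordDeriv a)^[k a] (listDeriv L k φ)
        have : ∀ n : ℕ, listDeriv L k ((coordDeriv a)^[n] φ) =
            (coordDeriv a)^[n] (listDeriv L k φ) := by
          intro n
          induction n with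
          | zero => rfl
          | succ n ih =>
            rw [Function.iterate_succ_apply', ← coordDeriv_listDeriv L k
              (hsmooth n a φ (fun m => contDiff_testFn φ m) _) a, ih,
              Function.iterate_succ_apply']
        exact this _
      · rw [List.foldr_cons, hT, hT', List.map_cons, List.sum_cons, pow_add]
        ring
  obtain ⟨ψ, hψ, hT⟩ := h2 (List.finRange d) φ
  rw [sum_map_finRange] at hT
  have : ψ = derivTest k φ := by
    ext y
    rw [hψ]; rfl
  rw [← this]
  exact hT

lemma tendsto_distr {ι : Type*} {l : Filter ι} (T : Distr d) {ψ : ι → TestFn d} {ψ₀ : TestFn d}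
    {R : ℝ} (hs : ∀ᶠ j in l, ∀ y, R < ‖y‖ → ψ j y = 0) (hs₀ : ∀ y, R < ‖y‖ → ψ₀ y = 0)
    (h : ∀ k : Fin d → ℕ, ∀ ε > 0, ∀ᶠ j in l, ∀ y,
      |partialDeriv k (ψ j) y - partialDeriv k ψ₀ y| ≤ ε) :
    Tendsto (fun j => T (ψ j)) l (𝓝 (T ψ₀)) := by
  obtain ⟨s, C, hC, hT⟩ := exists_order T R
  rw [Metric.tendsto_nhds]
  intro ε hε
  have h1 : ∀ᶠ j in l, ∀ k ∈ multiIndicesLE d s, ∀ y,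
      |partialDeriv k (ψ j) y - partialDeriv k ψ₀ y| ≤ ε / (C + 1) :=
    (Finset.eventually_all _).2 fun k _ => h k _ (by positivity)
  filter_upwards [h1, hs] with j hj hsj
  have h2 := hT (ψ j - ψ₀) (fun y hy => by
    change ψ j y - ψ₀ y = 0
    rw [hsj y hy, hs₀ y hy, sub_zero]) (ε / (C + 1)) (fun k hk y => by
      rw [partialDeriv_sub_test]
      exact hj k (mem_multiIndicesLE.2 hk) y)
  rw [map_sub] at h2
  rw [Real.dist_eq]
  refine h2.trans_lt ?_
  rw [mul_div_assoc', div_lt_iff₀ (by positivity)]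
  nlinarith

/-! ### Distributions and integrals -/

/-- The partial derivatives up to order `s` of a test function, as bounded functions. -/
def jet (s : ℕ) : TestFn d →ₗ[ℝ] (multiIndicesLE d s → BoundedContinuousFunction (Rd d) ℝ) where
  toFun φ k := TestFunction.toBoundedContinuousFunctionCLM ℝ (derivTest k φ)
  map_add' φ ψ := by
    funext k
    ext y
    change partialDeriv k (φ + ψ : TestFn d) y = partialDeriv k φ y + partialDeriv k ψ y
    rw [partialDeriv_add_test]
  map_smul' c φ := by
    funext k
    ext y
    change partialDeriv k (c • φ : TestFn d) y = c * partialDeriv k φ y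
    rw [partialDeriv_smul_test]

lemma jet_apply (s : ℕ) (φ : TestFn d) (k : multiIndicesLE d s) (y : Rd d) :
    jet s φ k y = partialDeriv k φ y := rfl

/-- Test functions vanishing outside of the ball of radius `R`. -/
def testsIn (d : ℕ) (R : ℝ) : Submodule ℝ (TestFn d) where
  carrier := {φ | ∀ y, R < ‖y‖ → φ y = 0}
  add_mem' {φ ψ} h h' y hy := by
    change φ y + ψ y = 0
    rw [h y hy, h' y hy, add_zero]
  zero_mem' y _ := rfl
  smul_mem' c φ h y hy := by
    change c * φ y = 0
    rw [h y hy, mul_zero]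

lemma exists_jet_extension (T : Distr d) (R : ℝ) :
    ∃ (s : ℕ) (Λ : (multiIndicesLE d s → BoundedContinuousFunction (Rd d) ℝ) →L[ℝ] ℝ),
      ∀ φ : TestFn d, (∀ y, R < ‖y‖ → φ y = 0) → T φ = Λ (jet s φ) := by
  obtain ⟨s, C, hC, hT⟩ := exists_order T R
  let J : testsIn d R →ₗ[ℝ] (multiIndicesLE d s → BoundedContinuousFunction (Rd d) ℝ) :=
    (jet s).comp (testsIn d R).subtype
  have hJ : Function.Injective J := by
    intro φ ψ h
    have h0 : (0 : Fin d → ℕ) ∈ multiIndicesLE d s := mem_multiIndicesLE.2 (by simp [mlen_zero])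
    ext y
    have := congrArg (fun F => F ⟨0, h0⟩ y) h
    simpa [J, jet_apply, partialDeriv_zero] using this
  let e := LinearEquiv.ofInjective J hJ
  let f₀ : LinearMap.range J →ₗ[ℝ] ℝ :=
    ((T : TestFn d →ₗ[ℝ] ℝ).comp (testsIn d R).subtype).comp e.symm.toLinearMap
  have hf₀ : ∀ φ : testsIn d R, f₀ (e φ) = T φ := fun φ => by simp [f₀]
  have hbound : ∀ x, ‖f₀ x‖ ≤ C * ‖x‖ := by
    intro x
    obtain ⟨φ, rfl⟩ := e.surjective x
    rw [hf₀, Real.norm_eq_abs]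
    refine hT φ φ.2 _ fun k hk y => ?_
    have h1 : jet s (φ : TestFn d) ⟨k, mem_multiIndicesLE.2 hk⟩ y = partialDeriv k φ y := rfl
    rw [← h1, ← Real.norm_eq_abs]
    refine (BoundedContinuousFunction.norm_coe_le_norm _ y).trans ?_
    exact norm_le_pi_norm (jet s (φ : TestFn d)) _
  let f : LinearMap.range J →L[ℝ] ℝ := ⟨f₀, AddMonoidHomClass.continuous_of_bound f₀ C hbound⟩
  obtain ⟨Λ, hΛ, -⟩ := exists_extension_norm_eq _ f
  refine ⟨s, Λ, fun φ hφ => ?_⟩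
  have h1 := hΛ (e ⟨φ, hφ⟩)
  have h2 : ((e ⟨φ, hφ⟩ : LinearMap.range J) : _) = jet s φ := rfl
  rw [h2] at h1
  rw [h1]
  exact (hf₀ ⟨φ, hφ⟩).symm

lemma partialDeriv_scaled_translate (k : Fin d → ℕ) (φ : TestFn d) {t : ℝ} (ht : 0 < t)
    (w y : Rd d) : partialDeriv k (scaled φ w t) y = partialDeriv k (scaled φ 0 t) (y - w) := by
  rw [partialDeriv_scaled _ _ _ ht, partialDeriv_scaled _ _ _ ht]
  simp

lemma scaled_translate (φ : TestFn d) {t : ℝ} (ht : 0 < t) (w y : Rd d) :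
    scaled φ w t y = scaled φ 0 t (y - w) := by
  rw [scaled_apply _ _ ht, scaled_apply _ _ ht, sub_zero]

lemma uniformContinuous_partialDeriv (k : Fin d → ℕ) (φ : TestFn d) :
    UniformContinuous (partialDeriv k φ) := by
  have h1 : HasCompactSupport (partialDeriv k φ) := (derivTest k φ).hasCompactSupport
  have h2 : Continuous (partialDeriv k φ) := (derivTest k φ).continuous
  exact h2.uniformContinuous_of_tendsto_cocompact h1.is_zero_at_infty

lemma continuous_jet_scaled (s : ℕ) (φ : TestFn d) {t : ℝ} (ht : 0 < t) :
    Continuous fun w => jet s (scaled φ w t) := by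
  refine continuous_pi fun k => ?_
  have hu := uniformContinuous_partialDeriv (k : Fin d → ℕ) (scaled φ 0 t)
  rw [Metric.continuous_iff]
  intro w ε hε
  obtain ⟨δ, hδ, h⟩ := Metric.uniformContinuous_iff.1 hu (ε / 2) (half_pos hε)
  refine ⟨δ, hδ, fun w' hw' => ?_⟩
  refine ((BoundedContinuousFunction.dist_le (half_pos hε).le).2 fun y => ?_).trans_lt
    (half_lt_self hε)
  rw [jet_apply, jet_apply, partialDeriv_scaled_translate _ _ ht w',
    partialDeriv_scaled_translate _ _ ht w]
  refine (h ?_).le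
  rw [dist_sub_left]
  exact hw'

lemma continuous_distr_scaled (T : Distr d) (φ : TestFn d) (t : ℝ) :
    Continuous fun w => T (scaled φ w t) := by
  by_cases ht : 0 < t
  swap
  · simp only [scaled, dif_neg ht]
    exact continuous_const
  obtain ⟨R, hR, hφ⟩ := exists_testFn_supp φ 0
  simp only [sub_zero] at hφ
  rw [continuous_iff_continuousAt]
  intro w₀
  obtain ⟨s, Λ, hΛ⟩ := exists_jet_extension T (‖w₀‖ + 1 + R * t)
  have h1 : Continuous fun w => Λ (jet s (scaled φ w t)) :=
    Λ.continuous.comp (continuous_jet_scaled s φ ht)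
  refine h1.continuousAt.congr ?_
  filter_upwards [Metric.ball_mem_nhds w₀ one_pos] with w hw
  refine (hΛ _ fun y hy => scaled_vanish hφ w ht y ?_).symm
  rw [Metric.mem_ball, dist_eq_norm] at hw
  have h2 := norm_add_le (y - w) (w - w₀ + w₀)
  have h3 := norm_add_le (w - w₀) w₀
  have : y - w + (w - w₀ + w₀) = y := by abel
  rw [this] at h2
  linarith

/-- The convolution of a continuous compactly supported function and a test function. -/
def convTest (u : Rd d → ℝ) (hu : Continuous u) (hs : HasCompactSupport u) (φ : TestFn d) :
    TestFn d where
  toFun := conv u φ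
  contDiff' := contDiff_infty_of_forall fun n => contDiff_conv hu hs (contDiff_testFn φ n)
  hasCompactSupport' :=
    HasCompactSupport.convolution (L := ContinuousLinearMap.mul ℝ ℝ) (μ := volume) hs
      φ.hasCompactSupport
  tsupport_subset' := fun _ _ => trivial

lemma coe_convTest (u : Rd d → ℝ) (hu : Continuous u) (hs : HasCompactSupport u) (φ : TestFn d) :
    (convTest u hu hs φ : Rd d → ℝ) = conv u φ := rfl

/-- A distribution commutes with the integral defining a convolution. -/
lemma distr_convTest (T : Distr d) {u : Rd d → ℝ} (hu : Continuous u) (hs : HasCompactSupport u)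
    (φ : TestFn d) {t : ℝ} (ht : 0 < t) :
    T (convTest u hu hs (scaled φ 0 t)) = ∫ w, u w * T (scaled φ w t) := by
  obtain ⟨R, hR, hφ⟩ := exists_testFn_supp φ 0
  simp only [sub_zero] at hφ
  obtain ⟨R₀, hR₀⟩ := hs.isCompact.isBounded.subset_closedBall (0 : Rd d)
  have hu0 := tsupport_subset_closedBall_iff.1 hR₀
  have hsup : ∀ w y : Rd d, ‖w‖ ≤ R₀ → R₀ + R * t < ‖y‖ → scaled φ w t y = 0 := by
    intro w y hw hy
    refine scaled_vanish hφ w ht y ?_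
    have h2 := norm_add_le (y - w) w
    rw [sub_add_cancel] at h2
    linarith
  obtain ⟨s, Λ, hΛ⟩ := exists_jet_extension T (R₀ + R * t)
  have hcont : Continuous fun w => u w • jet s (scaled φ w t) :=
    hu.smul (continuous_jet_scaled s φ ht)
  have hint : Integrable fun w => u w • jet s (scaled φ w t) :=
    hcont.integrable_of_hasCompactSupport hs.smul_right
  have h1 : jet s (convTest u hu hs (scaled φ 0 t)) = ∫ w, u w • jet s (scaled φ w t) := by
    funext k
    ext y
    let E := (BoundedContinuousFunction.evalCLM ℝ y).comp
      (ContinuousLinearMap.proj (R := ℝ)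
        (φ := fun _ : multiIndicesLE d s => BoundedContinuousFunction (Rd d) ℝ) k)
    change _ = E (∫ w, u w • jet s (scaled φ w t))
    rw [← E.integral_comp_comm hint, jet_apply, coe_convTest,
      partialDeriv_conv hu hs (contDiff_testFn _ _)]
    unfold conv
    congr 1
    funext w
    rw [map_smul, smul_eq_mul]
    congr 1
    exact (partialDeriv_scaled_translate k φ ht w y).symm
  rw [hΛ _ fun y hy => ?_, h1, ← Λ.integral_comp_comm hint]
  · congr 1
    funext w
    rw [map_smul, smul_eq_mul]
    by_cases hw : ‖w‖ ≤ R₀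
    · rw [hΛ _ fun y hy => hsup w y hw hy]
    · rw [hu0 w (by simpa using hw), zero_mul, zero_mul]
  · refine integral_eq_zero_of_ae (Eventually.of_forall fun w => ?_)
    by_cases hw : ‖w‖ ≤ R₀
    · change u w * scaled φ 0 t (y - w) = 0
      rw [← scaled_translate φ ht, hsup w y hw hy, mul_zero]
    · simp [hu0 w (by simpa using hw)]

/-! ### Mollifiers -/

/-- A test function with integral one and vanishing moments of orders `1, …, q - 1`. -/
structure IsMoll (q : ℕ) (φ : TestFn d) : Prop where
  supp : ∀ y, 1 < ‖y‖ → φ y = 0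
  integral_eq : ∫ z, φ z = 1
  moment : ∀ l : Fin d → ℕ, 1 ≤ mlen l → mlen l < q → ∫ z, φ z * mpow z l = 0

lemma exists_isMoll_one (d : ℕ) : ∃ φ : TestFn d, IsMoll 1 φ := by
  let f : ContDiffBump (0 : Rd d) := ⟨1 / 2, 1, by norm_num, by norm_num⟩
  have hs : ∀ y, 1 < ‖y - 0‖ → f.normed volume y = 0 := by
    intro y hy
    rw [sub_zero] at hy
    have : y ∉ Function.support (f.normed volume) := by
      rw [f.support_normed_eq]
      simp [f, hy.le]
    simpa using this
  refine ⟨mkTest (f.normed volume) (fun n => f.contDiff_normed) 0 1 hs, ?_, ?_, ?_⟩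
  · simpa using hs
  · exact f.integral_normed
  · intro l h1 h2
    omega

lemma IsMoll.step {q : ℕ} {φ : TestFn d} (h : IsMoll q φ) (hq : 1 ≤ q) :
    ∃ φ' : TestFn d, IsMoll (q + 1) φ' := by
  have h2 : (0 : ℝ) < 2⁻¹ := by norm_num
  have hq2 : (2 : ℝ) ^ q - 1 ≠ 0 := by
    have : (2 : ℝ) ^ 1 ≤ 2 ^ q := pow_le_pow_right₀ (by norm_num) hq
    intro h0
    linarith
  have hmom : ∀ l : Fin d → ℕ, ∫ z, scaled φ 0 2⁻¹ z * mpow z l =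
      2⁻¹ ^ mlen l * ∫ z, φ z * mpow z l := by
    intro l
    rw [integral_scaled_mul φ 0 h2, ← integral_const_mul]
    congr 1
    funext z
    rw [zero_add, mpow_smul]
    ring
  have hval : ∀ z, ((2 ^ q - 1 : ℝ)⁻¹ • ((2 : ℝ) ^ q • scaled φ 0 2⁻¹ - φ) : TestFn d) z =
      (2 ^ q - 1 : ℝ)⁻¹ * (2 ^ q * scaled φ 0 2⁻¹ z - φ z) := fun z => rfl
  have hint : ∀ (ψ : TestFn d) (l : Fin d → ℕ), Integrable fun z => ψ z * mpow z l := fun ψ l =>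
    integrable_mul_of_continuous ψ.continuous ψ.hasCompactSupport (continuous_mpow l)
  have hall : ∀ l : Fin d → ℕ,
      ∫ z, ((2 ^ q - 1 : ℝ)⁻¹ • ((2 : ℝ) ^ q • scaled φ 0 2⁻¹ - φ) : TestFn d) z * mpow z l =
      (2 ^ q - 1 : ℝ)⁻¹ * (2 ^ q * 2⁻¹ ^ mlen l - 1) * ∫ z, φ z * mpow z l := by
    intro l
    simp_rw [hval, mul_assoc, sub_mul, mul_assoc]
    rw [integral_const_mul, integral_sub ((hint _ l).const_mul _) (hint _ l), integral_const_mul,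
      hmom]
    ring
  refine ⟨(2 ^ q - 1 : ℝ)⁻¹ • ((2 : ℝ) ^ q • scaled φ 0 2⁻¹ - φ), ?_, ?_, ?_⟩
  · intro y hy
    rw [hval, h.supp y hy, scaled_vanish (R := 1) h.supp 0 h2 y (by rw [sub_zero]; linarith)]
    simp
  · have := hall 0
    simp only [mpow_zero, mul_one, mlen_zero, pow_zero, h.integral_eq] at this
    rw [this, inv_mul_cancel₀ hq2]
  · intro l h1 hl
    rw [hall]
    rcases (Nat.lt_succ_iff.1 hl).lt_or_eq with hl' | hl'
    · rw [h.moment l h1 hl', mul_zero]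
    · rw [hl', ← mul_pow]
      simp

lemma exists_isMoll (d q : ℕ) : ∃ φ : TestFn d, IsMoll q φ := by
  have h : ∀ n, ∃ φ : TestFn d, IsMoll (n + 1) φ := by
    intro n
    induction n with
    | zero => exact exists_isMoll_one d
    | succ n ih =>
      obtain ⟨φ, hφ⟩ := ih
      exact hφ.step (by omega)
  obtain ⟨φ, hφ⟩ := h q
  exact ⟨φ, hφ.supp, hφ.integral_eq, fun l h1 h2 => hφ.moment l h1 (by omega)⟩

/-- A fixed mollifier with vanishing moments of orders `1, …, q - 1`. -/
def moll (d q : ℕ) : TestFn d := (exists_isMoll d q).choose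

lemma isMoll_moll (d q : ℕ) : IsMoll q (moll d q) := (exists_isMoll d q).choose_spec

lemma IsMoll.scaled_vanish {q : ℕ} {φ : TestFn d} (h : IsMoll q φ) (x : Rd d) {t : ℝ}
    (ht : 0 < t) (y : Rd d) (hy : t < ‖y - x‖) : scaled φ x t y = 0 :=
  _root_.scaled_vanish (R := 1) h.supp x ht y (by rwa [one_mul])

lemma abs_conv_le {u : Rd d → ℝ} {M : ℝ} (hM : ∀ y, |u y| ≤ M) (φ : TestFn d) (w : Rd d) :
    |conv u φ w| ≤ M * ∫ z, |φ z| := by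
  rw [conv_comm, ← integral_const_mul, ← Real.norm_eq_abs]
  refine norm_integral_le_of_norm_le ((integrable_testFn φ).abs.const_mul M)
    (Eventually.of_forall fun z => ?_)
  rw [Real.norm_eq_abs, abs_mul, mul_comm]
  exact mul_le_mul_of_nonneg_right (hM _) (abs_nonneg _)

lemma conv_scaled_eq (g : Rd d → ℝ) (φ : TestFn d) {s : ℝ} (hs : 0 < s) (w : Rd d) :
    conv g (scaled φ 0 s) w = ∫ z, φ z * g (w + -(s • z)) := by
  rw [conv_comm]
  unfold conv
  rw [integral_scaled_mul φ 0 hs]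
  simp [sub_eq_add_neg]

/-- Approximation of the identity of order `q`. -/
lemma IsMoll.approx {q : ℕ} {φ : TestFn d} (h : IsMoll q φ) {g : Rd d → ℝ} (hg : ContDiff ℝ q g)
    {M : ℝ} (hM : ∀ k : Fin d → ℕ, mlen k = q → ∀ y, |partialDeriv k g y| ≤ M) {s : ℝ}
    (hs : 0 < s) (w : Rd d) :
    |conv g (scaled φ 0 s) w - g w| ≤ (d ^ q * (∫ z, |φ z|) + 1) * |M| * s ^ q := by
  rw [conv_scaled_eq g φ hs]
  have hgc : Continuous g := hg.continuous
  have hI0 : 0 ≤ ∫ z, |φ z| := integral_nonneg fun z => abs_nonneg _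
  set P : Rd d → ℝ := fun z => ∑ k ∈ multiIndicesLT d (q : ℝ),
    partialDeriv k g w * (mpow (-(s • z)) k / mfact k) with hP
  have hPc : Continuous P := continuous_finsetSum _ fun k _ =>
    continuous_const.mul (((continuous_mpow k).comp (by fun_prop)).div_const _)
  have hint1 : Integrable fun z => φ z * g (w + -(s • z)) :=
    integrable_mul_of_continuous φ.continuous φ.hasCompactSupport (hgc.comp (by fun_prop))
  have hint2 : Integrable fun z => φ z * P z :=
    integrable_mul_of_continuous φ.continuous φ.hasCompactSupport hPc
  have hrem : |∫ z, φ z * (g (w + -(s • z)) - P z)| ≤ d ^ q * (∫ z, |φ z|) * |M| * s ^ q := by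
    have : d ^ q * (∫ z, |φ z|) * |M| * s ^ q = ∫ z, d ^ q * |M| * s ^ q * |φ z| := by
      rw [integral_const_mul]; ring
    rw [this, ← Real.norm_eq_abs]
    refine norm_integral_le_of_norm_le ((integrable_testFn φ).abs.const_mul _)
      (Eventually.of_forall fun z => ?_)
    rw [norm_mul, Real.norm_eq_abs, Real.norm_eq_abs]
    by_cases hz : 1 < ‖z‖
    · simp [h.supp z hz]
    · rw [mul_comm]
      refine mul_le_mul_of_nonneg_right ?_ (abs_nonneg _)
      refine (taylor_bound hg w (-(s • z)) fun k hk τ _ => hM k hk _).trans ?_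
      have : ‖-(s • z)‖ ≤ s := by
        rw [norm_neg, norm_smul, Real.norm_of_nonneg hs.le]
        exact mul_le_of_le_one_right hs.le (not_lt.1 hz)
      gcongr
  have hmain : ∫ z, φ z * P z = if q = 0 then 0 else g w := by
    have h1 : ∀ z, φ z * P z = ∑ k ∈ multiIndicesLT d (q : ℝ),
        (partialDeriv k g w * (-s) ^ mlen k / mfact k) * (φ z * mpow z k) := by
      intro z
      rw [hP, Finset.mul_sum]
      refine Finset.sum_congr rfl fun k _ => ?_
      rw [← neg_smul, mpow_smul]
      ring
    simp_rw [h1]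
    rw [integral_finsetSum _ fun k _ => (integrable_mul_of_continuous φ.continuous
      φ.hasCompactSupport (continuous_mpow k)).const_mul _]
    simp_rw [integral_const_mul]
    split_ifs with hq
    · refine Finset.sum_eq_zero fun k hk => ?_
      rw [mem_multiIndicesLT, hq] at hk
      exact absurd hk (by simp)
    · rw [Finset.sum_eq_single (0 : Fin d → ℕ)]
      · simp [partialDeriv_zero, mlen_zero, mpow_zero, mfact, h.integral_eq]
      · intro k hk hk0
        rw [mem_multiIndicesLT] at hk
        rw [h.moment k _ (by exact_mod_cast hk), mul_zero]
        by_contra hcon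
        exact hk0 (eq_zero_of_mlen_eq_zero (by omega))
      · intro h0
        exact absurd (mem_multiIndicesLT.2 (by rw [mlen_zero]; exact_mod_cast Nat.pos_of_ne_zero hq)) h0
  have hsplit : ∫ z, φ z * g (w + -(s • z)) =
      (∫ z, φ z * (g (w + -(s • z)) - P z)) + ∫ z, φ z * P z := by
    rw [← integral_add ((hint1.sub hint2).congr (Eventually.of_forall fun z => by
      simp only [Pi.sub_apply]; ring)) hint2]
    congr 1
    funext z
    ring
  rw [hsplit, hmain]
  have hle : d ^ q * (∫ z, |φ z|) * |M| * s ^ q ≤ (d ^ q * (∫ z, |φ z|) + 1) * |M| * s ^ q := by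
    gcongr
    linarith
  split_ifs with hq
  · subst hq
    have h3 := hM 0 mlen_zero w
    rw [partialDeriv_zero] at h3
    rw [add_zero]
    refine (abs_sub _ _).trans ?_
    calc _ ≤ d ^ 0 * (∫ z, |φ z|) * |M| * s ^ 0 + |M| := add_le_add hrem (h3.trans (le_abs_self M))
      _ = _ := by simp; ring
  · rw [add_sub_cancel_right]
    exact hrem.trans hle

/-- Uniform convergence of mollifications. -/
lemma IsMoll.approx_uniform {q : ℕ} {φ : TestFn d} (h : IsMoll q φ) {u : Rd d → ℝ}
    (hu : UniformContinuous u) {ε : ℝ} (hε : 0 < ε) :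
    ∃ δ > 0, ∀ s, 0 < s → s < δ → ∀ w, |conv u (scaled φ 0 s) w - u w| ≤ ε := by
  have hI0 : 0 ≤ ∫ z, |φ z| := integral_nonneg fun z => abs_nonneg _
  obtain ⟨δ, hδ, hd⟩ := Metric.uniformContinuous_iff.1 hu (ε / ((∫ z, |φ z|) + 1)) (by positivity)
  refine ⟨δ, hδ, fun s hs hsδ w => ?_⟩
  have hsub : conv u (scaled φ 0 s) w - u w = ∫ z, φ z * (u (w + -(s • z)) - u w) := by
    rw [conv_scaled_eq u φ hs]
    simp_rw [mul_sub]
    rw [integral_sub, integral_mul_const, h.integral_eq, one_mul]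
    · exact integrable_mul_of_continuous φ.continuous φ.hasCompactSupport
        (hu.continuous.comp (by fun_prop))
    · exact (integrable_testFn φ).mul_const _
  rw [hsub]
  have : |∫ z, φ z * (u (w + -(s • z)) - u w)| ≤ ∫ z, ε / ((∫ z, |φ z|) + 1) * |φ z| := by
    rw [← Real.norm_eq_abs]
    refine norm_integral_le_of_norm_le ((integrable_testFn φ).abs.const_mul _)
      (Eventually.of_forall fun z => ?_)
    rw [norm_mul, Real.norm_eq_abs, Real.norm_eq_abs, mul_comm]
    by_cases hz : 1 < ‖z‖
    · simp [h.supp z hz]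
    · refine mul_le_mul_of_nonneg_right (hd ?_).le (abs_nonneg _)
      rw [dist_eq_norm, add_sub_cancel_left, norm_neg, norm_smul, Real.norm_of_nonneg hs.le]
      exact (mul_le_of_le_one_right hs.le (not_lt.1 hz)).trans_lt hsδ
  refine this.trans ?_
  rw [integral_const_mul, div_mul_eq_mul_div, div_le_iff₀ (by positivity)]
  nlinarith

lemma BumpAt.conv_scaled {q p : ℕ} {φ : TestFn d} (hφ : IsMoll p φ) {x : Rd d} {t b s : ℝ}
    {g : Rd d → ℝ} (hg : BumpAt q x t b g) (ht : 0 < t) (hs : 0 < s) (hst : s ≤ t) :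
    BumpAt q x (2 * t) (2 ^ (d + q) * (∫ z, |φ z|) * b) (conv g (scaled φ 0 s)) := by
  have hI0 : 0 ≤ ∫ z, |φ z| := integral_nonneg fun z => abs_nonneg _
  have hb := hg.nonneg ht
  have hcomm := conv_comm g (scaled φ 0 s)
  refine ⟨?_, fun y hy => ?_, fun k hk y => ?_⟩
  · rw [hcomm]
    exact contDiff_conv (scaled φ 0 s).continuous (scaled φ 0 s).hasCompactSupport hg.contDiff
  · refine conv_eq_zero hg.supp (fun y hy => hφ.scaled_vanish 0 hs y (by rwa [sub_zero]))
      (y := y) ?_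
    linarith
  · rw [partialDeriv_conv_left (hg.contDiff.of_le (by exact_mod_cast hk))
      (scaled φ 0 s).continuous (scaled φ 0 s).hasCompactSupport]
    refine (abs_conv_le (hg.bound k hk) _ _).trans ?_
    rw [integral_abs_scaled _ _ hs]
    have h1 : t⁻¹ ^ (d + mlen k) ≤ 2 ^ (d + q) * (2 * t)⁻¹ ^ (d + mlen k) := by
      calc t⁻¹ ^ (d + mlen k) = 2 ^ (d + mlen k) * (2 * t)⁻¹ ^ (d + mlen k) := by
            rw [← mul_pow]; congr 1; field_simp
        _ ≤ _ := by gcongr; norm_num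
    calc _ = b * (∫ z, |φ z|) * t⁻¹ ^ (d + mlen k) := by ring
      _ ≤ b * (∫ z, |φ z|) * (2 ^ (d + q) * (2 * t)⁻¹ ^ (d + mlen k)) := by gcongr
      _ = _ := by ring

/-! ### Extension of distributions to less regular functions -/

/-- The constant lost by mollification in the bounds of order `q`. -/
def mollConst (d q : ℕ) : ℝ := 2 ^ (d + q) * ∫ z, |moll d 1 z|

lemma mollConst_nonneg (d q : ℕ) : 0 ≤ mollConst d q :=
  mul_nonneg (by positivity) (integral_nonneg fun z => abs_nonneg _)

lemma hasCompactSupport_partialDeriv {g : Rd d → ℝ} (hs : HasCompactSupport g) (k : Fin d → ℕ) :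
    HasCompactSupport (partialDeriv k g) :=
  hs.mono' ((subset_tsupport _).trans (tsupport_partialDeriv_subset _ _))

lemma uniformContinuous_of_compact {u : Rd d → ℝ} (hu : Continuous u) (hs : HasCompactSupport u) :
    UniformContinuous u :=
  hu.uniformContinuous_of_tendsto_cocompact hs.is_zero_at_infty

lemma tsupport_conv_subset {g : Rd d → ℝ} {q : ℕ} {φ : TestFn d} (hφ : IsMoll q φ) {t : ℝ}
    (ht : 0 < t) : tsupport (conv g (scaled φ 0 t)) ⊆ Metric.cthickening t (tsupport g) := by
  refine closure_minimal (fun y hy => ?_) Metric.isClosed_cthickening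
  by_contra hcon
  apply hy
  refine integral_eq_zero_of_ae (Eventually.of_forall fun z => ?_)
  by_cases hz : z ∈ tsupport g
  · have h1 : t < dist y z := by
      by_contra h2
      exact hcon (Metric.mem_cthickening_of_dist_le y z t _ hz (not_lt.1 h2))
    have : scaled φ 0 t (y - z) = 0 := by
      refine hφ.scaled_vanish 0 ht _ ?_
      rwa [sub_zero, ← dist_eq_norm]
    simp [this]
  · simp [image_eq_zero_of_notMem_tsupport hz]

lemma exists_mollify_seq {g : Rd d → ℝ} (hg : Continuous g) (hs : HasCompactSupport g)
    {U : Set (Rd d)} (hU : IsOpen U) (hgU : tsupport g ⊆ U) :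
    ∃ φ : ℕ → TestFn d, (∀ j, tsupport (φ j) ⊆ U) ∧
      (∀ (s : ℕ) (k : Fin d → ℕ), ContDiff ℝ s g → mlen k ≤ s →
        TendstoUniformly (fun j => partialDeriv k (φ j)) (partialDeriv k g) atTop) ∧
      ∀ (q : ℕ) (x : Rd d) (t b : ℝ), BumpAt q x t b g → 0 < t →
        ∀ᶠ j in atTop, BumpAt q x (2 * t) (mollConst d q * b) (φ j) := by
  obtain ⟨δ, hδ, hδU⟩ := hs.isCompact.exists_cthickening_subset_open hU hgU
  have hε : ∀ j : ℕ, 0 < δ / (j + 1 : ℝ) := fun j => by positivity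
  have hlim : Tendsto (fun j : ℕ => δ / (j + 1 : ℝ)) atTop (𝓝 0) := by
    have := tendsto_one_div_add_atTop_nhds_zero_nat (𝕜 := ℝ).const_mul δ
    simpa [div_eq_mul_inv] using this
  refine ⟨fun j => convTest g hg hs (scaled (moll d 1) 0 (δ / (j + 1 : ℝ))), fun j => ?_, ?_, ?_⟩
  · refine (tsupport_conv_subset (isMoll_moll d 1) (hε j)).trans
      ((Metric.cthickening_mono ?_ _).trans hδU)
    exact div_le_self hδ.le (by linarith [(Nat.cast_nonneg j : (0 : ℝ) ≤ j)])
  · intro s k hgs hk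
    rw [Metric.tendstoUniformly_iff]
    intro ε hε0
    have hgk : ContDiff ℝ (mlen k) g := hgs.of_le (by exact_mod_cast hk)
    obtain ⟨δ', hδ', h⟩ := (isMoll_moll d 1).approx_uniform
      (uniformContinuous_of_compact (continuous_partialDeriv hgs hk)
        (hasCompactSupport_partialDeriv hs k)) (half_pos hε0)
    filter_upwards [hlim.eventually (gt_mem_nhds hδ')] with j hj y
    rw [coe_convTest, partialDeriv_conv_left hgk (scaled (moll d 1) 0 _).continuous
      (scaled (moll d 1) 0 _).hasCompactSupport, dist_comm, Real.dist_eq]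
    exact (h _ (hε j) hj y).trans_lt (half_lt_self hε0)
  · intro q x t b hb ht
    filter_upwards [hlim.eventually (gt_mem_nhds ht)] with j hj
    exact hb.conv_scaled (isMoll_moll d 1) ht (hε j) hj.le

lemma ExtPairing.continuous {f : Distr d} {g : Rd d → ℝ} {v : ℝ} (h : ExtPairing f g v) :
    Continuous g := by
  obtain ⟨s, L, -, -, hg, -⟩ := h
  exact hg.continuous

lemma ExtPairing.hasCompactSupport {f : Distr d} {g : Rd d → ℝ} {v : ℝ} (h : ExtPairing f g v) :
    HasCompactSupport g := by
  obtain ⟨s, L, hL, -, -, hgL, -⟩ := h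
  exact hL.of_isClosed_subset (isClosed_tsupport g) (hgL.trans interior_subset)

lemma ExtPairing.unique {f : Distr d} {g : Rd d → ℝ} {v v' : ℝ} (h : ExtPairing f g v)
    (h' : ExtPairing f g v') : v = v' := by
  have hc := h.continuous
  have hcs := h.hasCompactSupport
  obtain ⟨s, L, -, -, hg, hgL, hlim⟩ := h
  obtain ⟨s', L', -, -, hg', hgL', hlim'⟩ := h'
  obtain ⟨φ, hφ, hφc, -⟩ := exists_mollify_seq hc hcs
    (isOpen_interior.inter isOpen_interior) (Set.subset_inter hgL hgL')
  refine tendsto_nhds_unique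
    (hlim φ (fun j => (hφ j).trans (Set.inter_subset_left.trans interior_subset))
      fun k hk => hφc s k hg hk)
    (hlim' φ (fun j => (hφ j).trans (Set.inter_subset_right.trans interior_subset))
      fun k hk => hφc s' k hg' hk)

lemma ExtPairing.eq_apply {f : Distr d} {ψ : TestFn d} {v : ℝ} (h : ExtPairing f ψ v) :
    v = f ψ := by
  obtain ⟨s, L, -, -, hg, hgL, hlim⟩ := h
  have := hlim (fun _ => ψ) (fun _ => hgL.trans interior_subset) (fun k _ =>
    Metric.tendstoUniformly_iff.2 fun ε hε => Eventually.of_forall fun _ y => by simpa using hε)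
  exact tendsto_nhds_unique this tendsto_const_nhds

lemma ExtPairing.abs_le {f : Distr d} {g : Rd d → ℝ} {v : ℝ} (h : ExtPairing f g v) {q : ℕ}
    {x : Rd d} {t b A : ℝ} (ht : 0 < t) (hg : BumpAt q x t b g)
    (hf : BoundedAt f q x (2 * t) A) : |v| ≤ mollConst d q * b * A := by
  have hc := h.continuous
  have hcs := h.hasCompactSupport
  obtain ⟨s, L, -, -, hgs, hgL, hlim⟩ := h
  obtain ⟨φ, hφ, hφc, hφb⟩ := exists_mollify_seq hc hcs isOpen_interior hgL
  have h1 := hlim φ (fun j => (hφ j).trans interior_subset) fun k hk => hφc s k hgs hk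
  refine le_of_tendsto h1.abs ?_
  filter_upwards [hφb q x t b hg ht] with j hj
  exact hf.apply (by positivity) hj

lemma HasOrderOn.mono {f : Distr d} {s s' : ℕ} {L L' : Set (Rd d)} (h : HasOrderOn f s L)
    (hs : s ≤ s') (hL : L' ⊆ L) : HasOrderOn f s' L' := by
  obtain ⟨c, hc⟩ := h
  exact ⟨c, fun φ hφ M hM => hc φ (hφ.trans hL) M fun k hk => hM k (hk.trans hs)⟩

lemma hasOrderOn_closedBall {T : Distr d} {q : ℕ} {x : Rd d} {R A : ℝ} (hR : 0 < R)
    (h : BoundedAt T q x R A) : HasOrderOn T q (Metric.closedBall x R) := by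
  refine ⟨(max R 1) ^ (d + q) * A, fun φ hφ M hM => ?_⟩
  have hM0 : 0 ≤ M := (abs_nonneg _).trans (hM 0 (by simp [mlen_zero]) 0)
  have hb : BumpAt q x R (M * (max R 1) ^ (d + q)) φ := by
    refine ⟨contDiff_testFn _ _, tsupport_subset_closedBall_iff.1 hφ, fun k hk y => ?_⟩
    rw [mul_assoc]
    refine (hM k hk y).trans (le_mul_of_one_le_right hM0 ?_)
    have hR1 : (1 : ℝ) ≤ max R 1 := le_max_right _ _
    calc (1 : ℝ) = R ^ (d + mlen k) * R⁻¹ ^ (d + mlen k) := by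
          rw [← mul_pow, mul_inv_cancel₀ hR.ne', one_pow]
      _ ≤ (max R 1) ^ (d + mlen k) * R⁻¹ ^ (d + mlen k) := by gcongr; exact le_max_left _ _
      _ ≤ _ := by gcongr
  refine (h.apply hR hb).trans (le_of_eq (by ring))

lemma exists_extPairing {f : Distr d} {g : Rd d → ℝ} {s : ℕ} {L : Set (Rd d)} (hL : IsCompact L)
    (hf : HasOrderOn f s L) (hg : ContDiff ℝ s g) (hgL : tsupport g ⊆ interior L) :
    ∃ v, ExtPairing f g v := by
  have hcs : HasCompactSupport g :=
    hL.of_isClosed_subset (isClosed_tsupport g) (hgL.trans interior_subset)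
  obtain ⟨c, hc⟩ := hf
  have hdiff : ∀ φ ψ : TestFn d, tsupport φ ⊆ L → tsupport ψ ⊆ L → ∀ M : ℝ,
      (∀ k : Fin d → ℕ, mlen k ≤ s → ∀ y, |partialDeriv k φ y - partialDeriv k g y| ≤ M) →
      (∀ k : Fin d → ℕ, mlen k ≤ s → ∀ y, |partialDeriv k ψ y - partialDeriv k g y| ≤ M) →
      |f φ - f ψ| ≤ |c| * (2 * M) := by
    intro φ ψ hφ hψ M h1 h2
    rw [← map_sub]
    have hM0 : 0 ≤ M := (abs_nonneg _).trans (h1 0 (by simp [mlen_zero]) 0)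
    have hsub : tsupport (φ - ψ : TestFn d) ⊆ L := by
      refine closure_minimal (fun y hy => ?_) hL.isClosed
      by_contra hyL
      apply hy
      change φ y - ψ y = 0
      rw [image_eq_zero_of_notMem_tsupport fun h => hyL (hφ h),
        image_eq_zero_of_notMem_tsupport fun h => hyL (hψ h), sub_zero]
    refine (hc (φ - ψ) hsub (2 * M) fun k hk y => ?_).trans
      (mul_le_mul_of_nonneg_right (le_abs_self c) (by positivity))
    rw [partialDeriv_sub_test]
    have h3 := abs_sub_le (partialDeriv k φ y) (partialDeriv k g y) (partialDeriv k ψ y)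
    rw [abs_sub_comm (partialDeriv k g y)] at h3
    linarith [h1 k hk y, h2 k hk y]
  have hconv : ∀ φ : ℕ → TestFn d, (∀ k : Fin d → ℕ, mlen k ≤ s →
      TendstoUniformly (fun j => partialDeriv k (φ j)) (partialDeriv k g) atTop) →
      ∀ ε > 0, ∀ᶠ j in atTop, ∀ k : Fin d → ℕ, mlen k ≤ s → ∀ y,
        |partialDeriv k (φ j) y - partialDeriv k g y| ≤ ε := by
    intro φ hφ ε hε
    have : ∀ᶠ j in atTop, ∀ k ∈ multiIndicesLE d s, ∀ y,
        |partialDeriv k (φ j) y - partialDeriv k g y| ≤ ε := by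
      refine (Finset.eventually_all _).2 fun k hk => ?_
      filter_upwards [Metric.tendstoUniformly_iff.1 (hφ k (mem_multiIndicesLE.1 hk)) ε hε]
        with j hj y
      have := (hj y).le
      rwa [dist_comm, Real.dist_eq] at this
    filter_upwards [this] with j hj k hk y using hj k (mem_multiIndicesLE.2 hk) y
  obtain ⟨φ, hφ, hφc, -⟩ := exists_mollify_seq hg.continuous hcs isOpen_interior hgL
  have hφL : ∀ j, tsupport (φ j) ⊆ L := fun j => (hφ j).trans interior_subset
  have hkey : ∀ ε > 0, |c| * (2 * (ε / (2 * (|c| + 1)))) < ε := by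
    intro ε hε
    rw [show |c| * (2 * (ε / (2 * (|c| + 1)))) = |c| * ε / (|c| + 1) by field_simp,
      div_lt_iff₀ (by positivity)]
    nlinarith [abs_nonneg c]
  have hcau : CauchySeq fun j => f (φ j) := by
    rw [Metric.cauchySeq_iff']
    intro ε hε
    obtain ⟨N, hN⟩ := eventually_atTop.1 (hconv φ (fun k hk => hφc s k hg hk)
      (ε / (2 * (|c| + 1))) (by positivity))
    exact ⟨N, fun n hn => (hdiff _ _ (hφL n) (hφL N) _ (hN n hn) (hN N le_rfl)).trans_lt
      (hkey ε hε)⟩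
  obtain ⟨v, hv⟩ := cauchySeq_tendsto_of_complete hcau
  refine ⟨v, s, L, hL, ⟨c, hc⟩, hg, hgL, fun ψ hψ hψc => ?_⟩
  have hz : Tendsto (fun j => f (ψ j) - f (φ j)) atTop (𝓝 0) := by
    rw [Metric.tendsto_nhds]
    intro ε hε
    filter_upwards [hconv φ (fun k hk => hφc s k hg hk) (ε / (2 * (|c| + 1))) (by positivity),
      hconv ψ hψc (ε / (2 * (|c| + 1))) (by positivity)] with j h1 h2
    rw [Real.dist_eq, sub_zero]
    exact (hdiff _ _ (hψ j) (hφL j) _ h2 h1).trans_lt (hkey ε hε)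
  simpa using hz.add hv

lemma ExtPairing.add {f f' : Distr d} {g : Rd d → ℝ} {v v' : ℝ} (h : ExtPairing f g v)
    (h' : ExtPairing f' g v') : ExtPairing (f + f') g (v + v') := by
  obtain ⟨s, L, hL, ho, hg, hgL, hlim⟩ := h
  obtain ⟨s', L', hL', ho', hg', hgL', hlim'⟩ := h'
  refine ⟨max s s', L ∩ L', hL.inter hL', ?_, ?_, ?_, ?_⟩
  · obtain ⟨c, hc⟩ := ho.mono (le_max_left s s') (Set.inter_subset_left (t := L'))
    obtain ⟨c', hc'⟩ := ho'.mono (le_max_right s s') (Set.inter_subset_right (s := L))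
    refine ⟨c + c', fun φ hφ M hM => ?_⟩
    change |f φ + f' φ| ≤ _
    rw [add_mul]
    exact (abs_add_le _ _).trans (add_le_add (hc φ hφ M hM) (hc' φ hφ M hM))
  · rcases max_choice s s' with h | h <;> rw [h] <;> assumption
  · rw [interior_inter]
    exact Set.subset_inter hgL hgL'
  · intro φ hφ hφc
    exact (hlim φ (fun j => (hφ j).trans Set.inter_subset_left)
      fun k hk => hφc k (hk.trans (le_max_left _ _))).add
      (hlim' φ (fun j => (hφ j).trans Set.inter_subset_right)
      fun k hk => hφc k (hk.trans (le_max_right _ _)))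

lemma ExtPairing.smul {f : Distr d} {g : Rd d → ℝ} {v : ℝ} (h : ExtPairing f g v) (a : ℝ) :
    ExtPairing (a • f) g (a * v) := by
  obtain ⟨s, L, hL, ⟨c, hc⟩, hg, hgL, hlim⟩ := h
  refine ⟨s, L, hL, ⟨|a| * c, fun φ hφ M hM => ?_⟩, hg, hgL, fun φ hφ hφc => ?_⟩
  · change |a * f φ| ≤ _
    rw [abs_mul, mul_assoc]
    exact mul_le_mul_of_nonneg_left (hc φ hφ M hM) (abs_nonneg a)
  · exact (hlim φ hφ hφc).const_mul a

/-! ### Multiscale decomposition -/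

lemma abs_integral_le_of_ball {u : Rd d → ℝ} {x : Rd d} {R M : ℝ} (hR : 0 ≤ R)
    (hs : ∀ y, R < ‖y - x‖ → u y = 0) (hM : ∀ y, ‖y - x‖ ≤ R → |u y| ≤ M) :
    |∫ y, u y| ≤ M * (R ^ d * volume.real (Metric.ball (0 : Rd d) 1)) := by
  have h1 : ∫ y, u y = ∫ y in Metric.closedBall x R, u y := by
    refine (setIntegral_eq_integral_of_forall_compl_eq_zero fun y hy => hs y ?_).symm
    simpa [dist_eq_norm] using hy
  rw [h1, ← Real.norm_eq_abs]
  have h2 : ‖∫ y in Metric.closedBall x R, u y‖ ≤ M * volume.real (Metric.closedBall x R) := by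
    refine norm_setIntegral_le_of_norm_le_const (isCompact_closedBall x R).measure_lt_top
      fun y hy => ?_
    rw [Metric.mem_closedBall, dist_eq_norm] at hy
    exact hM y hy
  refine h2.trans (le_of_eq ?_)
  rw [Measure.addHaar_real_closedBall _ _ hR]
  simp

/-- The first term in the multiscale decomposition of `g`, integrated against `a`. -/
def lpBase (φ : TestFn d) (g : Rd d → ℝ) (s : ℝ) (a : Rd d → ℝ) : ℝ :=
  ∫ w, conv g (scaled φ 0 (2 * s)) w * a w

/-- The term at scale `s` in the multiscale decomposition of `g`, integrated against `a`. -/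
def lpTerm (φ : TestFn d) (g : Rd d → ℝ) (s : ℝ) (a : Rd d → ℝ) : ℝ :=
  ∫ w, (conv g (scaled φ 0 (s / 2)) w - conv g (scaled φ 0 (2 * s)) w) * a w

lemma lp_sum_eq (φ : TestFn d) (T : Distr d) (g : TestFn d) {s : ℝ}
    (hs : 0 < s) (n : ℕ) :
    lpBase φ g s (fun w => T (scaled φ w s)) +
      ∑ j ∈ Finset.range n, lpTerm φ g (s * 2⁻¹ ^ j) (fun w => T (scaled φ w (s * 2⁻¹ ^ j))) =
      ∫ w, conv g (scaled φ 0 (2 * (s * 2⁻¹ ^ n))) w * T (scaled φ w (s * 2⁻¹ ^ n)) := by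
  have hcc : ∀ r : ℝ, Continuous (conv g (scaled φ 0 r)) ∧
      HasCompactSupport (conv g (scaled φ 0 r)) := fun r =>
    ⟨(convTest g g.continuous g.hasCompactSupport (scaled φ 0 r)).continuous,
      (convTest g g.continuous g.hasCompactSupport (scaled φ 0 r)).hasCompactSupport⟩
  let A : ℝ → ℝ → TestFn d := fun r r' =>
    convTest (conv g (scaled φ 0 r)) (hcc r).1 (hcc r).2 (scaled φ 0 r')
  have hA : ∀ r r' : ℝ, 0 < r' → T (A r r') =
      ∫ w, conv g (scaled φ 0 r) w * T (scaled φ w r') := fun r r' hr' =>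
    distr_convTest T (hcc r).1 (hcc r).2 φ hr'
  have hAcomm : ∀ r r' : ℝ, A r r' = A r' r := by
    intro r r'
    ext y
    exact congrFun (conv_right_comm g.continuous g.hasCompactSupport (scaled φ 0 r).continuous
      (scaled φ 0 r).hasCompactSupport (scaled φ 0 r').continuous
      (scaled φ 0 r').hasCompactSupport) y
  have hterm : ∀ r : ℝ, 0 < r → lpTerm φ g r (fun w => T (scaled φ w r)) =
      T (A r (r / 2)) - T (A (2 * r) r) := by
    intro r hr
    rw [hAcomm r, hA _ _ hr, hA _ _ hr, lpTerm, ← integral_sub]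
    · simp only [sub_mul]
    · exact integrable_mul_of_continuous (hcc _).1 (hcc _).2 (continuous_distr_scaled T φ r)
    · exact integrable_mul_of_continuous (hcc _).1 (hcc _).2 (continuous_distr_scaled T φ r)
  have hsum : ∀ n : ℕ, lpBase φ g s (fun w => T (scaled φ w s)) +
      ∑ j ∈ Finset.range n, lpTerm φ g (s * 2⁻¹ ^ j) (fun w => T (scaled φ w (s * 2⁻¹ ^ j))) =
      T (A (2 * (s * 2⁻¹ ^ n)) (s * 2⁻¹ ^ n)) := by
    intro n
    induction n with
    | zero => simp [hA _ _ hs, lpBase]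
    | succ n ih =>
      rw [Finset.sum_range_succ, ← add_assoc, ih, hterm _ (by positivity)]
      have e1 : 2 * (s * 2⁻¹ ^ (n + 1)) = s * 2⁻¹ ^ n := by rw [pow_succ]; ring
      have e2 : s * 2⁻¹ ^ (n + 1) = s * 2⁻¹ ^ n / 2 := by rw [pow_succ]; ring
      rw [e1, e2]
      ring
  rw [hsum n, hA _ _ (by positivity)]

lemma tendsto_lp {q : ℕ} {φ : TestFn d} (hφ : IsMoll q φ) (T : Distr d) (g : TestFn d) {s : ℝ}
    (hs : 0 < s) :
    Tendsto (fun n => lpBase φ g s (fun w => T (scaled φ w s)) +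
      ∑ j ∈ Finset.range n, lpTerm φ g (s * 2⁻¹ ^ j) fun w => T (scaled φ w (s * 2⁻¹ ^ j)))
      atTop (𝓝 (T g)) := by
  have hcc : ∀ r : ℝ, Continuous (conv g (scaled φ 0 r)) ∧
      HasCompactSupport (conv g (scaled φ 0 r)) := fun r =>
    ⟨(convTest g g.continuous g.hasCompactSupport (scaled φ 0 r)).continuous,
      (convTest g g.continuous g.hasCompactSupport (scaled φ 0 r)).hasCompactSupport⟩
  let A : ℝ → ℝ → TestFn d := fun r r' =>
    convTest (conv g (scaled φ 0 r)) (hcc r).1 (hcc r).2 (scaled φ 0 r')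
  have hsum : ∀ n : ℕ, lpBase φ g s (fun w => T (scaled φ w s)) +
      ∑ j ∈ Finset.range n, lpTerm φ g (s * 2⁻¹ ^ j) (fun w => T (scaled φ w (s * 2⁻¹ ^ j))) =
      T (A (2 * (s * 2⁻¹ ^ n)) (s * 2⁻¹ ^ n)) := fun n => by
    rw [lp_sum_eq φ T g hs n, distr_convTest T (hcc _).1 (hcc _).2 φ (by positivity)]
  simp_rw [hsum]
  obtain ⟨R, hR, hg⟩ := exists_testFn_supp g 0
  simp only [sub_zero] at hg
  have hpow : Tendsto (fun n : ℕ => s * (2⁻¹ : ℝ) ^ n) atTop (𝓝 0) := by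
    simpa using (tendsto_pow_atTop_nhds_zero_of_lt_one (r := (2⁻¹ : ℝ)) (by norm_num)
      (by norm_num)).const_mul s
  have hpos : ∀ n : ℕ, 0 < s * (2⁻¹ : ℝ) ^ n := fun n => by positivity
  refine tendsto_distr T (R := R + 3 * s) (Eventually.of_forall fun n y hy => ?_)
    (fun y hy => hg y (by linarith)) fun k ε hε => ?_
  · have hle : s * (2⁻¹ : ℝ) ^ n ≤ s :=
      mul_le_of_le_one_right hs.le (pow_le_one₀ (by norm_num) (by norm_num))
    refine conv_eq_zero (x := 0) (R := R + 2 * (s * 2⁻¹ ^ n)) (s := s * 2⁻¹ ^ n)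
      (fun y hy => ?_) (fun y hy => hφ.scaled_vanish 0 (hpos n) y (by rwa [sub_zero])) ?_
    · refine conv_eq_zero (x := 0) (R := R) (s := 2 * (s * 2⁻¹ ^ n)) (fun y hy => ?_)
        (fun y hy => hφ.scaled_vanish 0 (by have := hpos n; positivity) y (by rwa [sub_zero])) hy
      exact hg y (by simpa using hy)
    · rw [sub_zero]
      linarith
  · set I := ∫ z, |φ z| with hI
    have hI0 : 0 ≤ I := integral_nonneg fun z => abs_nonneg _
    obtain ⟨δ, hδ, h⟩ := hφ.approx_uniform (uniformContinuous_partialDeriv k g)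
      (ε := ε / (I + 1)) (by positivity)
    have hpow2 : Tendsto (fun n : ℕ => 2 * (s * (2⁻¹ : ℝ) ^ n)) atTop (𝓝 0) := by
      simpa using hpow.const_mul 2
    filter_upwards [hpow.eventually (gt_mem_nhds hδ), hpow2.eventually (gt_mem_nhds hδ)]
      with n h1 h2 y
    have hc1 : ∀ r, ContDiff ℝ (mlen k) (conv g (scaled φ 0 r)) := fun r =>
      contDiff_testFn (convTest g g.continuous g.hasCompactSupport (scaled φ 0 r)) _
    change |partialDeriv k (conv (conv g (scaled φ 0 (2 * (s * 2⁻¹ ^ n))))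
      (scaled φ 0 (s * 2⁻¹ ^ n))) y - _| ≤ ε
    rw [partialDeriv_conv_left (hc1 _) (scaled φ 0 _).continuous (scaled φ 0 _).hasCompactSupport,
      partialDeriv_conv_left (contDiff_testFn g _) (scaled φ 0 _).continuous
        (scaled φ 0 _).hasCompactSupport]
    have h3 := h _ (hpos n) h1 y
    have h4 : |conv (fun w => conv (partialDeriv k g) (scaled φ 0 (2 * (s * 2⁻¹ ^ n))) w -
        partialDeriv k g w) (scaled φ 0 (s * 2⁻¹ ^ n)) y| ≤ ε / (I + 1) * I := by
      refine (abs_conv_le (h _ (by have := hpos n; positivity) h2) _ y).trans ?_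
      rw [integral_abs_scaled _ _ (hpos n)]
    have hint : ∀ u : Rd d → ℝ, Continuous u →
        Integrable fun x => u x * scaled φ 0 (s * 2⁻¹ ^ n) (y - x) := by
      intro u hu
      have := integrable_mul_of_continuous (u := fun x => scaled φ 0 (s * 2⁻¹ ^ n) (y - x))
        ((scaled φ 0 _).continuous.comp (by fun_prop))
        ((scaled φ 0 _).hasCompactSupport.comp_homeomorph (Homeomorph.subLeft y)) hu
      simpa only [mul_comm] using this
    have hck : Continuous (conv (partialDeriv k g) (scaled φ 0 (2 * (s * 2⁻¹ ^ n)))) :=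
      (convTest (derivTest k g) (derivTest k g).continuous (derivTest k g).hasCompactSupport
        (scaled φ 0 _)).continuous
    have h5 : conv (fun w => conv (partialDeriv k g) (scaled φ 0 (2 * (s * 2⁻¹ ^ n))) w -
        partialDeriv k g w) (scaled φ 0 (s * 2⁻¹ ^ n)) y =
        conv (conv (partialDeriv k g) (scaled φ 0 (2 * (s * 2⁻¹ ^ n))))
          (scaled φ 0 (s * 2⁻¹ ^ n)) y - conv (partialDeriv k g) (scaled φ 0 (s * 2⁻¹ ^ n)) y := by
      unfold conv
      rw [← integral_sub]
      · simp only [sub_mul]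
      · exact hint _ hck
      · exact hint _ (derivTest k g).continuous
    rw [h5] at h4
    have h6 : ε / (I + 1) + ε / (I + 1) * I = ε := by field_simp; ring
    have h7 := abs_sub_le (conv (conv (partialDeriv k g) (scaled φ 0 (2 * (s * 2⁻¹ ^ n))))
          (scaled φ 0 (s * 2⁻¹ ^ n)) y) (conv (partialDeriv k g) (scaled φ 0 (s * 2⁻¹ ^ n)) y)
          (partialDeriv k g y)
    linarith

/-! ### Bounds for the multiscale decomposition -/

lemma IsMoll.mono {p q : ℕ} {φ : TestFn d} (h : IsMoll p φ) (hq : q ≤ p) : IsMoll q φ :=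
  ⟨h.supp, h.integral_eq, fun k h1 h2 => h.moment k h1 (h2.trans_le hq)⟩

/-- The constant in the bounds for the multiscale decomposition. -/
def lpConst (q : ℕ) (φ : TestFn d) : ℝ :=
  3 ^ d * volume.real (Metric.ball (0 : Rd d) 1) *
    (2 ^ (q + 1) * (d ^ q * (∫ z, |φ z|) + 1) + ∫ z, |φ z|)

lemma integral_abs_testFn_nonneg (φ : TestFn d) : 0 ≤ ∫ z, |φ z| :=
  integral_nonneg fun z => abs_nonneg _

lemma lpConst_nonneg (q : ℕ) (φ : TestFn d) : 0 ≤ lpConst q φ := by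
  have := integral_abs_testFn_nonneg φ
  have h : 0 ≤ volume.real (Metric.ball (0 : Rd d) 1) := measureReal_nonneg
  unfold lpConst
  positivity

lemma abs_conv_sub_conv_le {p : ℕ} {φ : TestFn d} (hφ : IsMoll p φ) {g : Rd d → ℝ}
    (hg : ContDiff ℝ p g) {M : ℝ} (hM : ∀ k : Fin d → ℕ, mlen k = p → ∀ y, |partialDeriv k g y| ≤ M)
    (hM0 : 0 ≤ M) {s : ℝ} (hs : 0 < s) (w : Rd d) :
    |conv g (scaled φ 0 (s / 2)) w - conv g (scaled φ 0 (2 * s)) w| ≤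
      2 ^ (p + 1) * (d ^ p * (∫ z, |φ z|) + 1) * M * s ^ p := by
  have h1 := hφ.approx hg hM (half_pos hs) w
  have h2 := hφ.approx hg hM (s := 2 * s) (by positivity) w
  have hI := integral_abs_testFn_nonneg φ
  rw [abs_of_nonneg hM0] at h1 h2
  have h3 : (d ^ p * (∫ z, |φ z|) + 1) * M * (s / 2) ^ p ≤
      (d ^ p * (∫ z, |φ z|) + 1) * M * (2 * s) ^ p := by
    gcongr
    linarith
  have h4 := abs_sub_le (conv g (scaled φ 0 (s / 2)) w) (g w) (conv g (scaled φ 0 (2 * s)) w)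
  rw [abs_sub_comm (g w)] at h4
  calc _ ≤ (d ^ p * (∫ z, |φ z|) + 1) * M * (2 * s) ^ p +
        (d ^ p * (∫ z, |φ z|) + 1) * M * (2 * s) ^ p := by linarith
    _ = _ := by rw [mul_pow, pow_succ]; ring

lemma conv_scaled_vanish {p : ℕ} {φ : TestFn d} (hφ : IsMoll p φ) {g : Rd d → ℝ} {x : Rd d} {R : ℝ}
    (hs : ∀ y, R < ‖y - x‖ → g y = 0) {s : ℝ} (hs0 : 0 < s) {y : Rd d} (hy : R + s < ‖y - x‖) :
    conv g (scaled φ 0 s) y = 0 :=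
  conv_eq_zero hs (fun y hy => hφ.scaled_vanish 0 hs0 y (by rwa [sub_zero])) hy

lemma abs_lpTerm_le {p : ℕ} {φ : TestFn d} (hφ : IsMoll p φ) {g : Rd d → ℝ}
    (hg : ContDiff ℝ p g) {x : Rd d} {R : ℝ} (hR : 0 ≤ R) (hs : ∀ y, R < ‖y - x‖ → g y = 0) {M : ℝ}
    (hM : ∀ k : Fin d → ℕ, mlen k = p → ∀ y, |partialDeriv k g y| ≤ M) (hM0 : 0 ≤ M) {s : ℝ}
    (hs0 : 0 < s) {a : Rd d → ℝ} {A : ℝ} (ha : ∀ w, ‖w - x‖ ≤ R + 2 * s → |a w| ≤ A) :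
    |lpTerm φ g s a| ≤ 2 ^ (p + 1) * (d ^ p * (∫ z, |φ z|) + 1) * M * s ^ p * A *
      ((R + 2 * s) ^ d * volume.real (Metric.ball (0 : Rd d) 1)) := by
  have hI := integral_abs_testFn_nonneg φ
  refine abs_integral_le_of_ball (x := x) (R := R + 2 * s) (by positivity) (fun y hy => ?_)
    fun y hy => ?_
  · rw [conv_scaled_vanish hφ hs (half_pos hs0) (by linarith),
      conv_scaled_vanish hφ hs (by positivity) hy, sub_zero, zero_mul]
  · rw [abs_mul]
    exact mul_le_mul (abs_conv_sub_conv_le hφ hg hM hM0 hs0 y) (ha y hy) (abs_nonneg _)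
      (by positivity)

lemma abs_lpBase_le {p : ℕ} {φ : TestFn d} (hφ : IsMoll p φ) {g : Rd d → ℝ}
    {x : Rd d} {R : ℝ} (hR : 0 ≤ R) (hs : ∀ y, R < ‖y - x‖ → g y = 0) {M : ℝ}
    (hM : ∀ y, |g y| ≤ M) {s : ℝ} (hs0 : 0 < s) {a : Rd d → ℝ} {A : ℝ}
    (ha : ∀ w, ‖w - x‖ ≤ R + 2 * s → |a w| ≤ A) :
    |lpBase φ g s a| ≤ M * (∫ z, |φ z|) * A *
      ((R + 2 * s) ^ d * volume.real (Metric.ball (0 : Rd d) 1)) := by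
  have hI := integral_abs_testFn_nonneg φ
  have hM0 : 0 ≤ M := (abs_nonneg _).trans (hM 0)
  refine abs_integral_le_of_ball (x := x) (R := R + 2 * s) (by positivity) (fun y hy => ?_)
    fun y hy => ?_
  · rw [conv_scaled_vanish hφ hs (by positivity) hy, zero_mul]
  · rw [abs_mul]
    refine mul_le_mul ?_ (ha y hy) (abs_nonneg _) (by positivity)
    refine (abs_conv_le hM _ y).trans (le_of_eq ?_)
    rw [integral_abs_scaled _ _ (by positivity)]

lemma BumpAt.abs_lpTerm_le {q : ℕ} {φ : TestFn d} (hφ : IsMoll q φ) {g : Rd d → ℝ} {x : Rd d}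
    {R b : ℝ} (hg : BumpAt q x R b g) {s : ℝ} (hs0 : 0 < s) (hsR : s ≤ R) {a : Rd d → ℝ} {A : ℝ}
    (hA : 0 ≤ A) (ha : ∀ w, ‖w - x‖ ≤ R + 2 * s → |a w| ≤ A) :
    |lpTerm φ g s a| ≤ lpConst q φ * b * ((s / R) ^ q * A) := by
  have hR : 0 < R := hs0.trans_le hsR
  have hb := hg.nonneg hR
  have hI := integral_abs_testFn_nonneg φ
  have hv : 0 ≤ volume.real (Metric.ball (0 : Rd d) 1) := measureReal_nonneg
  refine (_root_.abs_lpTerm_le hφ hg.contDiff hR.le hg.supp (fun k hk y => ?_)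
    (M := b * R⁻¹ ^ (d + q)) (by positivity) hs0 ha).trans ?_
  · simpa [hk] using hg.bound k hk.le y
  · calc _ ≤ 2 ^ (q + 1) * (d ^ q * (∫ z, |φ z|) + 1) * (b * R⁻¹ ^ (d + q)) * s ^ q * A *
          ((3 * R) ^ d * volume.real (Metric.ball (0 : Rd d) 1)) := by
          gcongr
          linarith
      _ = 3 ^ d * volume.real (Metric.ball (0 : Rd d) 1) *
          (2 ^ (q + 1) * (d ^ q * (∫ z, |φ z|) + 1)) * b * ((s / R) ^ q * A) := by
          rw [mul_pow 3, div_pow, inv_pow, pow_add R]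
          field_simp
      _ ≤ _ := by
          unfold lpConst
          gcongr
          linarith

lemma BumpAt.abs_lpBase_le {q : ℕ} {φ : TestFn d} (hφ : IsMoll q φ) {g : Rd d → ℝ} {x : Rd d}
    {R b : ℝ} (hg : BumpAt q x R b g) {s : ℝ} (hs0 : 0 < s) (hsR : s ≤ R) {a : Rd d → ℝ} {A : ℝ}
    (hA : 0 ≤ A) (ha : ∀ w, ‖w - x‖ ≤ R + 2 * s → |a w| ≤ A) :
    |lpBase φ g s a| ≤ lpConst q φ * b * A := by
  have hR : 0 < R := hs0.trans_le hsR
  have hb := hg.nonneg hR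
  have hI := integral_abs_testFn_nonneg φ
  have hv : 0 ≤ volume.real (Metric.ball (0 : Rd d) 1) := measureReal_nonneg
  refine (_root_.abs_lpBase_le hφ hR.le hg.supp hg.abs_le hs0 ha).trans ?_
  calc _ ≤ b * R⁻¹ ^ d * (∫ z, |φ z|) * A *
        ((3 * R) ^ d * volume.real (Metric.ball (0 : Rd d) 1)) := by
        gcongr
        linarith
    _ = 3 ^ d * volume.real (Metric.ball (0 : Rd d) 1) * (∫ z, |φ z|) * b * A := by
        rw [mul_pow, inv_pow]
        field_simp
    _ ≤ _ := by
        unfold lpConst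
        gcongr
        nlinarith [show (0 : ℝ) ≤ 2 ^ (q + 1) * (d ^ q * (∫ z, |φ z|) + 1) by positivity]

/-- The sum of the geometric series `∑ 2^{-θ n}`. -/
def geomConst (θ : ℝ) : ℝ := (1 - (2 : ℝ) ^ (-θ))⁻¹

lemma two_rpow_neg_lt_one {θ : ℝ} (hθ : 0 < θ) : (2 : ℝ) ^ (-θ) < 1 :=
  Real.rpow_lt_one_of_one_lt_of_neg (by norm_num) (by linarith)

lemma geomConst_pos {θ : ℝ} (hθ : 0 < θ) : 0 < geomConst θ :=
  inv_pos.2 (by linarith [two_rpow_neg_lt_one hθ])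

lemma dyadic_rpow {s : ℝ} (hs : 0 < s) (θ : ℝ) (n : ℕ) :
    (s * 2⁻¹ ^ n) ^ θ = s ^ θ * ((2 : ℝ) ^ (-θ)) ^ n := by
  rw [Real.mul_rpow hs.le (by positivity), ← Real.rpow_natCast, ← Real.rpow_natCast,
    ← Real.rpow_mul (by positivity), Real.inv_rpow (by norm_num), ← Real.rpow_neg (by norm_num),
    ← Real.rpow_mul (by norm_num)]
  congr 2
  ring

lemma sum_dyadic_le {s : ℝ} (hs : 0 < s) {θ : ℝ} (hθ : 0 < θ) (n : ℕ) :
    ∑ j ∈ Finset.range n, (s * 2⁻¹ ^ j) ^ θ ≤ geomConst θ * s ^ θ := by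
  simp_rw [dyadic_rpow hs, ← Finset.mul_sum]
  rw [mul_comm]
  have h0 : (0 : ℝ) ≤ (2 : ℝ) ^ (-θ) := by positivity
  have h1 := two_rpow_neg_lt_one hθ
  refine mul_le_mul_of_nonneg_right ?_ (by positivity)
  rw [geomConst, ← tsum_geometric_of_lt_one h0 h1]
  exact (summable_geometric_of_lt_one h0 h1).sum_le_tsum _ fun i _ => by positivity

lemma abs_lp_sum_le {q : ℕ} {φ : TestFn d} (hφ : IsMoll q φ) {e : ℝ} (he : -e < q) {x : Rd d}
    {R b A s₀ : ℝ} (hs₀ : 0 < s₀) (hsR : s₀ ≤ R) (hA : 0 ≤ A) {g : Rd d → ℝ}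
    (hg : BumpAt q x R b g) {a : ℕ → Rd d → ℝ}
    (ha : ∀ n w, ‖w - x‖ ≤ R + 2 * s₀ → |a n w| ≤ A * (s₀ * 2⁻¹ ^ n) ^ e) (n : ℕ) :
    |lpBase φ g s₀ (a 0) + ∑ j ∈ Finset.range n, lpTerm φ g (s₀ * 2⁻¹ ^ j) (a j)| ≤
      lpConst q φ * (1 + geomConst (q + e)) * b * A * s₀ ^ e := by
  have hR : 0 < R := hs₀.trans_le hsR
  have hb := hg.nonneg hR
  have hC := lpConst_nonneg q φ
  have h1 : |lpBase φ g s₀ (a 0)| ≤ lpConst q φ * b * (A * s₀ ^ e) :=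
    hg.abs_lpBase_le hφ hs₀ hsR (by positivity) fun w hw => by simpa using ha 0 w hw
  have h2 : ∀ j : ℕ, |lpTerm φ g (s₀ * 2⁻¹ ^ j) (a j)| ≤
      lpConst q φ * b * A * R⁻¹ ^ q * (s₀ * 2⁻¹ ^ j) ^ (q + e) := by
    intro j
    have hle : s₀ * (2⁻¹ : ℝ) ^ j ≤ s₀ :=
      mul_le_of_le_one_right hs₀.le (pow_le_one₀ (by norm_num) (by norm_num))
    have hpos : 0 < s₀ * (2⁻¹ : ℝ) ^ j := by positivity
    refine (hg.abs_lpTerm_le hφ hpos (hle.trans hsR) (by positivity) fun w hw =>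
      ha j w (hw.trans (by linarith))).trans (le_of_eq ?_)
    rw [Real.rpow_add hpos, Real.rpow_natCast, div_pow, inv_pow R]
    field_simp
  have h3 : ∑ j ∈ Finset.range n, |lpTerm φ g (s₀ * 2⁻¹ ^ j) (a j)| ≤
      lpConst q φ * b * A * (geomConst (q + e) * s₀ ^ e) := by
    refine (Finset.sum_le_sum fun j _ => h2 j).trans ?_
    rw [← Finset.mul_sum]
    refine (mul_le_mul_of_nonneg_left (sum_dyadic_le hs₀ (by linarith) n)
      (by positivity)).trans ?_
    rw [Real.rpow_add hs₀, Real.rpow_natCast]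
    have hle : R⁻¹ ^ q * s₀ ^ q ≤ 1 := by
      rw [← mul_pow]
      refine pow_le_one₀ (by positivity) ?_
      rw [inv_mul_le_iff₀ hR]
      linarith
    have hG := geomConst_pos (θ := q + e) (by linarith)
    calc _ = lpConst q φ * b * A * (geomConst (q + e) * s₀ ^ e) * (R⁻¹ ^ q * s₀ ^ q) := by ring
      _ ≤ _ := mul_le_of_le_one_right (by positivity) hle
  refine (abs_add_le _ _).trans ((add_le_add h1 ((Finset.abs_sum_le_sum_abs _ _).trans h3)).trans
    (le_of_eq (by ring)))

lemma lp_bound {q : ℕ} {φ : TestFn d} (hφ : IsMoll q φ) {e : ℝ} (he : -e < q) (T : Distr d)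
    {x : Rd d} {R b A s₀ : ℝ} (hs₀ : 0 < s₀) (hsR : s₀ ≤ R) (hA : 0 ≤ A) {g : TestFn d}
    (hg : BumpAt q x R b g)
    (h : ∀ (n : ℕ) (w : Rd d), ‖w - x‖ ≤ R + 2 * s₀ →
      |T (scaled φ w (s₀ * 2⁻¹ ^ n))| ≤ A * (s₀ * 2⁻¹ ^ n) ^ e) :
    |T g| ≤ lpConst q φ * (1 + geomConst (q + e)) * b * A * s₀ ^ e := by
  refine le_of_tendsto (tendsto_lp hφ T g hs₀).abs (Eventually.of_forall fun n => ?_)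
  have := abs_lp_sum_le hφ he hs₀ hsR hA hg h n
  simpa using this

lemma tendsto_integral_mollify {q : ℕ} {φ : TestFn d} (hφ : IsMoll q φ) (T : Distr d)
    (g : TestFn d) {s : ℕ → ℝ} (hs : ∀ n, 0 < s n) (hs0 : Tendsto s atTop (𝓝 0)) :
    Tendsto (fun n => ∫ w, g w * T (scaled φ w (s n))) atTop (𝓝 (T g)) := by
  simp_rw [← fun n => distr_convTest T g.continuous g.hasCompactSupport φ (hs n)]
  obtain ⟨R, hR, hg⟩ := exists_testFn_supp g 0
  refine tendsto_distr T (R := R + 1) ?_ (fun y hy => hg y (by simpa using by linarith))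
    fun k ε hε => ?_
  · filter_upwards [hs0.eventually (gt_mem_nhds one_pos)] with n hn y hy
    refine conv_scaled_vanish hφ hg (hs n) (y := y) ?_
    rw [sub_zero]
    linarith
  · obtain ⟨δ, hδ, h⟩ := hφ.approx_uniform (uniformContinuous_partialDeriv k g) hε
    filter_upwards [hs0.eventually (gt_mem_nhds hδ)] with n hn y
    rw [coe_convTest, partialDeriv_conv_left (contDiff_testFn g _) (scaled φ 0 _).continuous
        (scaled φ 0 _).hasCompactSupport]
    exact h _ (hs n) hn y

lemma tendsto_dyadic (s : ℝ) : Tendsto (fun n : ℕ => s * (2⁻¹ : ℝ) ^ n) atTop (𝓝 0) := by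
  simpa using (tendsto_pow_atTop_nhds_zero_of_lt_one (r := (2⁻¹ : ℝ)) (by norm_num)
    (by norm_num)).const_mul s

/-- A distribution that is bounded on all small-scale mollifiers is bounded on `L¹`. -/
lemma abs_distr_le_integral {q : ℕ} {φ : TestFn d} (hφ : IsMoll q φ) (T : Distr d) (g : TestFn d)
    {δ A : ℝ} (hδ : 0 < δ)
    (h : ∀ w ∈ tsupport g, ∀ s ∈ Set.Ioc 0 δ, |T (scaled φ w s)| ≤ A) :
    |T g| ≤ A * ∫ w, |g w| := by
  refine le_of_tendsto (tendsto_integral_mollify hφ T g (s := fun n => δ * 2⁻¹ ^ n)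
    (fun n => by positivity) (tendsto_dyadic δ)).abs (Eventually.of_forall fun n => ?_)
  rw [← integral_const_mul, ← Real.norm_eq_abs]
  refine norm_integral_le_of_norm_le ((integrable_testFn g).abs.const_mul A)
    (Eventually.of_forall fun w => ?_)
  rw [Real.norm_eq_abs, abs_mul]
  by_cases hw : w ∈ tsupport g
  · rw [mul_comm A]
    refine mul_le_mul_of_nonneg_left (h w hw _ ⟨by positivity, ?_⟩) (abs_nonneg _)
    exact mul_le_of_le_one_right hδ.le (pow_le_one₀ (by norm_num) (by norm_num))
  · simp [image_eq_zero_of_notMem_tsupport hw]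

/-! ### Homogeneity and coherence with explicit constants, change of order and scale -/

/-- Homogeneity with an explicit constant. -/
def HomBound (a : ℝ) (r : ℕ) (L : Set (Rd d)) (Λ : ℝ) (F : Rd d → Distr d) (C : ℝ) : Prop :=
  ∀ x ∈ L, ∀ t ∈ Set.Ioc 0 Λ, ∀ φ ∈ testBall d r, |F x (scaled φ x t)| ≤ C * t ^ a

/-- Coherence with an explicit constant. -/
def CohBound (α γ : ℝ) (r : ℕ) (L : Set (Rd d)) (Λ : ℝ) (F : Rd d → Distr d) (C : ℝ) : Prop :=
  ∀ x ∈ L, ∀ y ∈ L, ∀ t ∈ Set.Ioc 0 Λ, ∀ φ ∈ testBall d r,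
    |(F y - F x) (scaled φ x t)| ≤ C * (t ^ α * (‖y - x‖ + t) ^ (γ - α))

lemma HomBound.mono {a : ℝ} {r r' : ℕ} {L L' : Set (Rd d)} {Λ Λ' : ℝ} {F : Rd d → Distr d}
    {C C' : ℝ} (h : HomBound a r L Λ F C) (hr : r ≤ r') (hL : L' ⊆ L) (hΛ : Λ' ≤ Λ) (hC : C ≤ C') :
    HomBound a r' L' Λ' F C' := fun x hx t ht φ hφ =>
  (h x (hL hx) t ⟨ht.1, ht.2.trans hΛ⟩ φ ⟨hφ.1, fun k hk => hφ.2 k (hk.trans hr)⟩).trans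
    (mul_le_mul_of_nonneg_right hC (Real.rpow_nonneg ht.1.le _))

lemma CohBound.mono {α γ : ℝ} {r r' : ℕ} {L L' : Set (Rd d)} {Λ Λ' : ℝ} {F : Rd d → Distr d}
    {C C' : ℝ} (h : CohBound α γ r L Λ F C) (hr : r ≤ r') (hL : L' ⊆ L) (hΛ : Λ' ≤ Λ)
    (hC : C ≤ C') : CohBound α γ r' L' Λ' F C' := fun x hx y hy t ht φ hφ =>
  (h x (hL hx) y (hL hy) t ⟨ht.1, ht.2.trans hΛ⟩ φ
    ⟨hφ.1, fun k hk => hφ.2 k (hk.trans hr)⟩).trans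
    (mul_le_mul_of_nonneg_right hC (mul_nonneg (Real.rpow_nonneg ht.1.le _)
      (Real.rpow_nonneg (add_nonneg (norm_nonneg _) ht.1.le) _)))

lemma HomBound.boundedAt {a : ℝ} {r : ℕ} {L : Set (Rd d)} {Λ : ℝ} {F : Rd d → Distr d}
    {C : ℝ} (h : HomBound a r L Λ F C) {x : Rd d} (hx : x ∈ L) {t : ℝ} (ht : t ∈ Set.Ioc 0 Λ) :
    BoundedAt (F x) r x t (C * t ^ a) := fun φ hφ => h x hx t ht φ hφ

lemma CohBound.boundedAt {α γ : ℝ} {r : ℕ} {L : Set (Rd d)} {Λ : ℝ} {F : Rd d → Distr d}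
    {C : ℝ} (h : CohBound α γ r L Λ F C) {x y : Rd d} (hx : x ∈ L) (hy : y ∈ L) {t : ℝ}
    (ht : t ∈ Set.Ioc 0 Λ) :
    BoundedAt (F y - F x) r x t (C * (t ^ α * (‖y - x‖ + t) ^ (γ - α))) :=
  fun φ hφ => h x hx y hy t ht φ hφ

lemma IsMoll.exists_bump {p : ℕ} {φ : TestFn d} (h : IsMoll p φ) (q : ℕ) :
    ∃ b : ℝ, 0 < b ∧ ∀ w s, 0 < s → BumpAt q w s b (scaled φ w s) := by
  obtain ⟨b, hb, hφ⟩ := exists_bumpAt_scaled one_pos h.supp q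
  exact ⟨b, hb, fun w s hs => by simpa using hφ w s hs⟩

lemma mem_cthickening_of_norm {L : Set (Rd d)} {x w : Rd d} (hx : x ∈ L) {δ : ℝ}
    (h : ‖w - x‖ ≤ δ) : w ∈ Metric.cthickening δ L :=
  Metric.mem_cthickening_of_dist_le w x δ L hx (by rwa [dist_eq_norm])

/-- Coherence with a low order and up to a given scale follows from coherence with any order and up
to any scale, on a slightly larger set. -/
lemma exists_cohBound {α γ : ℝ} (hαγ : α ≤ γ) {q : ℕ} (hq : -α < q) (s : ℕ) {Λ Λ₁ δ : ℝ}
    (hΛ : 0 < Λ) (hΛ₁ : 0 < Λ₁) (hδ : Λ₁ < δ) :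
    ∃ C : ℝ, 0 ≤ C ∧ ∀ (L : Set (Rd d)) (F : Rd d → Distr d) (A : ℝ), 0 ≤ A →
      CohBound α γ s (Metric.cthickening δ L) Λ F A → CohBound α γ q L Λ₁ F (C * A) := by
  obtain ⟨φ, hφ⟩ := exists_isMoll d q
  obtain ⟨b, hb, hbump⟩ := hφ.exists_bump s
  set c : ℝ := min 1 (min (Λ / Λ₁) ((δ - Λ₁) / (2 * Λ₁))) with hc
  have hc0 : 0 < c := by
    have : 0 < δ - Λ₁ := by linarith
    positivity
  have hc1 : c ≤ 1 := min_le_left _ _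
  have hc2 : c * Λ₁ ≤ Λ := by
    rw [← le_div_iff₀ hΛ₁]; exact (min_le_right _ _).trans (min_le_left _ _)
  have hc3 : 2 * (c * Λ₁) ≤ δ - Λ₁ := by
    have : c ≤ (δ - Λ₁) / (2 * Λ₁) := (min_le_right _ _).trans (min_le_right _ _)
    rw [le_div_iff₀ (by positivity)] at this
    linarith
  have hlp := lpConst_nonneg q φ
  have hge := geomConst_pos (θ := q + α) (by linarith)
  refine ⟨lpConst q φ * (1 + geomConst (q + α)) * (2 * b * 4 ^ (γ - α)) * c ^ α, by positivity,
    fun L F A hA h x hx y hy t ht ψ hψ => ?_⟩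
  set h' := ‖y - x‖ with hh'
  have hh0 : 0 ≤ h' := norm_nonneg _
  have ht0 : 0 < t := ht.1
  have hct : c * t ≤ c * Λ₁ := by gcongr; exact ht.2
  have hthick : ∀ w, ‖w - x‖ ≤ t + 2 * (c * t) → w ∈ Metric.cthickening δ L := fun w hw =>
    mem_cthickening_of_norm hx (by linarith [ht.2])
  have hxL := hthick x (by rw [sub_self, norm_zero]; positivity)
  have hyL : y ∈ Metric.cthickening δ L := Metric.self_subset_cthickening L hy
  have key := lp_bound hφ hq (F y - F x) (x := x) (R := t) (b := 1) (s₀ := c * t)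
    (A := 2 * b * 4 ^ (γ - α) * A * (h' + t) ^ (γ - α)) (by positivity)
    (by nlinarith) (by positivity) (bumpAt_scaled hψ x ht0) fun n w hw => ?_
  · refine key.trans (le_of_eq ?_)
    rw [Real.mul_rpow hc0.le ht0.le]
    ring
  · set s' := c * t * 2⁻¹ ^ n with hs'
    have hs0 : 0 < s' := by positivity
    have hsc : s' ≤ c * t := mul_le_of_le_one_right (by positivity)
      (pow_le_one₀ (by norm_num) (by norm_num))
    have hst : s' ≤ t := hsc.trans (by nlinarith)
    have hsΛ : s' ∈ Set.Ioc 0 Λ := ⟨hs0, by linarith⟩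
    have hwL := hthick w hw
    have hwx : ‖w - x‖ ≤ 3 * t := by nlinarith
    have hone : ∀ z ∈ Metric.cthickening δ L, ‖z - x‖ ≤ h' →
        |(F z - F w) (scaled φ w s')| ≤
          b * 4 ^ (γ - α) * A * (h' + t) ^ (γ - α) * s' ^ α := by
      intro z hz hzx
      refine ((h.boundedAt hwL hz hsΛ).apply hs0 (hbump w s' hs0)).trans ?_
      have hzw : ‖z - w‖ + s' ≤ 4 * (h' + t) := by
        have : ‖z - w‖ ≤ ‖z - x‖ + ‖w - x‖ := by
          rw [norm_sub_rev w x]; exact norm_sub_le_norm_sub_add_norm_sub z x w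
        linarith
      have : (‖z - w‖ + s') ^ (γ - α) ≤ 4 ^ (γ - α) * (h' + t) ^ (γ - α) := by
        rw [← Real.mul_rpow (by norm_num) (by positivity)]
        exact Real.rpow_le_rpow (by positivity) hzw (by linarith)
      calc _ ≤ b * (A * (s' ^ α * (4 ^ (γ - α) * (h' + t) ^ (γ - α)))) := by gcongr
        _ = _ := by ring
    have h1 := hone y hyL le_rfl
    have h2 := hone x hxL (by simpa using hh0)
    have h3 : (F y - F x) (scaled φ w s') =
        (F y - F w) (scaled φ w s') - (F x - F w) (scaled φ w s') := by
      change F y _ - F x _ = (F y _ - F w _) - (F x _ - F w _)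
      ring
    rw [h3]
    refine (abs_sub _ _).trans ?_
    linarith

/-- Homogeneity with a low order and up to a given scale follows from homogeneity and coherence with
any order and up to any scale, on a slightly larger set. -/
lemma exists_homBound {a α γ : ℝ} (hαγ : α ≤ γ) (haγ : a ≤ γ) {q : ℕ} (hqa : -a < q)
    (hq : -α < q) (s : ℕ) {Λ Λ₁ δ : ℝ} (hΛ : 0 < Λ) (hΛ₁ : 0 < Λ₁) (hδ : Λ₁ < δ) :
    ∃ C : ℝ, 0 ≤ C ∧ ∀ (L : Set (Rd d)) (F : Rd d → Distr d) (A : ℝ), 0 ≤ A →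
      HomBound a s (Metric.cthickening δ L) Λ F A →
      CohBound α γ s (Metric.cthickening δ L) Λ F A → HomBound a q L Λ₁ F (C * A) := by
  obtain ⟨φ, hφ⟩ := exists_isMoll d q
  obtain ⟨b, hb, hbump⟩ := hφ.exists_bump s
  set c : ℝ := min 1 (min (Λ / Λ₁) ((δ - Λ₁) / (2 * Λ₁))) with hc
  have hc0 : 0 < c := by
    have : 0 < δ - Λ₁ := by linarith
    positivity
  have hc1 : c ≤ 1 := min_le_left _ _
  have hc2 : c * Λ₁ ≤ Λ := by
    rw [← le_div_iff₀ hΛ₁]; exact (min_le_right _ _).trans (min_le_left _ _)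
  have hc3 : 2 * (c * Λ₁) ≤ δ - Λ₁ := by
    have : c ≤ (δ - Λ₁) / (2 * Λ₁) := (min_le_right _ _).trans (min_le_right _ _)
    rw [le_div_iff₀ (by positivity)] at this
    linarith
  set e := min a α with he
  have hea : e ≤ a := min_le_left _ _
  have heα : e ≤ α := min_le_right _ _
  have heq : -e < q := by
    rcases min_choice a α with h | h <;> rw [he, h] <;> assumption
  have hlp := lpConst_nonneg q φ
  have hge := geomConst_pos (θ := q + e) (by linarith)
  refine ⟨lpConst q φ * (1 + geomConst (q + e)) * (b * (1 + 4 ^ (γ - α) * Λ₁ ^ (γ - a))) * c ^ e,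
    by positivity, fun L F A hA hh h x hx t ht ψ hψ => ?_⟩
  have ht0 : 0 < t := ht.1
  have hct : c * t ≤ c * Λ₁ := by gcongr; exact ht.2
  have hthick : ∀ w, ‖w - x‖ ≤ t + 2 * (c * t) → w ∈ Metric.cthickening δ L := fun w hw =>
    mem_cthickening_of_norm hx (by linarith [ht.2])
  have hxL := hthick x (by rw [sub_self, norm_zero]; positivity)
  have key := lp_bound hφ heq (F x) (x := x) (R := t) (b := 1) (s₀ := c * t)
    (A := b * (1 + 4 ^ (γ - α) * Λ₁ ^ (γ - a)) * A * t ^ (a - e)) (by positivity)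
    (by nlinarith) (by positivity) (bumpAt_scaled hψ x ht0) fun n w hw => ?_
  · refine key.trans (le_of_eq ?_)
    rw [Real.mul_rpow hc0.le ht0.le]
    have : t ^ a = t ^ (a - e) * t ^ e := by rw [← Real.rpow_add ht0]; congr 1; ring
    rw [this]
    ring
  · set s' := c * t * 2⁻¹ ^ n with hs'
    have hs0 : 0 < s' := by positivity
    have hsc : s' ≤ c * t := mul_le_of_le_one_right (by positivity)
      (pow_le_one₀ (by norm_num) (by norm_num))
    have hst : s' ≤ t := hsc.trans (by nlinarith)
    have hsΛ : s' ∈ Set.Ioc 0 Λ := ⟨hs0, by linarith⟩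
    have hwL := hthick w hw
    have hwx : ‖w - x‖ ≤ 3 * t := by nlinarith
    have h1 : |F w (scaled φ w s')| ≤ b * A * (t ^ (a - e) * s' ^ e) := by
      refine ((hh.boundedAt hwL hsΛ).apply hs0 (hbump w s' hs0)).trans ?_
      have : s' ^ a = s' ^ (a - e) * s' ^ e := by rw [← Real.rpow_add hs0]; congr 1; ring
      rw [this, mul_assoc]
      have := Real.rpow_le_rpow hs0.le hst (sub_nonneg.2 hea)
      gcongr
    have h2 : |(F x - F w) (scaled φ w s')| ≤
        b * A * (4 ^ (γ - α) * Λ₁ ^ (γ - a)) * (t ^ (a - e) * s' ^ e) := by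
      refine ((h.boundedAt hwL hxL hsΛ).apply hs0 (hbump w s' hs0)).trans ?_
      have hzw : ‖x - w‖ + s' ≤ 4 * t := by rw [norm_sub_rev]; linarith
      have e1 : (‖x - w‖ + s') ^ (γ - α) ≤ 4 ^ (γ - α) * t ^ (γ - α) := by
        rw [← Real.mul_rpow (by norm_num) (by positivity)]
        exact Real.rpow_le_rpow (by positivity) hzw (by linarith)
      have e2 : s' ^ α = s' ^ (α - e) * s' ^ e := by rw [← Real.rpow_add hs0]; congr 1; ring
      have e3 := Real.rpow_le_rpow hs0.le hst (sub_nonneg.2 heα)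
      have e4 : t ^ (α - e) * t ^ (γ - α) = t ^ (a - e) * t ^ (γ - a) := by
        rw [← Real.rpow_add ht0, ← Real.rpow_add ht0]; congr 1; ring
      have e5 := Real.rpow_le_rpow ht0.le ht.2 (sub_nonneg.2 haγ)
      calc _ ≤ b * (A * (t ^ (α - e) * s' ^ e * (4 ^ (γ - α) * t ^ (γ - α)))) := by
            rw [e2]; gcongr
        _ = b * A * (4 ^ (γ - α)) * (t ^ (α - e) * t ^ (γ - α)) * s' ^ e := by ring
        _ = b * A * (4 ^ (γ - α)) * (t ^ (a - e) * t ^ (γ - a)) * s' ^ e := by rw [e4]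
        _ ≤ b * A * (4 ^ (γ - α)) * (t ^ (a - e) * Λ₁ ^ (γ - a)) * s' ^ e := by gcongr
        _ = _ := by ring
    have h3 : F x (scaled φ w s') = F w (scaled φ w s') + (F x - F w) (scaled φ w s') := by
      change F x _ = F w _ + (F x _ - F w _)
      ring
    rw [h3]
    refine (abs_add_le _ _).trans ((add_le_add h1 h2).trans (le_of_eq ?_))
    ring

/-! ### Two-sided dyadic sums -/

lemma sum_dyadic_small_le {p : ℝ} (hp : 0 < p) (N : ℕ) : ∀ u : ℝ, 0 < u →
    ∑ n ∈ Finset.range N, (if u * 2⁻¹ ^ n ≤ 1 then (u * 2⁻¹ ^ n) ^ p else 0) ≤ geomConst p := by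
  induction N with
  | zero => intro u _; simpa using (geomConst_pos hp).le
  | succ N ih =>
    intro u hu
    by_cases h : u ≤ 1
    · refine (Finset.sum_le_sum fun n _ => ?_).trans ((sum_dyadic_le hu hp (N + 1)).trans ?_)
      · split_ifs
        · exact le_rfl
        · positivity
      · exact mul_le_of_le_one_right (geomConst_pos hp).le (Real.rpow_le_one hu.le h hp.le)
    · rw [Finset.sum_range_succ', pow_zero, mul_one, if_neg h, add_zero]
      refine le_trans (le_of_eq ?_) (ih (u * 2⁻¹) (by positivity))
      refine Finset.sum_congr rfl fun n _ => ?_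
      rw [show u * (2⁻¹ : ℝ) ^ (n + 1) = u * 2⁻¹ * 2⁻¹ ^ n by rw [pow_succ]; ring]

lemma sum_dyadic_large_le {p : ℝ} (hp : 0 < p) (N : ℕ) : ∀ u : ℝ, 0 < u →
    ∑ n ∈ Finset.range N, (if u * 2⁻¹ ^ n ≤ 1 then 0 else (u * 2⁻¹ ^ n) ^ (-p)) ≤
      geomConst p - (geomConst p - 1) * (if u ≤ 1 then 0 else u ^ (-p)) := by
  have hθ := two_rpow_neg_lt_one hp
  have hθ0 : (0 : ℝ) < 2 ^ (-p) := by positivity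
  have hG : geomConst p * (1 - 2 ^ (-p)) = 1 := inv_mul_cancel₀ (by linarith)
  have hG1 : 1 ≤ geomConst p := by
    have := geomConst_pos hp
    nlinarith
  induction N with
  | zero =>
    intro u hu
    have : (if u ≤ 1 then 0 else u ^ (-p)) ≤ 1 := by
      split_ifs with h
      · exact zero_le_one
      · exact Real.rpow_le_one_of_one_le_of_nonpos (not_le.1 h).le (by linarith)
    rw [Finset.range_zero, Finset.sum_empty]
    nlinarith
  | succ N ih =>
    intro u hu
    have h1 : ∑ n ∈ Finset.range N, (if u * 2⁻¹ ^ (n + 1) ≤ 1 then 0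
        else (u * (2⁻¹ : ℝ) ^ (n + 1)) ^ (-p)) =
        ∑ n ∈ Finset.range N, (if u * 2⁻¹ * 2⁻¹ ^ n ≤ 1 then 0
        else (u * 2⁻¹ * (2⁻¹ : ℝ) ^ n) ^ (-p)) := by
      refine Finset.sum_congr rfl fun n _ => ?_
      rw [show u * (2⁻¹ : ℝ) ^ (n + 1) = u * 2⁻¹ * 2⁻¹ ^ n by rw [pow_succ]; ring]
    rw [Finset.sum_range_succ', pow_zero, mul_one, h1]
    have h2 := ih (u * 2⁻¹) (by positivity)
    by_cases hu1 : u ≤ 1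
    · rw [if_pos hu1]
      rw [if_pos (show u * 2⁻¹ ≤ 1 by linarith)] at h2
      linarith
    · rw [if_neg hu1]
      have hle : u ^ (-p) ≤ 1 :=
        Real.rpow_le_one_of_one_le_of_nonpos (not_le.1 hu1).le (by linarith)
      by_cases hu2 : u * 2⁻¹ ≤ 1
      · have h0 : ∑ n ∈ Finset.range N, (if u * 2⁻¹ * 2⁻¹ ^ n ≤ 1 then 0
            else (u * 2⁻¹ * (2⁻¹ : ℝ) ^ n) ^ (-p)) = 0 := by
          refine Finset.sum_eq_zero fun n _ => if_pos ?_
          exact (mul_le_of_le_one_right (by positivity)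
            (pow_le_one₀ (by norm_num) (by norm_num))).trans hu2
        rw [h0]
        nlinarith
      · rw [if_neg hu2] at h2
        have h3 : (u * 2⁻¹) ^ (-p) * 2 ^ (-p) = u ^ (-p) := by
          rw [← Real.mul_rpow (by positivity) (by norm_num)]
          congr 1
          ring
        have h4 : (geomConst p - 1) * (u * 2⁻¹) ^ (-p) = geomConst p * u ^ (-p) := by
          have : geomConst p - 1 = geomConst p * 2 ^ (-p) := by linarith
          rw [this, ← h3]
          ring
        linarith

/-- Summation of a sequence that decays geometrically away from a critical index. -/
lemma sum_two_sided_le {p₁ p₂ u A : ℝ} (hp₁ : 0 < p₁) (hp₂ : 0 < p₂) (hu : 0 < u) (hA : 0 ≤ A)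
    {a : ℕ → ℝ} (h₁ : ∀ n, u * 2⁻¹ ^ n ≤ 1 → a n ≤ A * (u * 2⁻¹ ^ n) ^ p₁)
    (h₂ : ∀ n, 1 < u * 2⁻¹ ^ n → a n ≤ A * (u * 2⁻¹ ^ n) ^ (-p₂)) (N : ℕ) :
    ∑ n ∈ Finset.range N, a n ≤ A * (geomConst p₁ + geomConst p₂) := by
  have hG : 1 ≤ geomConst p₂ := by
    have h1 := two_rpow_neg_lt_one hp₂
    have h2 : (0 : ℝ) < 2 ^ (-p₂) := by positivity
    exact (one_le_inv₀ (by linarith)).2 (by linarith)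
  have h3 : ∑ n ∈ Finset.range N, (if u * 2⁻¹ ^ n ≤ 1 then 0 else (u * (2⁻¹ : ℝ) ^ n) ^ (-p₂)) ≤
      geomConst p₂ := by
    refine (sum_dyadic_large_le hp₂ N u hu).trans (sub_le_self _ (mul_nonneg (by linarith) ?_))
    split_ifs
    · exact le_rfl
    · positivity
  refine le_trans (Finset.sum_le_sum fun n _ => ?_)
    ((Finset.mul_sum _ _ _).symm.le.trans (mul_le_mul_of_nonneg_left
      ((Finset.sum_add_distrib).le.trans (add_le_add (sum_dyadic_small_le hp₁ N u hu) h3)) hA))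
  split_ifs with h
  · simpa using h₁ n h
  · simpa using h₂ n (not_le.1 h)

/-! ### Measurability and integrability of germs -/

lemma IsGerm.measurable_scaled {F : Rd d → Distr d} (hF : IsGerm F) (φ : TestFn d) (t : ℝ) :
    Measurable fun p : Rd d × Rd d => F p.1 (scaled φ p.2 t) := by
  have := measurable_uncurry_of_continuous_of_measurable
    (u := fun (w z : Rd d) => F z (scaled φ w t)) (fun z => continuous_distr_scaled (F z) φ t)
    fun w => hF _
  exact this.comp measurable_swap

lemma IsGerm.measurable_diag {F : Rd d → Distr d} (hF : IsGerm F) (φ : TestFn d) (t : ℝ) :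
    Measurable fun w => F w (scaled φ w t) :=
  (hF.measurable_scaled φ t).comp (measurable_id.prodMk measurable_id)

lemma IsGerm.add_smul {F G : Rd d → Distr d} (hF : IsGerm F) (hG : IsGerm G) (a b : ℝ) :
    IsGerm fun x => a • F x + b • G x := fun φ => by
  change Measurable fun x => a * F x φ + b * G x φ
  exact ((hF φ).const_mul a).add ((hG φ).const_mul b)

lemma isGerm_const (f : Distr d) : IsGerm fun _ : Rd d => f := fun _ => measurable_const

lemma IsGerm.sub_const {F : Rd d → Distr d} (hF : IsGerm F) (f : Distr d) :
    IsGerm fun x => F x - f := fun φ => by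
  change Measurable fun x => F x φ - f φ
  exact (hF φ).sub measurable_const

lemma scaled_mem_bump (φ : TestFn d) (q : ℕ) :
    ∃ R b : ℝ, 0 < R ∧ 0 < b ∧ ∀ x t, 0 < t → BumpAt q x (R * t) b (scaled φ x t) := by
  obtain ⟨R, hR, hs⟩ := exists_testFn_supp φ 0
  simp only [sub_zero] at hs
  obtain ⟨b, hb, h⟩ := exists_bumpAt_scaled hR hs q
  exact ⟨R, b, hR, hb, h⟩

lemma IsCoherent.locally_bounded {α γ : ℝ} {F : Rd d → Distr d} (hF : IsCoherent α γ F)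
    (φ : TestFn d) {t : ℝ} (ht : 0 < t) (R : ℝ) :
    ∃ M : ℝ, ∀ z w : Rd d, ‖z‖ ≤ R → ‖w‖ ≤ R → |F z (scaled φ w t)| ≤ M := by
  obtain ⟨q, hq⟩ := hF
  obtain ⟨ρ, b, hρ, hb, hbump⟩ := scaled_mem_bump φ q
  obtain ⟨C, hC⟩ := hq (Metric.closedBall 0 (max R 0)) (isCompact_closedBall _ _)
    (max 1 (ρ * t)) (le_max_left _ _)
  obtain ⟨M, hM⟩ := (isCompact_closedBall (0 : Rd d) (max R 0)).exists_bound_of_continuousOn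
    (continuous_distr_scaled (F 0) φ t).continuousOn
  have hmem : ∀ w : Rd d, ‖w‖ ≤ R → w ∈ Metric.closedBall (0 : Rd d) (max R 0) := fun w hw => by
    rw [mem_closedBall_zero_iff]; exact hw.trans (le_max_left _ _)
  have h0 : (0 : Rd d) ∈ Metric.closedBall (0 : Rd d) (max R 0) := by simp
  -- the function of the distance is monotone in its absolute value
  have hcont : ContinuousOn (fun p : Rd d × Rd d => b * (C * ((ρ * t) ^ α *
      (‖p.1 - p.2‖ + ρ * t) ^ (γ - α)))) (Metric.closedBall 0 (max R 0) ×ˢ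
      Metric.closedBall 0 (max R 0)) := by
    refine Continuous.continuousOn ?_
    refine continuous_const.mul (continuous_const.mul (continuous_const.mul ?_))
    refine Continuous.rpow_const (by fun_prop) fun p => Or.inl ?_
    have := norm_nonneg (p.1 - p.2)
    positivity
  obtain ⟨M', hM'⟩ := ((isCompact_closedBall (0 : Rd d) (max R 0)).prod
    (isCompact_closedBall (0 : Rd d) (max R 0))).exists_bound_of_continuousOn hcont
  have hdiff : ∀ z w : Rd d, z ∈ Metric.closedBall (0 : Rd d) (max R 0) →
      w ∈ Metric.closedBall (0 : Rd d) (max R 0) → |(F z - F w) (scaled φ w t)| ≤ M' := by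
    intro z w hz hw
    have hb' : BoundedAt (F z - F w) q w (ρ * t) _ := fun φ hφ =>
      hC w hw z hz (ρ * t) ⟨by positivity, le_max_right _ _⟩ φ hφ
    exact (hb'.apply (by positivity) (hbump w t ht)).trans
      ((le_abs_self _).trans (hM' (z, w) ⟨hz, hw⟩))
  refine ⟨M' + M' + M, fun z w hz hw => ?_⟩
  have e : F z (scaled φ w t) = (F z - F w) (scaled φ w t) - (F 0 - F w) (scaled φ w t) +
      F 0 (scaled φ w t) := by
    change F z _ = (F z _ - F w _) - (F 0 _ - F w _) + F 0 _
    ring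
  rw [e]
  refine (abs_add_le _ _).trans (add_le_add ((abs_sub _ _).trans (add_le_add ?_ ?_)) ?_)
  · exact hdiff z w (hmem z hz) (hmem w hw)
  · exact hdiff 0 w h0 (hmem w hw)
  · exact hM w (hmem w hw)

lemma integrable_germ {α γ : ℝ} {F : Rd d → Distr d} (hF : F ∈ coherentGerms d α γ)
    {u : Rd d → ℝ} (hu : Continuous u) (hs : HasCompactSupport u) (φ : TestFn d) {t : ℝ}
    (ht : 0 < t) : Integrable fun w => u w * F w (scaled φ w t) := by
  obtain ⟨R, hR⟩ := hs.isCompact.isBounded.subset_closedBall (0 : Rd d)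
  obtain ⟨M, hM⟩ := hF.2.locally_bounded φ ht R
  refine Integrable.mono' ((hu.integrable_of_hasCompactSupport hs).norm.mul_const M)
    (hu.measurable.mul (hF.1.measurable_diag φ t)).aestronglyMeasurable
    (Eventually.of_forall fun w => ?_)
  rw [norm_mul]
  by_cases hw : w ∈ tsupport u
  · have := hR hw
    rw [mem_closedBall_zero_iff] at this
    exact mul_le_mul_of_nonneg_left (hM w w this this) (norm_nonneg _)
  · simp [image_eq_zero_of_notMem_tsupport hw]

lemma isCoherent_const (α γ : ℝ) (f : Distr d) : IsCoherent α γ fun _ : Rd d => f :=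
  ⟨0, fun _ _ _ _ => ⟨0, fun x _ y _ t _ φ _ => by
    change |f _ - f _| ≤ _
    simp⟩⟩

lemma const_mem_coherentGerms (α γ : ℝ) (f : Distr d) :
    (fun _ : Rd d => f) ∈ coherentGerms d α γ := ⟨isGerm_const f, isCoherent_const α γ f⟩

lemma IsCoherentOfOrder.exists_cohBound {α γ : ℝ} {q : ℕ} {F : Rd d → Distr d}
    (h : IsCoherentOfOrder α γ q F) {L : Set (Rd d)} (hL : IsCompact L) (Λ : ℝ) :
    ∃ C, 0 ≤ C ∧ CohBound α γ q L Λ F C := by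
  obtain ⟨C, hC⟩ := h L hL (max 1 Λ) (le_max_left _ _)
  exact ⟨max C 0, le_max_right _ _, CohBound.mono (C := C) hC le_rfl subset_rfl (le_max_right _ _)
    (le_max_left _ _)⟩

/-- Coherence with respect to a low order. -/
lemma IsCoherent.exists_cohBound {α γ : ℝ} (hαγ : α ≤ γ) {F : Rd d → Distr d}
    (h : IsCoherent α γ F) {q : ℕ} (hq : -α < q) {L : Set (Rd d)} (hL : IsCompact L) (Λ : ℝ) :
    ∃ C, 0 ≤ C ∧ CohBound α γ q L Λ F C := by
  obtain ⟨s, hs⟩ := h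
  obtain ⟨C, hC, H⟩ := _root_.exists_cohBound (d := d) hαγ hq s (Λ := 1) (Λ₁ := max 1 Λ)
    (δ := max 1 Λ + 1) one_pos (by positivity) (by linarith)
  obtain ⟨A, hA, hAb⟩ := hs.exists_cohBound (hL.cthickening (r := max 1 Λ + 1)) 1
  exact ⟨C * A, by positivity, (H L F A hA hAb).mono le_rfl subset_rfl (le_max_right _ _) le_rfl⟩

lemma CohBound.isCoherent {α γ : ℝ} {q : ℕ} {F : Rd d → Distr d}
    (h : ∀ L : Set (Rd d), IsCompact L → ∀ Λ : ℝ, 1 ≤ Λ → ∃ C, CohBound α γ q L Λ F C) :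
    IsCoherent α γ F := ⟨q, h⟩

lemma add_smul_mem_coherentGerms {α γ : ℝ} (hαγ : α ≤ γ) {F G : Rd d → Distr d}
    (hF : F ∈ coherentGerms d α γ) (hG : G ∈ coherentGerms d α γ) (a b : ℝ) :
    (fun x => a • F x + b • G x) ∈ coherentGerms d α γ := by
  obtain ⟨q, hq⟩ := exists_nat_gt (-α)
  refine ⟨hF.1.add_smul hG.1 a b, CohBound.isCoherent (q := q) fun L hL Λ _ => ?_⟩
  obtain ⟨A, hA, h1⟩ := hF.2.exists_cohBound hαγ hq hL Λ
  obtain ⟨B, hB, h2⟩ := hG.2.exists_cohBound hαγ hq hL Λ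
  refine ⟨|a| * A + |b| * B, fun x hx y hy t ht φ hφ => ?_⟩
  have e : ((a • F y + b • G y) - (a • F x + b • G x)) (scaled φ x t) =
      a * (F y - F x) (scaled φ x t) + b * (G y - G x) (scaled φ x t) := by
    change (a * F y _ + b * G y _) - (a * F x _ + b * G x _) =
      a * (F y _ - F x _) + b * (G y _ - G x _)
    ring
  rw [e]
  refine (abs_add_le _ _).trans ?_
  rw [abs_mul, abs_mul, add_mul, mul_assoc, mul_assoc]
  exact add_le_add (mul_le_mul_of_nonneg_left (h1 x hx y hy t ht φ hφ) (abs_nonneg _))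
    (mul_le_mul_of_nonneg_left (h2 x hx y hy t ht φ hφ) (abs_nonneg _))

/-! ### Reconstruction -/

/-- The convolution of two rescalings of `φ`. -/
def convScaled (φ : TestFn d) (r s : ℝ) : TestFn d :=
  convTest (scaled φ 0 r) (scaled φ 0 r).continuous (scaled φ 0 r).hasCompactSupport (scaled φ 0 s)

lemma convScaled_comm (φ : TestFn d) (r s : ℝ) : convScaled φ r s = convScaled φ s r := by
  ext y
  exact congrFun (conv_comm _ _) y

lemma distr_scaled_convScaled (T : Distr d) (φ : TestFn d) (z : Rd d) {r s : ℝ} (hr : 0 < r)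
    (hs : 0 < s) :
    T (scaled (convScaled φ r s) z 1) = ∫ w, scaled φ z r w * T (scaled φ w s) := by
  rw [← distr_convTest T (scaled φ z r).continuous (scaled φ z r).hasCompactSupport φ hs]
  congr 1
  ext y
  rw [scaled_apply _ _ one_pos, coe_convTest]
  change _ * conv (scaled φ 0 r) (scaled φ 0 s) _ = _
  simp only [inv_one, one_pow, one_mul, one_smul]
  unfold conv
  rw [← integral_sub_right_eq_self _ z]
  refine integral_congr_ae (Eventually.of_forall fun w => ?_)
  simp only
  rw [scaled_translate φ hr z w]
  congr 2
  abel

lemma integral_abs_le_of_bump {q : ℕ} {x : Rd d} {R b : ℝ} {g : Rd d → ℝ} (hg : BumpAt q x R b g)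
    (hR : 0 < R) : ∫ z, |g z| ≤ volume.real (Metric.ball (0 : Rd d) 1) * b := by
  have h := abs_integral_le_of_ball (u := fun z => |g z|) (x := x) (R := R) (M := b * R⁻¹ ^ d)
    hR.le (fun y hy => by simp [hg.supp y hy]) fun y _ => by rw [abs_abs]; exact hg.abs_le y
  refine (le_abs_self _).trans (h.trans (le_of_eq ?_))
  rw [inv_pow]
  field_simp

lemma abs_pairing_sub_le {α γ : ℝ} {F : Rd d → Distr d} (hF : F ∈ coherentGerms d α γ) {p : ℕ}
    {φ : TestFn d} (hφ : IsMoll p φ) (g : TestFn d) {x : Rd d} {R r s E : ℝ}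
    (hg : ∀ y, R < ‖y - x‖ → g y = 0) (hr : 0 < r) (hs : 0 < s)
    (hE : ∀ z w, ‖z - x‖ ≤ R → ‖w - z‖ ≤ r → |(F z - F w) (scaled φ w s)| ≤ E) :
    |(∫ z, g z * F z (scaled (convScaled φ r s) z 1)) -
      ∫ w, conv g (scaled φ 0 r) w * F w (scaled φ w s)| ≤ (∫ z, |g z|) * ((∫ z, |φ z|) * E) := by
  have hmeas : Measurable fun w => F w (scaled φ w s) := hF.1.measurable_diag φ s
  obtain ⟨M, hM⟩ := hF.2.locally_bounded φ hs (‖x‖ + R + r)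
  obtain ⟨B, hB0, hB⟩ := exists_partialDeriv_bound (scaled φ 0 r) 0
  have hB' : ∀ z w, |scaled φ z r w| ≤ B := fun z w => by
    have := hB 0 (by simp [mlen_zero]) (w - z)
    rwa [partialDeriv_zero, ← scaled_translate φ hr z w] at this
  have hloc : ∀ z w, g z * (scaled φ z r w * F w (scaled φ w s)) ≠ 0 → ‖w - x‖ ≤ R + r := by
    intro z w h
    have h1 : ‖z - x‖ ≤ R := not_lt.1 fun h1 => h (by rw [hg z h1, zero_mul])
    have h2 : ‖w - z‖ ≤ r := not_lt.1 fun h1 => h (by rw [hφ.scaled_vanish z hr w h1]; ring)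
    have := norm_sub_le_norm_sub_add_norm_sub w z x
    linarith
  have hprod : Integrable (Function.uncurry fun z w => g z * (scaled φ z r w *
      F w (scaled φ w s))) (volume.prod volume) := by
    have hind : Integrable ((Metric.closedBall x (R + r)).indicator fun _ => B * |M|) :=
      IntegrableOn.integrable_indicator
        (integrableOn_const (isCompact_closedBall x (R + r)).measure_lt_top.ne)
        measurableSet_closedBall
    refine Integrable.mono' ((integrable_testFn g).norm.mul_prod hind) ?_
      (Eventually.of_forall fun p => ?_)
    · have h1 : (fun p : Rd d × Rd d => scaled φ p.1 r p.2) =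
          fun p => scaled φ 0 r (p.2 - p.1) := funext fun p => scaled_translate φ hr _ _
      have h2 : Measurable fun p : Rd d × Rd d => scaled φ p.1 r p.2 := by
        rw [h1]
        exact ((scaled φ 0 r).continuous.comp (continuous_snd.sub continuous_fst)).measurable
      exact ((g.continuous.measurable.comp measurable_fst).mul
        (h2.mul (hmeas.comp measurable_snd))).aestronglyMeasurable
    · obtain ⟨z, w⟩ := p
      simp only [Function.uncurry_apply_pair]
      by_cases h0 : g z * (scaled φ z r w * F w (scaled φ w s)) = 0
      · rw [h0, norm_zero]
        exact mul_nonneg (norm_nonneg _) (Set.indicator_nonneg (fun _ _ => by positivity) _)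
      · have hw := hloc z w h0
        rw [Set.indicator_of_mem (by rwa [Metric.mem_closedBall, dist_eq_norm]), norm_mul, norm_mul]
        have hw' : ‖w‖ ≤ ‖x‖ + R + r := by
          have := norm_le_norm_add_norm_sub' w x
          linarith
        gcongr
        · exact hB' z w
        · exact (hM w w hw' hw').trans (le_abs_self M)
  have hsw : ∫ w, conv g (scaled φ 0 r) w * F w (scaled φ w s) =
      ∫ z, g z * ∫ w, scaled φ z r w * F w (scaled φ w s) := by
    calc _ = ∫ w, ∫ z, g z * (scaled φ z r w * F w (scaled φ w s)) := by
          refine integral_congr_ae (Eventually.of_forall fun w => ?_)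
          simp only [conv]
          rw [← integral_mul_const]
          refine integral_congr_ae (Eventually.of_forall fun z => ?_)
          simp only
          rw [scaled_translate φ hr z w]
          ring
      _ = ∫ z, ∫ w, g z * (scaled φ z r w * F w (scaled φ w s)) :=
          (integral_integral_swap hprod).symm
      _ = _ := by simp_rw [integral_const_mul]
  have hint1 := integrable_germ hF g.continuous g.hasCompactSupport (convScaled φ r s) one_pos
  have hint2 : Integrable fun z => g z * ∫ w, scaled φ z r w * F w (scaled φ w s) := by
    have := hprod.integral_prod_left
    simpa only [Function.uncurry_apply_pair, integral_const_mul] using this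
  rw [hsw, ← integral_sub hint1 hint2, ← integral_mul_const, ← Real.norm_eq_abs]
  refine norm_integral_le_of_norm_le ((integrable_testFn g).abs.mul_const _)
    (Eventually.of_forall fun z => ?_)
  rw [← mul_sub, norm_mul]
  by_cases hz : ‖z - x‖ ≤ R
  · refine mul_le_mul_of_nonneg_left ?_ (norm_nonneg _)
    rw [distr_scaled_convScaled _ _ _ hr hs, ← integral_sub
      (integrable_mul_of_continuous (scaled φ z r).continuous (scaled φ z r).hasCompactSupport
        (continuous_distr_scaled _ _ _))
      (integrable_germ hF (scaled φ z r).continuous (scaled φ z r).hasCompactSupport φ hs),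
      ← integral_abs_scaled φ z hr, ← integral_mul_const]
    refine norm_integral_le_of_norm_le ((integrable_testFn (scaled φ z r)).abs.mul_const _)
      (Eventually.of_forall fun w => ?_)
    rw [← mul_sub, norm_mul]
    by_cases hw : ‖w - z‖ ≤ r
    · exact mul_le_mul_of_nonneg_left (hE z w hz hw) (norm_nonneg _)
    · simp [hφ.scaled_vanish z hr w (not_le.1 hw)]
  · simp [hg z (not_le.1 hz)]

lemma exists_lp_coarse (φ : TestFn d) {p : ℕ} (hφ : IsMoll p φ) (q : ℕ) :
    ∃ C : ℝ, 0 ≤ C ∧ ∀ (g : Rd d → ℝ) (x : Rd d) (R b s : ℝ) (a : Rd d → ℝ) (A : ℝ), 0 < R →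
      BumpAt q x R b g → R ≤ s → 0 ≤ A → (∀ w, ‖w - x‖ ≤ R + 2 * s → |a w| ≤ A) →
      |lpTerm φ g s a| ≤ C * b * A ∧ |lpBase φ g s a| ≤ C * b * A := by
  obtain ⟨M, hM0, hM⟩ := exists_partialDeriv_bound φ 0
  have hM' : ∀ z, |φ z| ≤ M := fun z => by
    simpa only [partialDeriv_zero] using hM 0 (by simp [mlen_zero]) z
  set v := volume.real (Metric.ball (0 : Rd d) 1) with hv
  have hv0 : 0 ≤ v := measureReal_nonneg
  refine ⟨6 ^ d * v * v * M * 2, by positivity, fun g x R b s a A hR hg hRs hA ha => ?_⟩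
  have hs : 0 < s := hR.trans_le hRs
  have hb := hg.nonneg hR
  have hg1 := integral_abs_le_of_bump hg hR
  have hgint : Integrable g := hg.contDiff.continuous.integrable_of_hasCompactSupport
    hg.hasCompactSupport
  have hconv : ∀ r, 0 < r → s / 2 ≤ r → ∀ w, |conv g (scaled φ 0 r) w| ≤
      v * b * (M * (2 ^ d * s⁻¹ ^ d)) := by
    intro r hr hsr w
    have hbd : ∀ y, |scaled φ 0 r y| ≤ M * (2 ^ d * s⁻¹ ^ d) := fun y => by
      rw [scaled_apply _ _ hr, abs_mul, abs_of_pos (by positivity), mul_comm, ← mul_pow]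
      have : r⁻¹ ≤ 2 * s⁻¹ := by
        rw [inv_le_comm₀ hr (by positivity), mul_inv, inv_inv]
        linarith
      gcongr
      exact hM' _
    have : |conv g (scaled φ 0 r) w| ≤ (∫ z, |g z|) * (M * (2 ^ d * s⁻¹ ^ d)) := by
      rw [← integral_mul_const, ← Real.norm_eq_abs]
      refine norm_integral_le_of_norm_le (hgint.abs.mul_const _) (Eventually.of_forall fun z => ?_)
      rw [norm_mul]
      exact mul_le_mul_of_nonneg_left (hbd _) (abs_nonneg _)
    exact this.trans (by gcongr)
  have hfin : ∀ u : Rd d → ℝ, (∀ y, R + 2 * s < ‖y - x‖ → u y = 0) →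
      (∀ y, |u y| ≤ 2 * (v * b * (M * (2 ^ d * s⁻¹ ^ d)))) →
      |∫ w, u w * a w| ≤ 6 ^ d * v * v * M * 2 * b * A := by
    intro u hu hub
    refine (abs_integral_le_of_ball (x := x) (R := R + 2 * s)
      (M := 2 * (v * b * (M * (2 ^ d * s⁻¹ ^ d))) * A) (by positivity)
      (fun y hy => by rw [hu y hy, zero_mul]) fun y hy => ?_).trans ?_
    · rw [abs_mul]
      exact mul_le_mul (hub y) (ha y hy) (abs_nonneg _) (by positivity)
    · calc _ ≤ 2 * (v * b * (M * (2 ^ d * s⁻¹ ^ d))) * A * ((3 * s) ^ d * v) := by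
            gcongr
            linarith
        _ = (3 * 2) ^ d * v * v * M * 2 * b * A := by
            rw [mul_pow 3 s, mul_pow 3 2, inv_pow]
            field_simp
        _ = _ := by norm_num
  have hpos : 0 ≤ v * b * (M * (2 ^ d * s⁻¹ ^ d)) := by positivity
  constructor
  · refine hfin _ (fun y hy => ?_) fun y => ?_
    · rw [conv_scaled_vanish hφ hg.supp (half_pos hs) (by linarith),
        conv_scaled_vanish hφ hg.supp (by positivity) hy, sub_zero]
    · refine (abs_sub _ _).trans ?_
      linarith [hconv (s / 2) (half_pos hs) le_rfl y, hconv (2 * s) (by positivity) (by linarith) y]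
  · refine hfin _ (fun y hy => ?_) fun y => ?_
    · rw [conv_scaled_vanish hφ hg.supp (by positivity) hy]
    · linarith [hconv (2 * s) (by positivity) (by linarith) y]

lemma rpow_le_one_add {c u : ℝ} (hc : 0 < c) (hcu : c ≤ u) (hu : u ≤ 1) (α : ℝ) :
    u ^ α ≤ 1 + c ^ α := by
  have hu0 : 0 < u := hc.trans_le hcu
  rcases le_total 0 α with h | h
  · have := Real.rpow_le_one hu0.le hu h
    have : 0 < c ^ α := by positivity
    linarith
  · have := Real.rpow_le_rpow_of_nonpos hc hcu h
    linarith

lemma rpow_split {R s : ℝ} (hR : 0 < R) (hs : 0 < s) (α γ : ℝ) :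
    s ^ α * R ^ (γ - α) = R ^ γ * (s / R) ^ α := by
  rw [Real.div_rpow hs.le hR.le, Real.rpow_sub hR]
  field_simp

/-- The bounds on a germ vanishing at `x` that are used for reconstruction. -/
structure DiagBound (α γ : ℝ) (φ : TestFn d) (G : Rd d → Distr d) (x : Rd d) (R A : ℝ) : Prop where
  nonneg : 0 ≤ A
  diag : ∀ w s, ‖w - x‖ ≤ R + 2 * s → s ∈ Set.Ioc (0 : ℝ) 8⁻¹ →
    |G w (scaled φ w s)| ≤ A * (s ^ α * (‖w - x‖ + s) ^ (γ - α))
  diff : ∀ z w s, ‖z - x‖ ≤ R → ‖w - z‖ ≤ 2 * s → s ∈ Set.Ioc (0 : ℝ) 8⁻¹ →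
    |(G z - G w) (scaled φ w s)| ≤ A * s ^ γ

lemma DiagBound.diag_fine {α γ : ℝ} (hαγ : α ≤ γ) {φ : TestFn d} {G : Rd d → Distr d} {x : Rd d}
    {R A : ℝ} (h : DiagBound α γ φ G x R A) {w : Rd d} {s : ℝ} (hw : ‖w - x‖ ≤ R + 2 * s)
    (hs : s ∈ Set.Ioc (0 : ℝ) 8⁻¹) (hsR : s ≤ R) :
    |G w (scaled φ w s)| ≤ 4 ^ (γ - α) * A * R ^ γ * (s / R) ^ α := by
  have hs0 := hs.1
  have hR := hs0.trans_le hsR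
  have hA := h.nonneg
  calc _ ≤ A * (s ^ α * (‖w - x‖ + s) ^ (γ - α)) := h.diag w s hw hs
    _ ≤ A * (s ^ α * (4 * R) ^ (γ - α)) := by
        have := Real.rpow_le_rpow (z := γ - α) (by positivity)
          (show ‖w - x‖ + s ≤ 4 * R by linarith) (by linarith)
        gcongr
    _ = 4 ^ (γ - α) * A * (s ^ α * R ^ (γ - α)) := by
        rw [Real.mul_rpow (by norm_num) hR.le]; ring
    _ = _ := by rw [rpow_split hR hs0]; ring

lemma DiagBound.diag_coarse {α γ : ℝ} (hαγ : α ≤ γ) {φ : TestFn d} {G : Rd d → Distr d} {x : Rd d}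
    {R A : ℝ} (h : DiagBound α γ φ G x R A) {w : Rd d} {s : ℝ} (hw : ‖w - x‖ ≤ R + 2 * s)
    (hs : s ∈ Set.Ioc (0 : ℝ) 8⁻¹) (hsR : R ≤ s) :
    |G w (scaled φ w s)| ≤ 4 ^ (γ - α) * A * s ^ γ := by
  have hs0 := hs.1
  have hA := h.nonneg
  calc _ ≤ A * (s ^ α * (‖w - x‖ + s) ^ (γ - α)) := h.diag w s hw hs
    _ ≤ A * (s ^ α * (4 * s) ^ (γ - α)) := by
        have := Real.rpow_le_rpow (z := γ - α) (by positivity)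
          (show ‖w - x‖ + s ≤ 4 * s by linarith) (by linarith)
        gcongr
    _ = 4 ^ (γ - α) * A * (s ^ α * s ^ (γ - α)) := by
        rw [Real.mul_rpow (by norm_num) hs0.le]; ring
    _ = _ := by rw [← Real.rpow_add hs0]; congr 2; ring

/-- The approximations of the reconstruction of a germ with negative exponent. -/
def recNeg (φ : TestFn d) (F : Rd d → Distr d) (n : ℕ) (g : TestFn d) : ℝ :=
  lpBase φ g 8⁻¹ (fun w => F w (scaled φ w 8⁻¹)) +
    ∑ j ∈ Finset.range n, lpTerm φ g (8⁻¹ * 2⁻¹ ^ j) fun w => F w (scaled φ w (8⁻¹ * 2⁻¹ ^ j))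

/-- The approximations of the reconstruction of a germ with positive exponent. -/
def recPos (φ : TestFn d) (F : Rd d → Distr d) (n : ℕ) (g : TestFn d) : ℝ :=
  ∫ z, g z * F z (scaled (convScaled φ (2 * (8⁻¹ * 2⁻¹ ^ n)) (8⁻¹ * 2⁻¹ ^ n)) z 1)

lemma dyadic_mem (n : ℕ) : (8⁻¹ * 2⁻¹ ^ n : ℝ) ∈ Set.Ioc (0 : ℝ) 8⁻¹ :=
  ⟨by positivity, mul_le_of_le_one_right (by norm_num) (pow_le_one₀ (by norm_num) (by norm_num))⟩

lemma exists_recNeg_bound {α γ : ℝ} (hαγ : α ≤ γ) (hγ : γ < 0) {q : ℕ} (hq : -α < q)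
    {φ : TestFn d} (hφ : IsMoll q φ) {Λ : ℝ} (hΛ : 0 < Λ) :
    ∃ C : ℝ, 0 ≤ C ∧ ∀ (G : Rd d → Distr d) (x : Rd d) (R b A : ℝ) (g : TestFn d),
      R ∈ Set.Ioc 0 Λ → BumpAt q x R b g → DiagBound α γ φ G x R A →
      ∃ v, Tendsto (fun n => recNeg φ G n g) atTop (𝓝 v) ∧ |v| ≤ C * b * A * R ^ γ := by
  obtain ⟨C, hC, hcoarse⟩ := exists_lp_coarse φ hφ q
  have hlp := lpConst_nonneg q φ
  set K := lpConst q φ + C with hK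
  set c : ℝ := min 1 (8⁻¹ / Λ) with hc
  have hc0 : 0 < c := by positivity
  have hG1 := geomConst_pos (θ := q + α) (by linarith)
  have hG2 := geomConst_pos (θ := -γ) (by linarith)
  refine ⟨K * 4 ^ (γ - α) * (1 + (1 + c ^ α)) + K * 4 ^ (γ - α) * (geomConst (q + α) +
    geomConst (-γ)), by positivity, fun G x R b A g hR hg hG => ?_⟩
  have hR0 := hR.1
  have hA := hG.nonneg
  have hb := hg.nonneg hR0
  have hterm : ∀ n, ∑ j ∈ Finset.range n, |lpTerm φ g (8⁻¹ * 2⁻¹ ^ j)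
      (fun w => G w (scaled φ w (8⁻¹ * 2⁻¹ ^ j)))| ≤
      (K * 4 ^ (γ - α) * b * A * R ^ γ) * (geomConst (q + α) + geomConst (-γ)) := by
    intro n
    refine sum_two_sided_le (u := 8⁻¹ / R) (by linarith) (by linarith) (by positivity)
      (by positivity) (fun j hj => ?_) (fun j hj => ?_) n
    · have hs := dyadic_mem j
      have e : 8⁻¹ / R * 2⁻¹ ^ j = 8⁻¹ * 2⁻¹ ^ j / R := by ring
      rw [e] at hj ⊢
      have hsR := (div_le_one hR0).1 hj
      have hs0 := hs.1
      refine (hg.abs_lpTerm_le hφ hs0 hsR (by positivity) fun w hw =>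
        hG.diag_fine hαγ hw hs hsR).trans ?_
      rw [Real.rpow_add (by positivity), Real.rpow_natCast]
      have : lpConst q φ ≤ K := by linarith
      calc _ = lpConst q φ * (4 ^ (γ - α) * b * A * R ^ γ * ((8⁻¹ * 2⁻¹ ^ j / R) ^ q *
            (8⁻¹ * 2⁻¹ ^ j / R) ^ α)) := by ring
        _ ≤ K * (4 ^ (γ - α) * b * A * R ^ γ * ((8⁻¹ * 2⁻¹ ^ j / R) ^ q *
            (8⁻¹ * 2⁻¹ ^ j / R) ^ α)) := by gcongr
        _ = _ := by ring
    · have hs := dyadic_mem j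
      have e : 8⁻¹ / R * 2⁻¹ ^ j = 8⁻¹ * 2⁻¹ ^ j / R := by ring
      rw [e] at hj ⊢
      have hsR := ((one_lt_div hR0).1 hj).le
      have hs0 := hs.1
      refine (hcoarse g x R b _ _ _ hR0 hg hsR (by positivity) fun w hw =>
        hG.diag_coarse hαγ hw hs hsR).1.trans ?_
      have : C ≤ K := by linarith
      have e2 : (8⁻¹ * 2⁻¹ ^ j : ℝ) ^ γ = R ^ γ * (8⁻¹ * 2⁻¹ ^ j / R) ^ γ := by
        rw [← Real.mul_rpow hR0.le (by positivity)]; congr 1; field_simp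
      rw [neg_neg, e2]
      calc _ = C * (4 ^ (γ - α) * b * A * R ^ γ * (8⁻¹ * 2⁻¹ ^ j / R) ^ γ) := by ring
        _ ≤ K * (4 ^ (γ - α) * b * A * R ^ γ * (8⁻¹ * 2⁻¹ ^ j / R) ^ γ) := by gcongr
        _ = _ := by ring
  have hbase : |lpBase φ g 8⁻¹ (fun w => G w (scaled φ w 8⁻¹))| ≤
      (K * 4 ^ (γ - α) * b * A * R ^ γ) * (1 + (1 + c ^ α)) := by
    have hs : (8⁻¹ : ℝ) ∈ Set.Ioc (0 : ℝ) 8⁻¹ := ⟨by norm_num, le_rfl⟩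
    have hca : 0 < c ^ α := by positivity
    rcases le_total (8⁻¹ : ℝ) R with h | h
    · refine (hg.abs_lpBase_le hφ hs.1 h (by positivity) fun w hw =>
        hG.diag_fine hαγ hw hs h).trans ?_
      have h1 : (8⁻¹ / R) ^ α ≤ 1 + c ^ α := by
        refine rpow_le_one_add hc0 ((min_le_right _ _).trans ?_) ((div_le_one hR0).2 h) α
        exact div_le_div_of_nonneg_left (by norm_num) hR0 hR.2
      calc _ = lpConst q φ * (4 ^ (γ - α) * b * A * R ^ γ * (8⁻¹ / R) ^ α) := by ring
        _ ≤ K * (4 ^ (γ - α) * b * A * R ^ γ * (1 + (1 + c ^ α))) := by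
            gcongr
            · linarith
            · linarith
        _ = _ := by ring
    · refine (hcoarse g x R b _ _ _ hR0 hg h (by positivity) fun w hw =>
        hG.diag_coarse hαγ hw hs h).2.trans ?_
      have h1 : (8⁻¹ : ℝ) ^ γ ≤ R ^ γ := Real.rpow_le_rpow_of_nonpos hR0 h hγ.le
      calc _ ≤ K * b * (4 ^ (γ - α) * A * R ^ γ) := by gcongr; linarith
        _ = (K * 4 ^ (γ - α) * b * A * R ^ γ) * 1 := by ring
        _ ≤ _ := by gcongr; linarith
  have hsum : Summable fun j : ℕ => lpTerm φ g (8⁻¹ * 2⁻¹ ^ j)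
      fun w => G w (scaled φ w (8⁻¹ * 2⁻¹ ^ j)) :=
    (summable_of_sum_range_le (fun _ => abs_nonneg _) hterm).of_abs
  refine ⟨_, (hsum.hasSum.tendsto_sum_nat.const_add _), ?_⟩
  refine le_of_tendsto (hsum.hasSum.tendsto_sum_nat.const_add _).abs
    (Eventually.of_forall fun n => ?_)
  refine (abs_add_le _ _).trans ((add_le_add hbase
    ((Finset.abs_sum_le_sum_abs _ _).trans (hterm n))).trans (le_of_eq (by ring)))

lemma exists_recPos_bound {α γ : ℝ} (hαγ : α ≤ γ) (hγ : 0 < γ) {q : ℕ} (hq : -α < q)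
    {φ : TestFn d} (hφ : IsMoll q φ) {Λ : ℝ} (hΛ : 0 < Λ) :
    ∃ C : ℝ, 0 ≤ C ∧ ∀ (G : Rd d → Distr d) (x : Rd d) (R b A : ℝ) (g : TestFn d),
      G ∈ coherentGerms d α γ →
      R ∈ Set.Ioc 0 Λ → BumpAt q x R b g → DiagBound α γ φ G x R A →
      ∃ v, Tendsto (fun n => recPos φ G n g) atTop (𝓝 v) ∧ |v| ≤ C * b * A * R ^ γ := by
  have hlp := lpConst_nonneg q φ
  have hI := integral_abs_testFn_nonneg φ
  set I := ∫ z, |φ z| with hIdef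
  set v := volume.real (Metric.ball (0 : Rd d) 1) with hv
  have hv0 : 0 ≤ v := measureReal_nonneg
  set c : ℝ := min 2⁻¹ (8⁻¹ / Λ) with hc
  have hc0 : 0 < c := by positivity
  set θ := min γ (q + α) with hθ
  have hθ0 : 0 < θ := lt_min hγ (by linarith)
  set K := lpConst q φ * 4 ^ (γ - α) + 2 * (v * I) with hK
  have hK0 : 0 ≤ K := by positivity
  have hge := geomConst_pos hθ0
  refine ⟨K * (1 + (1 + c ^ α)) + K * geomConst θ, by positivity,
    fun G x R b A g hGc hR hg hG => ?_⟩
  have hR0 := hR.1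
  have hA := hG.nonneg
  have hb := hg.nonneg hR0
  have hg1 := integral_abs_le_of_bump hg hR0
  have hpair : ∀ r s : ℝ, 0 < r → r ≤ 2 * s → s ∈ Set.Ioc (0 : ℝ) 8⁻¹ →
      |(∫ z, g z * G z (scaled (convScaled φ r s) z 1)) -
      ∫ w, conv g (scaled φ 0 r) w * G w (scaled φ w s)| ≤ v * I * (b * A * s ^ γ) := by
    intro r s hr hrs hs
    refine (abs_pairing_sub_le hGc hφ g hg.supp hr hs.1 fun z w hz hw =>
      hG.diff z w s hz (hw.trans hrs) hs).trans ?_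
    have := hs.1
    calc _ ≤ (v * b) * (I * (A * s ^ γ)) := by gcongr
      _ = _ := by ring
  have hsγ : ∀ s : ℝ, 0 < s → s ^ γ = R ^ γ * (s / R) ^ γ := fun s hs => by
    rw [← Real.mul_rpow hR0.le (by positivity)]; congr 1; field_simp
  have hstep : ∀ n : ℕ, (8⁻¹ * 2⁻¹ ^ n : ℝ) ≤ R →
      |recPos φ G (n + 1) g - recPos φ G n g| ≤
        K * b * A * R ^ γ * (8⁻¹ * 2⁻¹ ^ n / R) ^ θ := by
    intro n hsR
    have hs := dyadic_mem n
    have e1 : recPos φ G (n + 1) g = ∫ z, g z * G z (scaled (convScaled φ (8⁻¹ * 2⁻¹ ^ n / 2)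
        (8⁻¹ * 2⁻¹ ^ n)) z 1) := by
      unfold recPos
      rw [convScaled_comm]
      congr! 6 <;> rw [pow_succ] <;> ring
    rw [e1, recPos]
    set s : ℝ := 8⁻¹ * 2⁻¹ ^ n with hsdef
    have hs0 := hs.1
    have h1 := hpair (s / 2) s (by positivity) (by linarith) hs
    have h2 := hpair (2 * s) s (by positivity) le_rfl hs
    have h3 : |lpTerm φ g s (fun w => G w (scaled φ w s))| ≤
        lpConst q φ * b * ((s / R) ^ q * (4 ^ (γ - α) * A * R ^ γ * (s / R) ^ α)) :=
      hg.abs_lpTerm_le hφ hs0 hsR (by positivity) fun w hw => hG.diag_fine hαγ hw hs hsR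
    have hcc : ∀ r : ℝ, Integrable fun w => conv g (scaled φ 0 r) w * G w (scaled φ w s) :=
      fun r => integrable_germ hGc
        (convTest g g.continuous g.hasCompactSupport (scaled φ 0 r)).continuous
        (convTest g g.continuous g.hasCompactSupport (scaled φ 0 r)).hasCompactSupport φ hs0
    have h4 : lpTerm φ g s (fun w => G w (scaled φ w s)) =
        (∫ w, conv g (scaled φ 0 (s / 2)) w * G w (scaled φ w s)) -
        ∫ w, conv g (scaled φ 0 (2 * s)) w * G w (scaled φ w s) := by
      rw [← integral_sub (hcc _) (hcc _), lpTerm]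
      simp only [sub_mul]
    have hsR1 : s / R ≤ 1 := (div_le_one hR0).2 hsR
    have hsR0 : 0 < s / R := by positivity
    have h5 : (s / R) ^ q * (s / R) ^ α ≤ (s / R) ^ θ := by
      rw [← Real.rpow_natCast, ← Real.rpow_add hsR0]
      exact Real.rpow_le_rpow_of_exponent_ge hsR0 hsR1 (min_le_right _ _)
    have h6 : s ^ γ ≤ R ^ γ * (s / R) ^ θ := by
      rw [hsγ s hs0]
      exact mul_le_mul_of_nonneg_left
        (Real.rpow_le_rpow_of_exponent_ge hsR0 hsR1 (min_le_left _ _)) (by positivity)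
    have h7 : lpConst q φ * b * ((s / R) ^ q * (4 ^ (γ - α) * A * R ^ γ * (s / R) ^ α)) ≤
        lpConst q φ * 4 ^ (γ - α) * (b * A * R ^ γ * (s / R) ^ θ) := by
      calc _ = lpConst q φ * 4 ^ (γ - α) * (b * A * R ^ γ * ((s / R) ^ q * (s / R) ^ α)) := by ring
        _ ≤ _ := by gcongr
    have h8 : v * I * (b * A * s ^ γ) ≤ v * I * (b * A * R ^ γ * (s / R) ^ θ) := by
      calc _ ≤ v * I * (b * A * (R ^ γ * (s / R) ^ θ)) := by gcongr
        _ = _ := by ring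
    rw [abs_le] at h1 h2 h3 ⊢
    rw [h4] at h3
    have e9 : K * b * A * R ^ γ * (s / R) ^ θ = lpConst q φ * 4 ^ (γ - α) *
      (b * A * R ^ γ * (s / R) ^ θ) + 2 * (v * I * (b * A * R ^ γ * (s / R) ^ θ)) := by
      rw [hK]; ring
    rw [e9]
    constructor <;> linarith [h1.1, h1.2, h2.1, h2.2, h3.1, h3.2]
  obtain ⟨m, hmR, hmc⟩ : ∃ m : ℕ, (8⁻¹ * 2⁻¹ ^ m : ℝ) ≤ R ∧ c ≤ 8⁻¹ * 2⁻¹ ^ m / R := by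
    rcases le_total (8⁻¹ : ℝ) R with h | h
    · refine ⟨0, by simpa using h, (min_le_right _ _).trans ?_⟩
      rw [pow_zero, mul_one]
      exact div_le_div_of_nonneg_left (by norm_num) hR0 hR.2
    · obtain ⟨n, h1, h2⟩ := exists_nat_pow_near_of_lt_one (x := R / 8⁻¹) (y := (2⁻¹ : ℝ))
        (by positivity) ((div_le_one (by norm_num)).2 h) (by norm_num) (by norm_num)
      rw [lt_div_iff₀ (by norm_num)] at h1
      rw [div_le_iff₀ (by norm_num)] at h2
      refine ⟨n + 1, by linarith, (min_le_left _ _).trans ?_⟩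
      rw [le_div_iff₀ hR0, pow_succ]
      linarith
  have hinit : |recPos φ G m g| ≤ K * b * A * R ^ γ * (1 + (1 + c ^ α)) := by
    have hs := dyadic_mem m
    rw [recPos]
    set s : ℝ := 8⁻¹ * 2⁻¹ ^ m with hsdef
    have hs0 := hs.1
    have h2 := hpair (2 * s) s (by positivity) le_rfl hs
    have h3 : |lpBase φ g s (fun w => G w (scaled φ w s))| ≤
        lpConst q φ * b * (4 ^ (γ - α) * A * R ^ γ * (s / R) ^ α) :=
      hg.abs_lpBase_le hφ hs0 hmR (by positivity) fun w hw => hG.diag_fine hαγ hw hs hmR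
    have h4 : (s / R) ^ α ≤ 1 + c ^ α := rpow_le_one_add hc0 hmc ((div_le_one hR0).2 hmR) α
    have h6 : s ^ γ ≤ R ^ γ := Real.rpow_le_rpow hs0.le hmR hγ.le
    have hcα : 0 < c ^ α := by positivity
    have h7 : lpConst q φ * b * (4 ^ (γ - α) * A * R ^ γ * (s / R) ^ α) ≤
        lpConst q φ * 4 ^ (γ - α) * (b * A * R ^ γ * (1 + (1 + c ^ α))) := by
      calc _ = lpConst q φ * 4 ^ (γ - α) * (b * A * R ^ γ * (s / R) ^ α) := by ring
        _ ≤ _ := by gcongr; linarith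
    have h8 : v * I * (b * A * s ^ γ) ≤ 2 * (v * I) * (b * A * R ^ γ * (1 + (1 + c ^ α))) := by
      calc _ ≤ 2 * (v * I) * (b * A * R ^ γ * 1) := by
            have : v * I * (b * A * s ^ γ) ≤ v * I * (b * A * R ^ γ) := by gcongr
            have : 0 ≤ v * I * (b * A * R ^ γ) := by positivity
            linarith
        _ ≤ _ := by gcongr; linarith
    rw [lpBase] at h3
    have h9 := abs_add_le ((∫ z, g z * G z (scaled (convScaled φ (2 * s) s) z 1)) -
      ∫ w, conv g (scaled φ 0 (2 * s)) w * G w (scaled φ w s))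
      (∫ w, conv g (scaled φ 0 (2 * s)) w * G w (scaled φ w s))
    rw [sub_add_cancel] at h9
    have e9 : K * b * A * R ^ γ * (1 + (1 + c ^ α)) = lpConst q φ * 4 ^ (γ - α) *
      (b * A * R ^ γ * (1 + (1 + c ^ α))) + 2 * (v * I) * (b * A * R ^ γ * (1 + (1 + c ^ α))) := by
      rw [hK]; ring
    linarith
  have hgeo : ∀ k : ℕ, dist (recPos φ G (k + m) g) (recPos φ G (k + 1 + m) g) ≤
      K * b * A * R ^ γ * ((2 : ℝ) ^ (-θ)) ^ k := by
    intro k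
    have hle : (8⁻¹ * 2⁻¹ ^ (k + m) : ℝ) = (8⁻¹ * 2⁻¹ ^ m) * 2⁻¹ ^ k := by
      rw [pow_add]; ring
    have hkm : (8⁻¹ * 2⁻¹ ^ (k + m) : ℝ) ≤ R * 2⁻¹ ^ k := by
      rw [hle]; gcongr
    have hk1 : (2⁻¹ : ℝ) ^ k ≤ 1 := pow_le_one₀ (by norm_num) (by norm_num)
    rw [dist_comm, Real.dist_eq, show k + 1 + m = k + m + 1 by ring]
    refine (hstep (k + m) (hkm.trans (mul_le_of_le_one_right hR0.le hk1))).trans ?_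
    have h1 : (8⁻¹ * 2⁻¹ ^ (k + m) / R : ℝ) ≤ 2⁻¹ ^ k := by
      rw [div_le_iff₀ hR0]; linarith
    have h2 : (8⁻¹ * 2⁻¹ ^ (k + m) / R : ℝ) ^ θ ≤ ((2 : ℝ) ^ (-θ)) ^ k := by
      refine (Real.rpow_le_rpow (by positivity) h1 hθ0.le).trans (le_of_eq ?_)
      have := dyadic_rpow one_pos θ k
      rwa [one_mul, Real.one_rpow, one_mul] at this
    gcongr
  obtain ⟨w, hw⟩ := cauchySeq_tendsto_of_complete
    (cauchySeq_of_le_geometric _ _ (two_rpow_neg_lt_one hθ0) hgeo)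
  refine ⟨w, (tendsto_add_atTop_iff_nat m).1 hw, ?_⟩
  have h1 := dist_le_of_le_geometric_of_tendsto₀ _ _ (two_rpow_neg_lt_one hθ0) hgeo hw
  rw [zero_add, Real.dist_eq, div_eq_mul_inv] at h1
  change _ ≤ K * b * A * R ^ γ * geomConst θ at h1
  have h2 := abs_sub_abs_le_abs_sub w (recPos φ G m g)
  rw [abs_sub_comm] at h2
  calc |w| ≤ K * b * A * R ^ γ * geomConst θ + K * b * A * R ^ γ * (1 + (1 + c ^ α)) := by linarith
    _ = _ := by ring

/-! ### Seminorms and explicit constants -/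

lemma canonicalOrder_spec (a α : ℝ) : max (-a) (-α) < canonicalOrder a α :=
  Nat.sInf_mem (s := {r : ℕ | max (-a) (-α) < (r : ℝ)}) (exists_nat_gt (max (-a) (-α)))

lemma neg_lt_canonicalOrder_left (a α : ℝ) : -a < canonicalOrder a α :=
  (le_max_left _ _).trans_lt (canonicalOrder_spec a α)

lemma neg_lt_canonicalOrder_right (a α : ℝ) : -α < canonicalOrder a α :=
  (le_max_right _ _).trans_lt (canonicalOrder_spec a α)

lemma canonicalOrder_le {a α : ℝ} {r : ℕ} (h : -a < r) (h' : -α < r) : canonicalOrder a α ≤ r :=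
  Nat.sInf_le (max_lt h h')

lemma homSeminorm_le {a : ℝ} {r : ℕ} {L : Set (Rd d)} {Λ : ℝ} {F : Rd d → Distr d} {A : ℝ}
    (h : HomBound a r L Λ F A) : homSeminorm a r L Λ F ≤ ENNReal.ofReal A := by
  refine iSup₂_le fun x hx => iSup₂_le fun t ht => iSup₂_le fun φ hφ =>
    ENNReal.ofReal_le_ofReal ?_
  have := ht.1
  rw [div_le_iff₀ (by positivity)]
  exact h x hx t ht φ hφ

lemma homBound_of_homSeminorm_le {a : ℝ} {r : ℕ} {L : Set (Rd d)} {Λ : ℝ} {F : Rd d → Distr d}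
    {A : ℝ} (hA : 0 ≤ A) (h : homSeminorm a r L Λ F ≤ ENNReal.ofReal A) :
    HomBound a r L Λ F A := by
  intro x hx t ht φ hφ
  have h1 : ENNReal.ofReal (|F x (scaled φ x t)| / t ^ a) ≤ ENNReal.ofReal A :=
    le_trans (le_iSup₂_of_le x hx (le_iSup₂_of_le t ht (le_iSup₂ (f := fun (φ : TestFn d)
      (_ : φ ∈ testBall d r) => ENNReal.ofReal (|F x (scaled φ x t)| / t ^ a)) φ hφ))) h
  have := ht.1
  rw [ENNReal.ofReal_le_ofReal_iff hA, div_le_iff₀ (by positivity)] at h1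
  exact h1

lemma cohSeminorm_le {α γ : ℝ} {r : ℕ} {L : Set (Rd d)} {Λ : ℝ} {F : Rd d → Distr d} {A : ℝ}
    (h : CohBound α γ r L Λ F A) : cohSeminorm α γ r L Λ F ≤ ENNReal.ofReal A := by
  refine iSup₂_le fun x hx => iSup₂_le fun y hy => iSup₂_le fun t ht => iSup₂_le fun φ hφ =>
    ENNReal.ofReal_le_ofReal ?_
  have := ht.1
  rw [div_le_iff₀ (by positivity)]
  exact h x hx y hy t ht φ hφ

lemma cohBound_of_cohSeminorm_le {α γ : ℝ} {r : ℕ} {L : Set (Rd d)} {Λ : ℝ}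
    {F : Rd d → Distr d} {A : ℝ} (hA : 0 ≤ A) (h : cohSeminorm α γ r L Λ F ≤ ENNReal.ofReal A) :
    CohBound α γ r L Λ F A := by
  intro x hx y hy t ht φ hφ
  have h1 : ENNReal.ofReal (|(F y - F x) (scaled φ x t)| / (t ^ α * (‖y - x‖ + t) ^ (γ - α))) ≤
      ENNReal.ofReal A :=
    le_trans (le_iSup₂_of_le x hx (le_iSup₂_of_le y hy (le_iSup₂_of_le t ht
      (le_iSup₂ (f := fun (φ : TestFn d) (_ : φ ∈ testBall d r) => ENNReal.ofReal
        (|(F y - F x) (scaled φ x t)| / (t ^ α * (‖y - x‖ + t) ^ (γ - α)))) φ hφ)))) h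
  have := ht.1
  rw [ENNReal.ofReal_le_ofReal_iff hA, div_le_iff₀ (by positivity)] at h1
  exact h1

lemma jointSeminorm_le {a α γ : ℝ} {r : ℕ} {L : Set (Rd d)} {Λ : ℝ} {F : Rd d → Distr d}
    {A B : ℝ} (hA : 0 ≤ A) (hB : 0 ≤ B) (h : HomBound a r L Λ F A) (h' : CohBound α γ r L Λ F B) :
    jointSeminorm a α γ r L Λ F ≤ ENNReal.ofReal (A + B) := by
  rw [ENNReal.ofReal_add hA hB]
  exact add_le_add (homSeminorm_le h) (cohSeminorm_le h')

lemma bounds_of_jointSeminorm_le {a α γ : ℝ} {r : ℕ} {L : Set (Rd d)} {Λ : ℝ}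
    {F : Rd d → Distr d} {A : ℝ} (hA : 0 ≤ A)
    (h : jointSeminorm a α γ r L Λ F ≤ ENNReal.ofReal A) :
    HomBound a r L Λ F A ∧ CohBound α γ r L Λ F A :=
  ⟨homBound_of_homSeminorm_le hA (le_self_add.trans h),
    cohBound_of_cohSeminorm_le hA (le_add_self.trans h)⟩

lemma ennreal_le_mul_of_forall {X Y : ℝ≥0∞} {C : ℝ} (hC : 0 ≤ C)
    (h : ∀ A : ℝ, 0 ≤ A → Y ≤ ENNReal.ofReal A → X ≤ ENNReal.ofReal (C * A)) :
    X ≤ (Real.toNNReal (C + 1) : ℝ≥0) * Y := by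
  have h1 : ((Real.toNNReal (C + 1) : ℝ≥0) : ℝ≥0∞) = ENNReal.ofReal (C + 1) := rfl
  rw [h1]
  rcases eq_or_ne Y ⊤ with hY | hY
  · rw [hY, ENNReal.mul_top]
    · exact le_top
    · rw [Ne, ENNReal.ofReal_eq_zero]
      linarith
  · refine (h Y.toReal ENNReal.toReal_nonneg (ENNReal.ofReal_toReal hY).ge).trans ?_
    rw [ENNReal.ofReal_mul hC, ENNReal.ofReal_toReal hY]
    gcongr
    linarith

lemma sub_sub_sub_const (F : Rd d → Distr d) (f : Distr d) (x y : Rd d) :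
    (F y - f) - (F x - f) = F y - F x := sub_sub_sub_cancel_right _ _ _

lemma CohBound.sub_const_iff {α γ : ℝ} {r : ℕ} {L : Set (Rd d)} {Λ : ℝ} {F : Rd d → Distr d}
    {A : ℝ} (f : Distr d) : CohBound α γ r L Λ (fun x => F x - f) A ↔ CohBound α γ r L Λ F A := by
  unfold CohBound
  simp only [sub_sub_sub_const]

lemma sub_const_mem_coherentGerms {α γ : ℝ} {F : Rd d → Distr d} (hF : F ∈ coherentGerms d α γ)
    (f : Distr d) : (fun x => F x - f) ∈ coherentGerms d α γ := by
  refine ⟨hF.1.sub_const f, ?_⟩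
  obtain ⟨q, hq⟩ := hF.2
  refine ⟨q, fun L hL Λ hΛ => ?_⟩
  simp only [sub_sub_sub_const]
  exact hq L hL Λ hΛ

/-! ### Existence of reconstructions -/

/-- The approximations of the reconstruction of a germ. -/
def recSeq (γ : ℝ) (φ : TestFn d) (F : Rd d → Distr d) (n : ℕ) (g : TestFn d) : ℝ :=
  if γ < 0 then recNeg φ F n g else recPos φ F n g

lemma continuous_conv_test (g κ : TestFn d) :
    Continuous (conv g κ) ∧ HasCompactSupport (conv g κ) :=
  ⟨(convTest g g.continuous g.hasCompactSupport κ).continuous,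
    (convTest g g.continuous g.hasCompactSupport κ).hasCompactSupport⟩

lemma conv_add_smul_test (g g' κ : TestFn d) (c c' : ℝ) (w : Rd d) :
    conv (c • g + c' • g' : TestFn d) κ w = c * conv g κ w + c' * conv g' κ w := by
  unfold conv
  have h : ∀ g : TestFn d, Integrable fun x => g x * κ (w - x) := fun g =>
    integrable_mul_of_continuous g.continuous g.hasCompactSupport
      (κ.continuous.comp (by fun_prop))
  rw [← integral_const_mul, ← integral_const_mul, ← integral_add ((h g).const_mul c)
    ((h g').const_mul c')]
  refine integral_congr_ae (Eventually.of_forall fun x => ?_)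
  change (c * g x + c' * g' x) * _ = _
  ring

section Linear

variable {α γ : ℝ} {F G : Rd d → Distr d}

lemma lpBase_add_smul_test (hF : F ∈ coherentGerms d α γ) (φ g g' : TestFn d) (c c' : ℝ)
    {s : ℝ} (hs : 0 < s) :
    lpBase φ (c • g + c' • g' : TestFn d) s (fun w => F w (scaled φ w s)) =
      c * lpBase φ g s (fun w => F w (scaled φ w s)) +
      c' * lpBase φ g' s (fun w => F w (scaled φ w s)) := by
  have h : ∀ (g : TestFn d) (r : ℝ), Integrable fun w => conv g (scaled φ 0 r) w *
      F w (scaled φ w s) := fun g r => integrable_germ hF (continuous_conv_test g _).1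
        (continuous_conv_test g _).2 φ hs
  unfold lpBase
  rw [← integral_const_mul, ← integral_const_mul, ← integral_add ((h g _).const_mul c)
    ((h g' _).const_mul c')]
  refine integral_congr_ae (Eventually.of_forall fun x => ?_)
  simp only [conv_add_smul_test]
  ring

lemma integrable_lpTerm (hF : F ∈ coherentGerms d α γ) (φ g : TestFn d) {s : ℝ} (hs : 0 < s) :
    Integrable fun w => (conv g (scaled φ 0 (s / 2)) w - conv g (scaled φ 0 (2 * s)) w) *
      F w (scaled φ w s) := by
  simp only [sub_mul]
  exact (integrable_germ hF (continuous_conv_test g _).1 (continuous_conv_test g _).2 φ hs).sub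
    (integrable_germ hF (continuous_conv_test g _).1 (continuous_conv_test g _).2 φ hs)

lemma lpTerm_add_smul_test (hF : F ∈ coherentGerms d α γ) (φ g g' : TestFn d) (c c' : ℝ)
    {s : ℝ} (hs : 0 < s) :
    lpTerm φ (c • g + c' • g' : TestFn d) s (fun w => F w (scaled φ w s)) =
      c * lpTerm φ g s (fun w => F w (scaled φ w s)) +
      c' * lpTerm φ g' s (fun w => F w (scaled φ w s)) := by
  unfold lpTerm
  rw [← integral_const_mul, ← integral_const_mul, ← integral_add
    ((integrable_lpTerm hF φ g hs).const_mul c) ((integrable_lpTerm hF φ g' hs).const_mul c')]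
  refine integral_congr_ae (Eventually.of_forall fun x => ?_)
  simp only [conv_add_smul_test]
  ring

lemma recSeq_add_smul_test (hF : F ∈ coherentGerms d α γ) (φ g g' : TestFn d) (c c' : ℝ) (n : ℕ) :
    recSeq γ φ F n (c • g + c' • g') = c * recSeq γ φ F n g + c' * recSeq γ φ F n g' := by
  unfold recSeq
  split_ifs
  · unfold recNeg
    rw [lpBase_add_smul_test hF _ _ _ _ _ (by norm_num)]
    simp_rw [fun j : ℕ => lpTerm_add_smul_test hF φ g g' c c'
      (s := (8⁻¹ * 2⁻¹ ^ j : ℝ)) (by positivity)]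
    rw [Finset.sum_add_distrib, ← Finset.mul_sum, ← Finset.mul_sum]
    ring
  · unfold recPos
    have h : ∀ g : TestFn d, _ := fun g => integrable_germ hF g.continuous g.hasCompactSupport
      (convScaled φ (2 * (8⁻¹ * 2⁻¹ ^ n)) (8⁻¹ * 2⁻¹ ^ n)) one_pos
    rw [← integral_const_mul, ← integral_const_mul, ← integral_add ((h g).const_mul c)
      ((h g').const_mul c')]
    refine integral_congr_ae (Eventually.of_forall fun x => ?_)
    change (c * g x + c' * g' x) * _ = _
    ring

lemma recSeq_add_smul_germ (hF : F ∈ coherentGerms d α γ) (hG : G ∈ coherentGerms d α γ)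
    (φ g : TestFn d) (a b : ℝ) (n : ℕ) :
    recSeq γ φ (fun x => a • F x + b • G x) n g = a * recSeq γ φ F n g + b * recSeq γ φ G n g := by
  have happ : ∀ (x : Rd d) (ψ : TestFn d), (a • F x + b • G x) ψ = a * F x ψ + b * G x ψ :=
    fun x ψ => rfl
  unfold recSeq
  split_ifs
  · unfold recNeg
    have h1 : ∀ s : ℝ, 0 < s → lpBase φ g s (fun w => (a • F w + b • G w) (scaled φ w s)) =
        a * lpBase φ g s (fun w => F w (scaled φ w s)) +
        b * lpBase φ g s (fun w => G w (scaled φ w s)) := by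
      intro s hs
      unfold lpBase
      rw [← integral_const_mul, ← integral_const_mul, ← integral_add
        ((integrable_germ hF (continuous_conv_test g _).1 (continuous_conv_test g _).2 φ
          hs).const_mul a)
        ((integrable_germ hG (continuous_conv_test g _).1 (continuous_conv_test g _).2 φ
          hs).const_mul b)]
      refine integral_congr_ae (Eventually.of_forall fun x => ?_)
      simp only [happ]
      ring
    have h2 : ∀ s : ℝ, 0 < s → lpTerm φ g s (fun w => (a • F w + b • G w) (scaled φ w s)) =
        a * lpTerm φ g s (fun w => F w (scaled φ w s)) +
        b * lpTerm φ g s (fun w => G w (scaled φ w s)) := by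
      intro s hs
      unfold lpTerm
      rw [← integral_const_mul, ← integral_const_mul, ← integral_add
        ((integrable_lpTerm hF φ g hs).const_mul a) ((integrable_lpTerm hG φ g hs).const_mul b)]
      refine integral_congr_ae (Eventually.of_forall fun x => ?_)
      simp only [happ]
      ring
    rw [h1 _ (by norm_num)]
    simp_rw [fun j : ℕ => h2 (8⁻¹ * 2⁻¹ ^ j : ℝ) (by positivity)]
    rw [Finset.sum_add_distrib, ← Finset.mul_sum, ← Finset.mul_sum]
    ring
  · unfold recPos
    rw [← integral_const_mul, ← integral_const_mul, ← integral_add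
      ((integrable_germ hF g.continuous g.hasCompactSupport _ one_pos).const_mul a)
      ((integrable_germ hG g.continuous g.hasCompactSupport _ one_pos).const_mul b)]
    refine integral_congr_ae (Eventually.of_forall fun x => ?_)
    simp only [happ]
    ring

end Linear

lemma tendsto_recSeq_const (γ : ℝ) {q : ℕ} {φ : TestFn d} (hφ : IsMoll q φ) (f : Distr d)
    (g : TestFn d) : Tendsto (fun n => recSeq γ φ (fun _ => f) n g) atTop (𝓝 (f g)) := by
  have h := tendsto_lp hφ f g (s := 8⁻¹) (by norm_num)
  refine h.congr fun n => ?_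
  unfold recSeq
  split_ifs
  · rfl
  · rw [lp_sum_eq φ f g (by norm_num)]
    obtain ⟨R, hR, hg⟩ := exists_testFn_supp g 0
    have := abs_pairing_sub_le (const_mem_coherentGerms 0 0 f) hφ g hg
      (r := 2 * (8⁻¹ * 2⁻¹ ^ n)) (s := 8⁻¹ * 2⁻¹ ^ n) (E := 0) (by positivity) (by positivity)
      fun z w _ _ => by
        change |f _ - f _| ≤ 0
        simp
    rw [mul_zero, mul_zero, abs_nonpos_iff, sub_eq_zero] at this
    exact this.symm

lemma exists_diagBound {α γ : ℝ} (hαγ : α ≤ γ) {q : ℕ} {φ : TestFn d} (hφ : IsMoll q φ) :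
    ∃ C : ℝ, 0 ≤ C ∧ ∀ (F : Rd d → Distr d) (x : Rd d) (R A : ℝ) (L : Set (Rd d)), 0 < R →
      0 ≤ A → CohBound α γ q L 8⁻¹ F A → (∀ w, ‖w - x‖ ≤ R + 4⁻¹ → w ∈ L) →
      DiagBound α γ φ (fun z => F z - F x) x R (C * A) := by
  obtain ⟨b, hb, hbump⟩ := hφ.exists_bump q
  have h3 : (1 : ℝ) ≤ 3 ^ (γ - α) := Real.one_le_rpow (by norm_num) (by linarith)
  refine ⟨b * 3 ^ (γ - α), by positivity, fun F x R A L hR hA h hL => ⟨by positivity, ?_, ?_⟩⟩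
  · intro w s hw hs
    have hs0 := hs.1
    have hwL : w ∈ L := hL w (by linarith [hs.2])
    have hxL : x ∈ L := hL x (by rw [sub_self, norm_zero]; positivity)
    have := (h.boundedAt hwL hxL hs).apply hs0 (hbump w s hs0)
    have e : (F w - F x) (scaled φ w s) = -(F x - F w) (scaled φ w s) := by
      change F w _ - F x _ = -(F x _ - F w _)
      ring
    rw [e, abs_neg, norm_sub_rev w x]
    refine this.trans ?_
    calc _ = b * 1 * A * (s ^ α * (‖x - w‖ + s) ^ (γ - α)) := by ring
      _ ≤ _ := by gcongr
  · intro z w s hz hw hs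
    have hs0 := hs.1
    have hwx : ‖w - x‖ ≤ R + 4⁻¹ := by
      have := norm_sub_le_norm_sub_add_norm_sub w z x
      linarith [hs.2]
    have hwL : w ∈ L := hL w hwx
    have hzL : z ∈ L := hL z (by linarith)
    have := (h.boundedAt hwL hzL hs).apply hs0 (hbump w s hs0)
    rw [sub_sub_sub_const]
    refine this.trans ?_
    have h4 : (‖z - w‖ + s) ^ (γ - α) ≤ (3 * s) ^ (γ - α) :=
      Real.rpow_le_rpow (by positivity) (by rw [norm_sub_rev]; linarith) (by linarith)
    calc _ ≤ b * (A * (s ^ α * (3 * s) ^ (γ - α))) := by gcongr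
      _ = b * 3 ^ (γ - α) * A * (s ^ α * s ^ (γ - α)) := by
          rw [Real.mul_rpow (by norm_num) hs0.le]; ring
      _ = _ := by rw [← Real.rpow_add hs0]; congr 2; ring

lemma exists_recSeq_bound {α γ : ℝ} (hαγ : α ≤ γ) (hγ : γ ≠ 0) {q : ℕ} (hq : -α < q)
    {φ : TestFn d} (hφ : IsMoll q φ) {Λ : ℝ} (hΛ : 0 < Λ) :
    ∃ C : ℝ, 0 ≤ C ∧ ∀ (F : Rd d → Distr d) (x : Rd d) (R b A : ℝ) (g : TestFn d)
      (L : Set (Rd d)), F ∈ coherentGerms d α γ → R ∈ Set.Ioc 0 Λ → BumpAt q x R b g → 0 ≤ A →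
      CohBound α γ q L 8⁻¹ F A → (∀ w, ‖w - x‖ ≤ R + 4⁻¹ → w ∈ L) →
      ∃ v, Tendsto (fun n => recSeq γ φ F n g) atTop (𝓝 v) ∧ |F x g - v| ≤ C * b * A * R ^ γ := by
  obtain ⟨C₁, hC₁, h₁⟩ := exists_diagBound hαγ hφ
  obtain ⟨C₂, hC₂, h₂⟩ : ∃ C : ℝ, 0 ≤ C ∧ ∀ (G : Rd d → Distr d) (x : Rd d) (R b A : ℝ)
      (g : TestFn d), G ∈ coherentGerms d α γ →
      R ∈ Set.Ioc 0 Λ → BumpAt q x R b g → DiagBound α γ φ G x R A →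
      ∃ v, Tendsto (fun n => recSeq γ φ G n g) atTop (𝓝 v) ∧ |v| ≤ C * b * A * R ^ γ := by
    unfold recSeq
    rcases lt_or_gt_of_ne hγ with h | h
    · obtain ⟨C, hC, H⟩ := exists_recNeg_bound hαγ h hq hφ hΛ
      simp only [h, if_true]
      exact ⟨C, hC, fun G x R b A g _ => H G x R b A g⟩
    · obtain ⟨C, hC, H⟩ := exists_recPos_bound hαγ h hq hφ hΛ
      simp only [h.not_gt, if_false]
      exact ⟨C, hC, H⟩
  refine ⟨C₂ * C₁, by positivity, fun F x R b A g L hF hR hg hA h hL => ?_⟩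
  have hG := sub_const_mem_coherentGerms hF (F x)
  obtain ⟨v, hv, hvb⟩ := h₂ _ x R b _ g hG hR hg (h₁ F x R A L hR.1 hA h hL)
  refine ⟨v + F x g, ?_, ?_⟩
  · refine (hv.add (tendsto_recSeq_const γ hφ (F x) g)).congr fun n => ?_
    have := recSeq_add_smul_germ hG (const_mem_coherentGerms α γ (F x)) φ g 1 1 n
    simp only [one_smul, one_mul, sub_add_cancel] at this
    exact this.symm
  · rw [show F x g - (v + F x g) = -v by ring, abs_neg]
    exact hvb.trans (le_of_eq (by ring))

lemma bumpAt_of_bound {q : ℕ} {x : Rd d} {R M : ℝ} (hR : 1 ≤ R) {g : Rd d → ℝ}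
    (hg : ContDiff ℝ q g) (hs : ∀ y, R < ‖y - x‖ → g y = 0)
    (hM : ∀ k : Fin d → ℕ, mlen k ≤ q → ∀ y, |partialDeriv k g y| ≤ M) :
    BumpAt q x R (R ^ (d + q) * M) g := by
  refine ⟨hg, hs, fun k hk y => (hM k hk y).trans ?_⟩
  have hM0 : 0 ≤ M := (abs_nonneg _).trans (hM 0 (by simp [mlen_zero]) 0)
  have : 1 ≤ R ^ (d + q) * R⁻¹ ^ (d + mlen k) := by
    rw [inv_pow, ← div_eq_mul_inv, one_le_div (by positivity)]
    exact pow_le_pow_right₀ hR (by omega)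
  calc M = M * 1 := (mul_one M).symm
    _ ≤ M * (R ^ (d + q) * R⁻¹ ^ (d + mlen k)) := by gcongr
    _ = _ := by ring

lemma exists_distr_recSeq {α γ : ℝ} (hαγ : α ≤ γ) (hγ : γ ≠ 0) {q : ℕ} (hq : -α < q)
    {φ : TestFn d} (hφ : IsMoll q φ) {F : Rd d → Distr d} (hF : F ∈ coherentGerms d α γ) :
    ∃ T : Distr d, ∀ g, Tendsto (fun n => recSeq γ φ F n g) atTop (𝓝 (T g)) := by
  have hloc : ∀ R : ℝ, 0 < R → ∃ B : ℝ, 0 ≤ B ∧ ∀ (g : TestFn d) (b : ℝ), BumpAt q 0 R b g →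
      ∃ v, Tendsto (fun n => recSeq γ φ F n g) atTop (𝓝 v) ∧ |F 0 g - v| ≤ B * b := by
    intro R hR
    obtain ⟨C, hC, h⟩ := exists_recSeq_bound hαγ hγ hq hφ hR
    obtain ⟨A, hA, hcoh⟩ := hF.2.exists_cohBound hαγ hq
      (isCompact_closedBall (0 : Rd d) (R + 4⁻¹)) 8⁻¹
    refine ⟨C * A * R ^ γ, by positivity, fun g b hg => ?_⟩
    obtain ⟨v, hv, hvb⟩ := h F 0 R b A g _ hF ⟨hR, le_rfl⟩ hg hA hcoh fun w hw => by
      rwa [Metric.mem_closedBall, dist_eq_norm]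
    exact ⟨v, hv, hvb.trans (le_of_eq (by ring))⟩
  have hlim : ∀ g : TestFn d, ∃ v, Tendsto (fun n => recSeq γ φ F n g) atTop (𝓝 v) := by
    intro g
    obtain ⟨R, hR, hg⟩ := exists_testFn_supp g 0
    obtain ⟨b, hb, hbump⟩ := exists_bumpAt g q 0 hR hg
    obtain ⟨B, hB, h⟩ := hloc R hR
    obtain ⟨v, hv, -⟩ := h g b hbump
    exact ⟨v, hv⟩
  choose f hf using hlim
  have hlin : ∀ (g g' : TestFn d) (c c' : ℝ), f (c • g + c' • g') = c * f g + c' * f g' := by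
    intro g g' c c'
    refine tendsto_nhds_unique (hf _) ((((hf g).const_mul c).add ((hf g').const_mul c')).congr
      fun n => ?_)
    exact (recSeq_add_smul_test hF φ g g' c c' n).symm
  let f' : TestFn d →ₗ[ℝ] ℝ :=
    { toFun := f
      map_add' := fun g g' => by simpa using hlin g g' 1 1
      map_smul' := fun c g => by simpa using hlin g 0 c 0 }
  have hT : ∃ T : Distr d, ∀ g, T g = f' g := by
    refine exists_distr_of_bound f' fun R => ?_
    obtain ⟨s, C, hC, ho⟩ := exists_order (F 0) R
    set R' := max R 1 with hR'
    obtain ⟨B, hB, h⟩ := hloc R' (by positivity)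
    refine ⟨max s q, C + B * R' ^ (d + q), fun ψ hψ M hM => ?_⟩
    have hb := bumpAt_of_bound (q := q) (x := 0) (le_max_right R 1) (contDiff_testFn ψ q)
      (fun y hy => hψ y (by rw [sub_zero] at hy; exact (le_max_left _ _).trans_lt hy))
      fun k hk => hM k (hk.trans (le_max_right _ _))
    obtain ⟨v, hv, hvb⟩ := h ψ _ hb
    have e : f' ψ = v := tendsto_nhds_unique (hf ψ) hv
    rw [e]
    have h1 := ho ψ hψ M fun k hk => hM k (hk.trans (le_max_left _ _))
    have h2 := abs_sub_abs_le_abs_sub v (F 0 ψ)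
    rw [abs_sub_comm] at h2
    linarith
  obtain ⟨T, hT⟩ := hT
  exact ⟨T, fun g => by rw [hT]; exact hf g⟩

open Classical in
/-- A reconstruction operator. -/
def reconstruct (γ : ℝ) (φ : TestFn d) (F : Rd d → Distr d) : Distr d :=
  if h : ∃ T : Distr d, ∀ g, Tendsto (fun n => recSeq γ φ F n g) atTop (𝓝 (T g)) then h.choose
  else 0

lemma tendsto_reconstruct {α γ : ℝ} (hαγ : α ≤ γ) (hγ : γ ≠ 0) {q : ℕ} (hq : -α < q)
    {φ : TestFn d} (hφ : IsMoll q φ) {F : Rd d → Distr d} (hF : F ∈ coherentGerms d α γ)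
    (g : TestFn d) :
    Tendsto (fun n => recSeq γ φ F n g) atTop (𝓝 (reconstruct γ φ F g)) := by
  have h := exists_distr_recSeq hαγ hγ hq hφ hF
  rw [reconstruct, dif_pos h]
  exact h.choose_spec g

lemma reconstruct_add_smul {α γ : ℝ} (hαγ : α ≤ γ) (hγ : γ ≠ 0) {q : ℕ} (hq : -α < q)
    {φ : TestFn d} (hφ : IsMoll q φ) {F G : Rd d → Distr d} (hF : F ∈ coherentGerms d α γ)
    (hG : G ∈ coherentGerms d α γ) (a b : ℝ) :
    reconstruct γ φ (fun x => a • F x + b • G x) =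
      a • reconstruct γ φ F + b • reconstruct γ φ G := by
  ext g
  refine tendsto_nhds_unique
    (tendsto_reconstruct hαγ hγ hq hφ (add_smul_mem_coherentGerms hαγ hF hG a b) g) ?_
  refine (((tendsto_reconstruct hαγ hγ hq hφ hF g).const_mul a).add
    ((tendsto_reconstruct hαγ hγ hq hφ hG g).const_mul b)).congr fun n => ?_
  exact (recSeq_add_smul_germ hF hG φ g a b n).symm

lemma exists_homBound_reconstruct {α γ : ℝ} (hαγ : α ≤ γ) (hγ : γ ≠ 0) {q : ℕ} (hq : -α < q)
    {φ : TestFn d} (hφ : IsMoll q φ) {Λ Λ₀ : ℝ} (hΛ : 0 < Λ) (hΛ₀ : 0 < Λ₀) (s : ℕ) :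
    ∃ C : ℝ, 0 ≤ C ∧ ∀ (F : Rd d → Distr d) (L : Set (Rd d)) (A : ℝ), F ∈ coherentGerms d α γ →
      0 ≤ A → CohBound α γ s (Metric.cthickening (1 + Λ) L) Λ₀ F A →
      HomBound γ q L Λ (fun x => F x - reconstruct γ φ F) (C * A) := by
  obtain ⟨C₁, hC₁, h₁⟩ := exists_cohBound (d := d) hαγ hq s (Λ := Λ₀) (Λ₁ := 8⁻¹) (δ := 2⁻¹)
    hΛ₀ (by norm_num) (by norm_num)
  obtain ⟨C₂, hC₂, h₂⟩ := exists_recSeq_bound hαγ hγ hq hφ hΛ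
  refine ⟨C₂ * C₁, by positivity, fun F L A hF hA h x hx t ht ψ hψ => ?_⟩
  have hcoh := h₁ (Metric.cthickening (Λ + 4⁻¹) L) F A hA (h.mono le_rfl
    ((Metric.cthickening_cthickening_subset (by norm_num) (by positivity) L).trans
      (Metric.cthickening_mono (by linarith) L)) le_rfl le_rfl)
  obtain ⟨v, hv, hvb⟩ := h₂ F x t 1 (C₁ * A) (scaled ψ x t) _ hF ht (bumpAt_scaled hψ x ht.1)
    (by positivity) hcoh fun w hw => mem_cthickening_of_norm hx (by linarith [ht.2])
  have e : reconstruct γ φ F (scaled ψ x t) = v :=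
    tendsto_nhds_unique (tendsto_reconstruct hαγ hγ hq hφ hF _) hv
  change |F x _ - reconstruct γ φ F _| ≤ _
  rw [e]
  exact hvb.trans (le_of_eq (by ring))

lemma isReconstruction_reconstruct {α γ : ℝ} (hαγ : α ≤ γ) (hγ : γ ≠ 0) {q : ℕ} (hq : -α < q)
    (hq' : ∀ r : ℕ, -α < r → q ≤ r)
    {φ : TestFn d} (hφ : IsMoll q φ) {F : Rd d → Distr d} (hF : F ∈ coherentGerms d α γ) :
    IsReconstruction α γ F (reconstruct γ φ F) := by
  intro r hr L hL
  obtain ⟨C, hC, h⟩ := exists_homBound_reconstruct hαγ hγ hq hφ (Λ := 1) (Λ₀ := 1) one_pos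
    one_pos q
  obtain ⟨A, hA, hcoh⟩ := hF.2.exists_cohBound hαγ hq (hL.cthickening (r := 1 + 1)) 1
  exact ⟨C * A, (h F L A hF hA hcoh).mono (hq' r hr) subset_rfl le_rfl le_rfl⟩

lemma reconstruction_unique {α γ : ℝ} (hγ : 0 < γ) {F : Rd d → Distr d} {f f' : Distr d}
    (hf : IsReconstruction α γ F f) (hf' : IsReconstruction α γ F f') : f = f' := by
  obtain ⟨q, hq⟩ := exists_nat_gt (-α)
  have hφ := isMoll_moll d q
  obtain ⟨b, hb, hbump⟩ := hφ.exists_bump q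
  ext g
  rw [← sub_eq_zero]
  obtain ⟨C, hC⟩ := hf q hq _ g.hasCompactSupport.isCompact
  obtain ⟨C', hC'⟩ := hf' q hq _ g.hasCompactSupport.isCompact
  set B := b * (|C| + |C'|) with hB
  have key : ∀ δ ∈ Set.Ioc (0 : ℝ) 1, |(f - f') g| ≤ B * δ ^ γ * ∫ w, |g w| := by
    intro δ hδ
    refine abs_distr_le_integral hφ (f - f') g hδ.1 fun w hw s hs => ?_
    have hs1 : s ∈ Set.Ioc (0 : ℝ) 1 := ⟨hs.1, hs.2.trans hδ.2⟩
    have hs0 := hs.1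
    have h1 : BoundedAt (F w - f) q w s (C * s ^ γ) := fun ψ hψ => hC w hw s hs1 ψ hψ
    have h2 : BoundedAt (F w - f') q w s (C' * s ^ γ) := fun ψ hψ => hC' w hw s hs1 ψ hψ
    have h3 := h1.apply hs.1 (hbump w s hs.1)
    have h4 := h2.apply hs.1 (hbump w s hs.1)
    have e : (f - f') (scaled (moll d q) w s) =
        (F w - f') (scaled (moll d q) w s) - (F w - f) (scaled (moll d q) w s) := by
      change f _ - f' _ = (F w _ - f' _) - (F w _ - f _)
      ring
    have h5 : s ^ γ ≤ δ ^ γ := Real.rpow_le_rpow hs0.le hs.2 hγ.le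
    rw [e]
    refine (abs_sub _ _).trans ((add_le_add h4 h3).trans ?_)
    calc _ ≤ b * (|C'| * s ^ γ) + b * (|C| * s ^ γ) := by gcongr <;> exact le_abs_self _
      _ = B * s ^ γ := by rw [hB]; ring
      _ ≤ _ := by gcongr
  have hlim : Tendsto (fun n : ℕ => B * (1 * (2⁻¹ : ℝ) ^ n) ^ γ * ∫ w, |g w|) atTop (𝓝 0) := by
    have := ((tendsto_dyadic 1).rpow_const (p := γ) (Or.inr hγ.le)).const_mul B
    rw [Real.zero_rpow hγ.ne', mul_zero] at this
    simpa using this.mul_const (∫ w, |g w|)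
  have : |(f - f') g| ≤ 0 := ge_of_tendsto hlim (Eventually.of_forall fun n =>
    key _ ⟨by positivity, by rw [one_mul]; exact pow_le_one₀ (by norm_num) (by norm_num)⟩)
  exact abs_nonpos_iff.1 this

lemma hasReconstructionBounds_of_eq {α γ : ℝ} (hαγ : α ≤ γ) (hγ : γ ≠ 0)
    {P : Set ((Rd d → Distr d) × Distr d)} {φ : TestFn d}
    (hφ : IsMoll (canonicalOrder γ α) φ)
    (hP : ∀ p ∈ P, p.1 ∈ coherentGerms d α γ ∧ p.2 = reconstruct γ φ p.1) :
    HasReconstructionBounds α γ P := by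
  intro L hL Λ hΛ s hs
  have hq := neg_lt_canonicalOrder_right γ α
  obtain ⟨C, hC, h⟩ := exists_homBound_reconstruct hαγ hγ hq hφ hΛ hΛ s
  obtain ⟨C', hC', h'⟩ := exists_cohBound (d := d) hαγ hq s (Λ := Λ) (Λ₁ := Λ) (δ := 1 + Λ) hΛ hΛ
    (by linarith)
  refine ⟨Real.toNNReal (C + C' + 1), fun p hp => ?_⟩
  obtain ⟨h1, h2⟩ := hP p hp
  refine ennreal_le_mul_of_forall (by positivity) fun A hA hY => ?_
  have hcoh := cohBound_of_cohSeminorm_le hA hY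
  rw [add_mul, h2]
  exact jointSeminorm_le (by positivity) (by positivity) (h p.1 L A h1 hA hcoh)
    ((CohBound.sub_const_iff _).2 (h' L p.1 A hA hcoh))

/-- The reconstruction operator of the canonical order. -/
def canonicalReconstruct (α γ : ℝ) (F : Rd d → Distr d) : Distr d :=
  reconstruct γ (moll d (canonicalOrder γ α)) F

lemma canonicalReconstruct_mem {α γ : ℝ} (hαγ : α ≤ γ) (hγ : γ ≠ 0) {F : Rd d → Distr d}
    (hF : F ∈ coherentGerms d α γ) :
    (F, canonicalReconstruct α γ F) ∈ reconstructedGerms d α γ :=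
  ⟨hF, isReconstruction_reconstruct hαγ hγ (neg_lt_canonicalOrder_right γ α)
    (fun r hr => canonicalOrder_le (by linarith) hr) (isMoll_moll _ _) hF⟩

lemma hasReconstructionBounds_of_pos {α γ : ℝ} (hαγ : α ≤ γ) (hγ : 0 < γ)
    {P : Set ((Rd d → Distr d) × Distr d)} (hP : P ⊆ reconstructedGerms d α γ) :
    HasReconstructionBounds α γ P :=
  hasReconstructionBounds_of_eq hαγ hγ.ne' (isMoll_moll _ _) fun p hp =>
    ⟨(hP hp).1, reconstruction_unique hγ (hP hp).2
      (canonicalReconstruct_mem hαγ hγ.ne' (hP hp).1).2⟩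

/-- Existence of a linear reconstruction operator with bounds. -/
lemma exists_reconstruction {α γ : ℝ} (hαγ : α ≤ γ) (hγ : γ ≠ 0) :
    ∃ S : (Rd d → Distr d) → Distr d,
      (∀ F ∈ coherentGerms d α γ, (F, S F) ∈ reconstructedGerms d α γ) ∧
      (∀ F ∈ coherentGerms d α γ, ∀ G ∈ coherentGerms d α γ, ∀ a b : ℝ,
        S (fun x => a • F x + b • G x) = a • S F + b • S G) ∧
      HasReconstructionBounds α γ {p | p.1 ∈ coherentGerms d α γ ∧ p.2 = S p.1} :=
  ⟨canonicalReconstruct α γ, fun _ hF => canonicalReconstruct_mem hαγ hγ hF,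
    fun _ hF _ hG a b => reconstruct_add_smul hαγ hγ (neg_lt_canonicalOrder_right γ α)
      (isMoll_moll _ _) hF hG a b,
    hasReconstructionBounds_of_eq hαγ hγ (isMoll_moll _ _) fun _ hp => hp⟩

/-! ### Mixed derivatives of kernels -/

lemma hasFDerivAt_of_continuous_family {g : ℝ → Rd d → ℝ} {g' : ℝ → Rd d → Fin d → ℝ}
    (hg : Continuous fun p : ℝ × Rd d => g p.1 p.2)
    (hg' : ∀ i, Continuous fun p : ℝ × Rd d => g' p.1 p.2 i)
    (h : ∀ s, 0 < s → ∀ y, HasFDerivAt (g s) (gradForm (g' s y)) y) (y : Rd d) :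
    HasFDerivAt (g 0) (gradForm (g' 0 y)) y := by
  let F' : C(ℝ × Rd d, Rd d →L[ℝ] ℝ) := ⟨fun p => gradForm (g' p.1 p.2), continuous_gradForm hg'⟩
  have hpos : Tendsto (fun n : ℕ => (1 : ℝ) * 2⁻¹ ^ n) atTop (𝓝 0) := tendsto_dyadic 1
  have h1 : TendstoLocallyUniformly (fun (n : ℕ) y => gradForm (g' (1 * 2⁻¹ ^ n) y))
      (fun y => gradForm (g' 0 y)) atTop :=
    ContinuousMap.tendsto_iff_tendstoLocallyUniformly.1
      ((F'.curry.continuous.tendsto 0).comp hpos)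
  refine hasFDerivAt_of_tendstoLocallyUniformlyOn isOpen_univ
    (tendstoLocallyUniformlyOn_univ.2 h1)
    (fun n y _ => h _ (by positivity) y) (fun y _ => ?_) (Set.mem_univ y)
  exact ((hg.comp (Continuous.prodMk_left y)).tendsto 0).comp hpos

lemma IsDerivFamily.sum {ι : Type*} {r : ℕ} (s : Finset ι) {g : ι → (Fin d → ℕ) → Rd d → ℝ}
    (h : ∀ i ∈ s, IsDerivFamily r (g i)) : IsDerivFamily r fun l y => ∑ i ∈ s, g i l y := by
  classical
  induction s using Finset.induction_on with
  | empty =>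
    refine ⟨fun _ _ => by simpa using continuous_const, fun _ _ x => ?_⟩
    simp only [Finset.sum_empty]
    refine (hasFDerivAt_const (0 : ℝ) x).congr_fderiv ?_
    ext v
    simp [gradForm_apply]
  | insert i s hi ih =>
    simp only [Finset.sum_insert hi]
    exact (h i (Finset.mem_insert_self i s)).add
      (ih fun j hj => h j (Finset.mem_insert_of_mem hj))

/-- The mixed derivative `∂_1^k ∂_2^l G (x, y)`. -/
def mixedDeriv (G : Rd d → Rd d → ℝ) (k l : Fin d → ℕ) (x y : Rd d) : ℝ :=
  partialDeriv k (fun x' => partialDeriv l (G x') y) x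

lemma mixedDeriv_zero_left (G : Rd d → Rd d → ℝ) (l : Fin d → ℕ) (x y : Rd d) :
    mixedDeriv G 0 l x y = partialDeriv l (G x) y := by
  unfold mixedDeriv
  rw [partialDeriv_zero]

/-- Integration of a function against a kernel in the first variable. -/
def adj (G : Rd d → Rd d → ℝ) (u : Rd d → ℝ) (y : Rd d) : ℝ := ∫ x, u x * G x y

lemma IsCmr.continuous_partialDeriv_snd {m r : ℕ} {G : Rd d → Rd d → ℝ} (hG : IsCmr m r G)
    {l : Fin d → ℕ} (hl : mlen l ≤ r) :
    Continuous fun p : Rd d × Rd d => partialDeriv l (G p.1) p.2 := by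
  simpa only [partialDeriv_zero] using hG.2.2 0 l (by simp [mlen_zero]) hl

lemma IsCmr.isDerivFamily_adj {m r : ℕ} {G : Rd d → Rd d → ℝ} (hG : IsCmr m r G) {u : Rd d → ℝ}
    (hu : Continuous u) (hs : HasCompactSupport u) :
    IsDerivFamily r fun l y => ∫ x, u x * partialDeriv l (G x) y :=
  isDerivFamily_integral (G := fun l x y => partialDeriv l (G x) y) hu hs
    (fun _ hl => hG.continuous_partialDeriv_snd hl)
    fun l hl x y => (isDerivFamily_partialDeriv (hG.1 x)).deriv l hl y

lemma IsCmr.isDerivFamily_adj' {m r : ℕ} {G : Rd d → Rd d → ℝ} (hG : IsCmr m r G) {u : Rd d → ℝ}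
    (hu : Continuous u) (hs : HasCompactSupport u) :
    ContDiff ℝ r (adj G u) ∧ ∀ l : Fin d → ℕ, mlen l ≤ r →
      partialDeriv l (adj G u) = fun y => ∫ x, u x * partialDeriv l (G x) y := by
  have h := hG.isDerivFamily_adj hu hs
  have e : adj G u = fun y => ∫ x, u x * partialDeriv 0 (G x) y := by
    funext y
    simp only [partialDeriv_zero]
    rfl
  rw [e]
  exact ⟨h.contDiff_zero', fun l hl => h.partialDeriv_zero_eq hl⟩

lemma IsCmr.isDerivFamily_mixedDeriv {m r : ℕ} {G : Rd d → Rd d → ℝ} (hG : IsCmr m r G)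
    {k : Fin d → ℕ} (hk : mlen k ≤ m) (x : Rd d) :
    IsDerivFamily r fun l y => mixedDeriv G k l x y := by
  have hcont : ∀ l, mlen l ≤ r → Continuous fun p : Rd d × Rd d => mixedDeriv G k l p.1 p.2 :=
    fun l hl => hG.2.2 k l hk hl
  refine ⟨fun l hl => (hcont l hl).comp (Continuous.prodMk_right x), fun l hl y => ?_⟩
  set φ : TestFn d := moll d 1 with hφdef
  have hφ : IsMoll 1 φ := isMoll_moll d 1
  set Φ : (Fin d → ℕ) → ℝ → Rd d → ℝ := fun l s y => ∫ z, φ z * mixedDeriv G k l (x + s • z) y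
    with hΦ
  have hΦc : ∀ l, mlen l ≤ r → Continuous fun p : ℝ × Rd d => Φ l p.1 p.2 := by
    intro l hl
    have h1 : Continuous (Function.uncurry fun (p : ℝ × Rd d) (z : Rd d) =>
        φ z * mixedDeriv G k l (x + p.1 • z) p.2) := by
      have h2 : Continuous fun q : (ℝ × Rd d) × Rd d => (x + q.1.1 • q.2, q.1.2) := by fun_prop
      exact (φ.continuous.comp continuous_snd).mul ((hcont l hl).comp h2)
    have h2 := continuous_parametric_integral_of_continuous (μ := volume) h1
      (isCompact_closedBall (0 : Rd d) 1)
    refine h2.congr fun p => ?_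
    refine setIntegral_eq_integral_of_forall_compl_eq_zero fun z hz => ?_
    rw [hφ.supp z (by simpa using hz), zero_mul]
  have hzero : ∀ l y, Φ l 0 y = mixedDeriv G k l x y := by
    intro l y
    simp only [hΦ, zero_smul, add_zero]
    rw [integral_mul_const, hφ.integral_eq, one_mul]
  have key : ∀ s, 0 < s → ∀ l, mlen l ≤ r → ∀ y, Φ l s y =
      (-1) ^ mlen k * ∫ x', partialDeriv k (scaled φ x s) x' * partialDeriv l (G x') y := by
    intro s hs l hl y
    simp only [hΦ]
    rw [← integral_scaled_mul φ x hs fun x' => mixedDeriv G k l x' y]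
    have := integral_mul_partialDeriv (k := k) (contDiff_testFn (scaled φ x s) _)
      (scaled φ x s).hasCompactSupport ((hG.2.1 l hl y).of_le (by exact_mod_cast hk))
    exact this
  have hfam : ∀ s, 0 < s → ∀ y, HasFDerivAt (Φ l s) (gradForm fun i => Φ (l + unitIdx i) s y) y := by
    intro s hs y
    have h1 := ((hG.isDerivFamily_adj (derivTest k (scaled φ x s)).continuous
      (derivTest k (scaled φ x s)).hasCompactSupport).const_mul ((-1) ^ mlen k)).deriv l hl y
    rw [funext (key s hs l hl.le)]
    refine h1.congr_fderiv ?_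
    congr 1
    funext i
    exact (key s hs _ (by rw [mlen_add_unitIdx]; omega) y).symm
  have h1 := hasFDerivAt_of_continuous_family (g := Φ l) (g' := fun s y i => Φ (l + unitIdx i) s y)
    (hΦc l hl.le) (fun i => hΦc _ (by rw [mlen_add_unitIdx]; omega)) hfam y
  simp only [hzero] at h1
  rwa [funext (hzero l)] at h1

/-! ### Regularising kernels applied to test functions -/

lemma two_rpow_eq (β : ℝ) (n : ℕ) : (2 : ℝ) ^ (-β * n) = ((2⁻¹ : ℝ) ^ n) ^ β := by
  rw [← Real.rpow_natCast, ← Real.rpow_mul (by norm_num), Real.inv_rpow (by norm_num),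
    ← Real.rpow_neg (by norm_num)]
  congr 1
  ring

lemma two_rpow_eq' (β : ℝ) (k l n : ℕ) : (2 : ℝ) ^ (((d : ℝ) - β + l + k) * n) =
    ((2⁻¹ : ℝ) ^ n) ^ β * ((2⁻¹ : ℝ) ^ n)⁻¹ ^ (d + l + k) := by
  rw [show ((d : ℝ) - β + l + k) * n = -β * n + ((n * (d + l + k) : ℕ) : ℝ) by push_cast; ring,
    Real.rpow_add (by norm_num), two_rpow_eq, Real.rpow_natCast, inv_pow, inv_inv, pow_mul]

section Kernel

variable {β ρ : ℝ} {m r : ℕ} {K : Rd d → Rd d → ℝ} {Kn : ℕ → Rd d → Rd d → ℝ}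

lemma IsRegularisingKernel.eq_zero (hK : IsRegularisingKernel β m r ρ K Kn) {n : ℕ} {x y : Rd d}
    (h : ρ * 2⁻¹ ^ n < ‖x - y‖) : Kn n x y = 0 := by
  by_contra hne
  exact absurd (hK.support n x y hne) (not_le.2 h)

lemma IsRegularisingKernel.partialDeriv_eq_zero (hK : IsRegularisingKernel β m r ρ K Kn) {n : ℕ}
    {x y : Rd d} (h : ρ * 2⁻¹ ^ n < ‖x - y‖) (l : Fin d → ℕ) : partialDeriv l (Kn n x) y = 0 :=
  partialDeriv_vanish (x := x) (R := ρ * 2⁻¹ ^ n)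
    (fun y hy => hK.eq_zero (by rwa [norm_sub_rev])) l y (by rwa [norm_sub_rev])

lemma IsRegularisingKernel.mixedDeriv_eq_zero (hK : IsRegularisingKernel β m r ρ K Kn) {n : ℕ}
    {x y : Rd d} (h : ρ * 2⁻¹ ^ n < ‖x - y‖) (k l : Fin d → ℕ) : mixedDeriv (Kn n) k l x y = 0 :=
  partialDeriv_vanish (x := y) (R := ρ * 2⁻¹ ^ n)
    (fun x hx => hK.partialDeriv_eq_zero hx l) k x h

lemma IsRegularisingKernel.exists_bounds (hK : IsRegularisingKernel β m r ρ K Kn)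
    {L : Set (Rd d)} (hL : IsCompact L) : ∃ c : ℝ, 0 < c ∧
    (∀ (n : ℕ) (k l : Fin d → ℕ), mlen k ≤ m → mlen l ≤ r → ∀ x ∈ L, ∀ y ∈ L,
      |mixedDeriv (Kn n) k l x y|
        ≤ c * (((2⁻¹ : ℝ) ^ n) ^ β * ((2⁻¹ : ℝ) ^ n)⁻¹ ^ (d + mlen l + mlen k))) ∧
    (∀ (n : ℕ) (k l : Fin d → ℕ), mlen k ≤ r → mlen l ≤ r → ∀ y ∈ L,
      |∫ x, mpow (y - x) l * partialDeriv k (Kn n x) y| ≤ c * ((2⁻¹ : ℝ) ^ n) ^ β) := by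
  obtain ⟨c, hc, h1, h2⟩ := hK.bounds L hL
  refine ⟨c, hc, fun n k l hk hl x hx y hy => ?_, fun n k l hk hl y hy => ?_⟩
  · rw [← two_rpow_eq']
    exact h1 n k l hk hl x hx y hy
  · rw [← two_rpow_eq]
    exact h2 n k l hk hl y hy

lemma mpow_neg (v : Rd d) (k : Fin d → ℕ) : mpow (-v) k = (-1) ^ mlen k * mpow v k := by
  rw [← neg_one_smul ℝ v, mpow_smul]

/-- At small scales a regularising kernel maps test functions at a point to test functions at the
same scale, with a gain. -/
lemma IsRegularisingKernel.exists_bumpAt_fine (hK : IsRegularisingKernel β m r ρ K Kn)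
    {L : Set (Rd d)} (hL : IsCompact L) {q : ℕ} (hq : q ≤ r) (Λ : ℝ) :
    ∃ C : ℝ, 0 ≤ C ∧ ∀ x ∈ L, ∀ t ∈ Set.Ioc 0 Λ, ∀ (n : ℕ) (b : ℝ) (ψ : Rd d → ℝ),
      ρ * 2⁻¹ ^ n ≤ t → BumpAt q x t b ψ →
      BumpAt q x (2 * t) (C * b * ((2⁻¹ : ℝ) ^ n) ^ β) (adj (Kn n) ψ) := by
  obtain ⟨c, hc, hc1, hc2⟩ := hK.exists_bounds (hL.cthickening (r := 3 * Λ))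
  set v := volume.real (Metric.ball (0 : Rd d) 1) with hv
  have hv0 : 0 ≤ v := measureReal_nonneg
  have hρ := hK.rho_pos
  set N : ℝ := ∑ _k ∈ multiIndicesLE d r, (1 : ℝ) with hN
  have hN0 : 0 ≤ N := Finset.sum_nonneg fun _ _ => zero_le_one
  set Q : ℝ := 2 ^ (d + r) * (1 + |Λ|) ^ r with hQ
  set E : ℝ := 2 ^ (d + r) * ((1 + d) ^ r * (1 + ρ) ^ (r + d) * v) with hE
  refine ⟨c * (N * Q + E), by positivity, fun x hx t ht n b ψ hn hψ => ?_⟩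
  set δ : ℝ := (2⁻¹ : ℝ) ^ n with hδ
  have hδ0 : 0 < δ := by positivity
  have ht0 : 0 < t := ht.1
  have hb : 0 ≤ b := hψ.nonneg ht0
  have hψc := hψ.contDiff.continuous
  have hψs := hψ.hasCompactSupport
  obtain ⟨hA, hAd⟩ := (hK.isCmr n).isDerivFamily_adj' hψc hψs
  have hsupp : ∀ y, 2 * t < ‖y - x‖ → adj (Kn n) ψ y = 0 := by
    intro y hy
    refine integral_eq_zero_of_ae (Eventually.of_forall fun x' => ?_)
    by_cases h1 : t < ‖x' - x‖
    · simp [hψ.supp x' h1]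
    · have h2 : ρ * 2⁻¹ ^ n < ‖x' - y‖ := by
        change ρ * δ < _
        have := norm_sub_le_norm_sub_add_norm_sub y x' x
        rw [norm_sub_rev y x'] at this
        linarith
      simp [hK.eq_zero h2]
  refine ⟨hA.of_le (by exact_mod_cast hq), hsupp, fun l hl y => ?_⟩
  have hlr := hl.trans hq
  by_cases hy : 2 * t < ‖y - x‖
  · rw [partialDeriv_vanish hsupp l y hy, abs_zero]
    positivity
  rw [not_lt] at hy
  rw [hAd l hlr]
  set κ : Rd d → ℝ := fun x' => partialDeriv l (Kn n x') y with hκ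
  have hκc : Continuous κ := (hK.isCmr n).continuous_partialDeriv_snd hlr |>.comp
    (Continuous.prodMk_left y)
  have hκ0 : ∀ x', ρ * δ < ‖x' - y‖ → κ x' = 0 := fun x' h => hK.partialDeriv_eq_zero h l
  have hκs : HasCompactSupport κ := HasCompactSupport.of_support_subset_isCompact
    (isCompact_closedBall y (ρ * δ)) fun x' hx' => by
      rw [Metric.mem_closedBall, dist_eq_norm]
      exact not_lt.1 fun h => hx' (hκ0 x' h)
  have hyL : y ∈ Metric.cthickening (3 * Λ) L := mem_cthickening_of_norm hx (by linarith [ht.2])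
  have hball : ∀ x', ‖x' - y‖ ≤ ρ * δ → x' ∈ Metric.cthickening (3 * Λ) L := fun x' h =>
    mem_cthickening_of_norm hx (by
      have := norm_sub_le_norm_sub_add_norm_sub x' y x
      linarith [ht.2])
  set j := mlen l with hj
  set P : Rd d → ℝ := fun x' => ∑ k ∈ multiIndicesLT d (j : ℝ),
    partialDeriv k ψ y * (mpow (x' - y) k / mfact k) with hP
  have hPc : Continuous P := continuous_finsetSum _ fun k _ => continuous_const.mul
    (((continuous_mpow k).comp (continuous_id.sub continuous_const)).div_const _)
  have hint : ∀ u : Rd d → ℝ, Continuous u → Integrable fun x' => u x' * κ x' := fun u hu => by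
    simpa only [mul_comm] using integrable_mul_of_continuous hκc hκs hu
  have hsplit : ∫ x', ψ x' * κ x' = (∫ x', (ψ x' - P x') * κ x') + ∫ x', P x' * κ x' := by
    rw [← integral_add (hint (fun x' => ψ x' - P x') (hψc.sub hPc)) (hint _ hPc)]
    refine integral_congr_ae (Eventually.of_forall fun x' => ?_)
    simp only
    ring
  have hinv : t⁻¹ = 2 * (2 * t)⁻¹ := by field_simp
  have ht1 : ∀ e : ℕ, d + e ≤ d + r → t⁻¹ ^ (d + e) ≤ 2 ^ (d + r) * (2 * t)⁻¹ ^ (d + e) := by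
    intro e he
    rw [hinv, mul_pow]
    gcongr
    norm_num
  -- the polynomial part
  have h1 : |∫ x', P x' * κ x'| ≤ c * (N * Q) * (b * δ ^ β * (2 * t)⁻¹ ^ (d + j)) := by
    have e1 : ∫ x', P x' * κ x' = ∑ k ∈ multiIndicesLT d (j : ℝ),
        partialDeriv k ψ y / mfact k * ((-1) ^ mlen k * ∫ x', mpow (y - x') k * κ x') := by
      simp only [hP, Finset.sum_mul]
      rw [integral_finsetSum]
      · refine Finset.sum_congr rfl fun k _ => ?_
        rw [← integral_const_mul, ← integral_const_mul]
        refine integral_congr_ae (Eventually.of_forall fun x' => ?_)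
        simp only
        rw [← neg_sub x' y, mpow_neg]
        have : ((-1 : ℝ) ^ mlen k) * (-1) ^ mlen k = 1 := by rw [← mul_pow]; norm_num
        linear_combination -(partialDeriv k ψ y / mfact k) * (mpow (x' - y) k * κ x') * this
      · intro k _
        exact hint _ (continuous_const.mul
          (((continuous_mpow k).comp (continuous_id.sub continuous_const)).div_const _))
    rw [e1]
    have hterm : ∀ k ∈ multiIndicesLT d (j : ℝ),
        |partialDeriv k ψ y / mfact k * ((-1) ^ mlen k * ∫ x', mpow (y - x') k * κ x')| ≤
          c * Q * (b * δ ^ β * (2 * t)⁻¹ ^ (d + j)) := by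
      intro k hk
      have hkj : mlen k < j := by exact_mod_cast mem_multiIndicesLT.1 hk
      have h2 := hc2 n l k hlr (by omega) y hyL
      have h3 := hψ.bound k (by omega) y
      rw [abs_mul, abs_mul, abs_pow, abs_neg, abs_one, one_pow, one_mul, abs_div,
        abs_of_pos (mfact_pos k)]
      have h4 : |partialDeriv k ψ y| / mfact k ≤ b * t⁻¹ ^ (d + mlen k) :=
        (div_le_self (abs_nonneg _) (one_le_mfact k)).trans h3
      have h5 : t⁻¹ ^ (d + mlen k) ≤ Q * (2 * t)⁻¹ ^ (d + j) := by
        have e2 : t⁻¹ ^ (d + mlen k) = t ^ (j - mlen k) * t⁻¹ ^ (d + j) := by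
          rw [show d + j = (j - mlen k) + (d + mlen k) by omega, pow_add t⁻¹ (j - mlen k),
            ← mul_assoc, ← mul_pow, mul_inv_cancel₀ ht0.ne', one_pow, one_mul]
        have e3 : t ^ (j - mlen k) ≤ (1 + |Λ|) ^ r :=
          (pow_le_pow_left₀ ht0.le (by linarith [ht.2, le_abs_self Λ]) _).trans
            (pow_le_pow_right₀ (by linarith [abs_nonneg Λ]) (by omega))
        rw [e2, hQ]
        calc _ ≤ (1 + |Λ|) ^ r * (2 ^ (d + r) * (2 * t)⁻¹ ^ (d + j)) := by
              gcongr
              exact ht1 j (by omega)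
          _ = _ := by ring
      calc _ ≤ b * (Q * (2 * t)⁻¹ ^ (d + j)) * (c * δ ^ β) := by
            gcongr
            exact h4.trans (by gcongr)
        _ = _ := by ring
    refine (Finset.abs_sum_le_sum_abs _ _).trans ((Finset.sum_le_sum hterm).trans ?_)
    rw [Finset.sum_const, nsmul_eq_mul]
    have hcard : ((multiIndicesLT d (j : ℝ)).card : ℝ) ≤ N := by
      rw [hN, Finset.sum_const, nsmul_eq_mul, mul_one, Nat.cast_le]
      refine Finset.card_le_card fun k hk => mem_multiIndicesLE.2 ?_
      have : mlen k < j := by exact_mod_cast mem_multiIndicesLT.1 hk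
      omega
    calc _ ≤ N * (c * Q * (b * δ ^ β * (2 * t)⁻¹ ^ (d + j))) := by gcongr
      _ = _ := by ring
  -- the remainder
  have h2 : |∫ x', (ψ x' - P x') * κ x'| ≤ c * E * (b * δ ^ β * (2 * t)⁻¹ ^ (d + j)) := by
    have hM : ∀ x', ‖x' - y‖ ≤ ρ * δ → |(ψ x' - P x') * κ x'| ≤
        (d ^ j * (b * t⁻¹ ^ (d + j)) * (ρ * δ) ^ j) * (c * (δ ^ β * δ⁻¹ ^ (d + j))) := by
      intro x' hx'
      rw [abs_mul]
      have e1 := taylor_bound (j := j) (hψ.contDiff.of_le (by exact_mod_cast hl)) y (x' - y)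
        (M := b * t⁻¹ ^ (d + j)) fun k hk τ _ => by
          have := hψ.bound k (hk.le.trans hl) (y + τ • (x' - y))
          rwa [hk] at this
      rw [add_sub_cancel, abs_of_nonneg (show 0 ≤ b * t⁻¹ ^ (d + j) by positivity)] at e1
      have e2 := hc1 n 0 l (by simp [mlen_zero]) hlr x' (hball x' hx') y hyL
      rw [mixedDeriv_zero_left, mlen_zero, add_zero] at e2
      refine mul_le_mul (e1.trans ?_) e2 (abs_nonneg _) (by positivity)
      gcongr
    refine (abs_integral_le_of_ball (x := y) (by positivity)
      (fun x' hx' => by rw [hκ0 x' hx', mul_zero]) hM).trans ?_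
    have e3 : (ρ * δ) ^ j * (δ⁻¹ ^ (d + j)) * (ρ * δ) ^ d = ρ ^ (j + d) := by
      rw [show (ρ * δ) ^ j * (δ⁻¹ ^ (d + j)) * (ρ * δ) ^ d = (ρ * δ) ^ (j + d) * δ⁻¹ ^ (j + d) by
        rw [pow_add (ρ * δ) j d, pow_add δ⁻¹ j d, pow_add δ⁻¹ d j]; ring, ← mul_pow, mul_assoc, mul_inv_cancel₀ hδ0.ne', mul_one]
    have e4 : (d : ℝ) ^ j ≤ (1 + d) ^ r :=
      (pow_le_pow_left₀ (by positivity) (by linarith) _).trans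
        (pow_le_pow_right₀ (by linarith [(Nat.cast_nonneg d : (0 : ℝ) ≤ d)]) hlr)
    have e5 : ρ ^ (j + d) ≤ (1 + ρ) ^ (r + d) :=
      (pow_le_pow_left₀ hρ.le (by linarith) _).trans (pow_le_pow_right₀ (by linarith) (by omega))
    calc _ = (d : ℝ) ^ j * ((ρ * δ) ^ j * (δ⁻¹ ^ (d + j)) * (ρ * δ) ^ d) * v * c *
          (b * δ ^ β * t⁻¹ ^ (d + j)) := by ring
      _ ≤ (1 + d) ^ r * (1 + ρ) ^ (r + d) * v * c *
          (b * δ ^ β * (2 ^ (d + r) * (2 * t)⁻¹ ^ (d + j))) := by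
          rw [e3]
          gcongr
          exact ht1 j (by omega)
      _ = _ := by rw [hE]; ring
  change |∫ x', ψ x' * κ x'| ≤ _
  rw [hsplit]
  refine (abs_add_le _ _).trans ((add_le_add h2 h1).trans (le_of_eq (by ring)))

/-- The pairing of `u` with the monomial `(· - z)^k / k!`. -/
def monoInt (u : Rd d → ℝ) (z : Rd d) (k : Fin d → ℕ) : ℝ := ∫ x, u x * (mpow (x - z) k / mfact k)

lemma abs_monoInt_le {u : Rd d → ℝ} (hu : Continuous u) (hus : HasCompactSupport u) {z : Rd d}
    {τ B : ℝ} (hs : ∀ y, τ < ‖y - z‖ → u y = 0) (hB : ∫ y, |u y| ≤ B)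
    (hB0 : 0 ≤ τ) (k : Fin d → ℕ) : |monoInt u z k| ≤ B * τ ^ mlen k := by
  have h1 : |monoInt u z k| ≤ (∫ y, |u y|) * τ ^ mlen k := by
    rw [← integral_mul_const, ← Real.norm_eq_abs]
    refine norm_integral_le_of_norm_le
      ((hu.integrable_of_hasCompactSupport hus).abs.mul_const _)
      (Eventually.of_forall fun y => ?_)
    rw [norm_mul]
    by_cases hy : τ < ‖y - z‖
    · simp [hs y hy]
    · refine mul_le_mul_of_nonneg_left ?_ (abs_nonneg _)
      rw [Real.norm_eq_abs, abs_div, abs_of_pos (mfact_pos k)]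
      exact (div_le_self (abs_nonneg _) (one_le_mfact k)).trans ((abs_mpow_le _ _).trans
        (pow_le_pow_left₀ (norm_nonneg _) (not_lt.1 hy) _))
  exact h1.trans (by gcongr)

/-- The function obtained from a kernel by subtracting its Taylor expansion at `z` in the first
variable and integrating against `u`. -/
def adjTaylor (G : Rd d → Rd d → ℝ) (j : ℕ) (u : Rd d → ℝ) (z y : Rd d) : ℝ :=
  adj G u y - ∑ k ∈ multiIndicesLT d (j : ℝ), monoInt u z k * mixedDeriv G k 0 z y

/-- At large scales a regularising kernel with its Taylor expansion subtracted maps localised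
functions to test functions at the scale of the kernel. -/
lemma IsRegularisingKernel.exists_bumpAt_coarse (hK : IsRegularisingKernel β m r ρ K Kn)
    {L : Set (Rd d)} (hL : IsCompact L) {j : ℕ} (hj : j ≤ m) :
    ∃ C : ℝ, 0 ≤ C ∧ ∀ z ∈ L, ∀ (n : ℕ) (τ B : ℝ) (u : Rd d → ℝ), 0 < τ →
      τ ≤ 2 * (ρ * 2⁻¹ ^ n) → Continuous u → (∀ y, τ < ‖y - z‖ → u y = 0) → ∫ y, |u y| ≤ B →
      BumpAt r z (3 * (ρ * 2⁻¹ ^ n)) (C * B * (((2⁻¹ : ℝ) ^ n) ^ β * (τ / 2⁻¹ ^ n) ^ j))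
        (adjTaylor (Kn n) j u z) := by
  have hρ := hK.rho_pos
  obtain ⟨c, hc, hc1, -⟩ := hK.exists_bounds (hL.cthickening (r := 3 * ρ))
  refine ⟨c * (d ^ j * (1 + 3 * ρ) ^ (d + r)), by positivity,
    fun z hz n τ B u hτ hτn hu hus hB => ?_⟩
  set δ : ℝ := (2⁻¹ : ℝ) ^ n with hδ
  have hδ0 : 0 < δ := by positivity
  have hδ1 : δ ≤ 1 := pow_le_one₀ (by norm_num) (by norm_num)
  have hB0 : 0 ≤ B := (integral_nonneg fun _ => abs_nonneg _).trans hB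
  have hcs : HasCompactSupport u := HasCompactSupport.of_support_subset_isCompact
    (isCompact_closedBall z τ) fun x' hx' => by
      rw [Metric.mem_closedBall, dist_eq_norm]
      exact not_lt.1 fun h => hx' (hus x' h)
  have hmem : ∀ k ∈ multiIndicesLT d (j : ℝ), mlen k ≤ m := fun k hk => by
    have : mlen k < j := by exact_mod_cast mem_multiIndicesLT.1 hk
    omega
  have hfam : IsDerivFamily r fun l y => (∫ x, u x * partialDeriv l (Kn n x) y) +
      (-1) * ∑ k ∈ multiIndicesLT d (j : ℝ), monoInt u z k * mixedDeriv (Kn n) k l z y :=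
    ((hK.isCmr n).isDerivFamily_adj hu hcs).add ((IsDerivFamily.sum _ fun k hk =>
      ((hK.isCmr n).isDerivFamily_mixedDeriv (hmem k hk) z).const_mul _).const_mul _)
  have e0 : adjTaylor (Kn n) j u z = fun y => (∫ x, u x * partialDeriv 0 (Kn n x) y) +
      (-1) * ∑ k ∈ multiIndicesLT d (j : ℝ), monoInt u z k * mixedDeriv (Kn n) k 0 z y := by
    funext y
    simp only [partialDeriv_zero, adjTaylor, adj]
    ring
  have hsupp : ∀ y, 3 * (ρ * δ) < ‖y - z‖ → adjTaylor (Kn n) j u z y = 0 := by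
    intro y hy
    have h0 : adj (Kn n) u y = 0 := by
      refine integral_eq_zero_of_ae (Eventually.of_forall fun x' => ?_)
      by_cases h1 : τ < ‖x' - z‖
      · simp [hus x' h1]
      · have h2 : ρ * 2⁻¹ ^ n < ‖x' - y‖ := by
          change ρ * δ < _
          have := norm_sub_le_norm_sub_add_norm_sub y x' z
          rw [norm_sub_rev y x'] at this
          linarith
        simp [hK.eq_zero h2]
    rw [adjTaylor, h0, Finset.sum_eq_zero, sub_zero]
    intro k _
    rw [hK.mixedDeriv_eq_zero, mul_zero]
    rw [norm_sub_rev]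
    have : 0 < ρ * δ := by positivity
    change ρ * δ < _
    linarith
  refine ⟨by rw [e0]; exact hfam.contDiff_zero', hsupp, fun l hl y => ?_⟩
  by_cases hy : 3 * (ρ * δ) < ‖y - z‖
  · rw [partialDeriv_vanish hsupp l y hy, abs_zero]
    positivity
  rw [not_lt] at hy
  rw [e0, hfam.partialDeriv_zero_eq hl]
  have hyL : y ∈ Metric.cthickening (3 * ρ) L := mem_cthickening_of_norm hz (by nlinarith)
  set κ : Rd d → ℝ := fun x' => partialDeriv l (Kn n x') y with hκ
  have hκm : ContDiff ℝ m κ := (hK.isCmr n).2.1 l hl y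
  have e1 : (∫ x, u x * partialDeriv l (Kn n x) y) + (-1) * ∑ k ∈ multiIndicesLT d (j : ℝ),
      monoInt u z k * mixedDeriv (Kn n) k l z y = ∫ x, u x * (κ x - ∑ k ∈ multiIndicesLT d (j : ℝ),
        partialDeriv k κ z * (mpow (x - z) k / mfact k)) := by
    have hi : ∀ w : Rd d → ℝ, Continuous w → Integrable fun x => u x * w x := fun w hw =>
      integrable_mul_of_continuous hu hcs hw
    have hmc : ∀ k : Fin d → ℕ, Continuous fun x => mpow (x - z) k / mfact k := fun k =>
      ((continuous_mpow k).comp (continuous_id.sub continuous_const)).div_const _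
    simp only [mul_sub]
    rw [integral_sub (hi _ hκm.continuous) (hi (fun x => ∑ k ∈ multiIndicesLT d (j : ℝ),
      partialDeriv k κ z * (mpow (x - z) k / mfact k)) (continuous_finsetSum _ fun k _ =>
      continuous_const.mul (hmc k)))]
    simp only [Finset.mul_sum]
    rw [integral_finsetSum _ fun k _ => hi (fun x => partialDeriv k κ z *
      (mpow (x - z) k / mfact k)) (continuous_const.mul (hmc k)), sub_eq_add_neg,
      ← Finset.sum_neg_distrib]
    congr 1
    refine Finset.sum_congr rfl fun k _ => ?_
    rw [monoInt, neg_one_mul, ← integral_mul_const]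
    congr 1
    refine integral_congr_ae (Eventually.of_forall fun x => ?_)
    simp only [mixedDeriv]
    ring
  beta_reduce
  rw [e1]
  have h1 : |∫ x, u x * (κ x - ∑ k ∈ multiIndicesLT d (j : ℝ),
        partialDeriv k κ z * (mpow (x - z) k / mfact k))| ≤
      (∫ x, |u x|) * (d ^ j * (c * (δ ^ β * δ⁻¹ ^ (d + mlen l + j))) * τ ^ j) := by
    rw [← integral_mul_const, ← Real.norm_eq_abs]
    refine norm_integral_le_of_norm_le ((hu.integrable_of_hasCompactSupport hcs).abs.mul_const _)
      (Eventually.of_forall fun x => ?_)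
    rw [norm_mul]
    by_cases hx : τ < ‖x - z‖
    · simp [hus x hx]
    · refine mul_le_mul_of_nonneg_left ?_ (abs_nonneg _)
      have e2 := taylor_bound (j := j) (hκm.of_le (by exact_mod_cast hj)) z (x - z)
        (M := c * (δ ^ β * δ⁻¹ ^ (d + mlen l + j))) fun k hk σ hσ => by
          have hmem : z + σ • (x - z) ∈ Metric.cthickening (3 * ρ) L := by
            refine mem_cthickening_of_norm hz ?_
            rw [add_sub_cancel_left, norm_smul, Real.norm_eq_abs, abs_of_nonneg hσ.1]
            have := mul_le_of_le_one_left (norm_nonneg (x - z)) hσ.2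
            nlinarith [not_lt.1 hx]
          have := hc1 n k l (by omega) hl _ hmem y hyL
          rwa [hk] at this
      rw [add_sub_cancel, abs_of_nonneg (show 0 ≤ c * (δ ^ β * δ⁻¹ ^ (d + mlen l + j)) by
        positivity)] at e2
      refine e2.trans ?_
      gcongr
      exact not_lt.1 hx
  refine h1.trans ?_
  have e3 : δ⁻¹ ^ (d + mlen l) ≤ (1 + 3 * ρ) ^ (d + r) * (3 * (ρ * δ))⁻¹ ^ (d + mlen l) := by
    have : δ⁻¹ = 3 * ρ * (3 * (ρ * δ))⁻¹ := by field_simp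
    rw [this, mul_pow]
    gcongr ?_ * _
    exact (pow_le_pow_left₀ (by positivity) (by linarith) _).trans
      (pow_le_pow_right₀ (by linarith) (by omega))
  calc _ ≤ B * (d ^ j * (c * (δ ^ β * (δ⁻¹ ^ (d + mlen l) * δ⁻¹ ^ j))) * τ ^ j) := by
        rw [pow_add]; gcongr
    _ ≤ B * (d ^ j * (c * (δ ^ β * (((1 + 3 * ρ) ^ (d + r) * (3 * (ρ * δ))⁻¹ ^ (d + mlen l)) *
        δ⁻¹ ^ j))) * τ ^ j) := by gcongr
    _ = _ := by rw [div_eq_mul_inv, mul_pow]; ring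

/-- The derivatives of a regularising kernel in the first variable are test functions in the
second variable. -/
lemma IsRegularisingKernel.exists_bumpAt_deriv (hK : IsRegularisingKernel β m r ρ K Kn)
    {L : Set (Rd d)} (hL : IsCompact L) :
    ∃ C : ℝ, 0 ≤ C ∧ ∀ z ∈ L, ∀ (n : ℕ) (k : Fin d → ℕ), mlen k ≤ m →
      BumpAt r z (ρ * 2⁻¹ ^ n) (C * (((2⁻¹ : ℝ) ^ n) ^ β * ((2⁻¹ : ℝ) ^ n)⁻¹ ^ mlen k))
        (mixedDeriv (Kn n) k 0 z) := by
  have hρ := hK.rho_pos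
  obtain ⟨c, hc, hc1, -⟩ := hK.exists_bounds (hL.cthickening (r := ρ))
  refine ⟨c * (1 + ρ) ^ (d + r), by positivity, fun z hz n k hk => ?_⟩
  have hfam := (hK.isCmr n).isDerivFamily_mixedDeriv hk z
  set δ : ℝ := (2⁻¹ : ℝ) ^ n with hδ
  have hδ0 : 0 < δ := by positivity
  have hδ1 : δ ≤ 1 := pow_le_one₀ (by norm_num) (by norm_num)
  have hsupp : ∀ y, ρ * δ < ‖y - z‖ → mixedDeriv (Kn n) k 0 z y = 0 := fun y hy =>
    hK.mixedDeriv_eq_zero (by rwa [norm_sub_rev]) k 0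
  refine ⟨hfam.contDiff_zero', hsupp, fun l hl y => ?_⟩
  by_cases hy : ρ * δ < ‖y - z‖
  · rw [partialDeriv_vanish hsupp l y hy, abs_zero]
    positivity
  have e := hfam.partialDeriv_zero_eq hl
  have e' : partialDeriv l (mixedDeriv (Kn n) k 0 z) y = mixedDeriv (Kn n) k l z y :=
    congrFun e y
  rw [e']
  refine (hc1 n k l hk hl z (Metric.self_subset_cthickening L hz) y
    (mem_cthickening_of_norm hz (by nlinarith [not_lt.1 hy]))).trans ?_
  have e3 : δ⁻¹ ^ (d + mlen l) ≤ (1 + ρ) ^ (d + r) * (ρ * δ)⁻¹ ^ (d + mlen l) := by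
    have : δ⁻¹ = ρ * (ρ * δ)⁻¹ := by field_simp
    rw [this, mul_pow]
    gcongr ?_ * _
    exact (pow_le_pow_left₀ (by positivity) (by linarith) _).trans
      (pow_le_pow_right₀ (by linarith) (by omega))
  calc _ = c * (δ ^ β * (δ⁻¹ ^ (d + mlen l) * δ⁻¹ ^ mlen k)) := by rw [pow_add]
    _ ≤ c * (δ ^ β * (((1 + ρ) ^ (d + r) * (ρ * δ)⁻¹ ^ (d + mlen l)) * δ⁻¹ ^ mlen k)) := by gcongr
    _ = _ := by ring

end Kernel

/-! ### Distributions of finite global order -/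

/-- `T` has order at most `q` on every bounded set. -/
def OrderLE (T : Distr d) (q : ℕ) : Prop := ∀ t : ℝ, 0 < t → ∃ A : ℝ, BoundedAt T q 0 t A

lemma orderLE_of_forall {T : Distr d} {q : ℕ} {x : Rd d}
    (h : ∀ t : ℝ, 0 < t → ∃ A : ℝ, BoundedAt T q x t A) : OrderLE T q := by
  intro t ht
  obtain ⟨A, hA⟩ := h (‖(0 : Rd d) - x‖ + t) (by positivity)
  exact ⟨_, boundedAt_of_bump ht fun ψ hψ => hA.apply (by positivity) (hψ.enlarge ht le_rfl)⟩

lemma OrderLE.hasOrderOn {T : Distr d} {q : ℕ} (h : OrderLE T q) {R : ℝ} (hR : 0 < R) :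
    HasOrderOn T q (Metric.closedBall 0 R) := by
  obtain ⟨A, hA⟩ := h R hR
  exact hasOrderOn_closedBall hR hA

lemma OrderLE.mono {T : Distr d} {q q' : ℕ} (h : OrderLE T q) (hq : q ≤ q') : OrderLE T q' :=
  fun t ht => (h t ht).imp fun _ hA => boundedAt_of_bump ht fun _ hψ =>
    (hA.apply ht (hψ.mono ht hq le_rfl)).trans_eq (one_mul _)

lemma OrderLE.add {T T' : Distr d} {q : ℕ} (h : OrderLE T q) (h' : OrderLE T' q) :
    OrderLE (T + T') q := by
  intro t ht
  obtain ⟨A, hA⟩ := h t ht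
  obtain ⟨A', hA'⟩ := h' t ht
  exact ⟨A + A', fun φ hφ => (abs_add_le _ _).trans (add_le_add (hA φ hφ) (hA' φ hφ))⟩

lemma OrderLE.smul {T : Distr d} {q : ℕ} (h : OrderLE T q) (c : ℝ) : OrderLE (c • T) q := by
  intro t ht
  obtain ⟨A, hA⟩ := h t ht
  refine ⟨|c| * A, fun φ hφ => ?_⟩
  change |c * T (scaled φ 0 t)| ≤ _
  rw [abs_mul]
  exact mul_le_mul_of_nonneg_left (hA φ hφ) (abs_nonneg c)

lemma OrderLE.sub {T T' : Distr d} {q : ℕ} (h : OrderLE T q) (h' : OrderLE T' q) :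
    OrderLE (T - T') q := by
  have := h.add (h'.smul (-1))
  rwa [neg_one_smul, ← sub_eq_add_neg] at this

open Classical in
/-- The value of the extension of a distribution at a function (`0` if it is not defined). -/
def extVal (T : Distr d) (g : Rd d → ℝ) : ℝ := if h : ∃ v, ExtPairing T g v then h.choose else 0

lemma ExtPairing.extVal_eq {T : Distr d} {g : Rd d → ℝ} {v : ℝ} (h : ExtPairing T g v) :
    extVal T g = v := by
  have hex : ∃ v, ExtPairing T g v := ⟨v, h⟩
  rw [extVal, dif_pos hex]
  exact hex.choose_spec.unique h

lemma exists_ball_of_hasCompactSupport {g : Rd d → ℝ} (hs : HasCompactSupport g) :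
    ∃ R : ℝ, 0 < R ∧ tsupport g ⊆ Metric.ball 0 R := by
  obtain ⟨R, hR⟩ := hs.isCompact.isBounded.subset_ball (0 : Rd d)
  exact ⟨max R 1, by positivity, hR.trans (Metric.ball_subset_ball (le_max_left _ _))⟩

lemma OrderLE.extPairing {T : Distr d} {q : ℕ} (hT : OrderLE T q) {g : Rd d → ℝ}
    (hg : ContDiff ℝ q g) (hs : HasCompactSupport g) : ExtPairing T g (extVal T g) := by
  obtain ⟨R, hR, hgR⟩ := exists_ball_of_hasCompactSupport hs
  obtain ⟨v, hv⟩ := exists_extPairing (isCompact_closedBall 0 R) (hT.hasOrderOn hR) hg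
    (hgR.trans Metric.ball_subset_interior_closedBall)
  rwa [hv.extVal_eq]

lemma OrderLE.abs_extVal_le {T : Distr d} {q r : ℕ} (hT : OrderLE T r) {x : Rd d} {t b A : ℝ}
    (ht : 0 < t) {g : Rd d → ℝ} (hg : BumpAt r x t b g) (hq : q ≤ r)
    (hA : BoundedAt T q x (2 * t) A) : |extVal T g| ≤ mollConst d q * b * A :=
  (hT.extPairing hg.contDiff (hg.hasCompactSupport)).abs_le ht (hg.mono ht hq le_rfl) hA

lemma OrderLE.tendsto_extVal {T : Distr d} {q : ℕ} (hT : OrderLE T q) {g : Rd d → ℝ}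
    (hg : ContDiff ℝ q g) (hs : HasCompactSupport g) {R : ℝ} {φ : ℕ → TestFn d}
    (hφ : ∀ j, tsupport (φ j) ⊆ Metric.closedBall 0 R)
    (h : ∀ k : Fin d → ℕ, mlen k ≤ q →
      TendstoUniformly (fun j => partialDeriv k (φ j)) (partialDeriv k g) atTop) :
    Tendsto (fun j => T (φ j)) atTop (𝓝 (extVal T g)) := by
  have hext := hT.extPairing hg hs
  obtain ⟨s, L, hL, -, hgs, hgL, hlim⟩ := hext
  obtain ⟨R', hR', hgR⟩ := exists_ball_of_hasCompactSupport hs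
  obtain ⟨ψ, hψ, hψd, -⟩ := exists_mollify_seq hg.continuous hs
    (isOpen_interior.inter Metric.isOpen_ball) (Set.subset_inter hgL hgR)
  have h1 := hlim ψ (fun j => (hψ j).trans (Set.inter_subset_left.trans interior_subset))
    fun k hk => hψd s k hgs hk
  obtain ⟨c, hc⟩ := hT.hasOrderOn (R := max R R') (lt_max_of_lt_right hR')
  have hdiff : Tendsto (fun j => T (φ j) - T (ψ j)) atTop (𝓝 0) := by
    rw [Metric.tendsto_atTop]
    intro ε hε
    have hε' : 0 < ε / (2 * (|c| + 1)) := by positivity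
    have hev : ∀ᶠ j in atTop, ∀ k ∈ multiIndicesLE d q, ∀ y,
        |partialDeriv k (φ j) y - partialDeriv k (ψ j) y| ≤ ε / (2 * (|c| + 1)) := by
      refine (eventually_all_finset _).2 fun k hk => ?_
      have hk' := mem_multiIndicesLE.1 hk
      have h2 := Metric.tendstoUniformly_iff.1 (h k hk') _ (half_pos hε')
      have h3 := Metric.tendstoUniformly_iff.1 (hψd q k hg hk') _ (half_pos hε')
      filter_upwards [h2, h3] with j h2 h3 y
      have := (dist_triangle_left (partialDeriv k (φ j) y) (partialDeriv k (ψ j) y)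
        (partialDeriv k g y)).trans_lt (add_lt_add (h2 y) (h3 y))
      rw [add_halves, Real.dist_eq] at this
      exact this.le
    obtain ⟨N, hN⟩ := eventually_atTop.1 hev
    refine ⟨N, fun j hj => ?_⟩
    have h4 := hc (φ j - ψ j) ((tsupport_sub _ _).trans (Set.union_subset
      ((hφ j).trans (Metric.closedBall_subset_closedBall (le_max_left _ _)))
      ((hψ j).trans (Set.inter_subset_right.trans (Metric.ball_subset_closedBall.trans
        (Metric.closedBall_subset_closedBall (le_max_right _ _))))))) (ε / (2 * (|c| + 1)))
      fun k hk y => by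
        rw [partialDeriv_sub_test]
        exact hN j hj k (mem_multiIndicesLE.2 hk) y
    rw [map_sub] at h4
    rw [Real.dist_eq, sub_zero]
    refine h4.trans_lt ?_
    have h5 : c * (ε / (2 * (|c| + 1))) ≤ (|c| + 1) * (ε / (2 * (|c| + 1))) := by
      gcongr
      linarith [le_abs_self c]
    have h6 : (|c| + 1) * (ε / (2 * (|c| + 1))) = ε / 2 := by field_simp
    linarith
  simpa using hdiff.add h1

lemma OrderLE.extVal_eq_apply {T : Distr d} {q : ℕ} (hT : OrderLE T q) (ψ : TestFn d) :
    extVal T ψ = T ψ :=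
  (hT.extPairing (contDiff_testFn ψ q) ψ.hasCompactSupport).eq_apply

lemma exists_test_seq {q : ℕ} {g : Rd d → ℝ}
    (hg : ContDiff ℝ q g) (hs : HasCompactSupport g) : ∃ (R : ℝ) (φ : ℕ → TestFn d),
      (∀ j, tsupport (φ j) ⊆ Metric.closedBall 0 R) ∧ ∀ k : Fin d → ℕ, mlen k ≤ q →
      TendstoUniformly (fun j => partialDeriv k (φ j)) (partialDeriv k g) atTop := by
  obtain ⟨R, hR, hgR⟩ := exists_ball_of_hasCompactSupport hs
  obtain ⟨φ, h1, h2, -⟩ := exists_mollify_seq hg.continuous hs Metric.isOpen_ball hgR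
  exact ⟨R, φ, fun j => (h1 j).trans Metric.ball_subset_closedBall, fun k hk => h2 q k hg hk⟩

lemma OrderLE.extVal_add {T : Distr d} {q : ℕ} (hT : OrderLE T q) {g g' : Rd d → ℝ}
    (hg : ContDiff ℝ q g) (hs : HasCompactSupport g) (hg' : ContDiff ℝ q g')
    (hs' : HasCompactSupport g') :
    extVal T (fun y => g y + g' y) = extVal T g + extVal T g' := by
  obtain ⟨R, φ, h1, h2⟩ := exists_test_seq hg hs
  obtain ⟨R', φ', h1', h2'⟩ := exists_test_seq hg' hs'
  refine tendsto_nhds_unique (hT.tendsto_extVal (hg.add hg') (hs.add hs') (R := max R R')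
    (φ := fun j => φ j + φ' j) (fun j => ?_) fun k hk => ?_) ?_
  · exact (tsupport_add _ _).trans (Set.union_subset
      ((h1 j).trans (Metric.closedBall_subset_closedBall (le_max_left _ _)))
      ((h1' j).trans (Metric.closedBall_subset_closedBall (le_max_right _ _))))
  · have := (h2 k hk).add (h2' k hk)
    have e : partialDeriv k (fun y => g y + g' y) = partialDeriv k g + partialDeriv k g' := by
      rw [partialDeriv_add (hg.of_le (by exact_mod_cast hk)) (hg'.of_le (by exact_mod_cast hk))]
      rfl
    rw [e]
    simp only [partialDeriv_add_test]
    exact this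
  · simp only [map_add]
    exact (hT.tendsto_extVal hg hs h1 h2).add (hT.tendsto_extVal hg' hs' h1' h2')

lemma OrderLE.extVal_const_mul {T : Distr d} {q : ℕ} (hT : OrderLE T q) {g : Rd d → ℝ}
    (hg : ContDiff ℝ q g) (hs : HasCompactSupport g) (c : ℝ) :
    extVal T (fun y => c * g y) = c * extVal T g := by
  obtain ⟨R, φ, h1, h2⟩ := exists_test_seq hg hs
  refine tendsto_nhds_unique (hT.tendsto_extVal (contDiff_const.mul hg) (hs.mul_left) (R := R)
    (φ := fun j => c • φ j) (fun j => ?_) fun k hk => ?_) ?_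
  · exact (tsupport_smul_subset_right (fun _ => c) (φ j)).trans (h1 j)
  · have e : partialDeriv k (fun y => c * g y) = fun y => c * partialDeriv k g y := by
      rw [partialDeriv_const_mul (hg.of_le (by exact_mod_cast hk))]
    rw [e]
    have h3 : UniformContinuous fun v : ℝ => c * v := uniformContinuous_const_smul c
    have := h3.comp_tendstoUniformly (h2 k hk)
    simp only [partialDeriv_smul_test]
    exact this
  · simp only [map_smul, smul_eq_mul]
    exact (hT.tendsto_extVal hg hs h1 h2).const_mul c

lemma OrderLE.extVal_sum {T : Distr d} {q : ℕ} (hT : OrderLE T q) {ι : Type*} (s : Finset ι)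
    {g : ι → Rd d → ℝ} (c : ι → ℝ) (hg : ∀ i ∈ s, ContDiff ℝ q (g i))
    (hs : ∀ i ∈ s, HasCompactSupport (g i)) :
    ContDiff ℝ q (fun y => ∑ i ∈ s, c i * g i y) ∧ HasCompactSupport (fun y => ∑ i ∈ s, c i * g i y) ∧
    extVal T (fun y => ∑ i ∈ s, c i * g i y) = ∑ i ∈ s, c i * extVal T (g i) := by
  classical
  induction s using Finset.induction_on with
  | empty =>
    have e : (fun _ : Rd d => (0 : ℝ)) = ((0 : TestFn d) : Rd d → ℝ) := rfl
    simp only [Finset.sum_empty]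
    refine ⟨contDiff_const, HasCompactSupport.zero, ?_⟩
    rw [e, hT.extVal_eq_apply, map_zero]
  | insert i s hi ih =>
    have hgi := hg i (Finset.mem_insert_self i s)
    have hsi := hs i (Finset.mem_insert_self i s)
    obtain ⟨h1, h2, h3⟩ := ih (fun j hj => hg j (Finset.mem_insert_of_mem hj))
      fun j hj => hs j (Finset.mem_insert_of_mem hj)
    simp only [Finset.sum_insert hi]
    refine ⟨(contDiff_const.mul hgi).add h1, (hsi.mul_left).add h2, ?_⟩
    rw [hT.extVal_add (g := fun y => c i * g i y) (contDiff_const.mul hgi) (hsi.mul_left) h1 h2,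
      hT.extVal_const_mul hgi hsi, h3]

lemma OrderLE.extVal_sub_distr {T T' : Distr d} {q : ℕ} (hT : OrderLE T q) (hT' : OrderLE T' q)
    {g : Rd d → ℝ} (hg : ContDiff ℝ q g) (hs : HasCompactSupport g) :
    extVal (T - T') g = extVal T g - extVal T' g := by
  have h := (hT.extPairing hg hs).add ((hT'.extPairing hg hs).smul (-1))
  rw [neg_one_smul, ← sub_eq_add_neg] at h
  rw [h.extVal_eq]
  ring

/-! ### Integration against kernels -/

section Integration

variable {Kn : ℕ → Rd d → Rd d → ℝ}

lemma IsKernelInt.unique {f g g' : Distr d} (h : IsKernelInt Kn f g) (h' : IsKernelInt Kn f g') :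
    g = g' := by
  ext ψ
  obtain ⟨a, ha, hlim⟩ := h ψ
  obtain ⟨a', ha', hlim'⟩ := h' ψ
  obtain rfl : a = a' := funext fun n => (ha n).unique (ha' n)
  exact tendsto_nhds_unique hlim hlim'

lemma IsKernelInt.kernelInt_eq {f g : Distr d} (h : IsKernelInt Kn f g) : kernelInt Kn f = g := by
  have hex : KernelIntDefined Kn f := ⟨g, h⟩
  rw [kernelInt, dif_pos hex]
  exact hex.choose_spec.unique h

lemma KernelIntDefined.isKernelInt {f : Distr d} (h : KernelIntDefined Kn f) :
    IsKernelInt Kn f (kernelInt Kn f) := by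
  obtain ⟨g, hg⟩ := h
  rwa [hg.kernelInt_eq]

lemma IsKernelInt.tendsto {f g : Distr d} (h : IsKernelInt Kn f g) (ψ : TestFn d) :
    Tendsto (fun N => ∑ n ∈ Finset.range N, extVal f (adj (Kn n) ψ)) atTop (𝓝 (g ψ)) := by
  obtain ⟨a, ha, hlim⟩ := h ψ
  have : ∀ n, extVal f (adj (Kn n) ψ) = a n := fun n => (ha n).extVal_eq
  simpa only [this] using hlim

lemma IsKernelInt.extPairing {f g : Distr d} (h : IsKernelInt Kn f g) (ψ : TestFn d) (n : ℕ) :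
    ExtPairing f (adj (Kn n) ψ) (extVal f (adj (Kn n) ψ)) := by
  obtain ⟨a, ha, -⟩ := h ψ
  rw [(show ExtPairing f (adj (Kn n) ψ) (a n) from ha n).extVal_eq]
  exact ha n

lemma IsKernelInt.add {f g f' g' : Distr d} (h : IsKernelInt Kn f g) (h' : IsKernelInt Kn f' g') :
    IsKernelInt Kn (f + f') (g + g') := by
  intro ψ
  obtain ⟨a, ha, hlim⟩ := h ψ
  obtain ⟨a', ha', hlim'⟩ := h' ψ
  refine ⟨fun n => a n + a' n, fun n => (ha n).add (ha' n), ?_⟩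
  simp only [Finset.sum_add_distrib]
  exact hlim.add hlim'

lemma IsKernelInt.smul {f g : Distr d} (h : IsKernelInt Kn f g) (c : ℝ) :
    IsKernelInt Kn (c • f) (c • g) := by
  intro ψ
  obtain ⟨a, ha, hlim⟩ := h ψ
  refine ⟨fun n => c * a n, fun n => (ha n).smul c, ?_⟩
  simp only [← Finset.mul_sum]
  exact hlim.const_mul c

variable {β ρ : ℝ} {m r : ℕ} {K : Rd d → Rd d → ℝ}

lemma IsRegularisingKernel.hasCompactSupport_adj (hK : IsRegularisingKernel β m r ρ K Kn)
    (ψ : TestFn d) (n : ℕ) : HasCompactSupport (adj (Kn n) ψ) := by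
  obtain ⟨R, -, hR⟩ := exists_testFn_supp ψ 0
  refine HasCompactSupport.of_support_subset_isCompact
    (isCompact_closedBall (0 : Rd d) (R + ρ * 2⁻¹ ^ n)) fun y hy => ?_
  rw [Metric.mem_closedBall, dist_eq_norm]
  by_contra hcon
  refine hy (integral_eq_zero_of_ae (Eventually.of_forall fun x => ?_))
  by_cases hx : R < ‖x - 0‖
  · simp [hR x hx]
  · have h2 : ρ * 2⁻¹ ^ n < ‖x - y‖ := by
      have := norm_sub_le_norm_sub_add_norm_sub y x 0
      rw [norm_sub_rev y x] at this
      linarith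
    simp [hK.eq_zero h2]

lemma IsRegularisingKernel.contDiff_adj (hK : IsRegularisingKernel β m r ρ K Kn)
    (ψ : TestFn d) (n : ℕ) : ContDiff ℝ r (adj (Kn n) ψ) :=
  ((hK.isCmr n).isDerivFamily_adj' ψ.continuous ψ.hasCompactSupport).1

lemma summable_dyadic_rpow {θ : ℝ} (hθ : 0 < θ) (C : ℝ) :
    Summable fun n : ℕ => C * ((2⁻¹ : ℝ) ^ n) ^ θ := by
  have h1 : ∀ n : ℕ, ((2⁻¹ : ℝ) ^ n) ^ θ = ((2 : ℝ) ^ (-θ)) ^ n := fun n => by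
    have := dyadic_rpow one_pos θ n
    simpa using this
  simp only [h1]
  exact (summable_geometric_of_lt_one (by positivity) (two_rpow_neg_lt_one hθ)).mul_left C

lemma IsRegularisingKernel.exists_isKernelInt (hK : IsRegularisingKernel β m r ρ K Kn)
    {T : Distr d} (hT : OrderLE T r) : KernelIntDefined Kn T := by
  have hρ := hK.rho_pos
  have hc := fun ψ n => hK.contDiff_adj ψ n
  have hs := fun ψ n => hK.hasCompactSupport_adj ψ n
  have hbound : ∀ R : ℝ, ∃ C : ℝ, 0 ≤ C ∧ ∀ φ : TestFn d, (∀ y, R < ‖y‖ → φ y = 0) → ∀ M : ℝ,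
      (∀ k : Fin d → ℕ, mlen k ≤ r → ∀ x, |partialDeriv k φ x| ≤ M) → ∀ n,
      |extVal T (adj (Kn n) φ)| ≤ C * M * ((2⁻¹ : ℝ) ^ n) ^ β := by
    intro R
    set R' := max (max R 1) ρ with hR'
    have h1 : 1 ≤ R' := (le_max_right _ _).trans (le_max_left _ _)
    have hR0 : 0 < R' := by linarith
    obtain ⟨C, hC, h⟩ := hK.exists_bumpAt_fine (isCompact_singleton (x := (0 : Rd d))) le_rfl R'
    obtain ⟨A, hA⟩ := hT (2 * (2 * R')) (by positivity)
    refine ⟨mollConst d r * (C * R' ^ (d + r)) * A, ?_, fun φ hφ M hM n => ?_⟩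
    · have := mollConst_nonneg d r
      have := hA.nonneg
      positivity
    · have h2 : BumpAt r 0 R' (R' ^ (d + r) * M) φ := bumpAt_of_bound h1 (contDiff_testFn φ r)
        (fun y hy => hφ y (((le_max_left R 1).trans (le_max_left _ _)).trans_lt
          (by rwa [sub_zero] at hy))) hM
      have h3 := h 0 rfl R' ⟨hR0, le_rfl⟩ n _ φ
        ((mul_le_of_le_one_right hρ.le (pow_le_one₀ (by norm_num) (by norm_num))).trans
          (le_max_right _ _)) h2
      exact (hT.abs_extVal_le (by positivity) h3 le_rfl hA).trans_eq (by ring)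
  have hsum : ∀ φ : TestFn d, Summable fun n => extVal T (adj (Kn n) φ) := by
    intro φ
    obtain ⟨R, -, hR⟩ := exists_testFn_supp φ 0
    obtain ⟨C, -, h⟩ := hbound R
    obtain ⟨M, -, hM⟩ := exists_partialDeriv_bound φ r
    exact Summable.of_norm_bounded (summable_dyadic_rpow hK.beta_pos (C * M))
      fun n => h φ (fun y hy => hR y (by simpa using hy)) M hM n
  have hint : ∀ (φ : TestFn d) n y, Integrable fun x => φ x * Kn n x y := fun φ n y =>
    integrable_mul_of_continuous φ.continuous φ.hasCompactSupport (by
      have := (hK.isCmr n).continuous_partialDeriv_snd (l := 0) (by simp [mlen_zero])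
      simp only [partialDeriv_zero] at this
      exact this.comp (Continuous.prodMk_left y))
  let lin : TestFn d →ₗ[ℝ] ℝ :=
    { toFun := fun φ => ∑' n, extVal T (adj (Kn n) φ)
      map_add' := fun φ ψ => by
        rw [← (hsum φ).tsum_add (hsum ψ)]
        congr 1
        funext n
        rw [← hT.extVal_add (hc φ n) (hs φ n) (hc ψ n) (hs ψ n)]
        congr 1
        funext y
        rw [adj, adj, adj, ← integral_add (hint φ n y) (hint ψ n y)]
        refine integral_congr_ae (Eventually.of_forall fun x => ?_)
        exact add_mul (φ x) (ψ x) _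
      map_smul' := fun c φ => by
        rw [RingHom.id_apply, smul_eq_mul, ← tsum_mul_left]
        congr 1
        funext n
        rw [← hT.extVal_const_mul (hc φ n) (hs φ n)]
        congr 1
        funext y
        rw [adj, adj, ← integral_const_mul]
        refine integral_congr_ae (Eventually.of_forall fun x => ?_)
        exact mul_assoc c (φ x) _ }
  obtain ⟨g, hg⟩ := exists_distr_of_bound lin (fun R => by
    obtain ⟨C, hC, h⟩ := hbound R
    refine ⟨r, C * ∑' n : ℕ, 1 * ((2⁻¹ : ℝ) ^ n) ^ β, fun φ hφ M hM => ?_⟩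
    have h1 := tsum_of_norm_bounded (f := fun n => extVal T (adj (Kn n) φ))
      (summable_dyadic_rpow hK.beta_pos (C * M)).hasSum (h φ hφ M hM)
    refine h1.trans_eq ?_
    simp only [one_mul]
    rw [tsum_mul_left]
    ring)
  refine ⟨g, fun ψ => ⟨fun n => extVal T (adj (Kn n) ψ), fun n =>
    hT.extPairing (hc ψ n) (hs ψ n), ?_⟩⟩
  rw [hg]
  exact (hsum ψ).hasSum.tendsto_sum_nat

end Integration

/-! ### Summation over the scales of a kernel -/

lemma exists_dyadic_sum_le {a β ρ : ℝ} (hρ : 0 < ρ) (hβ : 0 < β) (hab : a + β ≠ 0) :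
    ∃ C : ℝ, 0 ≤ C ∧ ∀ t τ D : ℝ, 0 < t → t ≤ τ → 0 ≤ D → ∀ v : ℕ → ℝ,
      (∀ n, ρ * 2⁻¹ ^ n ≤ t → v n ≤ D * (t ^ a * (ρ * 2⁻¹ ^ n) ^ β)) →
      (∀ n, t < ρ * 2⁻¹ ^ n → ρ * 2⁻¹ ^ n ≤ τ → v n ≤ D * (ρ * 2⁻¹ ^ n) ^ (a + β)) →
      (∀ n, τ < ρ * 2⁻¹ ^ n → v n ≤ 0) →
      ∀ N, ∑ n ∈ Finset.range N, v n ≤ C * D * (if a + β < 0 then t ^ (a + β) else τ ^ (a + β)) := by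
  rcases lt_or_gt_of_ne hab with h | h
  · have hg1 := geomConst_pos hβ
    have hg2 := geomConst_pos (neg_pos.2 h)
    refine ⟨geomConst β + geomConst (-(a + β)), by positivity,
      fun t τ D ht htτ hD v h1 h2 h3 N => ?_⟩
    rw [if_pos h]
    refine (sum_two_sided_le hβ (neg_pos.2 h) (div_pos hρ ht) (A := D * t ^ (a + β))
      (by positivity) (fun n hn => ?_) (fun n hn => ?_) N).trans_eq (by ring)
    · rw [div_mul_eq_mul_div] at hn ⊢
      refine (h1 n ((div_le_one ht).1 hn)).trans_eq ?_
      rw [Real.div_rpow (by positivity) ht.le, Real.rpow_add ht]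
      field_simp
    · rw [div_mul_eq_mul_div] at hn ⊢
      have hn' := (one_lt_div ht).1 hn
      have e : D * t ^ (a + β) * (ρ * 2⁻¹ ^ n / t) ^ (-(-(a + β))) =
          D * (ρ * 2⁻¹ ^ n) ^ (a + β) := by
        rw [neg_neg, Real.div_rpow (by positivity) ht.le]
        field_simp
      rw [e]
      rcases le_or_gt (ρ * 2⁻¹ ^ n) τ with h4 | h4
      · exact h2 n hn' h4
      · exact (h3 n h4).trans (by positivity)
  · have hp : 0 < min β (a + β) := lt_min hβ h
    have hg1 := geomConst_pos hp
    have hg2 := geomConst_pos one_pos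
    refine ⟨geomConst (min β (a + β)) + geomConst 1, by positivity,
      fun t τ D ht htτ hD v h1 h2 h3 N => ?_⟩
    rw [if_neg h.le.not_gt]
    have hτ : 0 < τ := ht.trans_le htτ
    refine (sum_two_sided_le hp one_pos (div_pos hρ hτ) (A := D * τ ^ (a + β))
      (by positivity) (fun n hn => ?_) (fun n hn => ?_) N).trans_eq (by ring)
    · rw [div_mul_eq_mul_div] at hn ⊢
      set w := ρ * 2⁻¹ ^ n with hw
      have hw0 : 0 < w := by positivity
      have hn' := (div_le_one hτ).1 hn
      rw [mul_assoc]
      have e1 : w ^ (a + β) ≤ τ ^ (a + β) * (w / τ) ^ min β (a + β) := by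
        calc w ^ (a + β) = τ ^ (a + β) * (w / τ) ^ (a + β) := by
              rw [Real.div_rpow hw0.le hτ.le]; field_simp
          _ ≤ _ := by
              gcongr ?_ * ?_
              exact Real.rpow_le_rpow_of_exponent_ge (by positivity) hn (min_le_right _ _)
      rcases le_or_gt w t with h4 | h4
      · refine (h1 n h4).trans (mul_le_mul_of_nonneg_left ?_ hD)
        rcases le_or_gt 0 a with h5 | h5
        · calc t ^ a * w ^ β ≤ τ ^ a * w ^ β := by gcongr
            _ = τ ^ (a + β) * (w / τ) ^ β := by
                rw [Real.div_rpow hw0.le hτ.le, Real.rpow_add hτ]; field_simp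
            _ ≤ _ := by
                gcongr ?_ * ?_
                exact Real.rpow_le_rpow_of_exponent_ge (by positivity) hn (min_le_left _ _)
        · refine le_trans ?_ e1
          rw [Real.rpow_add hw0]
          gcongr ?_ * _
          exact Real.rpow_le_rpow_of_nonpos hw0 h4 h5.le
      · exact (h2 n h4 hn').trans (mul_le_mul_of_nonneg_left e1 hD)
    · rw [div_mul_eq_mul_div] at hn ⊢
      exact (h3 n ((one_lt_div hτ).1 hn)).trans (by positivity)

lemma rpow_mul_pow_eq {w τ : ℝ} (hw : 0 < w) (hτ : 0 < τ) (γ β : ℝ) (k : ℕ) :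
    w ^ γ * (w ^ β * w⁻¹ ^ k) * τ ^ k = τ ^ (γ + β) * (w / τ) ^ (γ + β - k) := by
  rw [Real.div_rpow hw.le hτ.le, Real.rpow_sub hw, Real.rpow_sub hτ, Real.rpow_add hw,
    Real.rpow_natCast, Real.rpow_natCast]
  have : τ ^ (γ + β) ≠ 0 := (Real.rpow_pos_of_pos hτ _).ne'
  rw [inv_pow]
  field_simp

lemma exists_exponent_gap (δ : ℝ) :
    ∃ p : ℝ, 0 < p ∧ ∀ k : ℕ, (k : ℝ) < δ → p ≤ δ - k := by
  refine ⟨δ - (⌈δ⌉ - 1), by linarith [Int.ceil_lt_add_one δ], fun k hk => ?_⟩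
  have h1 : (k : ℤ) ≤ ⌈δ⌉ - 1 := Int.le_sub_one_of_lt (Int.lt_ceil.2 (by exact_mod_cast hk))
  have h2 : (k : ℝ) ≤ ⌈δ⌉ - 1 := by exact_mod_cast h1
  linarith

/-! ### Bounds for the pieces of a regularising kernel -/

section Kernel

variable {β ρ : ℝ} {m r : ℕ} {K : Rd d → Rd d → ℝ} {Kn : ℕ → Rd d → Rd d → ℝ}

/-- The Taylor polynomial of order `J` of a distribution convolved with `G`, tested with `ψ`. -/
def taylorPart (G : Rd d → Rd d → ℝ) (T : Distr d) (J : ℕ) (ψ : Rd d → ℝ) (z : Rd d) : ℝ :=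
  ∑ k ∈ multiIndicesLT d (J : ℝ), monoInt ψ z k * extVal T (mixedDeriv G k 0 z)

lemma mlen_lt_of_mem {J : ℕ} {k : Fin d → ℕ} (hk : k ∈ multiIndicesLT d (J : ℝ)) : mlen k < J := by
  exact_mod_cast mem_multiIndicesLT.1 hk

lemma IsRegularisingKernel.regular_mixedDeriv (hK : IsRegularisingKernel β m r ρ K Kn) (n : ℕ)
    {k : Fin d → ℕ} (hk : mlen k ≤ m) (z : Rd d) : ContDiff ℝ r (mixedDeriv (Kn n) k 0 z) ∧
    HasCompactSupport (mixedDeriv (Kn n) k 0 z) := by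
  obtain ⟨C, -, h⟩ := hK.exists_bumpAt_deriv (isCompact_singleton (x := z))
  exact ⟨(h z rfl n k hk).contDiff, (h z rfl n k hk).hasCompactSupport⟩

lemma IsRegularisingKernel.extVal_adjTaylor (hK : IsRegularisingKernel β m r ρ K Kn) {T : Distr d}
    (hT : OrderLE T r) {J : ℕ} (hJ : J ≤ m) (ψ : TestFn d) (z : Rd d) (n : ℕ) :
    extVal T (adjTaylor (Kn n) J ψ z) =
      extVal T (adj (Kn n) ψ) - taylorPart (Kn n) T J ψ z := by
  have hreg := fun k (hk : k ∈ multiIndicesLT d (J : ℝ)) =>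
    hK.regular_mixedDeriv n ((mlen_lt_of_mem hk).le.trans hJ) z
  obtain ⟨h1, h2, h3⟩ := hT.extVal_sum (multiIndicesLT d (J : ℝ)) (fun k => monoInt ψ z k)
    (g := fun k => mixedDeriv (Kn n) k 0 z) (fun k hk => (hreg k hk).1) fun k hk => (hreg k hk).2
  have e : adjTaylor (Kn n) J ψ z = fun y => adj (Kn n) ψ y + -1 *
      ∑ k ∈ multiIndicesLT d (J : ℝ), monoInt ψ z k * mixedDeriv (Kn n) k 0 z y := by
    funext y
    rw [adjTaylor]
    ring
  rw [e, hT.extVal_add (g' := fun y => -1 * ∑ k ∈ multiIndicesLT d (J : ℝ),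
    monoInt ψ z k * mixedDeriv (Kn n) k 0 z y) (hK.contDiff_adj ψ n) (hK.hasCompactSupport_adj ψ n)
    (contDiff_const.mul h1) h2.mul_left, hT.extVal_const_mul h1 h2, h3, taylorPart]
  ring

lemma adjTaylor_zero (G : Rd d → Rd d → ℝ) (u : Rd d → ℝ) (z : Rd d) :
    adjTaylor G 0 u z = adj G u := by
  have h : multiIndicesLT d ((0 : ℕ) : ℝ) = ∅ := Finset.eq_empty_of_forall_notMem fun k hk =>
    (mlen_lt_of_mem hk).not_ge (Nat.zero_le _)
  funext y
  rw [adjTaylor, h, Finset.sum_empty, sub_zero]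

lemma IsRegularisingKernel.rpow_dyadic (hK : IsRegularisingKernel β m r ρ K Kn) (n : ℕ) :
    ((2⁻¹ : ℝ) ^ n) ^ β = (ρ⁻¹) ^ β * (ρ * 2⁻¹ ^ n) ^ β := by
  have hρ := hK.rho_pos
  rw [← Real.mul_rpow (by positivity) (by positivity), ← mul_assoc, inv_mul_cancel₀ hρ.ne', one_mul]

lemma IsRegularisingKernel.rpow_mul_div_pow (hK : IsRegularisingKernel β m r ρ K Kn)
    (n J : ℕ) (τ : ℝ) : ((2⁻¹ : ℝ) ^ n) ^ β * (τ / 2⁻¹ ^ n) ^ J =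
      (ρ⁻¹) ^ β * ρ ^ J * ((ρ * 2⁻¹ ^ n) ^ β * (ρ * 2⁻¹ ^ n)⁻¹ ^ J * τ ^ J) := by
  have hρ := hK.rho_pos
  rw [hK.rpow_dyadic n, div_pow, mul_inv, mul_pow, inv_pow ρ, div_eq_mul_inv, inv_pow (2⁻¹ ^ n)]
  field_simp

/-- The contribution of the scales at most `τ` of a regularising kernel, applied to a distribution
with homogeneous bounds at a point. -/
lemma IsRegularisingKernel.exists_sum_adj_le (hK : IsRegularisingKernel β m r ρ K Kn)
    {L : Set (Rd d)} (hL : IsCompact L) {q : ℕ} (hq : q ≤ r) {a : ℝ} (hab : a + β ≠ 0) (Λ : ℝ) :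
    ∃ C : ℝ, 0 ≤ C ∧ ∀ x ∈ L, ∀ t ∈ Set.Ioc 0 Λ, ∀ τ, t ≤ τ → ∀ (T : Distr d) (A b : ℝ)
      (ψ : TestFn d), OrderLE T r → 0 ≤ A →
      (∀ s, 0 < s → s ≤ 4 * t ∨ (s ≤ 6 * τ ∧ s ≤ 6 * ρ) → BoundedAt T q x s (A * s ^ a)) →
      BumpAt q x t b ψ → ∀ N, ∑ n ∈ Finset.range N,
        (if ρ * 2⁻¹ ^ n ≤ τ then |extVal T (adj (Kn n) ψ)| else 0) ≤
          C * A * b * (if a + β < 0 then t ^ (a + β) else τ ^ (a + β)) := by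
  have hρ := hK.rho_pos
  obtain ⟨C₀, hC₀, h0⟩ := exists_dyadic_sum_le hρ hK.beta_pos hab
  obtain ⟨C₁, hC₁, h1⟩ := hK.exists_bumpAt_fine hL hq Λ
  obtain ⟨C₂, hC₂, h2⟩ := hK.exists_bumpAt_coarse hL (Nat.zero_le m)
  set v := volume.real (Metric.ball (0 : Rd d) 1) with hv
  have hv0 : 0 ≤ v := measureReal_nonneg
  have hM := mollConst_nonneg d q
  set D₁ : ℝ := mollConst d q * C₁ * ρ⁻¹ ^ β * 4 ^ a with hD₁
  set D₂ : ℝ := mollConst d q * C₂ * v * ρ⁻¹ ^ β * 6 ^ a with hD₂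
  have hD₁0 : 0 ≤ D₁ := by positivity
  have hD₂0 : 0 ≤ D₂ := by positivity
  refine ⟨C₀ * (D₁ + D₂), by positivity, fun x hx t ht τ htτ T A b ψ hT hA hTA hψ N => ?_⟩
  have ht0 := ht.1
  have hb := hψ.nonneg ht0
  refine (h0 t τ ((D₁ + D₂) * A * b) ht0 htτ (by positivity) _ (fun n hn => ?_)
    (fun n hn hnτ => ?_) (fun n hn => ?_) N).trans_eq (by ring)
  · rw [if_pos (hn.trans htτ)]
    have e := (hT.extPairing (hK.contDiff_adj ψ n) (hK.hasCompactSupport_adj ψ n)).abs_le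
      (by positivity) (h1 x hx t ht n b ψ hn hψ) (A := A * (4 * t) ^ a) (by
        rw [← mul_assoc]
        norm_num
        exact hTA _ (by positivity) (Or.inl le_rfl))
    refine e.trans ?_
    rw [hK.rpow_dyadic n, Real.mul_rpow (x := 4) (by norm_num) ht0.le]
    calc _ = D₁ * A * b * (t ^ a * (ρ * 2⁻¹ ^ n) ^ β) := by rw [hD₁]; ring
      _ ≤ _ := by
        gcongr
        linarith
  · rw [if_pos hnτ]
    have h3 := h2 x hx n t (v * b) ψ ht0 (by nlinarith) ψ.continuous hψ.supp
      (integral_abs_le_of_bump hψ ht0)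
    rw [adjTaylor_zero, pow_zero, mul_one] at h3
    have hle : (2⁻¹ : ℝ) ^ n ≤ 1 := pow_le_one₀ (by norm_num) (by norm_num)
    have e := (hT.extPairing (hK.contDiff_adj ψ n) (hK.hasCompactSupport_adj ψ n)).abs_le
      (by positivity) (h3.mono (by positivity) hq le_rfl) (A := A * (6 * (ρ * 2⁻¹ ^ n)) ^ a) (by
        rw [← mul_assoc 2]
        norm_num
        refine hTA _ (by positivity) (Or.inr ⟨?_, ?_⟩)
        · norm_num at hnτ; linarith
        · norm_num at hle; nlinarith)
    refine e.trans ?_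
    rw [hK.rpow_dyadic n, Real.mul_rpow (x := 6) (by norm_num) (by positivity),
      Real.rpow_add (show 0 < ρ * 2⁻¹ ^ n by positivity)]
    calc _ = D₂ * A * b * ((ρ * 2⁻¹ ^ n) ^ a * (ρ * 2⁻¹ ^ n) ^ β) := by rw [hD₂]; ring
      _ ≤ _ := by
        gcongr
        linarith
  · rw [if_neg (not_le.2 hn)]

/-- The error made by replacing, at scales at most `τ`, the Taylor remainder by `0`. -/
def taylorErr (Kn : ℕ → Rd d → Rd d → ℝ) (ρ : ℝ) (T : Distr d) (J : ℕ) (ψ : Rd d → ℝ) (z : Rd d)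
    (τ : ℝ) (n : ℕ) : ℝ :=
  if ρ * 2⁻¹ ^ n ≤ τ then |taylorPart (Kn n) T J ψ z| else |extVal T (adjTaylor (Kn n) J ψ z)|

lemma IsRegularisingKernel.exists_abs_deriv_le (hK : IsRegularisingKernel β m r ρ K Kn)
    {L : Set (Rd d)} (hL : IsCompact L) {q : ℕ} (hq : q ≤ r) (γ : ℝ) :
    ∃ C : ℝ, 0 ≤ C ∧ ∀ z ∈ L, ∀ (T : Distr d) (A : ℝ), OrderLE T r → 0 ≤ A →
      (∀ s ∈ Set.Ioc 0 (6 * ρ), BoundedAt T q z s (A * s ^ γ)) →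
      ∀ (n : ℕ) (k : Fin d → ℕ), mlen k ≤ m → |extVal T (mixedDeriv (Kn n) k 0 z)| ≤
        C * A * ((ρ * 2⁻¹ ^ n) ^ γ * ((ρ * 2⁻¹ ^ n) ^ β * (ρ * 2⁻¹ ^ n)⁻¹ ^ mlen k)) := by
  have hρ := hK.rho_pos
  obtain ⟨C, hC, h⟩ := hK.exists_bumpAt_deriv hL
  have hM := mollConst_nonneg d q
  refine ⟨mollConst d q * C * ρ⁻¹ ^ β * (1 + ρ) ^ m * 2 ^ γ, by positivity,
    fun z hz T A hT hA hTA n k hk => ?_⟩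
  have hle : (2⁻¹ : ℝ) ^ n ≤ 1 := pow_le_one₀ (by norm_num) (by norm_num)
  have e := hT.abs_extVal_le (by positivity) (h z hz n k hk) hq
    (hTA (2 * (ρ * 2⁻¹ ^ n)) ⟨by positivity, by nlinarith⟩)
  refine e.trans ?_
  have h1 : ((2⁻¹ : ℝ) ^ n)⁻¹ ^ mlen k ≤ (1 + ρ) ^ m * (ρ * 2⁻¹ ^ n)⁻¹ ^ mlen k := by
    have e1 : ((2⁻¹ : ℝ) ^ n)⁻¹ = ρ * (ρ * 2⁻¹ ^ n)⁻¹ := by field_simp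
    rw [e1, mul_pow]
    gcongr ?_ * _
    exact (pow_le_pow_left₀ hρ.le (by linarith) _).trans
      (pow_le_pow_right₀ (by linarith) hk)
  rw [hK.rpow_dyadic n, Real.mul_rpow (x := 2) (by norm_num) (by positivity)]
  calc _ ≤ mollConst d q * (C * (ρ⁻¹ ^ β * (ρ * 2⁻¹ ^ n) ^ β *
        ((1 + ρ) ^ m * (ρ * 2⁻¹ ^ n)⁻¹ ^ mlen k))) * (A * (2 ^ γ * (ρ * 2⁻¹ ^ n) ^ γ)) := by gcongr
    _ = _ := by ring

lemma IsRegularisingKernel.exists_sum_taylorErr_le (hK : IsRegularisingKernel β m r ρ K Kn)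
    {L : Set (Rd d)} (hL : IsCompact L) {q : ℕ} (hq : q ≤ r) {γ : ℝ} {J : ℕ} (hJ : J ≤ m)
    (hJγ : γ + β < J) (hJ' : ∀ k < J, (k : ℝ) < γ + β) :
    ∃ C : ℝ, 0 ≤ C ∧ ∀ z ∈ L, ∀ (T : Distr d) (A B τ : ℝ) (ψ : TestFn d), OrderLE T r → 0 ≤ A →
      (∀ s ∈ Set.Ioc 0 (6 * ρ), BoundedAt T q z s (A * s ^ γ)) → 0 < τ →
      (∀ y, τ < ‖y - z‖ → ψ y = 0) → ∫ y, |ψ y| ≤ B →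
      ∀ N, ∑ n ∈ Finset.range N, taylorErr Kn ρ T J ψ z τ n ≤ C * A * B * τ ^ (γ + β) := by
  have hρ := hK.rho_pos
  obtain ⟨C₁, hC₁, h1⟩ := hK.exists_abs_deriv_le hL hq γ
  obtain ⟨C₂, hC₂, h2⟩ := hK.exists_bumpAt_coarse hL hJ
  obtain ⟨p, hp, hpk⟩ := exists_exponent_gap (γ + β)
  have hM := mollConst_nonneg d q
  have hJ0 : 0 < (J : ℝ) - (γ + β) := by linarith
  set R : ℝ := ((multiIndicesLT d (J : ℝ)).card : ℝ) with hR
  set D₂ : ℝ := mollConst d q * C₂ * ρ⁻¹ ^ β * ρ ^ J * 6 ^ γ with hD₂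
  have hD₁0 : 0 ≤ R * C₁ := by positivity
  have hD₂0 : 0 ≤ D₂ := by positivity
  have hg1 := geomConst_pos hp
  have hg2 := geomConst_pos hJ0
  refine ⟨(R * C₁ + D₂) * (geomConst p + geomConst (J - (γ + β))), by positivity,
    fun z hz T A B τ ψ hT hA hTA hτ hψs hψB N => ?_⟩
  have hB : 0 ≤ B := (integral_nonneg fun _ => abs_nonneg _).trans hψB
  refine (sum_two_sided_le hp hJ0 (div_pos hρ hτ) (A := (R * C₁ + D₂) * A * B * τ ^ (γ + β))
    (by positivity) (fun n hn => ?_) (fun n hn => ?_) N).trans_eq (by ring)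
  · rw [div_mul_eq_mul_div] at hn ⊢
    rw [taylorErr, if_pos ((div_le_one hτ).1 hn)]
    refine (Finset.abs_sum_le_sum_abs _ _).trans ?_
    have hterm : ∀ k ∈ multiIndicesLT d (J : ℝ),
        |monoInt ψ z k * extVal T (mixedDeriv (Kn n) k 0 z)| ≤
          C₁ * A * B * τ ^ (γ + β) * (ρ * 2⁻¹ ^ n / τ) ^ p := by
      intro k hk
      have hkJ := mlen_lt_of_mem hk
      rw [abs_mul]
      calc _ ≤ B * τ ^ mlen k * (C₁ * A * ((ρ * 2⁻¹ ^ n) ^ γ *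
            ((ρ * 2⁻¹ ^ n) ^ β * (ρ * 2⁻¹ ^ n)⁻¹ ^ mlen k))) :=
            mul_le_mul (abs_monoInt_le ψ.continuous ψ.hasCompactSupport hψs hψB hτ.le k)
              (h1 z hz T A hT hA hTA n k (hkJ.le.trans hJ)) (abs_nonneg _) (by positivity)
        _ = C₁ * A * B * ((ρ * 2⁻¹ ^ n) ^ γ *
            ((ρ * 2⁻¹ ^ n) ^ β * (ρ * 2⁻¹ ^ n)⁻¹ ^ mlen k) * τ ^ mlen k) := by ring
        _ = C₁ * A * B * (τ ^ (γ + β) * (ρ * 2⁻¹ ^ n / τ) ^ (γ + β - mlen k)) := by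
            rw [rpow_mul_pow_eq (by positivity) hτ]
        _ ≤ C₁ * A * B * (τ ^ (γ + β) * (ρ * 2⁻¹ ^ n / τ) ^ p) := by
            gcongr ?_ * (?_ * ?_)
            exact Real.rpow_le_rpow_of_exponent_ge (by positivity) hn (hpk _ (hJ' _ hkJ))
        _ = _ := by ring
    refine (Finset.sum_le_sum hterm).trans ?_
    rw [Finset.sum_const, nsmul_eq_mul, ← hR]
    calc _ = R * C₁ * A * B * τ ^ (γ + β) * (ρ * 2⁻¹ ^ n / τ) ^ p := by ring
      _ ≤ _ := by
        gcongr
        linarith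
  · rw [div_mul_eq_mul_div] at hn ⊢
    have hn' := (one_lt_div hτ).1 hn
    rw [taylorErr, if_neg (not_le.2 hn')]
    have hle : (2⁻¹ : ℝ) ^ n ≤ 1 := pow_le_one₀ (by norm_num) (by norm_num)
    have h3 := h2 z hz n τ B ψ hτ (by nlinarith) ψ.continuous hψs hψB
    have e := hT.abs_extVal_le (by positivity) h3 hq (A := A * (6 * (ρ * 2⁻¹ ^ n)) ^ γ) (by
        rw [← mul_assoc 2]
        norm_num
        refine hTA _ ⟨by positivity, ?_⟩
        norm_num at hle
        nlinarith)
    refine e.trans ?_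
    rw [hK.rpow_mul_div_pow, Real.mul_rpow (x := 6) (by norm_num) (by positivity)]
    calc _ = D₂ * A * B * ((ρ * 2⁻¹ ^ n) ^ γ *
            ((ρ * 2⁻¹ ^ n) ^ β * (ρ * 2⁻¹ ^ n)⁻¹ ^ J) * τ ^ J) := by rw [hD₂]; ring
      _ = D₂ * A * B * τ ^ (γ + β) * (ρ * 2⁻¹ ^ n / τ) ^ (-((J : ℝ) - (γ + β))) := by
        rw [rpow_mul_pow_eq (by positivity) hτ, neg_sub]
        ring
      _ ≤ _ := by
        gcongr
        linarith

lemma IsRegularisingKernel.abs_extVal_adjTaylor_le (hK : IsRegularisingKernel β m r ρ K Kn)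
    {T : Distr d} (hT : OrderLE T r) {J : ℕ} (hJ : J ≤ m) (ψ : TestFn d) (z : Rd d) (τ : ℝ) (n : ℕ) :
    |extVal T (adjTaylor (Kn n) J ψ z)| ≤
      (if ρ * 2⁻¹ ^ n ≤ τ then |extVal T (adj (Kn n) ψ)| else 0) + taylorErr Kn ρ T J ψ z τ n := by
  rw [taylorErr]
  split_ifs
  · rw [hK.extVal_adjTaylor hT hJ]
    exact abs_sub _ _
  · rw [zero_add]

lemma IsRegularisingKernel.abs_extVal_adjTaylor_sub_le (hK : IsRegularisingKernel β m r ρ K Kn)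
    {T T' : Distr d} (hT : OrderLE T r) (hT' : OrderLE T' r) {J : ℕ} (hJ : J ≤ m) (ψ : TestFn d)
    (z z' : Rd d) (τ : ℝ) (n : ℕ) :
    |extVal T (adjTaylor (Kn n) J ψ z) - extVal T' (adjTaylor (Kn n) J ψ z')| ≤
      (if ρ * 2⁻¹ ^ n ≤ τ then |extVal (T - T') (adj (Kn n) ψ)| else 0) +
        (taylorErr Kn ρ T J ψ z τ n + taylorErr Kn ρ T' J ψ z' τ n) := by
  rw [taylorErr, taylorErr]
  split_ifs
  · rw [hK.extVal_adjTaylor hT hJ, hK.extVal_adjTaylor hT' hJ, hT.extVal_sub_distr hT'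
      (hK.contDiff_adj ψ n) (hK.hasCompactSupport_adj ψ n)]
    rw [abs_le]
    constructor <;>
    linarith [abs_le.1 (le_refl |extVal T (adj (Kn n) ψ) - extVal T' (adj (Kn n) ψ)|),
      abs_le.1 (le_refl |taylorPart (Kn n) T J ψ z|), abs_le.1 (le_refl |taylorPart (Kn n) T' J ψ z'|)]
  · rw [zero_add]
    exact abs_sub _ _

end Kernel

/-! ### Derivatives of monomials -/

/-- The normalised monomial `z^l / l!`. -/
def nmono (l : Fin d → ℕ) (z : Rd d) : ℝ := mpow z l / mfact l

lemma hasFDerivAt_nmono (l : Fin d → ℕ) (z : Rd d) : HasFDerivAt (nmono l)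
    (gradForm fun i => if 1 ≤ l i then nmono (l - unitIdx i) z else 0) z := by
  have h1 : ∀ i ∈ (Finset.univ : Finset (Fin d)), HasFDerivAt (fun w : Rd d => w i ^ l i)
      ((l i * z i ^ (l i - 1)) • (EuclideanSpace.proj i : Rd d →L[ℝ] ℝ)) z := fun i _ => by
    have := (EuclideanSpace.proj i : Rd d →L[ℝ] ℝ).hasFDerivAt (x := z)
    exact (this.pow (l i)).congr_fderiv (by ext; simp)
  have h2 := (HasFDerivAt.finsetProd h1).mul_const (mfact l)⁻¹
  refine h2.congr_fderiv ?_
  ext v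
  simp only [gradForm_apply, _root_.smul_apply, _root_.sum_apply,
    smul_eq_mul, Finset.mul_sum]
  refine Finset.sum_congr rfl fun i _ => ?_
  have hv : (EuclideanSpace.proj i : Rd d →L[ℝ] ℝ) v = v i := rfl
  rw [hv]
  split_ifs with h
  · have hu : ∀ j ∈ Finset.univ.erase i, (l - unitIdx i) j = l j := fun j hj => by
      simp [unitIdx, Finset.ne_of_mem_erase hj]
    have hi : (l - unitIdx i) i = l i - 1 := by simp [unitIdx]
    have e1 : mpow z (l - unitIdx i) =
        z i ^ (l i - 1) * ∏ j ∈ Finset.univ.erase i, z j ^ l j := by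
      rw [mpow, ← Finset.mul_prod_erase _ _ (Finset.mem_univ i), hi]
      congr 1
      exact Finset.prod_congr rfl fun j hj => by rw [hu j hj]
    have e2 : mfact l = l i * mfact (l - unitIdx i) := by
      rw [mfact, mfact, ← Finset.mul_prod_erase _ _ (Finset.mem_univ i),
        ← Finset.mul_prod_erase _ _ (Finset.mem_univ i), hi, ← mul_assoc, ← Nat.cast_mul,
        Nat.mul_factorial_pred (by omega)]
      congr 1
      exact Finset.prod_congr rfl fun j hj => by rw [hu j hj]
    have h3 := (mfact_pos (l - unitIdx i)).ne'
    have h4 : (l i : ℝ) ≠ 0 := by exact_mod_cast (by omega : l i ≠ 0)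
    rw [nmono, e1, e2]
    field_simp
  · rw [show l i = 0 by omega]
    simp

open Classical in
lemma isDerivFamily_nmono (r : ℕ) (l : Fin d → ℕ) :
    IsDerivFamily r fun k z => if k ≤ l then nmono (l - k) z else 0 := by
  refine ⟨fun k _ => ?_, fun k _ z => ?_⟩
  · split_ifs
    · exact (continuous_mpow _).div_const _
    · exact continuous_const
  · by_cases h : k ≤ l
    · simp only [if_pos h]
      refine (hasFDerivAt_nmono (l - k) z).congr_fderiv ?_
      congr 1
      funext i
      have e : l - k - unitIdx i = l - (k + unitIdx i) := by rw [tsub_tsub]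
      have hiff : 1 ≤ (l - k) i ↔ k + unitIdx i ≤ l := by
        constructor
        · intro h1 j
          have h2 := h j
          by_cases hj : j = i
          · subst hj
            simp [unitIdx] at h1 ⊢
            omega
          · simpa [unitIdx, hj] using h2
        · intro h1
          have := h1 i
          simp [unitIdx] at this ⊢
          omega
      simp only [hiff, e]
    · have h2 : ∀ i, ¬ k + unitIdx i ≤ l := fun i hi => h (le_trans (by simp) hi)
      simp only [if_neg h, h2, if_false]
      refine (hasFDerivAt_const (0 : ℝ) z).congr_fderiv ?_
      ext v
      simp [gradForm_apply]

open Classical in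
lemma partialDeriv_nmono (k l : Fin d → ℕ) :
    partialDeriv k (nmono l) = fun z => if k ≤ l then nmono (l - k) z else 0 := by
  have := (isDerivFamily_nmono (mlen k) l).partialDeriv_zero_eq le_rfl
  simpa using this

lemma contDiff_nmono (n : ℕ) (l : Fin d → ℕ) : ContDiff ℝ n (nmono l) := by
  have := (isDerivFamily_nmono n l).contDiff_zero'
  simpa using this

lemma integral_deriv_mul_nmono {δ : ℝ} {η : TestFn d} (h1 : ∫ z, η z = 1)
    (h : ∀ l : Fin d → ℕ, 1 ≤ mlen l → (mlen l : ℝ) < δ → ∫ z, η z * mpow z l = 0)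
    (k l : Fin d → ℕ) (hl : (mlen l : ℝ) < δ) :
    ∫ z, derivTest k η z * nmono l z = if l = k then (-1) ^ mlen k else 0 := by
  have e := integral_mul_partialDeriv (k := k) (contDiff_testFn η _) η.hasCompactSupport
    (contDiff_nmono _ l)
  have h2 : (-1 : ℝ) ^ mlen k * (-1) ^ mlen k = 1 := by rw [← mul_pow]; norm_num
  have e' : ∫ z, derivTest k η z * nmono l z = (-1) ^ mlen k * ∫ z, η z * partialDeriv k (nmono l) z := by
    rw [e, ← mul_assoc, h2, one_mul]
    rfl
  rw [e', partialDeriv_nmono]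
  by_cases hlk : l = k
  · subst hlk
    simp [nmono, mpow_zero, mfact, h1]
  · rw [if_neg hlk, mul_eq_zero]
    right
    by_cases hkl : k ≤ l
    · simp only [if_pos hkl]
      have hne : 1 ≤ mlen (l - k) := by
        rw [Nat.one_le_iff_ne_zero]
        intro h0
        have h3 : ∀ i, (l - k) i = 0 := by simpa [mlen] using h0
        exact hlk (funext fun i => by have := h3 i; have := hkl i; simp at *; omega)
      have hle : mlen (l - k) ≤ mlen l := Finset.sum_le_sum fun i _ => Nat.sub_le _ _
      have hle' : (mlen (l - k) : ℝ) ≤ mlen l := by exact_mod_cast hle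
      have := h (l - k) hne (by linarith)
      simp only [nmono, mul_div_assoc', integral_div, this, zero_div]
    · simp [hkl]

lemma monoInt_scaled (φ : TestFn d) (x : Rd d) {t : ℝ} (ht : 0 < t) (l : Fin d → ℕ) :
    monoInt (scaled φ x t) x l = t ^ mlen l * ∫ z, φ z * nmono l z := by
  rw [monoInt, integral_scaled_mul φ x ht fun y => mpow (y - x) l / mfact l, ← integral_const_mul]
  refine integral_congr_ae (Eventually.of_forall fun z => ?_)
  simp only [add_sub_cancel_left, mpow_smul, nmono]
  ring

lemma derivTest_scaled (k : Fin d → ℕ) (φ : TestFn d) (x : Rd d) {t : ℝ} (ht : 0 < t) :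
    derivTest k (scaled φ x t) = t⁻¹ ^ mlen k • scaled (derivTest k φ) x t := by
  ext y
  have h1 := congrFun (partialDeriv_scaled k φ x ht) y
  have h2 := scaled_apply (derivTest k φ) x ht y
  change partialDeriv k (scaled φ x t) y = t⁻¹ ^ mlen k * scaled (derivTest k φ) x t y
  rw [h1, h2, coe_derivTest, pow_add]
  ring

/-! ### Pointwise derivatives -/

lemma HasPointDeriv.unique {δ : ℝ} {f : Distr d} {x : Rd d} {k : Fin d → ℕ} {v v' : ℝ}
    (h : HasPointDeriv δ f x k v) (h' : HasPointDeriv δ f x k v') : v = v' := by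
  have hη := isMoll_moll d ⌈δ⌉₊
  have hm : ∀ l : Fin d → ℕ, 1 ≤ mlen l → (mlen l : ℝ) < δ → ∫ z, moll d ⌈δ⌉₊ z * mpow z l = 0 :=
    fun l h1 h2 => hη.moment l h1 (Nat.lt_ceil.2 h2)
  exact tendsto_nhds_unique (h _ hη.integral_eq hm) (h' _ hη.integral_eq hm)

lemma HasPointDeriv.pointDeriv_eq {δ : ℝ} {f : Distr d} {x : Rd d} {k : Fin d → ℕ} {v : ℝ}
    (h : HasPointDeriv δ f x k v) : pointDeriv δ f x k = v := by
  have hex : ∃ v, HasPointDeriv δ f x k v := ⟨v, h⟩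
  rw [pointDeriv, dif_pos hex]
  exact hex.choose_spec.unique h

/-- The coefficients of a polynomial approximating a distribution at a point to order `δ` are its
pointwise derivatives. -/
lemma hasPointDeriv_of_approx {δ : ℝ} {g : Distr d} {x : Rd d} {c : (Fin d → ℕ) → ℝ}
    (h : ∀ φ : TestFn d, ∃ C t₀ : ℝ, 0 < t₀ ∧ ∀ t ∈ Set.Ioc 0 t₀, |g (scaled φ x t) -
      ∑ l ∈ multiIndicesLT d δ, monoInt (scaled φ x t) x l * c l| ≤ C * t ^ δ)
    {k : Fin d → ℕ} (hk : (mlen k : ℝ) < δ) : HasPointDeriv δ g x k (c k) := by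
  intro η h1 hη
  obtain ⟨C, t₀, ht₀, hC⟩ := h (derivTest k η)
  have hkey : ∀ t ∈ Set.Ioc 0 t₀, |distrDeriv k g (scaled η x t) - c k| ≤ C * t ^ (δ - mlen k) := by
    intro t ht
    have hsum : ∑ l ∈ multiIndicesLT d δ, monoInt (scaled (derivTest k η) x t) x l * c l =
        t ^ mlen k * (-1) ^ mlen k * c k := by
      rw [Finset.sum_eq_single k]
      · rw [monoInt_scaled _ _ ht.1, integral_deriv_mul_nmono h1 hη k k hk, if_pos rfl]
      · intro l hl hlk
        rw [monoInt_scaled _ _ ht.1, integral_deriv_mul_nmono h1 hη k l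
          (mem_multiIndicesLT.1 hl), if_neg hlk]
        ring
      · intro hk'
        exact absurd (mem_multiIndicesLT.2 hk) hk'
    have h2 := hC t ht
    rw [hsum] at h2
    rw [distrDeriv_apply, derivTest_scaled k η x ht.1, map_smul, smul_eq_mul]
    have h3 : (-1 : ℝ) ^ mlen k * (-1) ^ mlen k = 1 := by rw [← mul_pow]; norm_num
    have h4 : t⁻¹ ^ mlen k * t ^ mlen k = 1 := by
      rw [← mul_pow, inv_mul_cancel₀ ht.1.ne', one_pow]
    have e : (-1) ^ mlen k * (t⁻¹ ^ mlen k * g (scaled (derivTest k η) x t)) - c k =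
        (-1) ^ mlen k * t⁻¹ ^ mlen k * (g (scaled (derivTest k η) x t) -
          t ^ mlen k * (-1) ^ mlen k * c k) := by
      linear_combination c k * (t⁻¹ ^ mlen k * t ^ mlen k) * h3 + c k * h4
    have h5 : 0 ≤ t⁻¹ ^ mlen k := pow_nonneg (inv_nonneg.2 ht.1.le) _
    rw [e, abs_mul, abs_mul, abs_pow, abs_neg, abs_one, one_pow, one_mul, abs_of_nonneg h5]
    calc _ ≤ t⁻¹ ^ mlen k * (C * t ^ δ) := mul_le_mul_of_nonneg_left h2 h5
      _ = _ := by rw [Real.rpow_sub ht.1, Real.rpow_natCast, inv_pow]; field_simp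
  have hlim : Tendsto (fun t : ℝ => C * t ^ (δ - mlen k)) (𝓝[>] 0) (𝓝 0) := by
    have h6 : ContinuousAt (fun t : ℝ => t ^ (δ - mlen k)) 0 :=
      Real.continuousAt_rpow_const _ _ (Or.inr (by linarith))
    have h7 := h6.tendsto.const_mul C
    rw [Real.zero_rpow (by linarith), mul_zero] at h7
    exact h7.mono_left nhdsWithin_le_nhds
  rw [tendsto_iff_norm_sub_tendsto_zero]
  refine squeeze_zero' (Eventually.of_forall fun t => norm_nonneg _) ?_ hlim
  filter_upwards [Ioc_mem_nhdsGT ht₀] with t ht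
  exact hkey t ht

lemma taylorDistr_apply (δ : ℝ) (f : Distr d) (x : Rd d) (ψ : TestFn d) :
    taylorDistr δ f x ψ = ∑ k ∈ multiIndicesLT d δ, monoInt ψ x k * pointDeriv δ f x k := by
  have hmc : ∀ k : Fin d → ℕ, Continuous fun y => mpow (y - x) k / mfact k := fun k =>
    ((continuous_mpow k).comp (continuous_id.sub continuous_const)).div_const _
  have hc : Continuous (taylorPoly δ f x) :=
    continuous_finsetSum _ fun k _ => continuous_const.mul (hmc k)
  have e : taylorDistr δ f x ψ = ∫ y, ψ y * taylorPoly δ f x y :=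
    TestFunction.integralAgainstBilinCLM_eq_integral (hc.locallyIntegrable.locallyIntegrableOn _)
  rw [e]
  simp only [taylorPoly, Finset.mul_sum]
  rw [integral_finsetSum]
  · refine Finset.sum_congr rfl fun k _ => ?_
    rw [monoInt, ← integral_mul_const]
    refine integral_congr_ae (Eventually.of_forall fun y => ?_)
    simp only
    ring
  · exact fun k _ => integrable_mul_of_continuous ψ.continuous ψ.hasCompactSupport
      (continuous_const.mul (hmc k))

/-! ### Homogeneity and coherence of the lifted difference -/

section Kernel

variable {β ρ : ℝ} {m r : ℕ} {K : Rd d → Rd d → ℝ} {Kn : ℕ → Rd d → Rd d → ℝ}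

/-- Partial sums of a distribution integrated against a kernel, minus its Taylor polynomial. -/
def partialDiff (Kn : ℕ → Rd d → Rd d → ℝ) (J : ℕ) (T : Distr d) (x : Rd d) (ψ : TestFn d)
    (N : ℕ) : ℝ := ∑ n ∈ Finset.range N, extVal T (adjTaylor (Kn n) J ψ x)

lemma IsRegularisingKernel.exists_abs_partialDiff_le (hK : IsRegularisingKernel β m r ρ K Kn)
    {L : Set (Rd d)} (hL : IsCompact L) {q : ℕ} (hq : q ≤ r) {γ : ℝ} {J : ℕ} (hJ : J ≤ m)
    (hJγ : γ + β < J) (hJ' : ∀ k < J, (k : ℝ) < γ + β) (hγβ : γ + β ≠ 0) {Λ S : ℝ}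
    (hΛS : 4 * Λ ≤ S) (hρS : 6 * ρ ≤ S) :
    ∃ C : ℝ, 0 ≤ C ∧ ∀ x ∈ L, ∀ t ∈ Set.Ioc 0 Λ, ∀ (T : Distr d) (A b : ℝ) (ψ : TestFn d),
      OrderLE T r → 0 ≤ A → (∀ s ∈ Set.Ioc 0 S, BoundedAt T q x s (A * s ^ γ)) →
      BumpAt q x t b ψ → ∀ N, |partialDiff Kn J T x ψ N| ≤ C * A * b * t ^ (γ + β) := by
  obtain ⟨C₁, hC₁, h1⟩ := hK.exists_sum_adj_le hL hq hγβ Λ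
  obtain ⟨C₂, hC₂, h2⟩ := hK.exists_sum_taylorErr_le hL hq hJ hJγ hJ'
  set v := volume.real (Metric.ball (0 : Rd d) 1) with hv
  have hv0 : 0 ≤ v := measureReal_nonneg
  refine ⟨C₁ + C₂ * v, by positivity, fun x hx t ht T A b ψ hT hA hTA hψ N => ?_⟩
  have e1 := h1 x hx t ht t le_rfl T A b ψ hT hA (fun s hs hs' => hTA s ⟨hs, by
    rcases hs' with hs' | ⟨-, hs'⟩ <;> linarith [ht.2]⟩) hψ N
  have e2 := h2 x hx T A (v * b) t ψ hT hA (fun s hs => hTA s ⟨hs.1, hs.2.trans hρS⟩) ht.1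
    hψ.supp (integral_abs_le_of_bump hψ ht.1) N
  rw [ite_self] at e1
  calc |partialDiff Kn J T x ψ N|
      ≤ ∑ n ∈ Finset.range N, |extVal T (adjTaylor (Kn n) J ψ x)| :=
        Finset.abs_sum_le_sum_abs _ _
    _ ≤ ∑ n ∈ Finset.range N, ((if ρ * 2⁻¹ ^ n ≤ t then |extVal T (adj (Kn n) ψ)| else 0) +
        taylorErr Kn ρ T J ψ x t n) :=
        Finset.sum_le_sum fun n _ => hK.abs_extVal_adjTaylor_le hT hJ ψ x t n
    _ ≤ _ := by
        rw [Finset.sum_add_distrib]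
        exact (add_le_add e1 e2).trans_eq (by ring)

lemma IsRegularisingKernel.exists_abs_partialDiff_sub_le
    (hK : IsRegularisingKernel β m r ρ K Kn)
    {L : Set (Rd d)} (hL : IsCompact L) {q : ℕ} (hq : q ≤ r) {α γ : ℝ} (hαγ : α ≤ γ)
    (hαβ : α + β ≠ 0) {J : ℕ} (hJ : J ≤ m)
    (hJγ : γ + β < J) (hJ' : ∀ k < J, (k : ℝ) < γ + β) (hγβ : γ + β ≠ 0) {Λ S : ℝ}
    (hΛS : 8 * Λ ≤ S) (hρS : 6 * ρ ≤ S) :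
    ∃ C : ℝ, 0 ≤ C ∧ ∀ x ∈ L, ∀ y ∈ L, ∀ t ∈ Set.Ioc 0 Λ, ∀ (T T' : Distr d) (A b : ℝ)
      (ψ : TestFn d), OrderLE T r → OrderLE T' r → 0 ≤ A →
      (∀ s ∈ Set.Ioc 0 S, BoundedAt T q x s (A * s ^ γ)) →
      (∀ s ∈ Set.Ioc 0 S, BoundedAt T' q y s (A * s ^ γ)) →
      (∀ s ∈ Set.Ioc 0 S,
        BoundedAt (T' - T) q x s (A * (s ^ α * (‖y - x‖ + s) ^ (γ - α)))) →
      BumpAt q x t b ψ → ∀ N, |partialDiff Kn J T' y ψ N - partialDiff Kn J T x ψ N| ≤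
        C * A * b * (t ^ min (α + β) 0 * (‖y - x‖ + t) ^ (γ + β - min (α + β) 0)) := by
  have hρ := hK.rho_pos
  obtain ⟨C₀, hC₀, h0⟩ := hK.exists_abs_partialDiff_le hL hq hJ hJγ hJ' hγβ (Λ := 2 * Λ)
    (by linarith) hρS
  obtain ⟨C₁, hC₁, h1⟩ := hK.exists_sum_adj_le hL hq hαβ Λ
  obtain ⟨C₂, hC₂, h2⟩ := hK.exists_sum_taylorErr_le hL hq hJ hJγ hJ'
  set v := volume.real (Metric.ball (0 : Rd d) 1) with hv
  have hv0 : 0 ≤ v := measureReal_nonneg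
  set α' := min (α + β) 0 with hα'
  have hα'0 : α' ≤ 0 := min_le_right _ _
  have hα'γ : 0 ≤ γ + β - α' := by have := min_le_left (α + β) 0; linarith
  set E₀ := C₀ * 2 ^ (d + q) * 2 ^ (γ + β) + C₀ with hE₀
  set E₁ := C₁ * 13 ^ (γ - α) * (1 + 2 ^ (α + β)) with hE₁
  set E₂ := 2 * (C₂ * v * 2 ^ (γ + β)) with hE₂
  have hE₀0 : 0 ≤ E₀ := by positivity
  have hE₁0 : 0 ≤ E₁ := by positivity
  have hE₂0 : 0 ≤ E₂ := by positivity
  refine ⟨E₀ + E₁ + E₂, by positivity,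
    fun x hx y hy t ht T T' A b ψ hT hT' hA hTA hTA' hTT hψ N => ?_⟩
  have ht0 := ht.1
  have hb := hψ.nonneg ht0
  set h := ‖y - x‖ with hh
  have hh0 : 0 ≤ h := norm_nonneg _
  have hX0 : 0 ≤ t ^ α' * (h + t) ^ (γ + β - α') := by positivity
  rcases le_or_gt h t with hht | hht
  · have e1 := h0 x hx t ⟨ht0, by linarith [ht.2]⟩ T A b ψ hT hA hTA hψ N
    have hψ' : BumpAt q y (2 * t) (b * 2 ^ (d + q)) ψ := by
      have := hψ.enlarge (x' := y) (t' := 2 * t) ht0 (by rw [norm_sub_rev]; linarith)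
      rwa [mul_div_cancel_right₀ _ ht0.ne'] at this
    have e2 := h0 y hy (2 * t) ⟨by linarith, by linarith [ht.2]⟩ T' A _ ψ hT' hA hTA' hψ' N
    have e3 : t ^ (γ + β) ≤ t ^ α' * (h + t) ^ (γ + β - α') := by
      calc t ^ (γ + β) = t ^ α' * t ^ (γ + β - α') := by
            rw [← Real.rpow_add ht0]; congr 1; ring
        _ ≤ _ := by gcongr; linarith
    calc _ ≤ |partialDiff Kn J T' y ψ N| + |partialDiff Kn J T x ψ N| := abs_sub _ _
      _ ≤ C₀ * A * (b * 2 ^ (d + q)) * (2 * t) ^ (γ + β) + C₀ * A * b * t ^ (γ + β) :=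
        add_le_add e2 e1
      _ = E₀ * A * b * t ^ (γ + β) := by
        rw [Real.mul_rpow (by norm_num) ht0.le, hE₀]; ring
      _ ≤ E₀ * A * b * (t ^ α' * (h + t) ^ (γ + β - α')) := by gcongr
      _ ≤ _ := by gcongr; linarith
  · have hh1 : 0 < h := ht0.trans hht
    have hτ : 0 < 2 * h := by linarith
    have e3 : t ^ α' * h ^ (γ + β - α') ≤ t ^ α' * (h + t) ^ (γ + β - α') := by
      gcongr; linarith
    have e4 : h ^ (γ + β) ≤ t ^ α' * h ^ (γ + β - α') := by
      calc h ^ (γ + β) = h ^ α' * h ^ (γ + β - α') := by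
            rw [← Real.rpow_add hh1]; congr 1; ring
        _ ≤ _ := by
          gcongr ?_ * _
          exact Real.rpow_le_rpow_of_nonpos ht0 hht.le hα'0
    -- the difference at small scales
    have d1 := h1 x hx t ht (2 * h) (by linarith) (T' - T) (A * (13 * h) ^ (γ - α)) b ψ
      (hT'.sub hT) (by positivity) (fun s hs hs' => by
        have hsS : s ∈ Set.Ioc 0 S := ⟨hs, by rcases hs' with hs' | ⟨-, hs'⟩ <;> linarith [ht.2]⟩
        have hs13 : h + s ≤ 13 * h := by rcases hs' with hs' | ⟨hs', -⟩ <;> linarith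
        refine fun φ hφ => (hTT s hsS φ hφ).trans ?_
        rw [mul_assoc, mul_comm ((13 * h) ^ (γ - α))]
        gcongr) hψ N
    have d2 : h ^ (γ - α) * (if α + β < 0 then t ^ (α + β) else (2 * h) ^ (α + β)) ≤
        (1 + 2 ^ (α + β)) * (t ^ α' * h ^ (γ + β - α')) := by
      split_ifs with hneg
      · rw [hα', min_eq_left hneg.le]
        have : h ^ (γ - α) * t ^ (α + β) = 1 * (t ^ (α + β) * h ^ (γ + β - (α + β))) := by
          rw [one_mul, mul_comm]; congr 2; ring
        rw [this]
        gcongr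
        linarith [Real.rpow_nonneg (show (0 : ℝ) ≤ 2 by norm_num) (α + β)]
      · rw [hα', min_eq_right (not_lt.1 hneg), Real.rpow_zero, one_mul, sub_zero,
          Real.mul_rpow (by norm_num) hh0]
        have : h ^ (γ - α) * (2 ^ (α + β) * h ^ (α + β)) = 2 ^ (α + β) * h ^ (γ + β) := by
          rw [mul_left_comm, ← Real.rpow_add hh1]; congr 2; ring
        rw [this]
        gcongr
        linarith
    have hsupp : ∀ w, 2 * h < ‖w - x‖ → ψ w = 0 := fun w hw => hψ.supp w (by linarith)
    have hsupp' : ∀ w, 2 * h < ‖w - y‖ → ψ w = 0 := fun w hw => hψ.supp w (by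
      have := norm_sub_le_norm_sub_add_norm_sub w x y
      rw [norm_sub_rev x y] at this
      linarith)
    have hI := integral_abs_le_of_bump hψ ht0
    have q1 := h2 x hx T A (v * b) (2 * h) ψ hT hA (fun s hs => hTA s ⟨hs.1, hs.2.trans hρS⟩) hτ
      hsupp hI N
    have q2 := h2 y hy T' A (v * b) (2 * h) ψ hT' hA (fun s hs => hTA' s ⟨hs.1, hs.2.trans hρS⟩)
      hτ hsupp' hI N
    calc |partialDiff Kn J T' y ψ N - partialDiff Kn J T x ψ N|
        ≤ ∑ n ∈ Finset.range N, ((if ρ * 2⁻¹ ^ n ≤ 2 * h then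
            |extVal (T' - T) (adj (Kn n) ψ)| else 0) +
            (taylorErr Kn ρ T' J ψ y (2 * h) n + taylorErr Kn ρ T J ψ x (2 * h) n)) := by
          rw [partialDiff, partialDiff, ← Finset.sum_sub_distrib]
          exact (Finset.abs_sum_le_sum_abs _ _).trans (Finset.sum_le_sum fun n _ =>
            hK.abs_extVal_adjTaylor_sub_le hT' hT hJ ψ y x (2 * h) n)
      _ ≤ C₁ * (A * (13 * h) ^ (γ - α)) * b *
            (if α + β < 0 then t ^ (α + β) else (2 * h) ^ (α + β)) +
          (C₂ * A * (v * b) * (2 * h) ^ (γ + β) + C₂ * A * (v * b) * (2 * h) ^ (γ + β)) := by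
          rw [Finset.sum_add_distrib, Finset.sum_add_distrib]
          exact add_le_add d1 (add_le_add q2 q1)
      _ = C₁ * 13 ^ (γ - α) * A * b * (h ^ (γ - α) *
            (if α + β < 0 then t ^ (α + β) else (2 * h) ^ (α + β))) +
          E₂ * A * b * h ^ (γ + β) := by
          rw [Real.mul_rpow (x := 13) (by norm_num) hh0, hE₂,
            Real.mul_rpow (x := 2) (z := γ + β) (by norm_num) hh0]
          ring
      _ ≤ C₁ * 13 ^ (γ - α) * A * b * ((1 + 2 ^ (α + β)) * (t ^ α' * h ^ (γ + β - α'))) +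
          E₂ * A * b * (t ^ α' * h ^ (γ + β - α')) := by gcongr
      _ = (E₁ + E₂) * A * b * (t ^ α' * h ^ (γ + β - α')) := by rw [hE₁]; ring
      _ ≤ (E₀ + E₁ + E₂) * A * b * (t ^ α' * (h + t) ^ (γ + β - α')) := by
          gcongr
          linarith

lemma IsRegularisingKernel.tendsto_partialDiff (hK : IsRegularisingKernel β m r ρ K Kn)
    {q : ℕ} (hq : q ≤ r) {γ : ℝ} {J : ℕ} (hJ : J ≤ m) (hJ' : ∀ k < J, (k : ℝ) < γ + β)
    {T : Distr d} (hT : OrderLE T r) {x : Rd d} {A : ℝ} (hA : 0 ≤ A)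
    (hTA : ∀ s ∈ Set.Ioc 0 (6 * ρ), BoundedAt T q x s (A * s ^ γ)) (ψ : TestFn d) :
    Tendsto (partialDiff Kn J T x ψ) atTop (𝓝 (kernelInt Kn T ψ -
      ∑ k ∈ multiIndicesLT d (J : ℝ), monoInt ψ x k *
        ∑' n, extVal T (mixedDeriv (Kn n) k 0 x))) := by
  have hρ := hK.rho_pos
  obtain ⟨C, hC, h⟩ := hK.exists_abs_deriv_le (isCompact_singleton (x := x)) hq γ
  have h1 := (hK.exists_isKernelInt hT).isKernelInt.tendsto ψ
  have hsum : ∀ k ∈ multiIndicesLT d (J : ℝ), Summable fun n =>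
      extVal T (mixedDeriv (Kn n) k 0 x) := by
    intro k hk
    have hkJ := mlen_lt_of_mem hk
    refine Summable.of_norm_bounded (summable_dyadic_rpow
      (sub_pos.2 (hJ' _ hkJ)) (C * A * ρ ^ (γ + β - mlen k))) fun n => ?_
    refine (h x rfl T A hT hA hTA n k (hkJ.le.trans hJ)).trans_eq ?_
    have e := rpow_mul_pow_eq (show 0 < ρ * 2⁻¹ ^ n by positivity) one_pos γ β (mlen k)
    rw [one_pow, mul_one, Real.one_rpow, one_mul, div_one] at e
    rw [e, Real.mul_rpow hρ.le (by positivity)]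
    ring
  have h2 : Tendsto (fun N => ∑ k ∈ multiIndicesLT d (J : ℝ), monoInt ψ x k *
      ∑ n ∈ Finset.range N, extVal T (mixedDeriv (Kn n) k 0 x)) atTop
      (𝓝 (∑ k ∈ multiIndicesLT d (J : ℝ), monoInt ψ x k *
        ∑' n, extVal T (mixedDeriv (Kn n) k 0 x))) :=
    tendsto_finsetSum _ fun k hk => (hsum k hk).hasSum.tendsto_sum_nat.const_mul _
  refine (h1.sub h2).congr fun N => ?_
  simp only [partialDiff, hK.extVal_adjTaylor hT hJ, Finset.sum_sub_distrib, taylorPart]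
  rw [Finset.sum_comm]
  simp only [Finset.mul_sum]

end Kernel

/-! ### The lifted difference of a germ and its reconstruction -/

lemma exists_homBound_of_small {a α γ : ℝ} (hαγ : α ≤ γ) (haγ : a ≤ γ) {G : Rd d → Distr d}
    {s : ℕ} (h : ∀ L : Set (Rd d), IsCompact L → ∃ C, HomBound a s L 1 G C)
    (hG : IsCoherent α γ G) {q : ℕ} (hqa : -a < q) (hq : -α < q) {L : Set (Rd d)}
    (hL : IsCompact L) (Λ : ℝ) : ∃ C, 0 ≤ C ∧ HomBound a q L Λ G C := by
  have hΛ : 0 < max Λ 1 := lt_max_of_lt_right one_pos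
  have hL' : IsCompact (Metric.cthickening (max Λ 1 + 1) L) := hL.cthickening
  obtain ⟨s', hs'⟩ := hG
  obtain ⟨C, hC, h1⟩ := exists_homBound (d := d) hαγ haγ hqa hq (max s s') one_pos hΛ (lt_add_one _)
  obtain ⟨A, hA⟩ := h _ hL'
  obtain ⟨B, hB, hcoh⟩ := hs'.exists_cohBound hL' 1
  have h2 := h1 L G (max A B) (le_max_of_le_right hB)
    (hA.mono (le_max_left _ _) subset_rfl le_rfl (le_max_left _ _))
    (hcoh.mono (le_max_right _ _) subset_rfl le_rfl (le_max_right _ _))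
  exact ⟨C * max A B, mul_nonneg hC (le_max_of_le_right hB),
    h2.mono le_rfl subset_rfl (le_max_left _ _) le_rfl⟩

lemma orderLE_of_homBound {a : ℝ} {q : ℕ} {G : Rd d → Distr d} {x : Rd d}
    (h : ∀ Λ : ℝ, ∃ C, 0 ≤ C ∧ HomBound a q {x} Λ G C) : OrderLE (G x) q :=
  orderLE_of_forall (x := x) fun t ht => by
    obtain ⟨C, -, hC⟩ := h t
    exact ⟨_, hC.boundedAt rfl ⟨ht, le_rfl⟩⟩

/-- The order of the test functions can be lowered in bounds for joint seminorms. -/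
lemma exists_jointSeminorm_le {a α γ : ℝ} (hαγ : α ≤ γ) (haγ : a ≤ γ) (s : ℕ) {Λ : ℝ}
    (hΛ : 0 < Λ) : ∃ C : ℝ≥0, ∀ (L : Set (Rd d)) (F : Rd d → Distr d),
      jointSeminorm a α γ (canonicalOrder a α) L Λ F ≤
        C * jointSeminorm a α γ s (Metric.cthickening (Λ + 1) L) Λ F := by
  obtain ⟨C₁, hC₁, h1⟩ := exists_homBound (d := d) hαγ haγ (neg_lt_canonicalOrder_left a α)
    (neg_lt_canonicalOrder_right a α) s hΛ hΛ (lt_add_one Λ)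
  obtain ⟨C₂, hC₂, h2⟩ := exists_cohBound (d := d) hαγ (neg_lt_canonicalOrder_right a α) s hΛ hΛ
    (lt_add_one Λ)
  refine ⟨Real.toNNReal (C₁ + C₂ + 1), fun L F => ennreal_le_mul_of_forall (by positivity)
    fun A hA hle => ?_⟩
  obtain ⟨h3, h4⟩ := bounds_of_jointSeminorm_le hA hle
  rw [add_mul]
  exact jointSeminorm_le (by positivity) (by positivity) (h1 L F A hA h3 h4) (h2 L F A hA h4)

lemma exists_cohSeminorm_le {α γ : ℝ} (hαγ : α ≤ γ) {q : ℕ} (hq : -α < q) (s : ℕ) {Λ : ℝ}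
    (hΛ : 0 < Λ) : ∃ C : ℝ≥0, ∀ (L : Set (Rd d)) (F : Rd d → Distr d),
      cohSeminorm α γ q L Λ F ≤ C * cohSeminorm α γ s (Metric.cthickening (Λ + 1) L) Λ F := by
  obtain ⟨C₂, hC₂, h2⟩ := exists_cohBound (d := d) hαγ hq s hΛ hΛ (lt_add_one Λ)
  exact ⟨Real.toNNReal (C₂ + 1), fun L F => ennreal_le_mul_of_forall hC₂ fun A hA hle =>
    cohSeminorm_le (h2 L F A hA (cohBound_of_cohSeminorm_le hA hle))⟩

/-- The parameters of the Schauder estimates. -/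
structure SchauderData (α γ β ρ : ℝ) (m r : ℕ) (K : Rd d → Rd d → ℝ)
    (Kn : ℕ → Rd d → Rd d → ℝ) : Prop where
  le : α ≤ γ
  ne : α + β ≠ 0
  notNat : ∀ N : ℕ, γ + β ≠ N
  kernel : IsRegularisingKernel β m r ρ K Kn
  lt_m : γ + β < m
  lt_r : -α < r

namespace SchauderData

variable {α γ β ρ : ℝ} {m r : ℕ} {K : Rd d → Rd d → ℝ} {Kn : ℕ → Rd d → Rd d → ℝ}
  {F : Rd d → Distr d} {f : Distr d}

section

variable (D : SchauderData α γ β ρ m r K Kn)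
include D

lemma order_le : canonicalOrder γ α ≤ r :=
  canonicalOrder_le (by linarith [D.le, D.lt_r]) D.lt_r

lemma ceil_le : ⌈γ + β⌉₊ ≤ m := Nat.ceil_le.2 D.lt_m.le

lemma lt_ceil : γ + β < (⌈γ + β⌉₊ : ℝ) := lt_of_le_of_ne (Nat.le_ceil _) (D.notNat _)

lemma lt_of_lt_ceil : ∀ k < ⌈γ + β⌉₊, (k : ℝ) < γ + β := fun _ hk => Nat.lt_ceil.1 hk

lemma sum_ne : γ + β ≠ 0 := by simpa using D.notNat 0

lemma min_le : min (α + β) 0 ≤ γ + β := (min_le_left _ _).trans (by linarith [D.le])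

lemma exists_homBound (h : (F, f) ∈ reconstructedGerms d α γ) {L : Set (Rd d)} (hL : IsCompact L)
    (Λ : ℝ) : ∃ C, 0 ≤ C ∧ HomBound γ (canonicalOrder γ α) L Λ (fun x => F x - f) C :=
  exists_homBound_of_small D.le le_rfl (h.2 _ (neg_lt_canonicalOrder_right γ α))
    (sub_const_mem_coherentGerms h.1 f).2 (neg_lt_canonicalOrder_left γ α)
    (neg_lt_canonicalOrder_right γ α) hL Λ

lemma orderLE (h : (F, f) ∈ reconstructedGerms d α γ) (x : Rd d) : OrderLE (F x - f) r :=
  (orderLE_of_homBound (G := fun x => F x - f) fun Λ =>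
    D.exists_homBound h isCompact_singleton Λ).mono D.order_le

lemma kernelIntDefined (h : (F, f) ∈ reconstructedGerms d α γ) (x : Rd d) :
    KernelIntDefined Kn (F x - f) := D.kernel.exists_isKernelInt (D.orderLE h x)

lemma tendsto_partialDiff (h : (F, f) ∈ reconstructedGerms d α γ) (x : Rd d) (ψ : TestFn d) :
    Tendsto (partialDiff Kn ⌈γ + β⌉₊ (F x - f) x ψ) atTop (𝓝 (kernelInt Kn (F x - f) ψ -
      ∑ k ∈ multiIndicesLT d (γ + β), monoInt ψ x k *
        ∑' n, extVal (F x - f) (mixedDeriv (Kn n) k 0 x))) := by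
  obtain ⟨A, hA, hb⟩ := D.exists_homBound h (isCompact_singleton (x := x)) (6 * ρ)
  rw [multiIndicesLT_ceil]
  exact D.kernel.tendsto_partialDiff D.order_le D.ceil_le D.lt_of_lt_ceil (D.orderLE h x) hA
    (fun s hs => hb.boundedAt rfl hs) ψ

lemma hasPointDeriv (h : (F, f) ∈ reconstructedGerms d α γ) (x : Rd d) {k : Fin d → ℕ}
    (hk : (mlen k : ℝ) < γ + β) : HasPointDeriv (γ + β) (kernelInt Kn (F x - f)) x k
      (∑' n, extVal (F x - f) (mixedDeriv (Kn n) k 0 x)) := by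
  refine hasPointDeriv_of_approx
    (c := fun k => ∑' n, extVal (F x - f) (mixedDeriv (Kn n) k 0 x)) (fun φ => ?_) hk
  obtain ⟨R, b, hR, hb, hφ⟩ := scaled_mem_bump φ (canonicalOrder γ α)
  obtain ⟨A, hA, hFA⟩ := D.exists_homBound h (isCompact_singleton (x := x)) (4 * 1 + 6 * ρ)
  have hρ := D.kernel.rho_pos
  obtain ⟨C, hC, hCb⟩ := D.kernel.exists_abs_partialDiff_le (isCompact_singleton (x := x))
    D.order_le (γ := γ) D.ceil_le D.lt_ceil D.lt_of_lt_ceil D.sum_ne (Λ := 1) (S := 4 * 1 + 6 * ρ)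
    (by linarith) (by linarith)
  refine ⟨C * A * b * R ^ (γ + β), R⁻¹, by positivity, fun t ht => ?_⟩
  refine le_of_tendsto (D.tendsto_partialDiff h x (scaled φ x t)).abs
    (Eventually.of_forall fun N => ?_)
  have h1 : R * t ≤ 1 := by
    have := mul_le_mul_of_nonneg_left ht.2 hR.le
    rwa [mul_inv_cancel₀ hR.ne'] at this
  refine (hCb x rfl (R * t) ⟨mul_pos hR ht.1, h1⟩ _ A b _ (D.orderLE h x) hA
    (fun s hs => hFA.boundedAt rfl hs) (hφ x t ht.1) N).trans_eq ?_
  rw [Real.mul_rpow hR.le ht.1.le]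
  ring

lemma tendsto_schauderDiff (h : (F, f) ∈ reconstructedGerms d α γ) (x : Rd d) (ψ : TestFn d) :
    Tendsto (partialDiff Kn ⌈γ + β⌉₊ (F x - f) x ψ) atTop
      (𝓝 (schauderDiff Kn (γ + β) F f x ψ)) := by
  have e : schauderDiff Kn (γ + β) F f x ψ = kernelInt Kn (F x - f) ψ -
      taylorDistr (γ + β) (kernelInt Kn (F x - f)) x ψ := rfl
  rw [e, taylorDistr_apply, Finset.sum_congr rfl fun k hk => by
    rw [(D.hasPointDeriv h x (mem_multiIndicesLT.1 hk)).pointDeriv_eq]]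
  exact D.tendsto_partialDiff h x ψ

omit D in
lemma measurable_extVal {G : Rd d → Distr d} (hG : IsGerm G) (ho : ∀ x, OrderLE (G x) r)
    {g : Rd d → ℝ} (hg : ContDiff ℝ r g) (hs : HasCompactSupport g) :
    Measurable fun x => extVal (G x) g := by
  obtain ⟨R, φ, h1, h2⟩ := exists_test_seq hg hs
  exact measurable_of_tendsto_metrizable (fun j => hG (φ j))
    (tendsto_pi_nhds.2 fun x => (ho x).tendsto_extVal hg hs h1 h2)

lemma isGerm_kernelInt (h : (F, f) ∈ reconstructedGerms d α γ) :
    IsGerm fun x => kernelInt Kn (F x - f) := fun ψ =>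
  measurable_of_tendsto_metrizable
    (f := fun N x => ∑ n ∈ Finset.range N, extVal (F x - f) (adj (Kn n) ψ))
    (fun N => Finset.measurable_fun_sum _ fun n _ =>
      measurable_extVal (h.1.1.sub_const f) (D.orderLE h)
        (D.kernel.contDiff_adj ψ n) (D.kernel.hasCompactSupport_adj ψ n))
    (tendsto_pi_nhds.2 fun x => (D.kernelIntDefined h x).isKernelInt.tendsto ψ)

lemma isGerm_schauderDiff (h : (F, f) ∈ reconstructedGerms d α γ) :
    IsGerm (schauderDiff Kn (γ + β) F f) := by
  intro ψ
  have hg := D.isGerm_kernelInt h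
  have e : ∀ x, schauderDiff Kn (γ + β) F f x ψ = kernelInt Kn (F x - f) ψ -
      ∑ k ∈ multiIndicesLT d (γ + β), monoInt ψ x k *
        pointDeriv (γ + β) (kernelInt Kn (F x - f)) x k := fun x => by
    rw [← taylorDistr_apply]
    rfl
  simp only [e]
  refine (hg ψ).sub (Finset.measurable_fun_sum _ fun k hk => Measurable.mul ?_ ?_)
  · refine (continuous_integral_param ψ.continuous ψ.hasCompactSupport ?_).measurable
    exact ((continuous_mpow k).comp (continuous_snd.sub continuous_fst) |>.div_const _).comp
      continuous_swap
  · set η := moll d ⌈γ + β⌉₊ with hηdef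
    have hη : IsMoll ⌈γ + β⌉₊ η := isMoll_moll d _
    have hpos : ∀ j : ℕ, (0 : ℝ) < 1 * 2⁻¹ ^ j := fun j => by positivity
    refine measurable_of_tendsto_metrizable (f := fun (j : ℕ) x => (-1) ^ mlen k *
      (((1 : ℝ) * 2⁻¹ ^ j)⁻¹ ^ mlen k *
        kernelInt Kn (F x - f) (scaled (derivTest k η) x (1 * 2⁻¹ ^ j)))) (fun j =>
      ((hg.measurable_diag (derivTest k η) _).const_mul _).const_mul _)
      (tendsto_pi_nhds.2 fun x => ?_)
    have h1 := D.hasPointDeriv h x (mem_multiIndicesLT.1 hk)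
    rw [h1.pointDeriv_eq]
    have h2 := (h1 η hη.integral_eq fun l hl hl' => hη.moment l hl (Nat.lt_ceil.2 hl')).comp
      (tendsto_nhdsWithin_iff.2 ⟨tendsto_dyadic 1, Eventually.of_forall hpos⟩)
    refine h2.congr fun j => ?_
    rw [Function.comp_apply, distrDeriv_apply, derivTest_scaled k η x (hpos j), map_smul,
      smul_eq_mul]

lemma le_enlargedScale {L : Set (Rd d)} {Λ : ℝ} (hΛ : 0 < Λ) :
    8 * Λ ≤ enlargedScale ρ L Λ ∧ 6 * ρ ≤ enlargedScale ρ L Λ ∧ 0 < enlargedScale ρ L Λ := by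
  have hρ := D.kernel.rho_pos
  have hd : 0 ≤ Metric.diam L := Metric.diam_nonneg
  unfold enlargedScale
  refine ⟨?_, ?_, ?_⟩ <;> linarith

/-- The Schauder estimate for the lifted difference. -/
lemma exists_schauderDiff_bounds {L : Set (Rd d)} (hL : IsCompact L) {Λ : ℝ} (hΛ : 0 < Λ) :
    ∃ C : ℝ, 0 ≤ C ∧ ∀ F f, (F, f) ∈ reconstructedGerms d α γ → ∀ A : ℝ, 0 ≤ A →
      HomBound γ (canonicalOrder γ α) L (enlargedScale ρ L Λ) (fun x => F x - f) A →
      CohBound α γ (canonicalOrder γ α) L (enlargedScale ρ L Λ) (fun x => F x - f) A →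
      HomBound (γ + β) (canonicalOrder γ α) L Λ (schauderDiff Kn (γ + β) F f) (C * A) ∧
      CohBound (min (α + β) 0) (γ + β) (canonicalOrder γ α) L Λ
        (schauderDiff Kn (γ + β) F f) (C * A) := by
  obtain ⟨h8, h6, -⟩ := D.le_enlargedScale (L := L) hΛ
  obtain ⟨C₁, hC₁, h1⟩ := D.kernel.exists_abs_partialDiff_le hL D.order_le (γ := γ) D.ceil_le
    D.lt_ceil D.lt_of_lt_ceil D.sum_ne (Λ := Λ) (S := enlargedScale ρ L Λ) (by linarith) h6
  obtain ⟨C₂, hC₂, h2⟩ := D.kernel.exists_abs_partialDiff_sub_le hL D.order_le D.le D.ne D.ceil_le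
    D.lt_ceil D.lt_of_lt_ceil D.sum_ne h8 h6
  refine ⟨C₁ + C₂, by positivity, fun F f h A hA hom coh => ⟨fun x hx t ht φ hφ => ?_,
    fun x hx y hy t ht φ hφ => ?_⟩⟩
  · refine le_of_tendsto (D.tendsto_schauderDiff h x _).abs (Eventually.of_forall fun N => ?_)
    refine (h1 x hx t ht _ A 1 _ (D.orderLE h x) hA (fun s hs => hom.boundedAt hx hs)
      (bumpAt_scaled hφ x ht.1) N).trans ?_
    have := ht.1
    rw [mul_one]
    gcongr
    linarith
  · refine le_of_tendsto ((D.tendsto_schauderDiff h y _).sub (D.tendsto_schauderDiff h x _)).abs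
      (Eventually.of_forall fun N => ?_)
    refine (h2 x hx y hy t ht _ _ A 1 _ (D.orderLE h x) (D.orderLE h y) hA
      (fun s hs => hom.boundedAt hx hs) (fun s hs => hom.boundedAt hy hs)
      (fun s hs => coh.boundedAt hx hy hs) (bumpAt_scaled hφ x ht.1) N).trans ?_
    have := ht.1
    rw [mul_one]
    gcongr
    linarith

lemma exists_bounds (h : (F, f) ∈ reconstructedGerms d α γ) {L : Set (Rd d)} (hL : IsCompact L)
    {Λ : ℝ} (hΛ : 0 < Λ) : ∃ C : ℝ,
      HomBound (γ + β) (canonicalOrder γ α) L Λ (schauderDiff Kn (γ + β) F f) C ∧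
      CohBound (min (α + β) 0) (γ + β) (canonicalOrder γ α) L Λ
        (schauderDiff Kn (γ + β) F f) C := by
  obtain ⟨C, hC, h1⟩ := D.exists_schauderDiff_bounds hL hΛ
  obtain ⟨A, hA, hom⟩ := D.exists_homBound h hL (enlargedScale ρ L Λ)
  obtain ⟨B, hB, coh⟩ := (sub_const_mem_coherentGerms h.1 f).2.exists_cohBound D.le
    (neg_lt_canonicalOrder_right γ α) hL (enlargedScale ρ L Λ)
  exact ⟨_, h1 F f h (max A B) (le_max_of_le_left hA)
    (hom.mono le_rfl subset_rfl le_rfl (le_max_left _ _))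
    (coh.mono le_rfl subset_rfl le_rfl (le_max_right _ _))⟩

lemma isHomogeneous_schauderDiff (h : (F, f) ∈ reconstructedGerms d α γ) :
    IsHomogeneous (γ + β) (schauderDiff Kn (γ + β) F f) :=
  ⟨canonicalOrder γ α, fun _ hL _ hΛ =>
    (D.exists_bounds h hL (zero_lt_one.trans_le hΛ)).imp fun _ h => h.1⟩

lemma isCoherent_schauderDiff (h : (F, f) ∈ reconstructedGerms d α γ) :
    IsCoherent (min (α + β) 0) (γ + β) (schauderDiff Kn (γ + β) F f) :=
  ⟨canonicalOrder γ α, fun _ hL _ hΛ =>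
    (D.exists_bounds h hL (zero_lt_one.trans_le hΛ)).imp fun _ h => h.2⟩

lemma jointSeminorm_schauderDiff_le {L : Set (Rd d)} (hL : IsCompact L) {Λ : ℝ} (hΛ : 0 < Λ) :
    ∃ C : ℝ≥0, ∀ F f, (F, f) ∈ reconstructedGerms d α γ →
      jointSeminorm (γ + β) (min (α + β) 0) (γ + β) (canonicalOrder γ α) L Λ
          (schauderDiff Kn (γ + β) F f)
        ≤ C * jointSeminorm γ α γ (canonicalOrder γ α) L (enlargedScale ρ L Λ)
          (fun x => F x - f) := by
  obtain ⟨C, hC, h⟩ := D.exists_schauderDiff_bounds hL hΛ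
  refine ⟨Real.toNNReal (C + C + 1), fun F f hF => ennreal_le_mul_of_forall (by positivity)
    fun A hA hle => ?_⟩
  obtain ⟨h1, h2⟩ := bounds_of_jointSeminorm_le hA hle
  obtain ⟨h3, h4⟩ := h F f hF A hA h1 h2
  rw [add_mul]
  exact jointSeminorm_le (by positivity) (by positivity) h3 h4

lemma jointSeminorm_schauderDiff_le' {L : Set (Rd d)} (hL : IsCompact L) {Λ : ℝ} (hΛ : 0 < Λ) :
    ∃ L' : Set (Rd d), IsCompact L' ∧ ∃ Λ' : ℝ, 0 < Λ' ∧ ∃ C : ℝ≥0,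
      ∀ F f, (F, f) ∈ reconstructedGerms d α γ →
        jointSeminorm (γ + β) (min (α + β) 0) (γ + β)
            (canonicalOrder (γ + β) (min (α + β) 0)) L Λ (schauderDiff Kn (γ + β) F f)
          ≤ C * jointSeminorm γ α γ (canonicalOrder γ α) L' Λ' (fun x => F x - f) := by
  have hL' : IsCompact (Metric.cthickening (Λ + 1) L) := hL.cthickening
  obtain ⟨C₁, h1⟩ := exists_jointSeminorm_le (d := d) D.min_le (le_refl (γ + β))
    (canonicalOrder γ α) hΛ
  obtain ⟨C₂, h2⟩ := D.jointSeminorm_schauderDiff_le hL' hΛ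
  refine ⟨_, hL', _, (D.le_enlargedScale (L := Metric.cthickening (Λ + 1) L) hΛ).2.2, C₁ * C₂,
    fun F f h => (h1 L _).trans ?_⟩
  rw [ENNReal.coe_mul, mul_assoc]
  gcongr
  exact h2 F f h

/-! ### The lifted germ -/

lemma isKernelInt_apply (h : (F, f) ∈ reconstructedGerms d α γ) (hf : KernelIntDefined Kn f)
    (x : Rd d) : IsKernelInt Kn (F x) (kernelInt Kn (F x - f) + kernelInt Kn f) := by
  have := (D.kernelIntDefined h x).isKernelInt.add hf.isKernelInt
  rwa [sub_add_cancel] at this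

lemma schauderGerm_sub (h : (F, f) ∈ reconstructedGerms d α γ) (hf : KernelIntDefined Kn f)
    (x : Rd d) : schauderGerm Kn (γ + β) F f x - kernelInt Kn f
      = schauderDiff Kn (γ + β) F f x := by
  rw [schauderGerm, schauderDiff, (D.isKernelInt_apply h hf x).kernelInt_eq]
  abel

lemma schauderGerm_eq (h : (F, f) ∈ reconstructedGerms d α γ) (hf : KernelIntDefined Kn f) :
    schauderGerm Kn (γ + β) F f =
      fun x => schauderDiff Kn (γ + β) F f x + kernelInt Kn f := by
  funext x
  rw [← D.schauderGerm_sub h hf x, sub_add_cancel]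

lemma cohBound_schauderGerm_iff (h : (F, f) ∈ reconstructedGerms d α γ)
    (hf : KernelIntDefined Kn f) {α' γ' : ℝ} {q : ℕ} {L : Set (Rd d)} {Λ C : ℝ} :
    CohBound α' γ' q L Λ (schauderGerm Kn (γ + β) F f) C ↔
      CohBound α' γ' q L Λ (schauderDiff Kn (γ + β) F f) C := by
  rw [← CohBound.sub_const_iff (kernelInt Kn f)]
  simp only [D.schauderGerm_sub h hf]

lemma isCoherent_schauderGerm (h : (F, f) ∈ reconstructedGerms d α γ)
    (hf : KernelIntDefined Kn f) :
    IsCoherent (min (α + β) 0) (γ + β) (schauderGerm Kn (γ + β) F f) :=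
  ⟨canonicalOrder γ α, fun _ hL _ hΛ => (D.exists_bounds h hL (zero_lt_one.trans_le hΛ)).imp
    fun _ h' => (D.cohBound_schauderGerm_iff h hf).2 h'.2⟩

lemma isReconstruction_schauderGerm (h : (F, f) ∈ reconstructedGerms d α γ)
    (hf : KernelIntDefined Kn f) :
    IsReconstruction (min (α + β) 0) (γ + β) (schauderGerm Kn (γ + β) F f) (kernelInt Kn f) := by
  intro q hq L hL
  obtain ⟨C, -, hC⟩ := exists_homBound_of_small D.min_le le_rfl
    (fun L hL => (D.exists_bounds h hL one_pos).imp fun _ h => h.1)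
    (D.isCoherent_schauderDiff h) (by linarith [D.min_le]) hq hL 1
  refine ⟨C, fun x hx t ht φ hφ => ?_⟩
  rw [D.schauderGerm_sub h hf]
  exact hC x hx t ht φ hφ

lemma isGerm_schauderGerm (h : (F, f) ∈ reconstructedGerms d α γ) (hf : KernelIntDefined Kn f) :
    IsGerm (schauderGerm Kn (γ + β) F f) := by
  rw [D.schauderGerm_eq h hf]
  exact fun φ => (D.isGerm_schauderDiff h φ).add measurable_const

/-- Pairs of germs and reconstructions form a vector space. -/
lemma add_smul_mem {G : Rd d → Distr d} {g : Distr d} (h : (F, f) ∈ reconstructedGerms d α γ)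
    (h' : (G, g) ∈ reconstructedGerms d α γ) (a b : ℝ) :
    (fun x => a • F x + b • G x, a • f + b • g) ∈ reconstructedGerms d α γ := by
  refine ⟨add_smul_mem_coherentGerms D.le h.1 h'.1 a b, fun q hq L hL => ?_⟩
  obtain ⟨C, hC⟩ := h.2 q hq L hL
  obtain ⟨C', hC'⟩ := h'.2 q hq L hL
  refine ⟨|a| * C + |b| * C', fun x hx t ht φ hφ => ?_⟩
  have e : a • F x + b • G x - (a • f + b • g) = a • (F x - f) + b • (G x - g) := by
    rw [smul_sub, smul_sub]
    abel
  change |((a • F x + b • G x - (a • f + b • g) : Distr d)) (scaled φ x t)| ≤ _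
  rw [e]
  change |a * (F x - f) (scaled φ x t) + b * (G x - g) (scaled φ x t)| ≤ _
  refine (abs_add_le _ _).trans ?_
  rw [abs_mul, abs_mul, add_mul, mul_assoc, mul_assoc]
  gcongr
  · exact hC x hx t ht φ hφ
  · exact hC' x hx t ht φ hφ

lemma schauderDiff_add_smul {G : Rd d → Distr d} {g : Distr d}
    (h : (F, f) ∈ reconstructedGerms d α γ) (h' : (G, g) ∈ reconstructedGerms d α γ) (a b : ℝ)
    (x : Rd d) :
    schauderDiff Kn (γ + β) (fun x => a • F x + b • G x) (a • f + b • g) x =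
      a • schauderDiff Kn (γ + β) F f x + b • schauderDiff Kn (γ + β) G g x := by
  have hx := D.orderLE h x
  have hx' := D.orderLE h' x
  ext ψ
  refine tendsto_nhds_unique (D.tendsto_schauderDiff (D.add_smul_mem h h' a b) x ψ) ?_
  change Tendsto _ _ (𝓝 (a * schauderDiff Kn (γ + β) F f x ψ +
    b * schauderDiff Kn (γ + β) G g x ψ))
  refine (((D.tendsto_schauderDiff h x ψ).const_mul a).add
    ((D.tendsto_schauderDiff h' x ψ).const_mul b)).congr fun N => ?_
  have e : a • F x + b • G x - (a • f + b • g) = a • (F x - f) + b • (G x - g) := by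
    rw [smul_sub, smul_sub]
    abel
  simp only [partialDiff, Finset.mul_sum, ← Finset.sum_add_distrib, e]
  refine Finset.sum_congr rfl fun n _ => ?_
  have hreg := fun k (hk : k ∈ multiIndicesLT d (⌈γ + β⌉₊ : ℝ)) =>
    D.kernel.regular_mixedDeriv n ((mlen_lt_of_mem hk).le.trans D.ceil_le) x
  have e2 : ∀ u : Rd d → ℝ, ContDiff ℝ r u → HasCompactSupport u →
      extVal (a • (F x - f) + b • (G x - g)) u =
        a * extVal (F x - f) u + b * extVal (G x - g) u := fun u hu hs =>
    (((hx.extPairing hu hs).smul a).add ((hx'.extPairing hu hs).smul b)).extVal_eq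
  rw [D.kernel.extVal_adjTaylor hx D.ceil_le, D.kernel.extVal_adjTaylor hx' D.ceil_le,
    D.kernel.extVal_adjTaylor ((hx.smul a).add (hx'.smul b)) D.ceil_le,
    e2 _ (D.kernel.contDiff_adj ψ n) (D.kernel.hasCompactSupport_adj ψ n)]
  have e3 : taylorPart (Kn n) (a • (F x - f) + b • (G x - g)) ⌈γ + β⌉₊ ψ x =
      a * taylorPart (Kn n) (F x - f) ⌈γ + β⌉₊ ψ x +
        b * taylorPart (Kn n) (G x - g) ⌈γ + β⌉₊ ψ x := by
    simp only [taylorPart, Finset.mul_sum]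
    rw [← Finset.sum_add_distrib]
    refine Finset.sum_congr rfl fun k hk => ?_
    rw [e2 _ (hreg k hk).1 (hreg k hk).2]
    ring
  rw [e3]
  ring

lemma schauderGerm_add_smul {G : Rd d → Distr d} {g : Distr d}
    (h : (F, f) ∈ reconstructedGerms d α γ) (h' : (G, g) ∈ reconstructedGerms d α γ)
    (hf : KernelIntDefined Kn f) (hg : KernelIntDefined Kn g) (a b : ℝ) :
    KernelIntDefined Kn (a • f + b • g) ∧
    ∀ x, schauderGerm Kn (γ + β) (fun x => a • F x + b • G x) (a • f + b • g) x
      = a • schauderGerm Kn (γ + β) F f x + b • schauderGerm Kn (γ + β) G g x := by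
  have hint := (hf.isKernelInt.smul a).add (hg.isKernelInt.smul b)
  refine ⟨⟨_, hint⟩, fun x => ?_⟩
  rw [D.schauderGerm_eq (D.add_smul_mem h h' a b) ⟨_, hint⟩, D.schauderGerm_eq h hf,
    D.schauderGerm_eq h' hg]
  simp only [D.schauderDiff_add_smul h h', hint.kernelInt_eq, smul_add]
  abel

end

end SchauderData

/-! ### Distributions tested with smooth functions at coarse scales -/

/-- A bound for a distribution of negative homogeneity, tested with a function of size `w` whose
derivatives of high order live on a smaller scale `t`. -/
lemma exists_abs_distr_le_of_coarse {p q : ℕ} {φ : TestFn d} (hφ : IsMoll (p + q) φ) {a θ : ℝ}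
    (hθ : θ ≤ p) (hθa : θ + a < 0) (hpq : 0 < p + q + a) :
    ∃ C : ℝ, 0 ≤ C ∧ ∀ (T : Distr d) (x : Rd d) (t w M A : ℝ) (g : TestFn d), 0 < t → t ≤ w →
      0 ≤ M → 0 ≤ A → (∀ y, 2 * w < ‖y - x‖ → g y = 0) → (∀ y, |g y| ≤ M * w⁻¹ ^ d) →
      (∀ k : Fin d → ℕ, mlen k = p → ∀ y, |partialDeriv k g y| ≤ M * w⁻¹ ^ (d + p)) →
      (∀ k : Fin d → ℕ, mlen k = p + q → ∀ y,
        |partialDeriv k g y| ≤ M * (t⁻¹ ^ q * w⁻¹ ^ (d + p))) →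
      (∀ y, ‖y - x‖ ≤ 4 * w → ∀ s ∈ Set.Ioc 0 w, |T (scaled φ y s)| ≤ A * s ^ a) →
      |T g| ≤ C * M * A * (w ^ (-θ) * t ^ (θ + a)) := by
  set I : ℝ := ∫ z, |φ z|
  have hI : 0 ≤ I := integral_nonneg fun _ => abs_nonneg _
  set v := volume.real (Metric.ball (0 : Rd d) 1)
  have hv : 0 ≤ v := measureReal_nonneg
  set K₁ : ℝ := 2 ^ (p + q + 1) * (d ^ (p + q) * I + 1) * (4 ^ d * v) with hK₁
  set K₂ : ℝ := 2 ^ (p + 1) * (d ^ p * I + 1) * (4 ^ d * v) with hK₂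
  have hK₁0 : 0 ≤ K₁ := by positivity
  have hK₂0 : 0 ≤ K₂ := by positivity
  have hg1 := geomConst_pos hpq
  have hg2 := geomConst_pos (neg_pos.2 hθa)
  refine ⟨I * (4 ^ d * v) + (K₁ + K₂) * (geomConst (p + q + a) + geomConst (-(θ + a))),
    by positivity, fun T x t w M A g ht htw hM hA hs h0 h1 h2 hT => ?_⟩
  have hw : 0 < w := ht.trans_le htw
  have hwd : w⁻¹ ^ d * w ^ d = 1 := by rw [← mul_pow, inv_mul_cancel₀ hw.ne', one_pow]
  have hX : 0 ≤ w ^ (-θ) * t ^ (θ + a) := by positivity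
  refine le_of_tendsto (tendsto_lp hφ T g hw).abs (Eventually.of_forall fun n => ?_)
  refine (abs_add_le _ _).trans ?_
  rw [add_mul, add_mul, add_mul]
  refine add_le_add ?_ ((Finset.abs_sum_le_sum_abs _ _).trans ?_)
  · refine (abs_lpBase_le hφ (by positivity) hs h0 hw (A := A * w ^ a)
      fun y hy => hT y (by linarith) w ⟨hw, le_rfl⟩).trans ?_
    have e : M * w⁻¹ ^ d * I * (A * w ^ a) * ((2 * w + 2 * w) ^ d * v) =
        I * (4 ^ d * v) * M * A * (w ^ (-θ) * w ^ (θ + a)) := by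
      rw [← Real.rpow_add hw, neg_add_cancel_left, show 2 * w + 2 * w = 4 * w by ring, mul_pow]
      linear_combination (M * I * A * w ^ a * 4 ^ d * v) * hwd
    rw [e]
    have : w ^ (θ + a) ≤ t ^ (θ + a) := Real.rpow_le_rpow_of_nonpos ht htw hθa.le
    gcongr
  · refine (sum_two_sided_le hpq (neg_pos.2 hθa) (div_pos hw ht)
      (A := (K₁ + K₂) * M * A * (w ^ (-θ) * t ^ (θ + a))) (by positivity) (fun j hj => ?_)
      (fun j hj => ?_) n).trans_eq (by ring)
    all_goals
      rw [div_mul_eq_mul_div] at hj ⊢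
      set s := w * 2⁻¹ ^ j with hsdef
      have hs0 : 0 < s := by positivity
      have hsw : s ≤ w := mul_le_of_le_one_right hw.le (pow_le_one₀ (by norm_num) (by norm_num))
      have hTs : ∀ y, ‖y - x‖ ≤ 2 * w + 2 * s → |T (scaled φ y s)| ≤ A * s ^ a := fun y hy =>
        hT y (by linarith) s ⟨hs0, hsw⟩
      have hvol : (2 * w + 2 * s) ^ d ≤ 4 ^ d * w ^ d := by
        rw [← mul_pow]
        gcongr
        linarith
    · refine (abs_lpTerm_le hφ (contDiff_testFn g _) (by positivity) hs h2 (by positivity) hs0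
        hTs).trans ?_
      have e1 : w⁻¹ ^ p ≤ w ^ (-θ) * t ^ (θ - p) := by
        calc w⁻¹ ^ p = w ^ (-θ) * w ^ (θ - p) := by
              rw [← Real.rpow_add hw, show -θ + (θ - p) = -(p : ℝ) by ring, Real.rpow_neg hw.le,
                Real.rpow_natCast, inv_pow]
          _ ≤ _ := by
              gcongr ?_ * ?_
              exact Real.rpow_le_rpow_of_nonpos ht htw (by linarith)
      have e2 : t ^ (θ + a) * (s / t) ^ (p + q + a : ℝ) =
          t ^ (θ - p) * (t⁻¹ ^ q * (s ^ (p + q) * s ^ a)) := by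
        rw [Real.div_rpow hs0.le ht.le, show (p : ℝ) + q + a = ((p + q : ℕ) : ℝ) + a by push_cast; ring,
          Real.rpow_add hs0, Real.rpow_add ht, Real.rpow_add ht, Real.rpow_sub ht,
          Real.rpow_natCast, Real.rpow_natCast, Real.rpow_natCast, pow_add t, inv_pow]
        field_simp
      calc _ ≤ 2 ^ (p + q + 1) * (d ^ (p + q) * I + 1) * (M * (t⁻¹ ^ q * w⁻¹ ^ (d + p))) *
            s ^ (p + q) * (A * s ^ a) * (4 ^ d * w ^ d * v) := by gcongr
        _ = K₁ * M * A * (w⁻¹ ^ p * (t⁻¹ ^ q * (s ^ (p + q) * s ^ a))) := by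
          rw [hK₁, pow_add w⁻¹ d p]
          linear_combination (2 ^ (p + q + 1) * (d ^ (p + q) * I + 1) * M * t⁻¹ ^ q * w⁻¹ ^ p *
            s ^ (p + q) * A * s ^ a * 4 ^ d * v) * hwd
        _ ≤ K₁ * M * A * ((w ^ (-θ) * t ^ (θ - p)) * (t⁻¹ ^ q * (s ^ (p + q) * s ^ a))) := by
          gcongr
        _ = K₁ * M * A * (w ^ (-θ) * (t ^ (θ + a) * (s / t) ^ (p + q + a : ℝ))) := by
          rw [e2]; ring
        _ ≤ (K₁ + K₂) * M * A * (w ^ (-θ) * (t ^ (θ + a) * (s / t) ^ (p + q + a : ℝ))) := by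
          gcongr
          linarith
        _ = _ := by ring
    · refine (abs_lpTerm_le (hφ.mono (Nat.le_add_right p q)) (contDiff_testFn g _) (by positivity)
        hs h1 (by positivity) hs0 hTs).trans ?_
      have e1 : w⁻¹ ^ p * s ^ (p - θ) ≤ w ^ (-θ) := by
        calc w⁻¹ ^ p * s ^ (p - θ) ≤ w⁻¹ ^ p * w ^ (p - θ) := by
              gcongr
          _ = w ^ (-θ) := by
              rw [sub_eq_add_neg, Real.rpow_add hw, Real.rpow_natCast, ← mul_assoc, ← mul_pow,
                inv_mul_cancel₀ hw.ne', one_pow, one_mul]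
      have e2 : t ^ (θ + a) * (s / t) ^ (-(-(θ + a))) = s ^ (θ + a) := by
        rw [neg_neg, Real.div_rpow hs0.le ht.le]
        field_simp
      have e3 : s ^ p * s ^ a = s ^ (p - θ) * s ^ (θ + a) := by
        rw [← Real.rpow_natCast, ← Real.rpow_add hs0, ← Real.rpow_add hs0]
        congr 1
        ring
      calc _ ≤ 2 ^ (p + 1) * (d ^ p * I + 1) * (M * w⁻¹ ^ (d + p)) *
            s ^ p * (A * s ^ a) * (4 ^ d * w ^ d * v) := by gcongr
        _ = K₂ * M * A * (w⁻¹ ^ p * (s ^ p * s ^ a)) := by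
          rw [hK₂, pow_add w⁻¹ d p]
          linear_combination (2 ^ (p + 1) * (d ^ p * I + 1) * M * w⁻¹ ^ p *
            s ^ p * A * s ^ a * 4 ^ d * v) * hwd
        _ = K₂ * M * A * ((w⁻¹ ^ p * s ^ (p - θ)) * s ^ (θ + a)) := by rw [e3]; ring
        _ ≤ (K₁ + K₂) * M * A * (w ^ (-θ) * s ^ (θ + a)) := by
          gcongr
          linarith
        _ = _ := by rw [← e2]; ring

/-! ### Translation invariant kernels -/

lemma exists_add_mlen_eq (l : Fin d → ℕ) (n : ℕ) (h : n ≤ mlen l) :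
    ∃ j k : Fin d → ℕ, l = j + k ∧ mlen j = n := by
  induction n with
  | zero => exact ⟨0, l, (zero_add l).symm, mlen_zero⟩
  | succ n ih =>
    obtain ⟨j, k, rfl, hj⟩ := ih (by omega)
    have hk : 1 ≤ mlen k := by
      have : mlen (j + k) = mlen j + mlen k := by simp [mlen, Finset.sum_add_distrib]
      omega
    obtain ⟨i, hi⟩ : ∃ i, k i ≠ 0 := by
      by_contra! hcon
      simp [mlen, hcon] at hk
    refine ⟨j + unitIdx i, k - unitIdx i, ?_, by rw [mlen_add_unitIdx, hj]⟩
    funext i'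
    by_cases hii : i' = i
    · subst hii
      simp [unitIdx]
      omega
    · simp [unitIdx, hii]

lemma partialDeriv_conv_add {ψ : TestFn d} {κ : Rd d → ℝ} {m r : ℕ} (hκ : ContDiff ℝ r κ)
    (hs : HasCompactSupport κ) (hκm : ∀ l : Fin d → ℕ, mlen l ≤ r → ContDiff ℝ m (partialDeriv l κ))
    (j : Fin d → ℕ) {k l : Fin d → ℕ} (hl : mlen l ≤ r) (hk : mlen k ≤ m) :
    partialDeriv (j + (l + k)) (conv ψ κ) =
      conv (partialDeriv j ψ) (partialDeriv k (partialDeriv l κ)) := by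
  have hj : partialDeriv j (conv ψ κ) = conv (derivTest j ψ) κ :=
    partialDeriv_conv_left (contDiff_testFn ψ _) hκ.continuous hs
  have hsm : ∀ (η : TestFn d) (n : ℕ), ContDiff ℝ n (conv η κ) := fun η n => by
    rw [conv_comm]
    exact contDiff_conv hκ.continuous hs (contDiff_testFn η n)
  rw [← partialDeriv_partialDeriv _ _ (hsm ψ _), hj, ← partialDeriv_partialDeriv _ _ (hsm _ _),
    partialDeriv_conv (derivTest j ψ).continuous (derivTest j ψ).hasCompactSupport
      (hκ.of_le (by exact_mod_cast hl)),
    partialDeriv_conv (derivTest j ψ).continuous (derivTest j ψ).hasCompactSupport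
      ((hκm l hl).of_le (by exact_mod_cast hk))]
  rfl

lemma abs_conv_le_mul {u κ : Rd d → ℝ} {M B : ℝ} (hu : Integrable u) (hB : ∫ x, |u x| ≤ B)
    (hM : ∀ y, |κ y| ≤ M) (y : Rd d) : |conv u κ y| ≤ B * M := by
  have hM0 : 0 ≤ M := (abs_nonneg _).trans (hM 0)
  refine le_trans ?_ (mul_le_mul_of_nonneg_right hB hM0)
  rw [← integral_mul_const, ← Real.norm_eq_abs]
  refine norm_integral_le_of_norm_le (hu.abs.mul_const _) (Eventually.of_forall fun x => ?_)
  rw [norm_mul]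
  exact mul_le_mul_of_nonneg_left (hM _) (norm_nonneg _)

section Kernel

variable {β ρ : ℝ} {m r : ℕ} {K : Rd d → Rd d → ℝ} {Kn : ℕ → Rd d → Rd d → ℝ}

lemma IsTranslationInvariant.apply_eq (h : IsTranslationInvariant Kn) (n : ℕ) (x y : Rd d) :
    Kn n x y = Kn n 0 (y - x) := by
  have := h n 0 (y - x) x
  rwa [zero_add, sub_add_cancel] at this

lemma IsTranslationInvariant.adj_eq (h : IsTranslationInvariant Kn) (n : ℕ) (u : Rd d → ℝ) :
    adj (Kn n) u = conv u (Kn n 0) := by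
  funext y
  simp only [adj, conv, h.apply_eq n _ y]

lemma IsTranslationInvariant.exists_bounds (h : IsTranslationInvariant Kn)
    (hK : IsRegularisingKernel β m r ρ K Kn) : ∃ c : ℝ, 0 < c ∧ ∀ n,
      ContDiff ℝ r (Kn n 0) ∧ (∀ y, ρ * 2⁻¹ ^ n < ‖y - 0‖ → Kn n 0 y = 0) ∧
      ∀ l : Fin d → ℕ, mlen l ≤ r → ContDiff ℝ m (partialDeriv l (Kn n 0)) ∧
        ∀ k : Fin d → ℕ, mlen k ≤ m → ∀ y, |partialDeriv k (partialDeriv l (Kn n 0)) y| ≤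
          c * (((2⁻¹ : ℝ) ^ n) ^ β * ((2⁻¹ : ℝ) ^ n)⁻¹ ^ (d + mlen l + mlen k)) := by
  have hρ := hK.rho_pos
  obtain ⟨c, hc, hb, -⟩ := hK.exists_bounds (isCompact_closedBall (0 : Rd d) ρ)
  refine ⟨c, hc, fun n => ⟨(hK.isCmr n).1 0, fun y hy => hK.eq_zero (by rwa [norm_sub_rev]),
    fun l hl => ?_⟩⟩
  have e : (fun x => partialDeriv l (Kn n x) 0) =
      fun x => partialDeriv l (Kn n 0) ((-1 : ℝ) • (x - 0)) := by
    funext x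
    have h1 : Kn n x = fun y => Kn n 0 ((1 : ℝ) • (y - x)) := by
      funext y
      rw [one_smul, ← h.apply_eq]
    rw [h1, partialDeriv_comp_affine (((hK.isCmr n).1 0).of_le (by exact_mod_cast hl))]
    simp
  have hm : ContDiff ℝ m (partialDeriv l (Kn n 0)) := by
    have h2 := (hK.isCmr n).2.1 l hl 0
    rw [e] at h2
    have h3 := h2.comp (contDiff_neg (n := m))
    convert h3 using 1
    funext x
    simp
  refine ⟨hm, fun k hk y => ?_⟩
  have e2 : |partialDeriv k (partialDeriv l (Kn n 0)) y| = |mixedDeriv (Kn n) k l (-y) 0| := by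
    rw [mixedDeriv, e, partialDeriv_comp_affine (hm.of_le (by exact_mod_cast hk)), abs_mul, abs_pow,
      abs_neg, abs_one, one_pow, one_mul]
    simp
  rw [e2]
  rcases le_or_gt ‖y‖ ρ with hy | hy
  · exact hb n k l hk hl _ (by simpa using hy) 0 (by simpa using hρ.le)
  · rw [hK.mixedDeriv_eq_zero, abs_zero]
    · positivity
    · rw [sub_zero, norm_neg]
      exact (mul_le_of_le_one_right hρ.le (pow_le_one₀ (by norm_num) (by norm_num))).trans_lt hy

lemma BumpAt.integral_abs_partialDeriv_le {q : ℕ} {x : Rd d} {t b : ℝ} {g : Rd d → ℝ}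
    (h : BumpAt q x t b g) (ht : 0 < t) {j : Fin d → ℕ} (hj : mlen j ≤ q) :
    ∫ y, |partialDeriv j g y| ≤ volume.real (Metric.ball (0 : Rd d) 1) * (b * t⁻¹ ^ mlen j) := by
  refine (le_abs_self _).trans ((abs_integral_le_of_ball ht.le (M := b * t⁻¹ ^ (d + mlen j))
    (fun y hy => by rw [partialDeriv_vanish h.supp j y hy, abs_zero]) fun y _ => by
      rw [abs_abs]; exact h.bound j hj y).trans_eq ?_)
  rw [pow_add]
  have : t⁻¹ ^ d * t ^ d = 1 := by rw [← mul_pow, inv_mul_cancel₀ ht.ne', one_pow]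
  linear_combination (b * t⁻¹ ^ mlen j * volume.real (Metric.ball (0 : Rd d) 1)) * this

/-- Bounds for the regularisation of a test function by a translation invariant kernel: at scales
smaller and larger than that of the test function. -/
lemma IsTranslationInvariant.exists_adj_bounds (h : IsTranslationInvariant Kn)
    (hK : IsRegularisingKernel β m r ρ K Kn) (q : ℕ) : ∃ C : ℝ, 0 ≤ C ∧
      ∀ (n : ℕ) (x : Rd d) (t b : ℝ) (ψ : TestFn d), 0 < t → BumpAt q x t b ψ →
      (ρ * 2⁻¹ ^ n ≤ t → BumpAt q x (2 * t) (C * b * (ρ * 2⁻¹ ^ n) ^ β) (adj (Kn n) ψ)) ∧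
      (t ≤ ρ * 2⁻¹ ^ n →
        (∀ y, 2 * (ρ * 2⁻¹ ^ n) < ‖y - x‖ → adj (Kn n) ψ y = 0) ∧
        (∀ l : Fin d → ℕ, mlen l ≤ m + r → ∀ y, |partialDeriv l (adj (Kn n) ψ) y| ≤
          C * b * (ρ * 2⁻¹ ^ n) ^ β * (ρ * 2⁻¹ ^ n)⁻¹ ^ (d + mlen l)) ∧
        ∀ l : Fin d → ℕ, mlen l = m + r + q → ∀ y, |partialDeriv l (adj (Kn n) ψ) y| ≤
          C * b * (ρ * 2⁻¹ ^ n) ^ β * (t⁻¹ ^ q * (ρ * 2⁻¹ ^ n)⁻¹ ^ (d + (m + r)))) := by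
  have hρ := hK.rho_pos
  obtain ⟨c, hc, hb⟩ := h.exists_bounds hK
  set v := volume.real (Metric.ball (0 : Rd d) 1) with hv
  have hv0 : 0 ≤ v := measureReal_nonneg
  set C₁ : ℝ := c * ρ⁻¹ ^ β * v * ρ ^ d * 2 ^ (d + q) with hC₁
  set C₂ : ℝ := c * ρ⁻¹ ^ β * v * (1 + ρ) ^ (d + (m + r)) with hC₂
  have hC₁0 : 0 ≤ C₁ := by positivity
  have hC₂0 : 0 ≤ C₂ := by positivity
  refine ⟨C₁ + C₂, by positivity, fun n x t b ψ ht hψ => ?_⟩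
  obtain ⟨hκ, hκs, hκl⟩ := hb n
  set w := ρ * 2⁻¹ ^ n with hw
  have hw0 : 0 < w := by positivity
  have hb0 := hψ.nonneg ht
  have hδ : ((2⁻¹ : ℝ) ^ n)⁻¹ = ρ * w⁻¹ := by rw [hw]; field_simp
  have hcs : HasCompactSupport (Kn n 0) := HasCompactSupport.of_support_subset_isCompact
    (isCompact_closedBall (0 : Rd d) w) fun y hy => by
      rw [Metric.mem_closedBall, dist_eq_norm]
      exact not_lt.1 fun hcon => hy (hκs y hcon)
  have hsupp : ∀ y, t + w < ‖y - x‖ → adj (Kn n) ψ y = 0 := fun y hy => by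
    rw [h.adj_eq]
    exact conv_eq_zero hψ.supp (fun z hz => hκs z (by rwa [sub_zero])) hy
  have hκm := fun l hl => (hκl l hl).1
  refine ⟨fun hwt => ⟨?_, fun y hy => hsupp y (by linarith), fun l hl y => ?_⟩, fun htw =>
    ⟨fun y hy => hsupp y (by linarith), ?_⟩⟩
  · rw [h.adj_eq, conv_comm]
    exact contDiff_conv hκ.continuous hcs (contDiff_testFn ψ q)
  · have e := partialDeriv_conv_add (ψ := ψ) hκ hcs hκm l (l := 0) (k := 0) (by simp [mlen_zero])
      (by simp [mlen_zero])
    rw [add_zero, add_zero, partialDeriv_zero, partialDeriv_zero] at e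
    rw [h.adj_eq, e, conv_comm]
    have hI : ∫ z, |Kn n 0 z| ≤ c * ρ⁻¹ ^ β * v * ρ ^ d * w ^ β := by
      refine (le_abs_self _).trans ((abs_integral_le_of_ball (x := 0) hw0.le
        (fun z hz => by rw [hκs z hz, abs_zero]) fun z _ => by
          have := (hκl 0 (by simp [mlen_zero])).2 0 (by simp [mlen_zero]) z
          rw [partialDeriv_zero, partialDeriv_zero] at this
          rwa [abs_abs]).trans_eq ?_)
      rw [mlen_zero, add_zero, add_zero, hδ, hK.rpow_dyadic n, mul_pow]
      have : w⁻¹ ^ d * w ^ d = 1 := by rw [← mul_pow, inv_mul_cancel₀ hw0.ne', one_pow]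
      linear_combination (c * ρ⁻¹ ^ β * w ^ β * ρ ^ d * v) * this
    refine (abs_conv_le_mul (hκ.continuous.integrable_of_hasCompactSupport hcs) hI
      (hψ.bound l hl) y).trans ?_
    have e2 : t⁻¹ ^ (d + mlen l) ≤ 2 ^ (d + q) * (2 * t)⁻¹ ^ (d + mlen l) := by
      rw [show t⁻¹ = 2 * (2 * t)⁻¹ by field_simp, mul_pow]
      gcongr
      norm_num
    calc _ ≤ c * ρ⁻¹ ^ β * v * ρ ^ d * w ^ β *
          (b * (2 ^ (d + q) * (2 * t)⁻¹ ^ (d + mlen l))) := by gcongr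
      _ = C₁ * b * w ^ β * (2 * t)⁻¹ ^ (d + mlen l) := by rw [hC₁]; ring
      _ ≤ _ := by
        gcongr
        linarith
  · have key : ∀ j l : Fin d → ℕ, mlen j ≤ q → mlen l ≤ m + r → ∀ y,
        |partialDeriv (j + l) (adj (Kn n) ψ) y| ≤
          (C₁ + C₂) * b * w ^ β * (t⁻¹ ^ mlen j * w⁻¹ ^ (d + mlen l)) := by
      intro j l hj hl y
      obtain ⟨l', k, rfl, hl'⟩ := exists_add_mlen_eq l (min r (mlen l)) (min_le_right _ _)
      have hadd : mlen (l' + k) = mlen l' + mlen k := by simp [mlen, Finset.sum_add_distrib]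
      have hlr : mlen l' ≤ r := hl'.trans_le (min_le_left _ _)
      have hkm : mlen k ≤ m := by omega
      rw [h.adj_eq, partialDeriv_conv_add hκ hcs hκm j hlr hkm]
      refine (abs_conv_le_mul (integrable_testFn (derivTest j ψ))
        (hψ.integral_abs_partialDeriv_le ht hj) ((hκl l' hlr).2 k hkm) y).trans ?_
      rw [hδ, hK.rpow_dyadic n, mul_pow, add_assoc, ← hadd]
      have e : ρ ^ (d + mlen (l' + k)) ≤ (1 + ρ) ^ (d + (m + r)) :=
        (pow_le_pow_left₀ hρ.le (by linarith) _).trans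
          (pow_le_pow_right₀ (by linarith) (by omega))
      calc _ ≤ v * (b * t⁻¹ ^ mlen j) * (c * (ρ⁻¹ ^ β * w ^ β *
            ((1 + ρ) ^ (d + (m + r)) * w⁻¹ ^ (d + mlen (l' + k))))) := by gcongr
        _ = C₂ * b * w ^ β * (t⁻¹ ^ mlen j * w⁻¹ ^ (d + mlen (l' + k))) := by rw [hC₂]; ring
        _ ≤ _ := by
          gcongr
          linarith
    refine ⟨fun l hl y => ?_, fun l hl y => ?_⟩
    · have := key 0 l (by simp [mlen_zero]) hl y
      rwa [zero_add, mlen_zero, pow_zero, one_mul] at this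
    · obtain ⟨j, l', rfl, hj⟩ := exists_add_mlen_eq l q (by omega)
      have hadd : mlen (j + l') = mlen j + mlen l' := by simp [mlen, Finset.sum_add_distrib]
      have hl' : mlen l' = m + r := by omega
      have := key j l' hj.le hl'.le y
      rwa [hj, hl'] at this

end Kernel

/-! ### Homogeneity of a distribution integrated against a kernel -/

lemma HomBound.weaken {a a' : ℝ} (h : a' ≤ a) {q : ℕ} {L : Set (Rd d)} {Λ A : ℝ}
    {F : Rd d → Distr d} (hF : HomBound a q L Λ F A) (hA : 0 ≤ A) :
    HomBound a' q L Λ F (A * Λ ^ (a - a')) := fun x hx t ht φ hφ => by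
  refine (hF x hx t ht φ hφ).trans ?_
  have ht0 := ht.1
  have e : t ^ a = t ^ (a - a') * t ^ a' := by
    rw [← Real.rpow_add ht0, sub_add_cancel]
  rw [e, mul_assoc]
  gcongr
  exact ht.2

lemma HomBound.add {a : ℝ} {q : ℕ} {L : Set (Rd d)} {Λ A B : ℝ} {F G : Rd d → Distr d}
    (hF : HomBound a q L Λ F A) (hG : HomBound a q L Λ G B) :
    HomBound a q L Λ (fun x => F x + G x) (A + B) := fun x hx t ht φ hφ => by
  rw [add_mul]
  exact (abs_add_le _ _).trans (add_le_add (hF x hx t ht φ hφ) (hG x hx t ht φ hφ))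

/-- A bound for a distribution from bounds for a germ and its difference with the distribution. -/
lemma HomBound.const_of_sub {a γ : ℝ} (haγ : a ≤ γ) {q q' : ℕ} (hq : q' ≤ q) {L : Set (Rd d)}
    {Λ A B : ℝ} (hB : 0 ≤ B) {F : Rd d → Distr d} {f : Distr d} (hF : HomBound a q L Λ F A)
    (hf : HomBound γ q' L Λ (fun x => F x - f) B) :
    HomBound a q L Λ (fun _ => f) (A + B * Λ ^ (γ - a)) := fun x hx t ht φ hφ => by
  have h2 := (hf.mono hq subset_rfl le_rfl le_rfl).weaken haγ hB x hx t ht φ hφ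
  have e : f (scaled φ x t) = F x (scaled φ x t) - (F x - f) (scaled φ x t) :=
    (sub_sub_cancel _ _).symm
  change |f (scaled φ x t)| ≤ _
  rw [e, add_mul]
  exact (abs_sub _ _).trans (add_le_add (hF x hx t ht φ hφ) h2)

/-- Distributions with homogeneous bounds belong to the local Hölder–Zygmund spaces. -/
lemma mem_zygmundSpace {a : ℝ} {f : Distr d} {q : ℕ}
    (h : ∀ L : Set (Rd d), IsCompact L → ∀ Λ : ℝ, ∃ C, 0 ≤ C ∧ HomBound a q L Λ (fun _ => f) C) :
    f ∈ zygmundSpace d a := by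
  intro L hL Λ hΛ
  have hΛ0 : 0 < Λ := one_pos.trans_le hΛ
  rw [zygmundNorm]
  split_ifs with ha
  · obtain ⟨C, -, hC⟩ := exists_homBound_of_small (a := a) (α := a) (q := ⌊-a + 1⌋₊) le_rfl le_rfl
      (fun L hL => (h L hL 1).imp fun _ h => h.2) (isCoherent_const a a f)
      (by have := Nat.lt_floor_add_one (-a); rwa [Nat.floor_add_one (by linarith), Nat.cast_add_one])
      (by have := Nat.lt_floor_add_one (-a); rwa [Nat.floor_add_one (by linarith), Nat.cast_add_one])
      hL Λ
    exact (homSeminorm_le hC).trans_lt ENNReal.ofReal_lt_top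
  · rw [not_lt] at ha
    obtain ⟨C, hC0, hC⟩ := h _ (hL.cthickening (r := Λ)) Λ
    obtain ⟨b, hb, hbump⟩ := (isMoll_moll d 1).exists_bump q
    set v := volume.real (Metric.ball (0 : Rd d) 1)
    have key : ∀ x ∈ L, ∀ t ∈ Set.Ioc 0 Λ, ∀ φ ∈ testBall d 0,
        |f (scaled φ x t)| / t ^ a ≤ b * C * v := by
      intro x hx t ht φ hφ
      have ht0 := ht.1
      have hψ := bumpAt_scaled hφ x ht0
      rw [div_le_iff₀ (by positivity)]
      have h1 := abs_distr_le_integral (isMoll_moll d 1) f (scaled φ x t) (δ := t)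
        (A := b * (C * t ^ a)) ht0 fun w hw s hs => by
          have hs0 := hs.1
          have hw' : ‖w - x‖ ≤ t := by
            have := tsupport_subset_closedBall_iff.2 hψ.supp hw
            rwa [Metric.mem_closedBall, dist_eq_norm] at this
          refine ((hC.boundedAt (mem_cthickening_of_norm hx (hw'.trans ht.2))
            ⟨hs0, hs.2.trans ht.2⟩).apply hs0 (hbump w s hs0)).trans ?_
          gcongr
          exact hs.2
      refine h1.trans ?_
      have h2 := integral_abs_le_of_bump hψ ht0
      rw [mul_one] at h2
      calc _ ≤ b * (C * t ^ a) * v := by gcongr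
        _ = _ := by ring
    refine ENNReal.add_lt_top.2 ⟨lt_of_le_of_lt ?_ (ENNReal.ofReal_lt_top (r := b * C * v)),
      lt_of_le_of_lt ?_ (ENNReal.ofReal_lt_top (r := b * C * v))⟩
    · refine iSup₂_le fun x hx => iSup₂_le fun ψ hψ => ENNReal.ofReal_le_ofReal ?_
      have := key x hx 1 ⟨one_pos, hΛ⟩ ψ hψ
      rwa [Real.one_rpow, div_one] at this
    · exact iSup₂_le fun x hx => iSup₂_le fun t ht => iSup₂_le fun φ hφ =>
        ENNReal.ofReal_le_ofReal (key x hx t ht φ hφ.1)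

section Kernel

variable {β ρ : ℝ} {m r : ℕ} {K : Rd d → Rd d → ℝ} {Kn : ℕ → Rd d → Rd d → ℝ}

lemma IsTranslationInvariant.exists_sum_le (h : IsTranslationInvariant Kn)
    (hK : IsRegularisingKernel β m r ρ K Kn) (hβ : β < m + r) {a : ℝ} (hab : a + β ≠ 0) {q : ℕ}
    (hqa : -a < q) (hq : 0 < a + β → q ≤ m + r) (L : Set (Rd d)) {Λ S : ℝ} (hΛS : 4 * Λ ≤ S)
    (hρS : 6 * ρ ≤ S) : ∃ C : ℝ, 0 ≤ C ∧ ∀ (f : Distr d) (A : ℝ), 0 ≤ A →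
      HomBound a q L S (fun _ => f) A →
      HomBound a q (Metric.cthickening (4 * ρ) L) ρ (fun _ => f) A →
      ∀ x ∈ L, ∀ t ∈ Set.Ioc 0 Λ, ∀ (b : ℝ) (ψ : TestFn d), BumpAt q x t b ψ → ∀ v : ℕ → ℝ,
      (∀ n, ExtPairing f (adj (Kn n) ψ) (v n)) → ∀ N, ∑ n ∈ Finset.range N, |v n| ≤
        C * A * b * (if a + β < 0 then t ^ (a + β) else (t + ρ) ^ (a + β)) := by
  have hρ := hK.rho_pos
  have hβ0 := hK.beta_pos
  obtain ⟨C, hC, hadj⟩ := h.exists_adj_bounds hK q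
  have hM := mollConst_nonneg d q
  have hle : ∀ n : ℕ, ρ * 2⁻¹ ^ n ≤ ρ := fun n =>
    mul_le_of_le_one_right hρ.le (pow_le_one₀ (by norm_num) (by norm_num))
  set D₁ : ℝ := mollConst d q * C * 4 ^ a * 2 ^ (d + q) with hD₁
  have hD₁0 : 0 ≤ D₁ := by positivity
  have hfine : ∀ (f : Distr d) (A : ℝ), 0 ≤ A → HomBound a q L S (fun _ => f) A →
      ∀ x ∈ L, ∀ t ∈ Set.Ioc 0 Λ, ∀ (b : ℝ) (ψ : TestFn d), BumpAt q x t b ψ → ∀ v n,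
      ExtPairing f (adj (Kn n) ψ) v → ρ * 2⁻¹ ^ n ≤ t →
      |v| ≤ D₁ * A * b * (t ^ a * (ρ * 2⁻¹ ^ n) ^ β) := by
    intro f A hA hf x hx t ht b ψ hψ v n hv hn
    have ht0 := ht.1
    have hb := hψ.nonneg ht0
    have h1 := hv.abs_le (by positivity) ((hadj n x t b ψ ht0 hψ).1 hn)
      (hf.boundedAt hx (t := 2 * (2 * t)) ⟨by positivity, by linarith [ht.2]⟩)
    refine h1.trans ?_
    rw [show 2 * (2 * t) = 4 * t by ring, Real.mul_rpow (x := 4) (by norm_num) ht0.le]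
    calc _ = D₁ / 2 ^ (d + q) * A * b * (t ^ a * (ρ * 2⁻¹ ^ n) ^ β) := by
          rw [hD₁]
          field_simp
      _ ≤ _ := by
        gcongr
        exact div_le_self hD₁0 (one_le_pow₀ (by norm_num))
  rcases lt_or_gt_of_ne hab with hneg | hpos
  · obtain ⟨θ, hβθ, hθ⟩ := exists_between (lt_min hβ (by linarith : β < -a))
    have hθp : θ ≤ ((m + r : ℕ) : ℝ) := by
      have := hθ.le.trans (min_le_left _ _)
      push_cast
      exact this
    have hθa : θ + a < 0 := by have := hθ.trans_le (min_le_right _ _); linarith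
    have hmoll := isMoll_moll d (m + r + q)
    obtain ⟨C₂, hC₂, h2⟩ := exists_abs_distr_le_of_coarse hmoll hθp hθa (by
      have : (0 : ℝ) ≤ ((m + r : ℕ) : ℝ) := Nat.cast_nonneg _
      linarith)
    obtain ⟨b', hb', hbump⟩ := hmoll.exists_bump q
    have hθβ : 0 < θ - β := sub_pos.2 hβθ
    have hg1 := geomConst_pos hβ0
    have hg2 := geomConst_pos hθβ
    refine ⟨(D₁ + C₂ * C * b') * (geomConst β + geomConst (θ - β)), by positivity,
      fun f A hA hf hf' x hx t ht b ψ hψ v hv N => ?_⟩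
    have ht0 := ht.1
    have hb := hψ.nonneg ht0
    rw [if_pos hneg]
    refine (sum_two_sided_le hβ0 hθβ (div_pos hρ ht0)
      (A := (D₁ + C₂ * C * b') * A * b * t ^ (a + β)) (by positivity) (fun n hn => ?_)
      (fun n hn => ?_) N).trans_eq (by ring)
    · rw [div_mul_eq_mul_div] at hn ⊢
      refine (hfine f A hA hf x hx t ht b ψ hψ _ n (hv n) ((div_le_one ht0).1 hn)).trans ?_
      have e : t ^ a * (ρ * 2⁻¹ ^ n) ^ β = t ^ (a + β) * (ρ * 2⁻¹ ^ n / t) ^ β := by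
        rw [Real.div_rpow (by positivity) ht0.le, Real.rpow_add ht0]
        field_simp
      rw [e, ← mul_assoc]
      gcongr
      linarith [show 0 ≤ C₂ * C * b' by positivity]
    · rw [div_mul_eq_mul_div] at hn ⊢
      have hn' := (one_lt_div ht0).1 hn
      obtain ⟨hs, hd, hd'⟩ := (hadj n x t b ψ ht0 hψ).2 hn'.le
      set w := ρ * 2⁻¹ ^ n with hw
      have hw0 : 0 < w := by positivity
      have hsm : ∀ k : ℕ, ContDiff ℝ k (adj (Kn n) ψ) := fun k => by
        have hext := (hK.isCmr n).1 0
        rw [h.adj_eq, conv_comm]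
        refine contDiff_conv hext.continuous (HasCompactSupport.of_support_subset_isCompact
          (isCompact_closedBall (0 : Rd d) w) fun y hy => ?_) (contDiff_testFn ψ k)
        rw [Metric.mem_closedBall, dist_eq_norm, norm_sub_rev]
        exact hK.support n 0 y hy
      have hfg : v n = f (mkTest (adj (Kn n) ψ) hsm x (2 * w) hs) :=
        ExtPairing.eq_apply (by rw [coe_mkTest]; exact hv n)
      rw [hfg]
      refine (h2 f x t w (C * b * w ^ β) (A * b') _ ht0 hn'.le (by positivity) (by positivity) hs
        (fun y => ?_) (fun k hk y => ?_) (fun k hk y => ?_) (fun y hy s hs' => ?_)).trans ?_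
      · have := hd 0 (by simp [mlen_zero]) y
        rwa [partialDeriv_zero, mlen_zero] at this
      · have := hd k hk.le y
        rwa [hk] at this
      · exact hd' k hk y
      · have hyL : y ∈ Metric.cthickening (4 * ρ) L :=
          mem_cthickening_of_norm hx (by linarith [hle n])
        refine ((hf'.boundedAt hyL ⟨hs'.1, hs'.2.trans (hle n)⟩).apply hs'.1
          (hbump y s hs'.1)).trans_eq (by ring)
      · have e : w ^ β * (w ^ (-θ) * t ^ (θ + a)) = t ^ (a + β) * (w / t) ^ (-(θ - β)) := by
          rw [Real.div_rpow hw0.le ht0.le, ← mul_assoc, ← Real.rpow_add hw0,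
            show β + -θ = -(θ - β) by ring, show θ + a = (a + β) - -(θ - β) by ring,
            Real.rpow_sub ht0 (a + β)]
          ring
        calc _ = C₂ * C * b' * A * b * (w ^ β * (w ^ (-θ) * t ^ (θ + a))) := by ring
          _ ≤ (D₁ + C₂ * C * b') * A * b * (w ^ β * (w ^ (-θ) * t ^ (θ + a))) := by
            gcongr
            linarith
          _ = _ := by rw [e]; ring
  · obtain ⟨C₀, hC₀, h0⟩ := exists_dyadic_sum_le hρ hβ0 hab
    refine ⟨C₀ * D₁, by positivity, fun f A hA hf hf' x hx t ht b ψ hψ v hv N => ?_⟩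
    have ht0 := ht.1
    have hb := hψ.nonneg ht0
    refine (h0 t (t + ρ) (D₁ * A * b) ht0 (by linarith) (by positivity) (fun n => |v n|)
      (fun n hn => hfine f A hA hf x hx t ht b ψ hψ _ n (hv n) hn) (fun n hn _ => ?_)
      (fun n hn => absurd (hle n) (by linarith)) N).trans_eq (by ring)
    obtain ⟨hs, hd, -⟩ := (hadj n x t b ψ ht0 hψ).2 hn.le
    set w := ρ * 2⁻¹ ^ n with hw
    have hw0 : 0 < w := by positivity
    have hbump : BumpAt q x (2 * w) (C * b * w ^ β * 2 ^ (d + q)) (adj (Kn n) ψ) := by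
      refine ⟨?_, hs, fun l hl y => (hd l (hl.trans (hq hpos)) y).trans ?_⟩
      · have hcs : HasCompactSupport (Kn n 0) := HasCompactSupport.of_support_subset_isCompact
          (isCompact_closedBall (0 : Rd d) w) fun y hy => by
            rw [Metric.mem_closedBall, dist_eq_norm, norm_sub_rev]
            exact hK.support n 0 y hy
        rw [h.adj_eq, conv_comm]
        exact contDiff_conv ((hK.isCmr n).1 0).continuous hcs (contDiff_testFn ψ q)
      · rw [show w⁻¹ = 2 * (2 * w)⁻¹ by field_simp, mul_pow, ← mul_assoc]
        gcongr
        norm_num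
    refine ((hv n).abs_le (by positivity) hbump
      (hf.boundedAt hx (t := 2 * (2 * w)) ⟨by positivity, by linarith [hle n]⟩)).trans_eq ?_
    rw [show 2 * (2 * w) = 4 * w by ring, Real.mul_rpow (x := 4) (by norm_num) hw0.le,
      Real.rpow_add hw0]
    ring

lemma IsRegularisingKernel.exists_homBound_kernelInt (hK : IsRegularisingKernel β m r ρ K Kn)
    (hβ : β < m + r) {a : ℝ} (hab : a + β ≠ 0) {q : ℕ} (hqa : -a < q)
    (hcase : q ≤ r ∨ IsTranslationInvariant Kn ∧ (0 < a + β → q ≤ m + r)) {L : Set (Rd d)}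
    (hL : IsCompact L) {Λ S : ℝ} (hΛ : 0 < Λ) (hΛS : 4 * Λ ≤ S) (hρS : 6 * ρ ≤ S) :
    ∃ C : ℝ, 0 ≤ C ∧ ∀ (f : Distr d) (A : ℝ), 0 ≤ A → OrderLE f q → KernelIntDefined Kn f →
      HomBound a q L S (fun _ => f) A →
      HomBound a q (Metric.cthickening (4 * ρ) L) ρ (fun _ => f) A →
      HomBound (min (a + β) 0) q L Λ (fun _ => kernelInt Kn f) (C * A) := by
  have hρ := hK.rho_pos
  have key : ∃ C : ℝ, 0 ≤ C ∧ ∀ (f : Distr d) (A : ℝ), 0 ≤ A → OrderLE f q →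
      KernelIntDefined Kn f → HomBound a q L S (fun _ => f) A →
      HomBound a q (Metric.cthickening (4 * ρ) L) ρ (fun _ => f) A →
      ∀ x ∈ L, ∀ t ∈ Set.Ioc 0 Λ, ∀ (b : ℝ) (ψ : TestFn d), BumpAt q x t b ψ →
      ∀ N, ∑ n ∈ Finset.range N, |extVal f (adj (Kn n) ψ)| ≤
        C * A * b * (if a + β < 0 then t ^ (a + β) else (t + ρ) ^ (a + β)) := by
    rcases hcase with hqr | ⟨hTI, hq⟩
    · obtain ⟨C, hC, h⟩ := hK.exists_sum_adj_le hL hqr hab Λ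
      refine ⟨C, hC, fun f A hA hfq _ hf _ x hx t ht b ψ hψ N => ?_⟩
      have h1 := h x hx t ht (t + ρ) (by linarith) f A b ψ (hfq.mono hqr) hA
        (fun s hs hs' => hf.boundedAt hx ⟨hs, by
          rcases hs' with hs' | ⟨-, hs'⟩ <;> linarith [ht.2]⟩) hψ N
      refine le_trans (le_of_eq (Finset.sum_congr rfl fun n _ => ?_)) h1
      have : ρ * 2⁻¹ ^ n ≤ ρ :=
        mul_le_of_le_one_right hρ.le (pow_le_one₀ (by norm_num) (by norm_num))
      rw [if_pos (by linarith [ht.1])]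
    · obtain ⟨C, hC, h⟩ := hTI.exists_sum_le hK hβ hab hqa hq L hΛS hρS
      exact ⟨C, hC, fun f A hA _ hint hf hf' x hx t ht b ψ hψ N =>
        h f A hA hf hf' x hx t ht b ψ hψ _ (hint.isKernelInt.extPairing ψ) N⟩
  obtain ⟨C, hC, h⟩ := key
  refine ⟨C * (1 + (Λ + ρ) ^ (a + β)), by positivity,
    fun f A hA hfq hint hf hf' x hx t ht φ hφ => ?_⟩
  have ht0 := ht.1
  refine le_of_tendsto (hint.isKernelInt.tendsto (scaled φ x t)).abs
    (Eventually.of_forall fun N => ?_)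
  refine (Finset.abs_sum_le_sum_abs _ _).trans
    ((h f A hA hfq hint hf hf' x hx t ht 1 _ (bumpAt_scaled hφ x ht0) N).trans ?_)
  have e : (if a + β < 0 then t ^ (a + β) else (t + ρ) ^ (a + β)) ≤
      (1 + (Λ + ρ) ^ (a + β)) * t ^ min (a + β) 0 := by
    split_ifs with hneg
    · rw [min_eq_left hneg.le]
      exact le_mul_of_one_le_left (by positivity) (by
        linarith [Real.rpow_nonneg (show 0 ≤ Λ + ρ by positivity) (a + β)])
    · rw [min_eq_right (not_lt.1 hneg), Real.rpow_zero, mul_one]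
      have := Real.rpow_le_rpow (by positivity) (show t + ρ ≤ Λ + ρ by linarith [ht.2])
        (not_lt.1 hneg)
      linarith
  calc _ ≤ C * A * 1 * ((1 + (Λ + ρ) ^ (a + β)) * t ^ min (a + β) 0) := by gcongr
    _ = _ := by ring

end Kernel

/-! ### Homogeneity and continuity of the lifted germ -/

lemma HasReconstructionBounds.exists_bounds {α γ : ℝ}
    {P : Set ((Rd d → Distr d) × Distr d)} (h : HasReconstructionBounds α γ P) {L : Set (Rd d)}
    (hL : IsCompact L) {Λ : ℝ} (hΛ : 0 < Λ) {s : ℕ} (hs : canonicalOrder γ α ≤ s) :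
    ∃ C : ℝ, 0 ≤ C ∧ ∀ p ∈ P, ∀ A : ℝ, 0 ≤ A →
      CohBound α γ s (Metric.cthickening (1 + Λ) L) Λ p.1 A →
      HomBound γ (canonicalOrder γ α) L Λ (fun x => p.1 x - p.2) (C * A) ∧
      CohBound α γ (canonicalOrder γ α) L Λ (fun x => p.1 x - p.2) (C * A) := by
  obtain ⟨C, hC⟩ := h L hL Λ hΛ s hs
  refine ⟨C, C.2, fun p hp A hA hb => bounds_of_jointSeminorm_le (by positivity) ?_⟩
  rw [ENNReal.ofReal_mul C.coe_nonneg, ENNReal.ofReal_coe_nnreal]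
  exact (hC p hp).trans (mul_le_mul_right (cohSeminorm_le hb) _)

namespace SchauderData

variable {α γ β ρ : ℝ} {m r : ℕ} {K : Rd d → Rd d → ℝ} {Kn : ℕ → Rd d → Rd d → ℝ}
  {F : Rd d → Distr d} {f : Distr d} {a : ℝ}

section

variable (D : SchauderData α γ β ρ m r K Kn)
include D

lemma lt_add : β < m + r := by linarith [D.lt_m, D.le, D.lt_r]

omit D in
lemma order_le_order (ha : a ≤ γ) : canonicalOrder γ α ≤ canonicalOrder a α :=
  canonicalOrder_le (by linarith [neg_lt_canonicalOrder_left a α])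
    (neg_lt_canonicalOrder_right a α)

lemma order_cases (hc : -a < r ∨ IsTranslationInvariant Kn) :
    canonicalOrder a α ≤ r ∨
      IsTranslationInvariant Kn ∧ (0 < a + β → canonicalOrder a α ≤ m + r) := by
  rcases hc with h | h
  · exact Or.inl (canonicalOrder_le h D.lt_r)
  · refine Or.inr ⟨h, fun h0 => canonicalOrder_le ?_ ?_⟩
    · push_cast
      linarith [D.lt_add]
    · push_cast
      linarith [D.lt_r, (Nat.cast_nonneg m : (0 : ℝ) ≤ m)]

lemma exists_homBound_const (ha : a ≤ γ) (h : (F, f) ∈ reconstructedGerms d α γ)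
    (hF : IsHomogeneous a F) {L : Set (Rd d)} (hL : IsCompact L) (Λ : ℝ) :
    ∃ C, 0 ≤ C ∧ HomBound a (canonicalOrder a α) L Λ (fun _ => f) C := by
  obtain ⟨s, hs⟩ := hF
  obtain ⟨A, hA, h1⟩ := exists_homBound_of_small D.le ha (fun L hL => hs L hL 1 le_rfl) h.1.2
    (neg_lt_canonicalOrder_left a α) (neg_lt_canonicalOrder_right a α) hL (max Λ 1)
  obtain ⟨B, hB, h2⟩ := D.exists_homBound h hL (max Λ 1)
  have h0 : 0 < max Λ 1 := lt_max_of_lt_right one_pos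
  exact ⟨A + B * max Λ 1 ^ (γ - a), by positivity,
    (h1.const_of_sub ha (order_le_order ha) hB h2).mono le_rfl subset_rfl (le_max_left _ _) le_rfl⟩

lemma orderLE_const (ha : a ≤ γ) (h : (F, f) ∈ reconstructedGerms d α γ)
    (hF : IsHomogeneous a F) : OrderLE f (canonicalOrder a α) :=
  orderLE_of_homBound (G := fun _ : Rd d => f) (x := 0) fun Λ =>
    D.exists_homBound_const ha h hF isCompact_singleton Λ

/-- Quantitative homogeneity of the lifted germ. -/
lemma exists_schauderGerm_bounds (ha : a ≤ γ) (hab : a + β ≠ 0)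
    (hc : -a < r ∨ IsTranslationInvariant Kn) {L : Set (Rd d)} (hL : IsCompact L) {Λ : ℝ}
    (hΛ : 0 < Λ) :
    ∃ C : ℝ, 0 ≤ C ∧ ∀ F f, (F, f) ∈ reconstructedGerms d α γ → KernelIntDefined Kn f →
      IsHomogeneous a F → ∀ A : ℝ, 0 ≤ A →
      HomBound a (canonicalOrder a α) L (enlargedScale ρ L Λ) F A →
      HomBound a (canonicalOrder a α) (Metric.cthickening (4 * ρ) L) ρ F A →
      HomBound γ (canonicalOrder γ α) L (enlargedScale ρ L Λ) (fun x => F x - f) A →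
      CohBound α γ (canonicalOrder γ α) L (enlargedScale ρ L Λ) (fun x => F x - f) A →
      HomBound γ (canonicalOrder γ α) (Metric.cthickening (4 * ρ) L) ρ (fun x => F x - f) A →
      HomBound (min (a + β) 0) (canonicalOrder a α) L Λ (fun _ => kernelInt Kn f) (C * A) ∧
      HomBound (min (a + β) 0) (canonicalOrder a α) L Λ (schauderGerm Kn (γ + β) F f) (C * A) ∧
      CohBound (min (α + β) 0) (γ + β) (canonicalOrder a α) L Λ
        (schauderGerm Kn (γ + β) F f) (C * A) := by
  obtain ⟨h8, h6, hS⟩ := D.le_enlargedScale (L := L) hΛ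
  have hρ := D.kernel.rho_pos
  set S := enlargedScale ρ L Λ
  obtain ⟨C₁, hC₁, h1⟩ := D.kernel.exists_homBound_kernelInt D.lt_add hab
    (neg_lt_canonicalOrder_left a α) (D.order_cases hc) hL hΛ (S := S) (by linarith) h6
  obtain ⟨C₂, hC₂, h2⟩ := D.exists_schauderDiff_bounds hL hΛ
  have hab' : min (a + β) 0 ≤ γ + β := (min_le_left _ _).trans (by linarith)
  set M := 1 + S ^ (γ - a) + ρ ^ (γ - a) with hM
  have hM0 : 0 ≤ M := by positivity
  set W := Λ ^ (γ + β - min (a + β) 0) with hW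
  have hW0 : 0 ≤ W := by positivity
  have hq := order_le_order (α := α) ha
  refine ⟨C₁ * M + C₂ * W + C₂, by positivity, fun F f h hf hF A hA a1 a2 b1 b2 b3 => ?_⟩
  obtain ⟨c1, c2⟩ := h2 F f h A hA b1 b2
  have e1 : A + A * S ^ (γ - a) ≤ M * A := by
    have : 0 ≤ ρ ^ (γ - a) * A := by positivity
    rw [hM]
    linarith
  have e2 : A + A * ρ ^ (γ - a) ≤ M * A := by
    have : 0 ≤ S ^ (γ - a) * A := by positivity
    rw [hM]
    linarith
  have c3 := h1 f (M * A) (by positivity) (D.orderLE_const ha h hF) hf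
    ((a1.const_of_sub ha hq hA b1).mono le_rfl subset_rfl le_rfl e1)
    ((a2.const_of_sub ha hq hA b3).mono le_rfl subset_rfl le_rfl e2)
  have n1 : 0 ≤ C₂ * A := by positivity
  have n2 : 0 ≤ C₂ * W * A := by positivity
  have n3 : 0 ≤ C₁ * M * A := by positivity
  refine ⟨c3.mono le_rfl subset_rfl le_rfl (by linarith), ?_,
    (D.cohBound_schauderGerm_iff h hf).2 (c2.mono hq subset_rfl le_rfl (by linarith))⟩
  rw [D.schauderGerm_eq h hf]
  exact (((c1.mono hq subset_rfl le_rfl le_rfl).weaken hab' n1).add c3).mono le_rfl subset_rfl le_rfl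
    (by linarith)

lemma exists_schauderGerm_homBound (ha : a ≤ γ) (hab : a + β ≠ 0)
    (hc : -a < r ∨ IsTranslationInvariant Kn) (h : (F, f) ∈ reconstructedGerms d α γ)
    (hf : KernelIntDefined Kn f) (hF : IsHomogeneous a F) {L : Set (Rd d)} (hL : IsCompact L)
    {Λ : ℝ} (hΛ : 0 < Λ) : ∃ C : ℝ, 0 ≤ C ∧
      HomBound (min (a + β) 0) (canonicalOrder a α) L Λ (fun _ => kernelInt Kn f) C ∧
      HomBound (min (a + β) 0) (canonicalOrder a α) L Λ (schauderGerm Kn (γ + β) F f) C := by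
  obtain ⟨C, hC, h1⟩ := D.exists_schauderGerm_bounds ha hab hc hL hΛ
  have hL' : IsCompact (Metric.cthickening (4 * ρ) L) := hL.cthickening
  obtain ⟨s, hs⟩ := hF
  have hom := fun {L : Set (Rd d)} (hL : IsCompact L) (Λ : ℝ) =>
    exists_homBound_of_small D.le ha (fun L hL => hs L hL 1 le_rfl) h.1.2
      (neg_lt_canonicalOrder_left a α) (neg_lt_canonicalOrder_right a α) hL Λ
  obtain ⟨A₁, hA₁, a1⟩ := hom hL (enlargedScale ρ L Λ)
  obtain ⟨A₂, hA₂, a2⟩ := hom hL' ρ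
  obtain ⟨B₁, hB₁, b1⟩ := D.exists_homBound h hL (enlargedScale ρ L Λ)
  obtain ⟨B₂, hB₂, b2⟩ := (sub_const_mem_coherentGerms h.1 f).2.exists_cohBound D.le
    (neg_lt_canonicalOrder_right γ α) hL (enlargedScale ρ L Λ)
  obtain ⟨B₃, hB₃, b3⟩ := D.exists_homBound h hL' ρ
  have hA : 0 ≤ A₁ + A₂ + B₁ + B₂ + B₃ := by positivity
  obtain ⟨c1, c2, -⟩ := h1 F f h hf ⟨s, hs⟩ _ hA
    (a1.mono le_rfl subset_rfl le_rfl (by linarith))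
    (a2.mono le_rfl subset_rfl le_rfl (by linarith))
    (b1.mono le_rfl subset_rfl le_rfl (by linarith))
    (b2.mono le_rfl subset_rfl le_rfl (by linarith))
    (b3.mono le_rfl subset_rfl le_rfl (by linarith))
  exact ⟨_, mul_nonneg hC hA, c1, c2⟩

lemma isHomogeneous_schauderGerm (ha : a ≤ γ) (hab : a + β ≠ 0)
    (hc : -a < r ∨ IsTranslationInvariant Kn) (h : (F, f) ∈ reconstructedGerms d α γ)
    (hf : KernelIntDefined Kn f) (hF : IsHomogeneous a F) :
    IsHomogeneous (min (a + β) 0) (schauderGerm Kn (γ + β) F f) ∧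
      f ∈ zygmundSpace d a ∧ kernelInt Kn f ∈ zygmundSpace d (min (a + β) 0) := by
  refine ⟨⟨canonicalOrder a α, fun L hL Λ hΛ => ?_⟩,
    mem_zygmundSpace fun L hL Λ => D.exists_homBound_const ha h hF hL Λ,
    mem_zygmundSpace (q := canonicalOrder a α) fun L hL Λ => ?_⟩
  · obtain ⟨C, -, -, hC⟩ := D.exists_schauderGerm_homBound ha hab hc h hf hF hL
      (zero_lt_one.trans_le hΛ)
    exact ⟨C, hC⟩
  · obtain ⟨C, hC, h1, -⟩ := D.exists_schauderGerm_homBound ha hab hc h hf hF hL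
      (lt_max_of_lt_right one_pos : 0 < max Λ 1)
    exact ⟨C, hC, h1.mono le_rfl subset_rfl (le_max_left _ _) le_rfl⟩

variable {P : Set ((Rd d → Distr d) × Distr d)} (hP : P ⊆ reconstructedGerms d α γ)
  (hPK : ∀ p ∈ P, KernelIntDefined Kn p.2) (hR : HasReconstructionBounds α γ P)
include hP hPK hR

lemma cohSeminorm_schauderGerm_le {L : Set (Rd d)} (hL : IsCompact L) {Λ : ℝ} (hΛ : 0 < Λ)
    {s : ℕ} (hs : canonicalOrder γ α ≤ s) : ∃ C : ℝ≥0, ∀ p ∈ P,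
      cohSeminorm (min (α + β) 0) (γ + β) (canonicalOrder γ α) L Λ
          (schauderGerm Kn (γ + β) p.1 p.2)
        ≤ C * cohSeminorm α γ s (Metric.cthickening (1 + enlargedScale ρ L Λ) L)
          (enlargedScale ρ L Λ) p.1 := by
  obtain ⟨C₁, hC₁, h1⟩ := D.exists_schauderDiff_bounds hL hΛ
  obtain ⟨C₂, hC₂, h2⟩ := hR.exists_bounds hL (D.le_enlargedScale (L := L) hΛ).2.2 hs
  refine ⟨Real.toNNReal (C₁ * C₂ + 1), fun p hp =>
    ennreal_le_mul_of_forall (by positivity) fun A hA hle => ?_⟩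
  obtain ⟨b1, b2⟩ := h2 p hp A hA (cohBound_of_cohSeminorm_le hA hle)
  rw [mul_assoc]
  exact cohSeminorm_le ((D.cohBound_schauderGerm_iff (hP hp) (hPK p hp)).2
    (h1 _ _ (hP hp) _ (by positivity) b1 b2).2)

lemma cohSeminorm_schauderGerm_le' {L : Set (Rd d)} (hL : IsCompact L) {Λ : ℝ} (hΛ : 0 < Λ)
    {s : ℕ} (hs : canonicalOrder γ α ≤ s) :
    ∃ L' : Set (Rd d), IsCompact L' ∧ ∃ Λ' : ℝ, 0 < Λ' ∧ ∃ C : ℝ≥0, ∀ p ∈ P,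
      cohSeminorm (min (α + β) 0) (γ + β) (canonicalOrder (γ + β) (min (α + β) 0)) L Λ
          (schauderGerm Kn (γ + β) p.1 p.2)
        ≤ C * cohSeminorm α γ s L' Λ' p.1 := by
  have hL' : IsCompact (Metric.cthickening (Λ + 1) L) := hL.cthickening
  obtain ⟨C₁, h1⟩ := exists_cohSeminorm_le (d := d) D.min_le
    (neg_lt_canonicalOrder_right (γ + β) (min (α + β) 0)) (canonicalOrder γ α) hΛ
  obtain ⟨C₂, h2⟩ := D.cohSeminorm_schauderGerm_le hP hPK hR hL' hΛ hs
  refine ⟨Metric.cthickening (1 + enlargedScale ρ (Metric.cthickening (Λ + 1) L) Λ) _,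
    hL'.cthickening, _, (D.le_enlargedScale (L := Metric.cthickening (Λ + 1) L) hΛ).2.2,
    C₁ * C₂, fun p hp => (h1 L _).trans ?_⟩
  rw [ENNReal.coe_mul, mul_assoc]
  gcongr
  exact h2 p hp

lemma jointSeminorm_schauderGerm_le (ha : a ≤ γ) (hab : a + β ≠ 0)
    (hc : -a < r ∨ IsTranslationInvariant Kn) {L : Set (Rd d)} (hL : IsCompact L) {Λ : ℝ}
    (hΛ : 0 < Λ) : ∃ C : ℝ≥0, ∀ p ∈ P, IsHomogeneous a p.1 →
      jointSeminorm (min (a + β) 0) (min (α + β) 0) (γ + β) (canonicalOrder a α) L Λ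
          (schauderGerm Kn (γ + β) p.1 p.2)
        ≤ C * jointSeminorm a α γ (canonicalOrder a α)
          (Metric.cthickening (1 + enlargedScale ρ L Λ) L) (enlargedScale ρ L Λ) p.1 := by
  obtain ⟨C, hC, h1⟩ := D.exists_schauderGerm_bounds ha hab hc hL hΛ
  obtain ⟨-, h6, hS⟩ := D.le_enlargedScale (L := L) hΛ
  have hρ := D.kernel.rho_pos
  set S := enlargedScale ρ L Λ
  have hq := order_le_order (α := α) ha
  have hL' : IsCompact (Metric.cthickening (4 * ρ) L) := hL.cthickening
  obtain ⟨C₁, hC₁, r1⟩ := hR.exists_bounds hL hS hq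
  obtain ⟨C₂, hC₂, r2⟩ := hR.exists_bounds hL' hρ hq
  have s1 : L ⊆ Metric.cthickening (1 + S) L := Metric.self_subset_cthickening L
  have s2 : Metric.cthickening (4 * ρ) L ⊆ Metric.cthickening (1 + S) L :=
    Metric.cthickening_mono (by linarith) L
  have s3 : Metric.cthickening (1 + ρ) (Metric.cthickening (4 * ρ) L) ⊆
      Metric.cthickening (1 + S) L :=
    (Metric.cthickening_cthickening_subset (by positivity) (by positivity) L).trans
      (Metric.cthickening_mono (by linarith) L)
  refine ⟨Real.toNNReal (C * (1 + C₁ + C₂) + C * (1 + C₁ + C₂) + 1), fun p hp hF =>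
    ennreal_le_mul_of_forall (by positivity) fun A hA hle => ?_⟩
  obtain ⟨hom, coh⟩ := bounds_of_jointSeminorm_le hA hle
  obtain ⟨b1, b2⟩ := r1 p hp A hA coh
  obtain ⟨b3, -⟩ := r2 p hp A hA (coh.mono le_rfl s3 (by linarith) le_rfl)
  have n1 : 0 ≤ C₁ * A := by positivity
  have n2 : 0 ≤ C₂ * A := by positivity
  obtain ⟨-, c1, c2⟩ := h1 _ _ (hP hp) (hPK p hp) hF ((1 + C₁ + C₂) * A) (by positivity)
    (hom.mono le_rfl s1 le_rfl (by linarith)) (hom.mono le_rfl s2 (by linarith) (by linarith))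
    (b1.mono le_rfl subset_rfl le_rfl (by linarith))
    (b2.mono le_rfl subset_rfl le_rfl (by linarith))
    (b3.mono le_rfl subset_rfl le_rfl (by linarith))
  rw [add_mul, mul_assoc]
  exact jointSeminorm_le (by positivity) (by positivity) c1 c2

lemma jointSeminorm_schauderGerm_le' (ha : a ≤ γ) (hab : a + β ≠ 0)
    (hc : -a < r ∨ IsTranslationInvariant Kn) {L : Set (Rd d)} (hL : IsCompact L) {Λ : ℝ}
    (hΛ : 0 < Λ) :
    ∃ L' : Set (Rd d), IsCompact L' ∧ ∃ Λ' : ℝ, 0 < Λ' ∧ ∃ C : ℝ≥0, ∀ p ∈ P,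
      IsHomogeneous a p.1 →
      jointSeminorm (min (a + β) 0) (min (α + β) 0) (γ + β)
          (canonicalOrder (min (a + β) 0) (min (α + β) 0)) L Λ (schauderGerm Kn (γ + β) p.1 p.2)
        ≤ C * jointSeminorm a α γ (canonicalOrder a α) L' Λ' p.1 := by
  have hL' : IsCompact (Metric.cthickening (Λ + 1) L) := hL.cthickening
  have hab' : min (a + β) 0 ≤ γ + β := (min_le_left _ _).trans (by linarith)
  obtain ⟨C₁, h1⟩ := exists_jointSeminorm_le (d := d) D.min_le hab' (canonicalOrder a α) hΛ
  obtain ⟨C₂, h2⟩ := D.jointSeminorm_schauderGerm_le hP hPK hR ha hab hc hL' hΛ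
  refine ⟨Metric.cthickening (1 + enlargedScale ρ (Metric.cthickening (Λ + 1) L) Λ) _,
    hL'.cthickening, _, (D.le_enlargedScale (L := Metric.cthickening (Λ + 1) L) hΛ).2.2,
    C₁ * C₂, fun p hp hF => (h1 L _).trans ?_⟩
  rw [ENNReal.coe_mul, mul_assoc]
  gcongr
  exact h2 p hp hF

end

end SchauderData

end

theorem theorem3p7 (d : ℕ) (hd : 1 ≤ d) (α γ β ρ : ℝ) (m r : ℕ)
    (K : Rd d → Rd d → ℝ) (Kn : ℕ → Rd d → Rd d → ℝ)
    (hαγ : α ≤ γ) (hγ : γ ≠ 0) (hαβ : α + β ≠ 0) (hγβ : ∀ N : ℕ, γ + β ≠ N)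
    (hK : IsRegularisingKernel β m r ρ K Kn) (hm : γ + β < m) (hr : -α < r) :
    -- the difference is well defined, homogeneous and coherent
    (∀ F f, (F, f) ∈ reconstructedGerms d α γ →
      (∀ x, KernelIntDefined Kn (F x - f)) ∧
      (∀ x (k : Fin d → ℕ), (mlen k : ℝ) < γ + β →
        ∃ v, HasPointDeriv (γ + β) (kernelInt Kn (F x - f)) x k v) ∧
      IsGerm (schauderDiff Kn (γ + β) F f) ∧
      IsHomogeneous (γ + β) (schauderDiff Kn (γ + β) F f) ∧
      IsCoherent (min (α + β) 0) (γ + β) (schauderDiff Kn (γ + β) F f)) ∧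
    -- continuity estimate with the same compact set and the same order on both sides
    (∀ L : Set (Rd d), IsCompact L → ∀ Λ : ℝ, 0 < Λ → ∃ C : ℝ≥0,
      ∀ F f, (F, f) ∈ reconstructedGerms d α γ →
        jointSeminorm (γ + β) (min (α + β) 0) (γ + β) (canonicalOrder γ α) L Λ
            (schauderDiff Kn (γ + β) F f)
          ≤ C * jointSeminorm γ α γ (canonicalOrder γ α) L (enlargedScale ρ L Λ)
            (fun x => F x - f)) ∧
    -- continuity estimate with the canonical order on both sides, up to enlarging the compact set
    (∀ L : Set (Rd d), IsCompact L → ∀ Λ : ℝ, 0 < Λ →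
      ∃ L' : Set (Rd d), IsCompact L' ∧ ∃ Λ' : ℝ, 0 < Λ' ∧ ∃ C : ℝ≥0,
      ∀ F f, (F, f) ∈ reconstructedGerms d α γ →
        jointSeminorm (γ + β) (min (α + β) 0) (γ + β)
            (canonicalOrder (γ + β) (min (α + β) 0)) L Λ (schauderDiff Kn (γ + β) F f)
          ≤ C * jointSeminorm γ α γ (canonicalOrder γ α) L' Λ' (fun x => F x - f)) ∧
    -- coherence and reconstruction of the lifted germ
    (∀ F f, (F, f) ∈ reconstructedGerms d α γ → KernelIntDefined Kn f →
      (∀ x, KernelIntDefined Kn (F x)) ∧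
      IsGerm (schauderGerm Kn (γ + β) F f) ∧
      (∀ x, schauderGerm Kn (γ + β) F f x - kernelInt Kn f
        = schauderDiff Kn (γ + β) F f x) ∧
      IsCoherent (min (α + β) 0) (γ + β) (schauderGerm Kn (γ + β) F f) ∧
      IsReconstruction (min (α + β) 0) (γ + β) (schauderGerm Kn (γ + β) F f)
        (kernelInt Kn f)) ∧
    -- homogeneity of the lifted germ
    (∀ a : ℝ, a ≤ γ → a + β ≠ 0 → (-a < r ∨ IsTranslationInvariant Kn) →
      ∀ F f, (F, f) ∈ reconstructedGerms d α γ → KernelIntDefined Kn f → IsHomogeneous a F →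
        IsHomogeneous (min (a + β) 0) (schauderGerm Kn (γ + β) F f) ∧
        f ∈ zygmundSpace d a ∧ kernelInt Kn f ∈ zygmundSpace d (min (a + β) 0)) ∧
    -- linearity
    (∀ F f G g, (F, f) ∈ reconstructedGerms d α γ → (G, g) ∈ reconstructedGerms d α γ →
      KernelIntDefined Kn f → KernelIntDefined Kn g → ∀ a b : ℝ,
        (fun x => a • F x + b • G x, a • f + b • g) ∈ reconstructedGerms d α γ ∧
        KernelIntDefined Kn (a • f + b • g) ∧
        ∀ x, schauderGerm Kn (γ + β) (fun x => a • F x + b • G x) (a • f + b • g) x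
          = a • schauderGerm Kn (γ + β) F f x + b • schauderGerm Kn (γ + β) G g x) ∧
    -- continuity of the lifted germ
    (∀ P : Set ((Rd d → Distr d) × Distr d), P ⊆ reconstructedGerms d α γ →
      (∀ p ∈ P, KernelIntDefined Kn p.2) → (γ < 0 → HasReconstructionBounds α γ P) →
      -- for the coherence seminorms
      (∀ L : Set (Rd d), IsCompact L → ∀ Λ : ℝ, 0 < Λ → ∀ s : ℕ, canonicalOrder γ α ≤ s →
        (∃ C : ℝ≥0, ∀ p ∈ P,
          cohSeminorm (min (α + β) 0) (γ + β) (canonicalOrder γ α) L Λ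
              (schauderGerm Kn (γ + β) p.1 p.2)
            ≤ C * cohSeminorm α γ s (Metric.cthickening (1 + enlargedScale ρ L Λ) L)
              (enlargedScale ρ L Λ) p.1) ∧
        (∃ L' : Set (Rd d), IsCompact L' ∧ ∃ Λ' : ℝ, 0 < Λ' ∧ ∃ C : ℝ≥0, ∀ p ∈ P,
          cohSeminorm (min (α + β) 0) (γ + β) (canonicalOrder (γ + β) (min (α + β) 0)) L Λ
              (schauderGerm Kn (γ + β) p.1 p.2)
            ≤ C * cohSeminorm α γ s L' Λ' p.1)) ∧
      -- for the joint homogeneity and coherence seminorms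
      (∀ a : ℝ, a ≤ γ → a + β ≠ 0 → (-a < r ∨ IsTranslationInvariant Kn) →
        ∀ L : Set (Rd d), IsCompact L → ∀ Λ : ℝ, 0 < Λ →
        (∃ C : ℝ≥0, ∀ p ∈ P, IsHomogeneous a p.1 →
          jointSeminorm (min (a + β) 0) (min (α + β) 0) (γ + β) (canonicalOrder a α) L Λ
              (schauderGerm Kn (γ + β) p.1 p.2)
            ≤ C * jointSeminorm a α γ (canonicalOrder a α)
              (Metric.cthickening (1 + enlargedScale ρ L Λ) L) (enlargedScale ρ L Λ) p.1) ∧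
        (∃ L' : Set (Rd d), IsCompact L' ∧ ∃ Λ' : ℝ, 0 < Λ' ∧ ∃ C : ℝ≥0, ∀ p ∈ P,
          IsHomogeneous a p.1 →
          jointSeminorm (min (a + β) 0) (min (α + β) 0) (γ + β)
              (canonicalOrder (min (a + β) 0) (min (α + β) 0)) L Λ
              (schauderGerm Kn (γ + β) p.1 p.2)
            ≤ C * jointSeminorm a α γ (canonicalOrder a α) L' Λ' p.1))) ∧
    -- reconstructions exist, can be chosen linearly with bounds, and are unique for `γ > 0`
    (∃ S : (Rd d → Distr d) → Distr d,
      (∀ F ∈ coherentGerms d α γ, (F, S F) ∈ reconstructedGerms d α γ) ∧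
      (∀ F ∈ coherentGerms d α γ, ∀ G ∈ coherentGerms d α γ, ∀ a b : ℝ,
        S (fun x => a • F x + b • G x) = a • S F + b • S G) ∧
      HasReconstructionBounds α γ {p | p.1 ∈ coherentGerms d α γ ∧ p.2 = S p.1}) ∧
    (0 < γ → ∀ F f g, (F, f) ∈ reconstructedGerms d α γ → (F, g) ∈ reconstructedGerms d α γ →
      f = g) := by
  have D : SchauderData α γ β ρ m r K Kn := ⟨hαγ, hαβ, hγβ, hK, hm, hr⟩
  refine ⟨fun F f h => ⟨D.kernelIntDefined h, fun x k hk => ⟨_, D.hasPointDeriv h x hk⟩,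
      D.isGerm_schauderDiff h, D.isHomogeneous_schauderDiff h, D.isCoherent_schauderDiff h⟩,
    fun L hL Λ hΛ => D.jointSeminorm_schauderDiff_le hL hΛ,
    fun L hL Λ hΛ => D.jointSeminorm_schauderDiff_le' hL hΛ,
    fun F f h hf => ⟨fun x => ⟨_, D.isKernelInt_apply h hf x⟩, D.isGerm_schauderGerm h hf,
      D.schauderGerm_sub h hf, D.isCoherent_schauderGerm h hf,
      D.isReconstruction_schauderGerm h hf⟩,
    fun a ha hab hc F f h hf hF => D.isHomogeneous_schauderGerm ha hab hc h hf hF,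
    fun F f G g h h' hf hg a b => ⟨D.add_smul_mem h h' a b,
      D.schauderGerm_add_smul h h' hf hg a b⟩,
    fun P hP hPK hR => ?_, exists_reconstruction hαγ hγ,
    fun hγ F f g h h' => reconstruction_unique hγ h.2 h'.2⟩
  have hR' : HasReconstructionBounds α γ P := by
    rcases lt_or_gt_of_ne hγ with h | h
    · exact hR h
    · exact hasReconstructionBounds_of_pos hαγ h hP
  exact ⟨fun L hL Λ hΛ s hs => ⟨D.cohSeminorm_schauderGerm_le hP hPK hR' hL hΛ hs,
      D.cohSeminorm_schauderGerm_le' hP hPK hR' hL hΛ hs⟩,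
    fun a ha hab hc L hL Λ hΛ => ⟨D.jointSeminorm_schauderGerm_le hP hPK hR' ha hab hc hL hΛ,
      D.jointSeminorm_schauderGerm_le' hP hPK hR' ha hab hc hL hΛ⟩⟩
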